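/- Work over $\mathbb{C}[[t]]$; Hopf algebras are $t$-adically complete and $\otimes$ is the completed tensor product (equivalently, everything is a compatible system of ordinary Hopf algebras over $\mathbb{C}[[t]]/(t^{n+1})$, $n\ge 0$). Let $s\in t\,\mathbb{C}[[t]]$, $\lambda=e^{s}$, $\lambda^{1/2}=e^{s/2}$. Let $H$ be a quasitriangular Hopf algebra with universal R-matrix $\mathcal{R}$, dually paired with a Hopf algebra $A$ containing a matrix $\mathbf{t}=(t^i{}_j)_{i,j=1}^N$ with $\Delta t^i{}_j=\sum_a t^i{}_a\otimes t^a{}_j$, $\epsilon(t^i{}_j)=\delta^i_j$. Let $R\in M_N\otimes M_N$ satisfy $\langle\mathcal{R},t^i{}_a\otimes t^j{}_b\rangle=\lambda^{1/2}R^i{}_a{}^j{}_b$, and let $R$ be $q$-Hecke, $(PR-q)(PR+q^{-1})=0$, with $q$ invertible and $P$ the permutation matrix. For a Hopf algebra $K$, a quantum 2-cocycle is an invertible $\chi\in K\otimes K$ with $\chi_{12}(\Delta\otimes\mathrm{id})\chi=\chi_{23}(\mathrm{id}\otimes\Delta)\chi$ and $(\epsilon\otimes\mathrm{id})\chi=1$.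 The twisting $K_\chi$ is the algebra $K$ with the same counit, $\Delta_\chi=\chi(\Delta\,\cdot\,)\chi^{-1}$ and $S_\chi=U(S\,\cdot\,)U^{-1}$, $U=\chi^{(1)}S\chi^{(2)}$; a quasitriangular structure $\mathcal{R}_K$ becomes $\chi_{21}\mathcal{R}_K\chi^{-1}$. The dilatonic extension $\widetilde K$ of a quasitriangular Hopf algebra $K$ adjoins a central primitive generator $\xi$ and multiplies the quasitriangular structure by $\lambda^{-\xi\otimes\xi}$. The bosonisation $B\rtimes K$ of a braided group $B$ in the category of $K$-modules is the Hopf algebra generated by $B$ and its sub-Hopf algebra $K$ with cross relations $hb=(h_{(1)}\triangleright b)h_{(2)}$, coproduct $\Delta b=b_{\underline{(1)}}\mathcal{R}_K^{(2)}\otimes\mathcal{R}_K^{(1)}\triangleright b_{\underline{(2)}}$, counit $\epsilon(b)=\underline\epsilon(b)$ and antipode $Sb=(u\mathcal{R}_K^{(1)}\triangleright\underline{S}b)\,S\mathcal{R}_K^{(2)}$, $u=(S\mathcal{R}_K^{(2)})\mathcal{R}_K^{(1)}$. Let $\chi=\mathcal{R}_{23}^{-1}\in(H\otimes H)^{\otimes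 2}$, i.e. $\mathcal{R}^{-1}$ with its first leg in the second copy of $H$ (in the first factor) and its second leg in the first copy of $H$ (in the second factor). It is a quantum 2-cocycle for $H\otimes H$ with the tensor product Hopf algebra structure and quasitriangular structure $\mathcal{R}_{13}\mathcal{R}_{24}$; put $H\bowtie H=(H\otimes H)_\chi$. Let $\bar A(R)$ and $B(R)$ be the algebras generated by a matrix $\mathbf{p}=(p^i{}_j)$ with relations $R_{21}\mathbf{p}_1\mathbf{p}_2=\mathbf{p}_2\mathbf{p}_1R$ and $R_{21}\mathbf{p}_1R\mathbf{p}_2=\mathbf{p}_2R_{21}\mathbf{p}_1R$ respectively. They are braided groups in the categories of modules of $\widetilde{H\otimes H}$ and of $\widetilde{H\bowtie H}$ respectively, with $\underline\Delta\mathbf{p}=\mathbf{p}\otimes1+1\otimes\mathbf{p}$ and, in both cases, with the action $(h\otimes g)\triangleright p^i{}_j=\sum_{a,b}\langle h,St^i{}_a\rangle\langle g,t^b{}_j\rangle\,p^a{}_b$, $\xi\triangleright p^i{}_j=-p^i{}_j$. Then $\chi$, viewed in the spinorial $q$-Euclidean Poincaré quantum group $\bar A(R)\rtimes\widetilde{H\otimes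 H}$, is a quantum 2-cocycle for it, and the spinorial $q$-Minkowski Poincaré quantum group $B(R)\rtimes\widetilde{H\bowtie H}$ is its twisting by $\chi$: there is an isomorphism of Hopf algebras $$\theta:\ \bigl(\bar A(R)\rtimes\widetilde{H\otimes H}\bigr)_\chi\ \longrightarrow\ B(R)\rtimes\widetilde{H\bowtie H}$$ which is the identity on the common subalgebra $H\otimes H$ and on $\xi$, and sends $p^i{}_j$ to $\sum_a p^i{}_a\,l^-{}^a{}_j$, where $l^-{}^a{}_j=\langle t^a{}_j\otimes\mathrm{id},\mathcal{R}^{-1}\rangle$ lies in the first copy of $H$. -/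

import Mathlib

open scoped TensorProduct Kronecker PowerSeries

universe u v w

noncomputable section

namespace QPoincare

/-! ### Hopf algebras as data on a fixed algebra, quantum 2-cocycles, twisting

One and the same algebra carries several Hopf algebra structures below, so the coproduct, counit and
antipode are kept as terms; `IsHopf` are the usual axioms. -/

section Hopf

variable (k : Type u) [CommRing k] (A : Type v) [Ring A] [Algebra k A]

/-- A coproduct and a counit, both algebra maps, and a candidate antipode on the algebra `A`. -/
structure HopfData where
  comul : A →ₐ[k] A ⊗[k] A
  counit : A →ₐ[k] k
  antipode : A →ₗ[k] A

/-- The structure maps of a Hopf algebra in the sense of Mathlib. -/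
def HopfData.of (H : Type v) [Ring H] [HopfAlgebra k H] : HopfData k H where
  comul := Bialgebra.comulAlgHom k H
  counit := Bialgebra.counitAlgHom k H
  antipode := HopfAlgebraStruct.antipode k

variable {k A}

/-- The axioms of a Hopf algebra. -/
structure HopfData.IsHopf (D : HopfData k A) : Prop where
  coassoc : (TensorProduct.assoc k A A A).toLinearMap ∘ₗ
      D.comul.toLinearMap.rTensor A ∘ₗ D.comul.toLinearMap =
    D.comul.toLinearMap.lTensor A ∘ₗ D.comul.toLinearMap
  counit_left : ∀ a, D.counit.toLinearMap.rTensor A (D.comul a) = 1 ⊗ₜ[k] a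
  counit_right : ∀ a, D.counit.toLinearMap.lTensor A (D.comul a) = a ⊗ₜ[k] 1
  antipode_left : ∀ a, LinearMap.mul' k A (D.antipode.rTensor A (D.comul a)) =
    algebraMap k A (D.counit a)
  antipode_right : ∀ a, LinearMap.mul' k A (D.antipode.lTensor A (D.comul a)) =
    algebraMap k A (D.counit a)

/-- `R` is a quasitriangular structure:
`τ Δ h = R (Δ h) R⁻¹`, `(Δ ⊗ id) R = R₁₃ R₂₃`, `(id ⊗ Δ) R = R₁₃ R₁₂`. -/
structure HopfData.IsQuasitriangular (D : HopfData k A) (R : (A ⊗[k] A)ˣ) : Prop where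
  intertwine : ∀ h, TensorProduct.comm k A A (D.comul h) * (R : A ⊗[k] A) =
    (R : A ⊗[k] A) * D.comul h
  comul_left : Algebra.TensorProduct.assoc k k k A A A
      (Algebra.TensorProduct.map D.comul (AlgHom.id k A) (R : A ⊗[k] A)) =
    Algebra.TensorProduct.map (AlgHom.id k A) Algebra.TensorProduct.includeRight (R : A ⊗[k] A) *
      Algebra.TensorProduct.includeRight (R : A ⊗[k] A)
  comul_right : Algebra.TensorProduct.map (AlgHom.id k A) D.comul (R : A ⊗[k] A) =
    Algebra.TensorProduct.map (AlgHom.id k A) Algebra.TensorProduct.includeRight (R : A ⊗[k] A) *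
      Algebra.TensorProduct.map (AlgHom.id k A) Algebra.TensorProduct.includeLeft (R : A ⊗[k] A)

/-- `χ` is a quantum 2-cocycle:
`χ₁₂ (Δ ⊗ id) χ = χ₂₃ (id ⊗ Δ) χ` and `(ε ⊗ id) χ = 1`. -/
structure HopfData.IsCocycle (D : HopfData k A) (χ : (A ⊗[k] A)ˣ) : Prop where
  cocycle :
    Algebra.TensorProduct.map (AlgHom.id k A) Algebra.TensorProduct.includeLeft (χ : A ⊗[k] A) *
        Algebra.TensorProduct.assoc k k k A A A
          (Algebra.TensorProduct.map D.comul (AlgHom.id k A) (χ : A ⊗[k] A)) =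
      Algebra.TensorProduct.includeRight (χ : A ⊗[k] A) *
        Algebra.TensorProduct.map (AlgHom.id k A) D.comul (χ : A ⊗[k] A)
  counit : TensorProduct.lid k A (D.counit.toLinearMap.rTensor A (χ : A ⊗[k] A)) = 1

/-- Conjugation by a unit. -/
def conjHom (χ : Aˣ) : A →ₐ[k] A where
  toFun x := χ * x * (↑χ⁻¹ : A)
  map_one' := by simp
  map_mul' x y := by simp [mul_assoc]
  map_zero' := by simp
  map_add' x y := by simp [mul_add, add_mul]
  commutes' r := by
    rw [← Algebra.commutes, mul_assoc, Units.mul_inv, mul_one]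

/-- The element `U = χ⁽¹⁾ S χ⁽²⁾`. -/
def HopfData.twistU (D : HopfData k A) (χ : (A ⊗[k] A)ˣ) : A :=
  LinearMap.mul' k A (D.antipode.lTensor A (χ : A ⊗[k] A))

/-- The twist by `χ`: the same algebra and counit, `Δ_χ = χ (Δ ·) χ⁻¹`, `S_χ = U (S ·) U⁻¹`. -/
def HopfData.twist (D : HopfData k A) (χ : (A ⊗[k] A)ˣ) : HopfData k A where
  comul := (conjHom χ).comp D.comul
  counit := D.counit
  antipode := LinearMap.mulLeft k (D.twistU χ) ∘ₗ
    LinearMap.mulRight k (Ring.inverse (D.twistU χ)) ∘ₗ D.antipode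

/-- The twisted quasitriangular structure `χ₂₁ R χ⁻¹`. -/
def twistR (χ : (A ⊗[k] A)ˣ) (R : A ⊗[k] A) : A ⊗[k] A :=
  TensorProduct.comm k A A (χ : A ⊗[k] A) * R * (↑χ⁻¹ : A ⊗[k] A)

/-- An algebra isomorphism that respects coproduct, counit and antipode. -/
structure IsHopfIso {A' : Type w} [Ring A'] [Algebra k A'] (D : HopfData k A)
    (D' : HopfData k A') (θ : A ≃ₐ[k] A') : Prop where
  comul : ∀ a, D'.comul (θ a) =
    Algebra.TensorProduct.map θ.toAlgHom θ.toAlgHom (D.comul a)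
  counit : ∀ a, D'.counit (θ a) = D.counit a
  antipode : ∀ a, D'.antipode (θ a) = θ (D.antipode a)

/-- The tensor product Hopf algebra. -/
def HopfData.tensor {A' : Type w} [Ring A'] [Algebra k A'] (D : HopfData k A)
    (D' : HopfData k A') : HopfData k (A ⊗[k] A') where
  comul := (Algebra.TensorProduct.tensorTensorTensorComm k k k k A A A' A').toAlgHom.comp
    (Algebra.TensorProduct.map D.comul D'.comul)
  counit := (Algebra.TensorProduct.lmul' k).comp
    (Algebra.TensorProduct.map D.counit D'.counit)
  antipode := TensorProduct.map D.antipode D'.antipode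

/-- `R₁₃ R₂₄`, the quasitriangular structure of the tensor product of two copies of `A`. -/
def tensorR (R : A ⊗[k] A) : (A ⊗[k] A) ⊗[k] (A ⊗[k] A) :=
  Algebra.TensorProduct.tensorTensorTensorComm k k k k A A A A (R ⊗ₜ[k] R)

/-- `χ = R₂₃⁻¹`: the inverse of `R`, its first leg in the second copy and its second leg in the
first copy of `A`. -/
def wickCocycle (R : (A ⊗[k] A)ˣ) : ((A ⊗[k] A) ⊗[k] (A ⊗[k] A))ˣ :=
  Units.map (Algebra.TensorProduct.map
    (Algebra.TensorProduct.includeRight : A →ₐ[k] A ⊗[k] A)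
    (Algebra.TensorProduct.includeLeft : A →ₐ[k] A ⊗[k] A) :
      A ⊗[k] A →ₐ[k] (A ⊗[k] A) ⊗[k] (A ⊗[k] A)) R⁻¹

end Hopf

/-! ### The dilatonic extension -/

section Dilaton

variable (k : Type u) [CommRing k]

/-- The polynomial Hopf algebra on one primitive generator `ξ`. -/
def dilatonLine : HopfData k (Polynomial k) where
  comul := Polynomial.aeval
    ((Polynomial.X : Polynomial k) ⊗ₜ[k] (1 : Polynomial k) + 1 ⊗ₜ[k] Polynomial.X)
  counit := Polynomial.aeval 0
  antipode := (Polynomial.aeval (-Polynomial.X : Polynomial k)).toLinearMap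

/-- The algebra of the dilatonic extension of `K`: a central generator `ξ` is adjoined. -/
abbrev Dil (K : Type v) [Ring K] [Algebra k K] : Type (max u v) := K ⊗[k] Polynomial k

variable {k} {K : Type v} [Ring K] [Algebra k K]

/-- The Hopf algebra structure of the dilatonic extension, `ξ` being primitive. -/
def HopfData.dil (D : HopfData k K) : HopfData k (Dil k K) := D.tensor (dilatonLine k)

/-- The inclusion of `K` in its dilatonic extension. -/
def dilIncl (k : Type u) [CommRing k] (K : Type v) [Ring K] [Algebra k K] : K →ₐ[k] Dil k K := Algebra.TensorProduct.includeLeft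

/-- The dilaton. -/
def xi (k : Type u) [CommRing k] (K : Type v) [Ring K] [Algebra k K] : Dil k K := (1 : K) ⊗ₜ[k] Polynomial.X

/-- `R λ^{-ξ⊗ξ}` where `λ = exp s` and `s` is nilpotent. -/
def dilR [Algebra ℚ k] (s : k) (R : K ⊗[k] K) : Dil k K ⊗[k] Dil k K :=
  Algebra.TensorProduct.map (dilIncl k K) (dilIncl k K) R *
    Algebra.TensorProduct.map
      (Algebra.TensorProduct.includeRight : Polynomial k →ₐ[k] Dil k K)
      (Algebra.TensorProduct.includeRight : Polynomial k →ₐ[k] Dil k K)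
      (IsNilpotent.exp
        (-(s • ((Polynomial.X : Polynomial k) ⊗ₜ[k] (Polynomial.X : Polynomial k)))))

end Dilaton

/-! ### Braided groups in the category of modules and their bosonisation -/

section Braided

variable {k : Type u} [CommRing k] {K : Type v} [Ring K] [Algebra k K]

/-- The action of `K ⊗ K` on `B ⊗ B`. -/
def actTensor {B : Type w} [Ring B] [Algebra k B] (act : K →ₐ[k] Module.End k B) :
    K ⊗[k] K →ₐ[k] Module.End k (B ⊗[k] B) :=
  (Module.endTensorEndAlgHom (R := k) (S := k) (A := k) (M := B) (N := B)).comp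
    (Algebra.TensorProduct.map act act)

/-- An action of the Hopf algebra `K` on the algebra `B`, making it a module algebra. -/
structure ModuleAlgebra (D : HopfData k K) (B : Type w) [Ring B] [Algebra k B] where
  act : K →ₐ[k] Module.End k B
  act_one : ∀ h, act h 1 = algebraMap k B (D.counit h)
  act_mul : ∀ h (x : B ⊗[k] B), act h (LinearMap.mul' k B x) =
    LinearMap.mul' k B (actTensor act (D.comul h) x)

variable {D : HopfData k K} {B : Type w} [Ring B] [Algebra k B]

/-- The braiding `Ψ(b ⊗ c) = R⁽²⁾ ▷ c ⊗ R⁽¹⁾ ▷ b`. -/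
def ModuleAlgebra.braiding (M : ModuleAlgebra D B) (R : K ⊗[k] K) :
    B ⊗[k] B →ₗ[k] B ⊗[k] B :=
  (TensorProduct.comm k B B).toLinearMap ∘ₗ actTensor M.act R

/-- The product `(a ⊗ b)(c ⊗ d) = a Ψ(b ⊗ c) d` of the braided tensor product algebra. -/
def ModuleAlgebra.braidedMul (M : ModuleAlgebra D B) (R : K ⊗[k] K) :
    (B ⊗[k] B) ⊗[k] (B ⊗[k] B) →ₗ[k] B ⊗[k] B :=
  TensorProduct.map (LinearMap.mul' k B) (LinearMap.mul' k B) ∘ₗ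
    (TensorProduct.assoc k B B (B ⊗[k] B)).symm.toLinearMap ∘ₗ
    ((TensorProduct.assoc k B B B).toLinearMap ∘ₗ
      (M.braiding R).rTensor B ∘ₗ
      (TensorProduct.assoc k B B B).symm.toLinearMap).lTensor B ∘ₗ
    (TensorProduct.assoc k B B (B ⊗[k] B)).toLinearMap

/-- A braided group `B` in the category of modules of the Hopf algebra `D` with quasitriangular
structure `R`. -/
structure BraidedGroup (D : HopfData k K) (R : K ⊗[k] K) (B : Type w) [Ring B] [Algebra k B]
    extends ModuleAlgebra D B where
  comul : B →ₗ[k] B ⊗[k] B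
  counit : B →ₗ[k] k
  antipode : B →ₗ[k] B
  comul_act : ∀ h b, comul (act h b) = actTensor act (D.comul h) (comul b)
  counit_act : ∀ h b, counit (act h b) = D.counit h * counit b
  antipode_act : ∀ h b, antipode (act h b) = act h (antipode b)
  coassoc : (TensorProduct.assoc k B B B).toLinearMap ∘ₗ comul.rTensor B ∘ₗ comul =
    comul.lTensor B ∘ₗ comul
  counit_left : ∀ b, counit.rTensor B (comul b) = 1 ⊗ₜ[k] b
  counit_right : ∀ b, counit.lTensor B (comul b) = b ⊗ₜ[k] 1
  comul_one : comul 1 = 1 ⊗ₜ[k] 1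
  comul_mul : ∀ b c, comul (b * c) =
    toModuleAlgebra.braidedMul R (comul b ⊗ₜ[k] comul c)
  counit_one : counit 1 = 1
  counit_mul : ∀ b c, counit (b * c) = counit b * counit c
  antipode_left : ∀ b, LinearMap.mul' k B (antipode.rTensor B (comul b)) =
    algebraMap k B (counit b)
  antipode_right : ∀ b, LinearMap.mul' k B (antipode.lTensor B (comul b)) =
    algebraMap k B (counit b)

/-- The relations of the semidirect product algebra generated by `B` and `K`: those of `B`, those
of `K` and `h b = (h₍₁₎ ▷ b) h₍₂₎`. -/
inductive BosRel (M : ModuleAlgebra D B) :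
    TensorAlgebra k (B × K) → TensorAlgebra k (B × K) → Prop
  | one_left : BosRel M (TensorAlgebra.ι k ((1 : B), (0 : K))) 1
  | mul_left (b c : B) : BosRel M (TensorAlgebra.ι k (b * c, (0 : K)))
      (TensorAlgebra.ι k (b, (0 : K)) * TensorAlgebra.ι k (c, (0 : K)))
  | one_right : BosRel M (TensorAlgebra.ι k ((0 : B), (1 : K))) 1
  | mul_right (h g : K) : BosRel M (TensorAlgebra.ι k ((0 : B), h * g))
      (TensorAlgebra.ι k ((0 : B), h) * TensorAlgebra.ι k ((0 : B), g))
  | cross (h : K) (b : B) : BosRel M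
      (TensorAlgebra.ι k ((0 : B), h) * TensorAlgebra.ι k (b, (0 : K)))
      (LinearMap.mul' k (TensorAlgebra k (B × K))
        (TensorProduct.map
          (TensorAlgebra.ι k ∘ₗ LinearMap.inl k B K ∘ₗ M.act.toLinearMap.flip b)
          (TensorAlgebra.ι k ∘ₗ LinearMap.inr k B K) (D.comul h)))

/-- The algebra `B ⋊ K`. -/
abbrev Bos (M : ModuleAlgebra D B) : Type (max u v w) := RingQuot (BosRel M)

/-- The canonical map `B → B ⋊ K`. -/
def inB (M : ModuleAlgebra D B) : B →ₐ[k] Bos M :=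
  AlgHom.ofLinearMap
    ((RingQuot.mkAlgHom k (BosRel M)).toLinearMap ∘ₗ TensorAlgebra.ι k ∘ₗ LinearMap.inl k B K)
    (by
      have h := RingQuot.mkAlgHom_rel k (BosRel.one_left (M := M))
      simpa using h)
    (fun b c => by
      have h := RingQuot.mkAlgHom_rel k (BosRel.mul_left (M := M) b c)
      simpa using h)

/-- The canonical map `K → B ⋊ K`. -/
def inK (M : ModuleAlgebra D B) : K →ₐ[k] Bos M :=
  AlgHom.ofLinearMap
    ((RingQuot.mkAlgHom k (BosRel M)).toLinearMap ∘ₗ TensorAlgebra.ι k ∘ₗ LinearMap.inr k B K)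
    (by
      have h := RingQuot.mkAlgHom_rel k (BosRel.one_right (M := M))
      simpa using h)
    (fun b c => by
      have h := RingQuot.mkAlgHom_rel k (BosRel.mul_right (M := M) b c)
      simpa using h)

/-- An element of `K ⊗ K` viewed in the bosonisation. -/
def bosUnit (M : ModuleAlgebra D B) (χ : (K ⊗[k] K)ˣ) : (Bos M ⊗[k] Bos M)ˣ :=
  Units.map (Algebra.TensorProduct.map (inK M) (inK M) :
    K ⊗[k] K →ₐ[k] Bos M ⊗[k] Bos M) χ

/-- The map `(r ⊗ r') ⊗ (b ⊗ b') ↦ b r' ⊗ (r ▷ b')`. -/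
def bosComulMap (M : ModuleAlgebra D B) :
    (K ⊗[k] K) ⊗[k] (B ⊗[k] B) →ₗ[k] Bos M ⊗[k] Bos M :=
  TensorProduct.map
      (LinearMap.mul' k (Bos M) ∘ₗ
        TensorProduct.map (inB M).toLinearMap (inK M).toLinearMap ∘ₗ
        (TensorProduct.comm k K B).toLinearMap)
      ((inB M).toLinearMap ∘ₗ TensorProduct.lift M.act.toLinearMap) ∘ₗ
    (TensorProduct.tensorTensorTensorComm k K K B B).toLinearMap ∘ₗ
    (TensorProduct.comm k K K).toLinearMap.rTensor (B ⊗[k] B)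

/-- The element `u = (S R⁽²⁾) R⁽¹⁾`. -/
def drinfeldU (D : HopfData k K) (R : K ⊗[k] K) : K :=
  LinearMap.mul' k K (D.antipode.rTensor K (TensorProduct.comm k K K R))

/-- The Hopf algebra structure of the bosonisation of a braided group: `K` is a sub-Hopf algebra,
`Δ b = b₍₁₎ R⁽²⁾ ⊗ R⁽¹⁾ ▷ b₍₂₎`, `ε b = ε(b)` and `S b = (u R⁽¹⁾ ▷ S b) S R⁽²⁾`. -/
structure IsBosonisation {R : K ⊗[k] K} (G : BraidedGroup D R B)
    (E : HopfData k (Bos G.toModuleAlgebra)) : Prop where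
  isHopf : E.IsHopf
  comul_inK : ∀ h, E.comul (inK _ h) =
    Algebra.TensorProduct.map (inK _) (inK _) (D.comul h)
  counit_inK : ∀ h, E.counit (inK _ h) = D.counit h
  antipode_inK : ∀ h, E.antipode (inK _ h) = inK _ (D.antipode h)
  comul_inB : ∀ b, E.comul (inB _ b) = bosComulMap _ (R ⊗ₜ[k] G.comul b)
  counit_inB : ∀ b, E.counit (inB _ b) = G.counit b
  antipode_inB : ∀ b, E.antipode (inB _ b) =
    LinearMap.mul' k _
      (TensorProduct.map
        ((inB G.toModuleAlgebra).toLinearMap ∘ₗ G.act.toLinearMap.flip (G.antipode b) ∘ₗ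
          LinearMap.mulLeft k (drinfeldU D R))
        ((inK G.toModuleAlgebra).toLinearMap ∘ₗ D.antipode) R)

end Braided

/-! ### The quadratic algebras of momenta

`R : Matrix (Fin N × Fin N) (Fin N × Fin N) k` has the entries `R (i, j) (a, b) = R^i_a^j_b`. -/

section Quadratic

variable {k : Type u} [CommRing k] {N : ℕ}

/-- `R₂₁`. -/
def flipR (R : Matrix (Fin N × Fin N) (Fin N × Fin N) k) :
    Matrix (Fin N × Fin N) (Fin N × Fin N) k := R.submatrix Prod.swap Prod.swap

/-- The permutation matrix `P`. -/
def permP (k : Type u) [CommRing k] (N : ℕ) : Matrix (Fin N × Fin N) (Fin N × Fin N) k :=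
  (1 : Matrix (Fin N × Fin N) (Fin N × Fin N) k).submatrix id Prod.swap

/-- The `q`-Hecke condition `(P R - q)(P R + q⁻¹) = 0`. -/
def IsHecke (q : kˣ) (R : Matrix (Fin N × Fin N) (Fin N × Fin N) k) : Prop :=
  (permP k N * R - (q : k) • 1) * (permP k N * R + (↑q⁻¹ : k) • 1) = 0

/-- The matrix of free generators. -/
def freeP (k : Type u) [CommRing k] (N : ℕ) :
    Matrix (Fin N) (Fin N) (FreeAlgebra k (Fin N × Fin N)) :=
  Matrix.of fun i j => FreeAlgebra.ι k (i, j)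

/-- `p₁ = p ⊗ 1`. -/
def freeP₁ (k : Type u) [CommRing k] (N : ℕ) :
    Matrix (Fin N × Fin N) (Fin N × Fin N) (FreeAlgebra k (Fin N × Fin N)) :=
  freeP k N ⊗ₖ 1

/-- `p₂ = 1 ⊗ p`. -/
def freeP₂ (k : Type u) [CommRing k] (N : ℕ) :
    Matrix (Fin N × Fin N) (Fin N × Fin N) (FreeAlgebra k (Fin N × Fin N)) :=
  1 ⊗ₖ freeP k N

/-- A scalar matrix viewed over the free algebra. -/
def scalarMat (R : Matrix (Fin N × Fin N) (Fin N × Fin N) k) :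
    Matrix (Fin N × Fin N) (Fin N × Fin N) (FreeAlgebra k (Fin N × Fin N)) :=
  R.map (algebraMap k _)

/-- `R₂₁ p₁ p₂ = p₂ p₁ R`. -/
inductive EucRel (R : Matrix (Fin N × Fin N) (Fin N × Fin N) k) :
    FreeAlgebra k (Fin N × Fin N) → FreeAlgebra k (Fin N × Fin N) → Prop
  | rel (x y : Fin N × Fin N) : EucRel R
      ((scalarMat (flipR R) * freeP₁ k N * freeP₂ k N) x y)
      ((freeP₂ k N * freeP₁ k N * scalarMat R) x y)

/-- `R₂₁ p₁ R p₂ = p₂ R₂₁ p₁ R`. -/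
inductive MinkRel (R : Matrix (Fin N × Fin N) (Fin N × Fin N) k) :
    FreeAlgebra k (Fin N × Fin N) → FreeAlgebra k (Fin N × Fin N) → Prop
  | rel (x y : Fin N × Fin N) : MinkRel R
      ((scalarMat (flipR R) * freeP₁ k N * scalarMat R * freeP₂ k N) x y)
      ((freeP₂ k N * scalarMat (flipR R) * freeP₁ k N * scalarMat R) x y)

/-- The `q`-Euclidean algebra `Ā(R)`. -/
abbrev EucAlg (R : Matrix (Fin N × Fin N) (Fin N × Fin N) k) : Type u := RingQuot (EucRel R)

/-- The braided matrix (`q`-Minkowski) algebra `B(R)`. -/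
abbrev MinkAlg (R : Matrix (Fin N × Fin N) (Fin N × Fin N) k) : Type u := RingQuot (MinkRel R)

/-- The generators `p^i_j` of `Ā(R)`. -/
def eucP (R : Matrix (Fin N × Fin N) (Fin N × Fin N) k) : Matrix (Fin N) (Fin N) (EucAlg R) :=
  (freeP k N).map (RingQuot.mkAlgHom k (EucRel R))

/-- The generators `p^i_j` of `B(R)`. -/
def minkP (R : Matrix (Fin N × Fin N) (Fin N × Fin N) k) : Matrix (Fin N) (Fin N) (MinkAlg R) :=
  (freeP k N).map (RingQuot.mkAlgHom k (MinkRel R))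

end Quadratic

/-! ### The additive braided group of momenta over the dilatonic extension of two copies of `H` -/

section Spinorial

variable {k : Type u} [CommRing k] {H : Type v} [Ring H] [Algebra k H] {N : ℕ}

/-- `⟨x ⊗ y, z⟩` for two functionals `x`, `y`. -/
def pairTwo (x y : Module.Dual k H) : H ⊗[k] H →ₗ[k] k :=
  LinearMap.mul' k k ∘ₗ TensorProduct.map x y

/-- `l⁻ = ⟨t ⊗ id, R⁻¹⟩`, where `t i j` is the functional `⟨·, t^i_j⟩`. -/
def lMinus (t : Matrix (Fin N) (Fin N) (Module.Dual k H)) (R : (H ⊗[k] H)ˣ) :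
    Matrix (Fin N) (Fin N) H :=
  Matrix.of fun i j => TensorProduct.lid k H ((t i j).rTensor H (↑R⁻¹ : H ⊗[k] H))

/-- The braided group structure on an algebra generated by `p^i_j` is the additive one,
`Δ p = p ⊗ 1 + 1 ⊗ p`, covariant under the dilatonic extension of two copies of `H` by evaluation
against `p^i_j ↦ p^a_b ⊗ (S s^i_a) t^b_j` and by `ξ ▷ p = -p`. Here `t i j` is the functional
`⟨·, t^i_j⟩` and `St i j` is `⟨·, S t^i_j⟩`. -/
structure IsMomentum (t St : Matrix (Fin N) (Fin N) (Module.Dual k H))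
    {D : HopfData k (Dil k (H ⊗[k] H))}
    {R : Dil k (H ⊗[k] H) ⊗[k] Dil k (H ⊗[k] H)}
    {B : Type w} [Ring B] [Algebra k B] (G : BraidedGroup D R B)
    (p : Matrix (Fin N) (Fin N) B) : Prop where
  act_rotation : ∀ (h g : H) (i j : Fin N), G.act (dilIncl k (H ⊗[k] H) (h ⊗ₜ[k] g)) (p i j) =
    ∑ a, ∑ b, (St i a h * t b j g) • p a b
  act_dilaton : ∀ i j, G.act (xi k (H ⊗[k] H)) (p i j) = -p i j
  comul_p : ∀ i j, G.comul (p i j) = p i j ⊗ₜ[k] 1 + 1 ⊗ₜ[k] p i j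

/-- The Hopf algebra `(H ⊗ H)~`. -/
def eucRot (D : HopfData k H) : HopfData k (Dil k (H ⊗[k] H)) := (D.tensor D).dil

/-- The quasitriangular structure of `(H ⊗ H)~`. -/
def eucRotR [Algebra ℚ k] (s : k) (R : (H ⊗[k] H)ˣ) :
    Dil k (H ⊗[k] H) ⊗[k] Dil k (H ⊗[k] H) :=
  dilR s (tensorR (R : H ⊗[k] H))

/-- The Hopf algebra `(H ⋈ H)~`, where `H ⋈ H` is the twist of `H ⊗ H` by `R₂₃⁻¹`. -/
def minkRot (D : HopfData k H) (R : (H ⊗[k] H)ˣ) : HopfData k (Dil k (H ⊗[k] H)) :=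
  ((D.tensor D).twist (wickCocycle R)).dil

/-- The quasitriangular structure of `(H ⋈ H)~`. -/
def minkRotR [Algebra ℚ k] (s : k) (R : (H ⊗[k] H)ˣ) :
    Dil k (H ⊗[k] H) ⊗[k] Dil k (H ⊗[k] H) :=
  dilR s (twistR (wickCocycle R) (tensorR (R : H ⊗[k] H)))

/-- The cocycle `R₂₃⁻¹` viewed in the dilatonic extension. -/
def dilCocycle (R : (H ⊗[k] H)ˣ) : (Dil k (H ⊗[k] H) ⊗[k] Dil k (H ⊗[k] H))ˣ :=
  Units.map (Algebra.TensorProduct.map (dilIncl k (H ⊗[k] H)) (dilIncl k (H ⊗[k] H)) :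
    (H ⊗[k] H) ⊗[k] (H ⊗[k] H) →ₐ[k] Dil k (H ⊗[k] H) ⊗[k] Dil k (H ⊗[k] H)) (wickCocycle R)

end Spinorial

/-! ### Complete Hopf algebras over `ℂ⟦t⟧`

A `t`-adically complete module `M` over `ℂ⟦t⟧` is the same thing as the system of the modules
`M n = M / t^(n+1) M` over `ℂ⟦t⟧ / t^(n+1)`, and the completed tensor product of `M` and `M'` is the
system `M n ⊗ M' n`. A topological Hopf algebra over `ℂ⟦t⟧` is therefore a system of Hopf algebras
over `ℂ⟦t⟧ / t^(n+1)`, each the reduction of the next. -/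

section Formal

/-- `ℂ⟦t⟧ / t^(n+1)`. -/
abbrev PowTrunc (n : ℕ) : Type := ℂ⟦X⟧ ⧸ Ideal.span {(PowerSeries.X : ℂ⟦X⟧) ^ (n + 1)}

/-- The projection `ℂ⟦t⟧ / t^(n+2) → ℂ⟦t⟧ / t^(n+1)`. -/
def truncProj (n : ℕ) : PowTrunc (n + 1) →+* PowTrunc n :=
  Ideal.Quotient.factor (Ideal.span_singleton_le_span_singleton.mpr (pow_dvd_pow _ (by omega)))

/-- The reduction of a power series. -/
abbrev red (n : ℕ) : ℂ⟦X⟧ →+* PowTrunc n := algebraMap ℂ⟦X⟧ (PowTrunc n)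

/-- The ring map `π`, semilinear over `σ`, exhibits `A` as the reduction `A' / (ker σ) A'`. -/
structure IsReduction {k' k : Type*} [CommRing k'] [CommRing k] {σ : k' →+* k}
    {A' A : Type*} [Ring A'] [Algebra k' A'] [Ring A] [Algebra k A] (π : A' →ₛₗ[σ] A) : Prop where
  map_one : π 1 = 1
  map_mul : ∀ x y, π (x * y) = π x * π y
  surjective : Function.Surjective π
  ker : ∀ x, π x = 0 → x ∈ RingHom.ker σ • (⊤ : Submodule k' A')

/-- The system of Hopf algebras `D n` with the reduction maps `π n` is a complete Hopf algebra over
`ℂ⟦t⟧`. -/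
structure IsFormalHopf {A : ℕ → Type u} [∀ n, Ring (A n)] [∀ n, Algebra (PowTrunc n) (A n)]
    (D : ∀ n, HopfData (PowTrunc n) (A n)) (π : ∀ n, A (n + 1) →ₛₗ[truncProj n] A n) : Prop where
  isHopf : ∀ n, (D n).IsHopf
  isReduction : ∀ n, IsReduction (π n)
  comul : ∀ n x, (D n).comul (π n x) = TensorProduct.map (π n) (π n) ((D (n + 1)).comul x)
  counit : ∀ n x, (D n).counit (π n x) = truncProj n ((D (n + 1)).counit x)

/-- The reduction maps of a system of bosonisations over the dilatonic extension of two copies of `H`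
are the evident ones: those of `H` on both copies, and the identity on `ξ` and on the momenta. -/
structure IsCanonical {H : ℕ → Type u} [∀ n, Ring (H n)] [∀ n, Algebra (PowTrunc n) (H n)]
    (πH : ∀ n, H (n + 1) →ₛₗ[truncProj n] H n)
    {D : ∀ n, HopfData (PowTrunc n) (Dil (PowTrunc n) (H n ⊗[PowTrunc n] H n))}
    {B : ℕ → Type v} [∀ n, Ring (B n)] [∀ n, Algebra (PowTrunc n) (B n)]
    (M : ∀ n, ModuleAlgebra (D n) (B n))
    {N : ℕ} (p : ∀ n, Matrix (Fin N) (Fin N) (B n))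
    (π : ∀ n, Bos (M (n + 1)) →ₛₗ[truncProj n] Bos (M n)) : Prop where
  rotation : ∀ n h g,
    π n (inK (M (n + 1)) (dilIncl (PowTrunc (n + 1)) (H (n + 1) ⊗[PowTrunc (n + 1)] H (n + 1))
        (h ⊗ₜ[PowTrunc (n + 1)] g))) =
      inK (M n) (dilIncl (PowTrunc n) (H n ⊗[PowTrunc n] H n) (πH n h ⊗ₜ[PowTrunc n] πH n g))
  dilaton : ∀ n, π n (inK (M (n + 1)) (xi _ _)) = inK (M n) (xi _ _)
  momentum : ∀ n i j, π n (inB (M (n + 1)) (p (n + 1) i j)) = inB (M n) (p n i j)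

/-- A duality pairing of a Hopf algebra `A` over `k` with a Hopf algebra `H` over a `k`-algebra
`k'`. -/
structure IsHopfPairing {k k' A H : Type*} [CommRing k] [CommRing k'] [Algebra k k']
    [Ring A] [HopfAlgebra k A] [Ring H] [HopfAlgebra k' H]
    (pair : A →ₗ[k] Module.Dual k' H) : Prop where
  mul_left : ∀ a b h, pair (a * b) h = pairTwo (pair a) (pair b) (Coalgebra.comul h)
  one_left : ∀ h, pair 1 h = Coalgebra.counit h
  mul_right : ∀ a h g, pair a (h * g) =
    LinearMap.mul' k k' (TensorProduct.map (pair.flip h) (pair.flip g) (Coalgebra.comul (R := k) a))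
  one_right : ∀ a, pair a 1 = algebraMap k k' (Coalgebra.counit a)
  antipode : ∀ a h,
    pair (HopfAlgebraStruct.antipode k a) h = pair a (HopfAlgebraStruct.antipode k' h)

end Formal

end QPoincare

end

open QPoincare

open scoped TensorProduct Kronecker PowerSeries

open QPoincare

/-! Work first over one truncation `k = ℂ⟦t⟧/(t^(n+1))`, and let `K` be the dilatonic extension of
`H ⊗ H`. The dilaton takes no part in `χ`, so the Minkowski rotations are simply the twist `K_χ` of
`K`, with quasitriangular structure `χ₂₁ R χ⁻¹` (`minkRot_eq_twist`, `minkRotR_eq_twistR`). That `χ`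
is a cocycle comes down, after the hexagon identities, to the commutation of two copies of `R⁻¹`
sitting in disjoint legs.

The general principle behind the isomorphism: a cocycle deforms the product of a `K`-module algebra
into that of a `K_χ`-module algebra, and `b ↦ (χ⁽¹⁾ ▷ b) χ⁽²⁾`, `h ↦ h` identifies the two
semidirect products. Multiplicativity is the cocycle identity (`gaugeB_mul`), and the inverse is the
same map for `χ⁻¹` (`gaugeMap_comp`). The map carries the coproduct of one bosonisation, conjugated
by `χ`, to that of the other (`comul_gaugeMap`); antipodes follow by uniqueness of convolution
inverses.

In the present case both algebras have generators `p^i_j` with the same matrix representation, so it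
suffices that `χ` carries the relations of `Ā(R)` to those of `B(R)`. The first leg of `χ` acts on
the column index of the left `p`, the second, through the antipode, on the row index of the right
`p`. Since `(id ⊗ S)𝓡⁻¹ = 𝓡`, a factor `λ^{1/2} R` is inserted between the two: `R₂₁ p₁ p₂ = p₂ p₁
R` becomes `R₂₁ p₁ R p₂ = p₂ R₂₁ p₁ R` (`tensorRep_eucCoeff`). The same contraction performed on a
single `p` produces `l⁻` (`contract_dilCocycle`).

The additive coproduct exists because the relation tensors are eigenvectors of the braiding with
eigenvalue `-1`, so that the mixed terms in `(p ⊗ 1 + 1 ⊗ p)²` cancel. For `Ā(R)` two factors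
`λ^{1/2}` are absorbed by the `λ⁻¹` of the dilaton, and the rest is the Hecke condition
(`IsHecke.antisymm`); for `B(R)` the property is transported by `χ`. The bosonisation is built
first, by its universal property and with axioms checked on generators, and is proved to be a Hopf
algebra (`isHopf_bosHopf`). The braided coproduct and counit, with their axioms, are then obtained
by projecting along `b h ↦ b ε(h)`; the braided antipode is recovered from the ordinary one through
`bosAnti`.

Finally all data are given by generators, relations and matrix coefficients compatible with the
passage from `n + 1` to `n`, which yields the reduction maps. Their kernels are no larger than
required because the universal reduction of the source factors through the target (`exists_bosRed`).
-/

noncomputable section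

namespace QPoincare

/-! ### Legs of tensors and coproducts as algebra maps -/

section Legs

variable (k : Type u) [CommRing k] (A : Type v) [Ring A] [Algebra k A]

/-- `x ↦ x₁₂`. -/
abbrev leg₁₂ : A ⊗[k] A →ₐ[k] A ⊗[k] (A ⊗[k] A) :=
  Algebra.TensorProduct.map (AlgHom.id k A) Algebra.TensorProduct.includeLeft

/-- `x ↦ x₁₃`. -/
abbrev leg₁₃ : A ⊗[k] A →ₐ[k] A ⊗[k] (A ⊗[k] A) :=
  Algebra.TensorProduct.map (AlgHom.id k A) Algebra.TensorProduct.includeRight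

/-- `x ↦ x₂₃`. -/
abbrev leg₂₃ : A ⊗[k] A →ₐ[k] A ⊗[k] (A ⊗[k] A) :=
  Algebra.TensorProduct.includeRight

variable {k A}

/-- `Δ ⊗ id`. -/
def HopfData.comulL (D : HopfData k A) : A ⊗[k] A →ₐ[k] A ⊗[k] (A ⊗[k] A) :=
  (Algebra.TensorProduct.assoc k k k A A A).toAlgHom.comp
    (Algebra.TensorProduct.map D.comul (AlgHom.id k A))

/-- `id ⊗ Δ`. -/
def HopfData.comulR (D : HopfData k A) : A ⊗[k] A →ₐ[k] A ⊗[k] (A ⊗[k] A) :=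
  Algebra.TensorProduct.map (AlgHom.id k A) D.comul

theorem HopfData.comulL_tmul (D : HopfData k A) (a b : A) :
    D.comulL (a ⊗ₜ b) = Algebra.TensorProduct.assoc k k k A A A (D.comul a ⊗ₜ b) := rfl

theorem HopfData.comulR_tmul (D : HopfData k A) (a b : A) :
    D.comulR (a ⊗ₜ b) = a ⊗ₜ D.comul b := rfl

theorem HopfData.IsHopf.comulL_comul {D : HopfData k A} (hD : D.IsHopf) (a : A) :
    D.comulL (D.comul a) = D.comulR (D.comul a) :=
  LinearMap.congr_fun hD.coassoc a

/-- An algebra with coproduct, counit and antipode as a Hopf algebra of the library. -/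
@[reducible] def HopfData.IsHopf.hopfAlgebra {D : HopfData k A} (hD : D.IsHopf) :
    HopfAlgebra k A where
  comul := D.comul.toLinearMap
  counit := D.counit.toLinearMap
  coassoc := hD.coassoc
  rTensor_counit_comp_comul := LinearMap.ext hD.counit_left
  lTensor_counit_comp_comul := LinearMap.ext hD.counit_right
  counit_one := map_one D.counit
  mul_compr₂_counit := by ext; simp
  comul_one := map_one D.comul
  mul_compr₂_comul := by ext; simp
  antipode := D.antipode
  mul_antipode_rTensor_comul := LinearMap.ext hD.antipode_left
  mul_antipode_lTensor_comul := LinearMap.ext hD.antipode_right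

theorem HopfData.IsHopf.antipode_one {D : HopfData k A} (hD : D.IsHopf) : D.antipode 1 = 1 := by
  let _ := hD.hopfAlgebra
  exact HopfAlgebra.antipode_one (R := k) (A := A)

theorem HopfData.IsHopf.antipode_mul {D : HopfData k A} (hD : D.IsHopf) (a b : A) :
    D.antipode (a * b) = D.antipode b * D.antipode a := by
  let _ := hD.hopfAlgebra
  exact HopfAlgebra.antipode_mul_antidistrib (R := k) a b

/-- The antipode is determined by coproduct and counit. -/
theorem HopfData.IsHopf.ext {D D' : HopfData k A} (hD : D.IsHopf) (hD' : D'.IsHopf)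
    (h : D.comul = D'.comul) (h' : D.counit = D'.counit) : D = D' := by
  obtain ⟨c, e, S⟩ := D
  obtain ⟨c', e', S'⟩ := D'
  obtain rfl : c = c' := h
  obtain rfl : e = e' := h'
  congr
  let _ := hD.hopfAlgebra
  -- The two antipodes are convolution inverses of the identity, one used as a left and the other as
  -- a right inverse.
  refine WithConv.toConv_injective (left_inv_eq_right_inv
    (a := WithConv.toConv (LinearMap.id : A →ₗ[k] A)) ?_ ?_)
  · ext a
    exact hD.antipode_left a
  · ext a
    exact hD'.antipode_right a

theorem HopfData.isHopf_of (H : Type v) [Ring H] [HopfAlgebra k H] : (HopfData.of k H).IsHopf where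
  coassoc := Coalgebra.coassoc
  counit_left := Coalgebra.rTensor_counit_comul
  counit_right := Coalgebra.lTensor_counit_comul
  antipode_left := HopfAlgebra.mul_antipode_rTensor_comul_apply
  antipode_right := HopfAlgebra.mul_antipode_lTensor_comul_apply

theorem HopfData.IsHopf.tensor {A' : Type w} [Ring A'] [Algebra k A'] {D : HopfData k A}
    {D' : HopfData k A'} (hD : D.IsHopf) (hD' : D'.IsHopf) : (D.tensor D').IsHopf := by
  let _ := hD.hopfAlgebra
  let _ := hD'.hopfAlgebra
  have e : D.tensor D' = HopfData.of k (A ⊗[k] A') := by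
    unfold HopfData.tensor HopfData.of
    congr 1
    ext <;> simp <;> rfl
  rw [e]
  exact HopfData.isHopf_of (k := k) (A ⊗[k] A')

end Legs

/-! ### Twisting -/

section Twist

variable {k : Type u} [CommRing k] {A : Type v} [Ring A] [Algebra k A]

theorem twist_comul (D : HopfData k A) (χ : (A ⊗[k] A)ˣ) (a : A) :
    (D.twist χ).comul a = χ * D.comul a * (↑χ⁻¹ : A ⊗[k] A) := rfl

theorem comulL_twist (D : HopfData k A) (χ : (A ⊗[k] A)ˣ) (x : A ⊗[k] A) :
    (D.twist χ).comulL x = leg₁₂ k A χ * D.comulL x * leg₁₂ k A (↑χ⁻¹ : A ⊗[k] A) := by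
  have key : ∀ y : A ⊗[k] A, ∀ b : A, leg₁₂ k A y =
      Algebra.TensorProduct.assoc k k k A A A (y ⊗ₜ 1) := fun y b => by
    induction y with
    | zero => simp
    | tmul p q => rfl
    | add p q hp hq => rw [map_add, hp, hq, TensorProduct.add_tmul, map_add]
  induction x with
  | zero => simp
  | tmul a b =>
    rw [HopfData.comulL_tmul, HopfData.comulL_tmul, key _ b, key _ b, ← map_mul, ← map_mul,
      twist_comul, Algebra.TensorProduct.tmul_mul_tmul, Algebra.TensorProduct.tmul_mul_tmul,
      one_mul, mul_one]
  | add p q hp hq => rw [map_add, map_add, hp, hq, mul_add, add_mul]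

theorem comulR_twist (D : HopfData k A) (χ : (A ⊗[k] A)ˣ) (x : A ⊗[k] A) :
    (D.twist χ).comulR x = leg₂₃ k A χ * D.comulR x * leg₂₃ k A (↑χ⁻¹ : A ⊗[k] A) := by
  induction x with
  | zero => simp
  | tmul a b =>
    rw [HopfData.comulR_tmul, HopfData.comulR_tmul, twist_comul,
      Algebra.TensorProduct.includeRight_apply, Algebra.TensorProduct.includeRight_apply,
      Algebra.TensorProduct.tmul_mul_tmul, Algebra.TensorProduct.tmul_mul_tmul,
      one_mul, mul_one]
  | add p q hp hq => rw [map_add, map_add, hp, hq, mul_add, add_mul]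

variable {D : HopfData k A}

/-- `ε ⊗ id` as an algebra map. -/
def HopfData.counitL (D : HopfData k A) : A ⊗[k] A →ₐ[k] A :=
  (Algebra.TensorProduct.lid k A).toAlgHom.comp
    (Algebra.TensorProduct.map D.counit (AlgHom.id k A))

/-- `id ⊗ ε` as an algebra map. -/
def HopfData.counitR (D : HopfData k A) : A ⊗[k] A →ₐ[k] A :=
  (Algebra.TensorProduct.rid k k A).toAlgHom.comp
    (Algebra.TensorProduct.map (AlgHom.id k A) D.counit)

@[simp] theorem HopfData.counitL_tmul (a b : A) : D.counitL (a ⊗ₜ b) = D.counit a • b := by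
  simp [HopfData.counitL]

@[simp] theorem HopfData.counitR_tmul (a b : A) : D.counitR (a ⊗ₜ b) = D.counit b • a := by
  simp [HopfData.counitR]

theorem HopfData.IsHopf.counitL_comul (hD : D.IsHopf) (a : A) : D.counitL (D.comul a) = a := by
  have := congrArg (TensorProduct.lid k A) (hD.counit_left a)
  rw [TensorProduct.lid_tmul, one_smul] at this
  exact this

theorem HopfData.IsHopf.counitR_comul (hD : D.IsHopf) (a : A) : D.counitR (D.comul a) = a := by
  have := congrArg (TensorProduct.rid k A) (hD.counit_right a)
  rw [TensorProduct.rid_tmul, one_smul] at this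
  exact this

theorem HopfData.IsCocycle.counitL {χ : (A ⊗[k] A)ˣ} (hχ : D.IsCocycle χ) :
    D.counitL (χ : A ⊗[k] A) = 1 := hχ.counit

/-- `id ⊗ ε ⊗ id`. -/
def HopfData.counitM (D : HopfData k A) : A ⊗[k] (A ⊗[k] A) →ₐ[k] A ⊗[k] A :=
  Algebra.TensorProduct.map (AlgHom.id k A) D.counitL

theorem HopfData.IsHopf.counitM_comulL (hD : D.IsHopf) (x : A ⊗[k] A) :
    D.counitM (D.comulL x) = x := by
  induction x with
  | zero => simp
  | tmul a b =>
    have key : ∀ y : A ⊗[k] A, D.counitM (Algebra.TensorProduct.assoc k k k A A A (y ⊗ₜ b)) =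
        D.counitR y ⊗ₜ b := fun y => by
      induction y with
      | zero => simp
      | tmul p q =>
        simp [HopfData.counitM, TensorProduct.smul_tmul']
      | add p q hp hq => simp only [TensorProduct.add_tmul, map_add, hp, hq]
    rw [HopfData.comulL_tmul, key, hD.counitR_comul]
  | add p q hp hq => simp only [map_add, hp, hq]

theorem HopfData.IsHopf.counitM_comulR (hD : D.IsHopf) (x : A ⊗[k] A) :
    D.counitM (D.comulR x) = x := by
  induction x with
  | zero => simp
  | tmul a b =>
    simp [HopfData.comulR_tmul, HopfData.counitM, hD.counitL_comul]
  | add p q hp hq => simp only [map_add, hp, hq]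

theorem counitM_leg₁₂ (x : A ⊗[k] A) :
    D.counitM (leg₁₂ k A x) = D.counitR x ⊗ₜ 1 := by
  induction x with
  | zero => simp
  | tmul a b => simp [HopfData.counitM, TensorProduct.smul_tmul']
  | add p q hp hq => simp only [map_add, hp, hq, TensorProduct.add_tmul]

theorem counitM_leg₂₃ (x : A ⊗[k] A) :
    D.counitM (leg₂₃ k A x) = 1 ⊗ₜ D.counitL x := by
  simp [HopfData.counitM]

theorem HopfData.IsCocycle.eq {χ : (A ⊗[k] A)ˣ} (hχ : D.IsCocycle χ) :
    leg₁₂ k A χ * D.comulL (χ : A ⊗[k] A) = leg₂₃ k A χ * D.comulR (χ : A ⊗[k] A) := hχ.cocycle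

/-- Each side inverts the common value of the two sides of the cocycle identity. -/
theorem HopfData.IsCocycle.inv_eq {χ : (A ⊗[k] A)ˣ} (hχ : D.IsCocycle χ) :
    D.comulL (↑χ⁻¹ : A ⊗[k] A) * leg₁₂ k A (↑χ⁻¹ : A ⊗[k] A) =
      D.comulR (↑χ⁻¹ : A ⊗[k] A) * leg₂₃ k A (↑χ⁻¹ : A ⊗[k] A) := by
  refine left_inv_eq_right_inv (a := leg₁₂ k A χ * D.comulL (χ : A ⊗[k] A)) ?_ ?_
  · rw [mul_assoc, ← mul_assoc (leg₁₂ k A _), ← map_mul (leg₁₂ k A), Units.inv_mul, map_one,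
      one_mul, ← map_mul, Units.inv_mul, map_one]
  · rw [hχ.eq, mul_assoc, ← mul_assoc (D.comulR _), ← map_mul D.comulR, Units.mul_inv, map_one,
      one_mul, ← map_mul, Units.mul_inv, map_one]

theorem HopfData.tmul_one_injective (D : HopfData k A) {a b : A}
    (h : a ⊗ₜ[k] (1 : A) = b ⊗ₜ[k] 1) : a = b := by
  have := congrArg D.counitR h
  simpa using this

/-- Applying `id ⊗ ε ⊗ id` to the cocycle identity leaves `((id ⊗ ε)χ ⊗ 1) χ = (1 ⊗ (ε ⊗ id)χ) χ`.
Cancelling `χ` derives the second normalisation from the first. -/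
theorem HopfData.IsCocycle.counitR (hD : D.IsHopf) {χ : (A ⊗[k] A)ˣ} (hχ : D.IsCocycle χ) :
    D.counitR (χ : A ⊗[k] A) = 1 := by
  have h := congrArg D.counitM hχ.eq
  rw [map_mul, map_mul, hD.counitM_comulL, hD.counitM_comulR, counitM_leg₁₂, counitM_leg₂₃,
    hχ.counitL] at h
  exact D.tmul_one_injective (χ.isUnit.mul_left_injective h)

/-- The element `V = S χ⁽¹⁾ χ⁽²⁾`. -/
def HopfData.twistV (D : HopfData k A) (x : A ⊗[k] A) : A :=
  LinearMap.mul' k A (D.antipode.rTensor A x)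

/-- `a ⊗ b ⊗ c ↦ a S(b) c`. -/
def HopfData.mulAntipodeMid (D : HopfData k A) : A ⊗[k] (A ⊗[k] A) →ₗ[k] A :=
  LinearMap.mul' k A ∘ₗ (LinearMap.mul' k A ∘ₗ D.antipode.rTensor A).lTensor A

/-- `a ⊗ b ⊗ c ↦ S(a) b S(c)`. -/
def HopfData.mulAntipodeOuter (D : HopfData k A) : A ⊗[k] (A ⊗[k] A) →ₗ[k] A :=
  LinearMap.mul' k A ∘ₗ TensorProduct.map D.antipode (LinearMap.mul' k A ∘ₗ D.antipode.lTensor A)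

theorem HopfData.IsHopf.mulAntipodeMid_legs (hD : D.IsHopf) (x y : A ⊗[k] A) :
    D.mulAntipodeMid (leg₂₃ k A x * leg₁₂ k A y) =
      LinearMap.mul' k A (D.antipode.lTensor A y) * D.twistV x := by
  induction x with
  | zero => simp [HopfData.twistV]
  | add p q hp hq =>
    rw [HopfData.twistV] at hp hq ⊢
    simp only [map_add, add_mul, hp, hq, mul_add]
  | tmul a b =>
    induction y with
    | zero => simp
    | add p q hp hq => simp only [map_add, add_mul, hp, hq, mul_add]
    | tmul c d =>
      simp [HopfData.mulAntipodeMid, HopfData.twistV, hD.antipode_mul, mul_assoc]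

theorem HopfData.IsHopf.mulAntipodeMid_comul (hD : D.IsHopf) (x y : A ⊗[k] A) :
    D.mulAntipodeMid (D.comulR y * D.comulL x) = D.counitR y * D.counitL x := by
  induction x with
  | zero => simp
  | add p q hp hq => simp only [map_add, hp, hq, mul_add]
  | tmul a b =>
    induction y with
    | zero => simp
    | add p q hp hq => simp only [map_add, add_mul, hp, hq]
    | tmul c d =>
      have key : ∀ s t : A ⊗[k] A, D.mulAntipodeMid
          (c ⊗ₜ s * Algebra.TensorProduct.assoc k k k A A A (t ⊗ₜ b)) =
          c * LinearMap.mul' k A (D.antipode.lTensor A t) *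
            LinearMap.mul' k A (D.antipode.rTensor A s) * b := fun s t => by
        induction s with
        | zero => simp
        | add p q hp hq => simp only [map_add, TensorProduct.tmul_add, hp, hq, mul_add, add_mul]
        | tmul s₁ s₂ =>
          induction t with
          | zero => simp
          | add p q hp hq => simp only [map_add, TensorProduct.add_tmul, hp, hq, mul_add, add_mul]
          | tmul t₁ t₂ => simp [HopfData.mulAntipodeMid, hD.antipode_mul, mul_assoc]
      rw [HopfData.comulR_tmul, HopfData.comulL_tmul, key, hD.antipode_left, hD.antipode_right]
      simp [Algebra.algebraMap_eq_smul_one, smul_smul, mul_comm]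

theorem HopfData.mulAntipodeOuter_legs (D : HopfData k A) (x y : A ⊗[k] A) :
    D.mulAntipodeOuter (leg₁₂ k A x * leg₂₃ k A y) =
      D.twistV x * LinearMap.mul' k A (D.antipode.lTensor A y) := by
  induction x with
  | zero => simp [HopfData.twistV]
  | add p q hp hq =>
    rw [HopfData.twistV] at hp hq ⊢
    simp only [map_add, add_mul, hp, hq]
  | tmul a b =>
    induction y with
    | zero => simp
    | add p q hp hq => simp only [map_add, hp, hq, mul_add]
    | tmul c d =>
      simp [HopfData.mulAntipodeOuter, HopfData.twistV, mul_assoc]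

theorem HopfData.IsHopf.mulAntipodeOuter_comul (hD : D.IsHopf) (x y : A ⊗[k] A) :
    D.mulAntipodeOuter (D.comulL y * D.comulR x) =
      D.antipode (D.counitR x) * D.antipode (D.counitL y) := by
  induction x with
  | zero => simp
  | add p q hp hq => simp only [map_add, hp, hq, mul_add, add_mul]
  | tmul a b =>
    induction y with
    | zero => simp
    | add p q hp hq => simp only [map_add, add_mul, hp, hq, mul_add]
    | tmul c d =>
      have key : ∀ s t : A ⊗[k] A, D.mulAntipodeOuter
          (Algebra.TensorProduct.assoc k k k A A A (t ⊗ₜ d) * a ⊗ₜ s) =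
          D.antipode a * LinearMap.mul' k A (D.antipode.rTensor A t) *
            LinearMap.mul' k A (D.antipode.lTensor A s) * D.antipode d := fun s t => by
        induction s with
        | zero => simp
        | add p q hp hq => simp only [map_add, TensorProduct.tmul_add, hp, hq, mul_add, add_mul]
        | tmul s₁ s₂ =>
          induction t with
          | zero => simp
          | add p q hp hq => simp only [map_add, TensorProduct.add_tmul, hp, hq, mul_add, add_mul]
          | tmul t₁ t₂ => simp [HopfData.mulAntipodeOuter, hD.antipode_mul, mul_assoc]
      rw [HopfData.comulR_tmul, HopfData.comulL_tmul, key, hD.antipode_left, hD.antipode_right]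
      simp [Algebra.algebraMap_eq_smul_one, smul_smul, mul_comm]

/-- The cocycle identity can be rearranged as `χ₂₃⁻¹ χ₁₂ = (id ⊗ Δ)χ (Δ ⊗ id)χ⁻¹`. Under `a ⊗ b ⊗ c
↦ a S(b) c` the left side becomes `U V`, while on the right the antipode axioms collapse both
coproducts to counits. -/
theorem HopfData.IsCocycle.twistU_mul_twistV (hD : D.IsHopf) {χ : (A ⊗[k] A)ˣ}
    (hχ : D.IsCocycle χ) : D.twistU χ * D.twistV (↑χ⁻¹ : A ⊗[k] A) = 1 := by
  have e : leg₂₃ k A (↑χ⁻¹ : A ⊗[k] A) * leg₁₂ k A (χ : A ⊗[k] A) =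
      D.comulR (χ : A ⊗[k] A) * D.comulL (↑χ⁻¹ : A ⊗[k] A) := by
    have h1 : D.comulL (χ : A ⊗[k] A) * D.comulL (↑χ⁻¹ : A ⊗[k] A) = 1 := by
      rw [← map_mul, Units.mul_inv, map_one]
    have h2 : leg₂₃ k A (↑χ⁻¹ : A ⊗[k] A) * leg₂₃ k A (χ : A ⊗[k] A) = 1 := by
      rw [← map_mul, Units.inv_mul, map_one]
    calc _ = leg₂₃ k A (↑χ⁻¹ : A ⊗[k] A) * (leg₁₂ k A (χ : A ⊗[k] A) *
          D.comulL (χ : A ⊗[k] A)) * D.comulL (↑χ⁻¹ : A ⊗[k] A) := by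
          rw [mul_assoc, mul_assoc, h1, mul_one]
      _ = _ := by rw [hχ.eq, ← mul_assoc, h2, one_mul]
  have hx : D.counitL (↑χ⁻¹ : A ⊗[k] A) = 1 := by
    have := map_mul D.counitL (χ : A ⊗[k] A) (↑χ⁻¹ : A ⊗[k] A)
    rw [Units.mul_inv, map_one, hχ.counitL, one_mul] at this
    exact this.symm
  have h := congrArg D.mulAntipodeMid e
  rw [hD.mulAntipodeMid_legs, hD.mulAntipodeMid_comul, hχ.counitR hD, hx, one_mul] at h
  exact h

/-- The mirror argument: `a ⊗ b ⊗ c ↦ S(a) b S(c)` is applied to `χ₁₂⁻¹ χ₂₃ = (Δ ⊗ id)χ (id ⊗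
Δ)χ⁻¹`. -/
theorem HopfData.IsCocycle.twistV_mul_twistU (hD : D.IsHopf) {χ : (A ⊗[k] A)ˣ}
    (hχ : D.IsCocycle χ) : D.twistV (↑χ⁻¹ : A ⊗[k] A) * D.twistU χ = 1 := by
  have e : leg₁₂ k A (↑χ⁻¹ : A ⊗[k] A) * leg₂₃ k A (χ : A ⊗[k] A) =
      D.comulL (χ : A ⊗[k] A) * D.comulR (↑χ⁻¹ : A ⊗[k] A) := by
    have h1 : D.comulR (χ : A ⊗[k] A) * D.comulR (↑χ⁻¹ : A ⊗[k] A) = 1 := by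
      rw [← map_mul, Units.mul_inv, map_one]
    have h2 : leg₁₂ k A (↑χ⁻¹ : A ⊗[k] A) * leg₁₂ k A (χ : A ⊗[k] A) = 1 := by
      rw [← map_mul, Units.inv_mul, map_one]
    calc _ = leg₁₂ k A (↑χ⁻¹ : A ⊗[k] A) * (leg₂₃ k A (χ : A ⊗[k] A) *
          D.comulR (χ : A ⊗[k] A)) * D.comulR (↑χ⁻¹ : A ⊗[k] A) := by
          rw [mul_assoc, mul_assoc, h1, mul_one]
      _ = _ := by rw [← hχ.eq, ← mul_assoc, h2, one_mul]
  have hx : D.counitR (↑χ⁻¹ : A ⊗[k] A) = 1 := by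
    have := map_mul D.counitR (χ : A ⊗[k] A) (↑χ⁻¹ : A ⊗[k] A)
    rw [Units.mul_inv, map_one, hχ.counitR hD, one_mul] at this
    exact this.symm
  have h := congrArg D.mulAntipodeOuter e
  rw [D.mulAntipodeOuter_legs, hD.mulAntipodeOuter_comul, hχ.counitL, hx, hD.antipode_one,
    one_mul] at h
  exact h

/-- `Ring.inverse` would return `0` off the units; the two one-sided identities make it the genuine
inverse in the definition of the twisted antipode. -/
theorem HopfData.IsCocycle.inverse_twistU (hD : D.IsHopf) {χ : (A ⊗[k] A)ˣ}
    (hχ : D.IsCocycle χ) : Ring.inverse (D.twistU χ) = D.twistV (↑χ⁻¹ : A ⊗[k] A) :=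
  Ring.inverse_unit ⟨D.twistU χ, D.twistV (↑χ⁻¹ : A ⊗[k] A), hχ.twistU_mul_twistV hD,
    hχ.twistV_mul_twistU hD⟩

/-- `w ↦ S(x⁽¹⁾) w x⁽²⁾`. -/
def HopfData.adL (D : HopfData k A) (x : A ⊗[k] A) (w : A) : A :=
  LinearMap.mul' k A (TensorProduct.map D.antipode (LinearMap.mulLeft k w) x)

/-- `w ↦ x⁽¹⁾ w S(x⁽²⁾)`. -/
def HopfData.adR (D : HopfData k A) (x : A ⊗[k] A) (w : A) : A :=
  LinearMap.mul' k A (TensorProduct.map (LinearMap.mulRight k w) D.antipode x)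

/-- `adL` is a right action and `adR` a left action of `A ⊗ A` on `A`, so the antipode axioms, which
evaluate them on `Δ a` and `1`, pass to products. Only antimultiplicativity of `S` is assumed,
because the bosonisation uses these facts before it is known to be a Hopf algebra. -/
theorem HopfData.adL_mul_of (h : ∀ a b, D.antipode (a * b) = D.antipode b * D.antipode a)
    (x y : A ⊗[k] A) (w : A) : D.adL (x * y) w = D.adL y (D.adL x w) := by
  unfold HopfData.adL
  induction y with
  | zero => simp
  | add p q hp hq => simp only [map_add, mul_add, hp, hq]
  | tmul c d =>
    induction x with
    | zero => simp
    | add p q hp hq => simp only [map_add, add_mul, hp, hq, TensorProduct.map_tmul,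
        LinearMap.mulLeft_apply, LinearMap.mul'_apply, mul_add]
    | tmul a b => simp [h, mul_assoc]

theorem HopfData.adR_mul_of (h : ∀ a b, D.antipode (a * b) = D.antipode b * D.antipode a)
    (x y : A ⊗[k] A) (w : A) : D.adR (x * y) w = D.adR x (D.adR y w) := by
  unfold HopfData.adR
  induction x with
  | zero => simp
  | add p q hp hq => simp only [map_add, add_mul, hp, hq]
  | tmul c d =>
    induction y with
    | zero => simp
    | add p q hp hq => simp only [map_add, mul_add, add_mul, hp, hq, TensorProduct.map_tmul,
        LinearMap.mulRight_apply, LinearMap.mul'_apply]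
    | tmul a b => simp [h, mul_assoc]

theorem HopfData.IsHopf.adL_mul (hD : D.IsHopf) (x y : A ⊗[k] A) (w : A) :
    D.adL (x * y) w = D.adL y (D.adL x w) := HopfData.adL_mul_of hD.antipode_mul x y w

theorem HopfData.IsHopf.adR_mul (hD : D.IsHopf) (x y : A ⊗[k] A) (w : A) :
    D.adR (x * y) w = D.adR x (D.adR y w) := HopfData.adR_mul_of hD.antipode_mul x y w

theorem HopfData.IsHopf.adL_one (hD : D.IsHopf) (w : A) : D.adL 1 w = w := by
  simp [HopfData.adL, Algebra.TensorProduct.one_def, hD.antipode_one]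

theorem HopfData.IsHopf.adR_one (hD : D.IsHopf) (w : A) : D.adR 1 w = w := by
  simp [HopfData.adR, Algebra.TensorProduct.one_def, hD.antipode_one]

theorem HopfData.adL_apply_one (D : HopfData k A) (x : A ⊗[k] A) :
    D.adL x 1 = LinearMap.mul' k A (D.antipode.rTensor A x) := by
  simp [HopfData.adL, LinearMap.rTensor]

theorem HopfData.adR_apply_one (D : HopfData k A) (x : A ⊗[k] A) :
    D.adR x 1 = LinearMap.mul' k A (D.antipode.lTensor A x) := by
  simp [HopfData.adR, LinearMap.lTensor]

theorem HopfData.adL_algebraMap (D : HopfData k A) (x : A ⊗[k] A) (c : k) :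
    D.adL x (algebraMap k A c) = c • D.adL x 1 := by
  unfold HopfData.adL
  induction x with
  | zero => simp
  | add p q hp hq => simp only [map_add, smul_add, hp, hq]
  | tmul a b => simp [Algebra.algebraMap_eq_smul_one]

theorem HopfData.adR_algebraMap (D : HopfData k A) (x : A ⊗[k] A) (c : k) :
    D.adR x (algebraMap k A c) = c • D.adR x 1 := by
  unfold HopfData.adR
  induction x with
  | zero => simp
  | add p q hp hq => simp only [map_add, smul_add, hp, hq]
  | tmul a b => simp [Algebra.algebraMap_eq_smul_one]

theorem HopfData.IsCocycle.twist_antipode (hD : D.IsHopf) {χ : (A ⊗[k] A)ˣ}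
    (hχ : D.IsCocycle χ) (a : A) : (D.twist χ).antipode a =
      D.twistU χ * (D.antipode a * D.twistV (↑χ⁻¹ : A ⊗[k] A)) := by
  rw [← hχ.inverse_twistU hD]
  rfl

/-- The twist of a Hopf algebra by a quantum 2-cocycle is a Hopf algebra. -/
theorem HopfData.IsCocycle.isHopf_twist (hD : D.IsHopf) {χ : (A ⊗[k] A)ˣ}
    (hχ : D.IsCocycle χ) : (D.twist χ).IsHopf where
  coassoc := by
    refine LinearMap.ext fun a => ?_
    change (D.twist χ).comulL ((D.twist χ).comul a) = (D.twist χ).comulR ((D.twist χ).comul a)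
    rw [comulL_twist, comulR_twist, twist_comul]
    simp only [map_mul]
    calc _ = (leg₁₂ k A χ * D.comulL (χ : A ⊗[k] A)) * D.comulL (D.comul a) *
          (D.comulL (↑χ⁻¹ : A ⊗[k] A) * leg₁₂ k A (↑χ⁻¹ : A ⊗[k] A)) := by
            simp only [mul_assoc]
      _ = _ := by
        rw [hχ.inv_eq, hχ.eq, hD.comulL_comul]
        simp only [mul_assoc]
  counit_left a := by
    have : D.counitL ((D.twist χ).comul a) = a := by
      rw [twist_comul, map_mul, map_mul, hχ.counitL, hD.counitL_comul, one_mul]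
      have := map_mul D.counitL (χ : A ⊗[k] A) (↑χ⁻¹ : A ⊗[k] A)
      rw [Units.mul_inv, map_one, hχ.counitL, one_mul] at this
      rw [← this, mul_one]
    refine (TensorProduct.lid k A).injective ?_
    rw [TensorProduct.lid_tmul, one_smul]
    exact this
  counit_right a := by
    have : D.counitR ((D.twist χ).comul a) = a := by
      rw [twist_comul, map_mul, map_mul, hχ.counitR hD, hD.counitR_comul, one_mul]
      have := map_mul D.counitR (χ : A ⊗[k] A) (↑χ⁻¹ : A ⊗[k] A)
      rw [Units.mul_inv, map_one, hχ.counitR hD, one_mul] at this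
      rw [← this, mul_one]
    refine (TensorProduct.rid k A).injective ?_
    rw [TensorProduct.rid_tmul, one_smul]
    exact this
  antipode_left a := by
    have key : ∀ x : A ⊗[k] A, LinearMap.mul' k A ((D.twist χ).antipode.rTensor A x) =
        D.twistU χ * D.adL x (D.twistV (↑χ⁻¹ : A ⊗[k] A)) := fun x => by
      unfold HopfData.adL
      induction x with
      | zero => simp
      | add p q hp hq => simp only [map_add, mul_add, hp, hq]
      | tmul a b => simp [hχ.twist_antipode hD, mul_assoc]
    -- With `V = adL χ⁻¹ 1` and `adL` a right action, the inner `χ⁻¹` and `χ` cancel. What remains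
    -- is `adL χ⁻¹ (adL (Δ a) 1) = ε(a) V`, and `U V = 1`.
    have e : D.twistV (↑χ⁻¹ : A ⊗[k] A) = D.adL (↑χ⁻¹ : A ⊗[k] A) 1 := (D.adL_apply_one _).symm
    rw [key, twist_comul, mul_assoc, hD.adL_mul, e, ← hD.adL_mul (↑χ⁻¹ : A ⊗[k] A) χ, Units.inv_mul,
      hD.adL_one, hD.adL_mul,
      D.adL_apply_one (D.comul a), hD.antipode_left, D.adL_algebraMap, ← e, mul_smul_comm,
      hχ.twistU_mul_twistV hD, Algebra.algebraMap_eq_smul_one]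
    rfl
  antipode_right a := by
    have key : ∀ x : A ⊗[k] A, LinearMap.mul' k A ((D.twist χ).antipode.lTensor A x) =
        D.adR x (D.twistU χ) * D.twistV (↑χ⁻¹ : A ⊗[k] A) := fun x => by
      unfold HopfData.adR
      induction x with
      | zero => simp
      | add p q hp hq => simp only [map_add, add_mul, hp, hq]
      | tmul a b => simp [hχ.twist_antipode hD, mul_assoc]
    have e : D.twistU χ = D.adR (χ : A ⊗[k] A) 1 := (D.adR_apply_one _).symm
    rw [key, twist_comul, hD.adR_mul, e, ← hD.adR_mul (↑χ⁻¹ : A ⊗[k] A) χ, Units.inv_mul,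
      hD.adR_one, hD.adR_mul,
      D.adR_apply_one (D.comul a), hD.antipode_right, D.adR_algebraMap, ← e, smul_mul_assoc,
      hχ.twistU_mul_twistV hD, Algebra.algebraMap_eq_smul_one]
    rfl

end Twist

end QPoincare

end

noncomputable section

namespace QPoincare

/-! ### Quasitriangular structures -/

section Quasitriangular

variable {k : Type u} [CommRing k] {A : Type v} [Ring A] [Algebra k A]

variable (k A) in
/-- The flip as an algebra map. -/
abbrev flipHom : A ⊗[k] A →ₐ[k] A ⊗[k] A := (Algebra.TensorProduct.comm k A A).toAlgHom

variable (k A) in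
/-- `a ⊗ b ⊗ c ↦ a ⊗ c ⊗ b`. -/
def perm₂₃ : A ⊗[k] (A ⊗[k] A) →ₐ[k] A ⊗[k] (A ⊗[k] A) :=
  Algebra.TensorProduct.map (AlgHom.id k A) (flipHom k A)

variable (k A) in
/-- `a ⊗ b ⊗ c ↦ b ⊗ a ⊗ c`. -/
def perm₁₂ : A ⊗[k] (A ⊗[k] A) →ₐ[k] A ⊗[k] (A ⊗[k] A) :=
  (Algebra.TensorProduct.assoc k k k A A A).toAlgHom.comp
    ((Algebra.TensorProduct.map (flipHom k A) (AlgHom.id k A)).comp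
      (Algebra.TensorProduct.assoc k k k A A A).symm.toAlgHom)

@[simp] theorem perm₂₃_tmul (a b c : A) :
    perm₂₃ k A (a ⊗ₜ (b ⊗ₜ c)) = a ⊗ₜ (c ⊗ₜ b) := rfl

@[simp] theorem perm₁₂_tmul (a b c : A) :
    perm₁₂ k A (a ⊗ₜ (b ⊗ₜ c)) = b ⊗ₜ (a ⊗ₜ c) := rfl

theorem perm₂₃_leg₁₂ (x : A ⊗[k] A) : perm₂₃ k A (leg₁₂ k A x) = leg₁₃ k A x := by
  induction x with
  | zero => simp
  | tmul a b => rfl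
  | add p q hp hq => simp only [map_add, hp, hq]

theorem perm₂₃_leg₁₃ (x : A ⊗[k] A) : perm₂₃ k A (leg₁₃ k A x) = leg₁₂ k A x := by
  induction x with
  | zero => simp
  | tmul a b => rfl
  | add p q hp hq => simp only [map_add, hp, hq]

theorem perm₂₃_leg₂₃ (x : A ⊗[k] A) :
    perm₂₃ k A (leg₂₃ k A x) = leg₂₃ k A (flipHom k A x) := rfl

theorem perm₁₂_leg₁₂ (x : A ⊗[k] A) :
    perm₁₂ k A (leg₁₂ k A x) = leg₁₂ k A (flipHom k A x) := by
  induction x with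
  | zero => simp
  | tmul a b => rfl
  | add p q hp hq => simp only [map_add, hp, hq]

theorem perm₁₂_leg₂₃ (x : A ⊗[k] A) : perm₁₂ k A (leg₂₃ k A x) = leg₁₃ k A x := by
  induction x with
  | zero => simp
  | tmul a b => rfl
  | add p q hp hq => simp only [map_add, hp, hq]

theorem perm₁₂_leg₁₃ (x : A ⊗[k] A) : perm₁₂ k A (leg₁₃ k A x) = leg₂₃ k A x := by
  induction x with
  | zero => simp
  | tmul a b => rfl
  | add p q hp hq => simp only [map_add, hp, hq]

variable {D : HopfData k A}

theorem comulL_flip (x : A ⊗[k] A) :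
    D.comulL (flipHom k A x) = perm₂₃ k A (perm₁₂ k A (D.comulR x)) := by
  induction x with
  | zero => simp
  | add p q hp hq => simp only [map_add, hp, hq]
  | tmul a b =>
    change Algebra.TensorProduct.assoc k k k A A A (D.comul b ⊗ₜ a) =
      perm₂₃ k A (perm₁₂ k A (a ⊗ₜ D.comul b))
    induction D.comul b with
    | zero => simp
    | tmul s t => simp
    | add p q hp hq => simp only [map_add, TensorProduct.add_tmul, TensorProduct.tmul_add, hp, hq]

theorem comulR_flip (x : A ⊗[k] A) :
    D.comulR (flipHom k A x) = perm₁₂ k A (perm₂₃ k A (D.comulL x)) := by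
  induction x with
  | zero => simp
  | add p q hp hq => simp only [map_add, hp, hq]
  | tmul a b =>
    change b ⊗ₜ D.comul a =
      perm₁₂ k A (perm₂₃ k A (Algebra.TensorProduct.assoc k k k A A A (D.comul a ⊗ₜ b)))
    induction D.comul a with
    | zero => simp
    | tmul s t => simp
    | add p q hp hq => simp only [map_add, TensorProduct.add_tmul, TensorProduct.tmul_add, hp, hq]

variable {R : (A ⊗[k] A)ˣ}

theorem HopfData.IsQuasitriangular.comulL (hR : D.IsQuasitriangular R) :
    D.comulL (R : A ⊗[k] A) = leg₁₃ k A R * leg₂₃ k A R := hR.comul_left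

theorem HopfData.IsQuasitriangular.comulR (hR : D.IsQuasitriangular R) :
    D.comulR (R : A ⊗[k] A) = leg₁₃ k A R * leg₁₂ k A R := hR.comul_right

theorem HopfData.IsQuasitriangular.flip_comul (hR : D.IsQuasitriangular R) (h : A) :
    flipHom k A (D.comul h) * (R : A ⊗[k] A) = R * D.comul h := hR.intertwine h

/-- The intertwining axiom read in the first two of three legs, the form in which the twist and the
bosonisation use it. -/
theorem HopfData.IsQuasitriangular.perm₁₂_comulL (hR : D.IsQuasitriangular R) (x : A ⊗[k] A) :
    perm₁₂ k A (D.comulL x) * leg₁₂ k A (R : A ⊗[k] A) = leg₁₂ k A R * D.comulL x := by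
  have key : ∀ y : A ⊗[k] A, leg₁₂ k A y =
      Algebra.TensorProduct.assoc k k k A A A (y ⊗ₜ 1) := fun y => by
    induction y with
    | zero => simp
    | tmul p q => rfl
    | add p q hp hq => rw [map_add, hp, hq, TensorProduct.add_tmul, map_add]
  induction x with
  | zero => simp
  | add p q hp hq => simp only [map_add, add_mul, mul_add, hp, hq]
  | tmul a b =>
    have e : perm₁₂ k A (D.comulL (a ⊗ₜ b)) = Algebra.TensorProduct.assoc k k k A A A
        (flipHom k A (D.comul a) ⊗ₜ b) := by
      rw [HopfData.comulL_tmul]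
      induction D.comul a with
      | zero => simp
      | tmul s t => rfl
      | add p q hp hq => simp only [map_add, TensorProduct.add_tmul, hp, hq]
    rw [e, key, HopfData.comulL_tmul, ← map_mul, ← map_mul, Algebra.TensorProduct.tmul_mul_tmul,
      Algebra.TensorProduct.tmul_mul_tmul, hR.flip_comul, one_mul, mul_one]

theorem HopfData.IsQuasitriangular.perm₂₃_comulR (hR : D.IsQuasitriangular R) (x : A ⊗[k] A) :
    perm₂₃ k A (D.comulR x) * leg₂₃ k A (R : A ⊗[k] A) = leg₂₃ k A R * D.comulR x := by
  induction x with
  | zero => simp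
  | add p q hp hq => simp only [map_add, add_mul, mul_add, hp, hq]
  | tmul a b =>
    change a ⊗ₜ flipHom k A (D.comul b) * 1 ⊗ₜ (R : A ⊗[k] A) = 1 ⊗ₜ (R : A ⊗[k] A) * a ⊗ₜ D.comul b
    rw [Algebra.TensorProduct.tmul_mul_tmul,
      Algebra.TensorProduct.tmul_mul_tmul, hR.flip_comul, one_mul, mul_one]

/-- The counit on the first leg of `(Δ ⊗ id)R = R₁₃ R₂₃` gives `R = (1 ⊗ (ε ⊗ id)R) R`, and the unit
`R` cancels. -/
theorem HopfData.IsQuasitriangular.counitL (hD : D.IsHopf) (hR : D.IsQuasitriangular R) :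
    D.counitL (R : A ⊗[k] A) = 1 := by
  let c : A ⊗[k] (A ⊗[k] A) →ₐ[k] A ⊗[k] A :=
    (Algebra.TensorProduct.lid k (A ⊗[k] A)).toAlgHom.comp
      (Algebra.TensorProduct.map D.counit (AlgHom.id k _))
  have hc : ∀ (a : A) (y : A ⊗[k] A), c (a ⊗ₜ y) = D.counit a • y := fun a y => by simp [c]
  have h1 : ∀ x : A ⊗[k] A, c (D.comulL x) = x := fun x => by
    induction x with
    | zero => simp
    | add p q hp hq => simp only [map_add, hp, hq]
    | tmul a b =>
      have key : ∀ y : A ⊗[k] A, c (Algebra.TensorProduct.assoc k k k A A A (y ⊗ₜ b)) =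
          D.counitL y ⊗ₜ b := fun y => by
        induction y with
        | zero => simp
        | tmul p q => simp [hc, TensorProduct.smul_tmul']
        | add p q hp hq => simp only [TensorProduct.add_tmul, map_add, hp, hq]
      rw [HopfData.comulL_tmul, key, hD.counitL_comul]
  have h2 : ∀ x : A ⊗[k] A, c (leg₁₃ k A x) = 1 ⊗ₜ D.counitL x := fun x => by
    induction x with
    | zero => simp
    | add p q hp hq => simp only [map_add, hp, hq, TensorProduct.tmul_add]
    | tmul a b => simp [hc]
  have h3 : ∀ x : A ⊗[k] A, c (leg₂₃ k A x) = x := fun x => by simp [hc]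
  have h := congrArg c hR.comulL
  rw [map_mul, h1, h2, h3] at h
  have h4 : (1 : A ⊗[k] A) = 1 ⊗ₜ D.counitL (R : A ⊗[k] A) :=
    R.isUnit.mul_left_injective (by simpa using h)
  simpa using (congrArg D.counitL h4).symm

theorem HopfData.IsQuasitriangular.counitR (hD : D.IsHopf) (hR : D.IsQuasitriangular R) :
    D.counitR (R : A ⊗[k] A) = 1 := by
  let c : A ⊗[k] (A ⊗[k] A) →ₐ[k] A ⊗[k] A :=
    Algebra.TensorProduct.map (AlgHom.id k A) D.counitR
  have h1 : ∀ x : A ⊗[k] A, c (D.comulR x) = x := fun x => by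
    induction x with
    | zero => simp
    | add p q hp hq => simp only [map_add, hp, hq]
    | tmul a b => simp [c, HopfData.comulR_tmul, hD.counitR_comul]
  have h2 : ∀ x : A ⊗[k] A, c (leg₁₃ k A x) = D.counitR x ⊗ₜ 1 := fun x => by
    induction x with
    | zero => simp
    | add p q hp hq => simp only [map_add, hp, hq, TensorProduct.add_tmul]
    | tmul a b => simp [c, TensorProduct.smul_tmul']
  have h3 : ∀ x : A ⊗[k] A, c (leg₁₂ k A x) = x := fun x => by
    induction x with
    | zero => simp
    | add p q hp hq => simp only [map_add, hp, hq]
    | tmul a b => simp [c]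
  have h := congrArg c hR.comulR
  rw [map_mul, h1, h2, h3] at h
  have h4 : (1 : A ⊗[k] A) = D.counitR (R : A ⊗[k] A) ⊗ₜ 1 :=
    R.isUnit.mul_left_injective (by simpa using h)
  simpa using (congrArg D.counitR h4).symm

/-- `(S ⊗ id) R = R⁻¹`. -/
theorem HopfData.IsQuasitriangular.antipode_rTensor (hD : D.IsHopf) (hR : D.IsQuasitriangular R) :
    D.antipode.rTensor A (R : A ⊗[k] A) = (↑R⁻¹ : A ⊗[k] A) := by
  -- The map `a ⊗ b ⊗ c ↦ S(a) b ⊗ c` turns `(Δ ⊗ id)R = R₁₃ R₂₃` into `1 = ((S ⊗ id)R) R`.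
  let c : A ⊗[k] (A ⊗[k] A) →ₗ[k] A ⊗[k] A :=
    (LinearMap.mul' k A ∘ₗ D.antipode.rTensor A).rTensor A ∘ₗ
      (TensorProduct.assoc k A A A).symm.toLinearMap
  have h1 : ∀ x : A ⊗[k] A, c (D.comulL x) = 1 ⊗ₜ D.counitL x := fun x => by
    induction x with
    | zero => simp
    | add p q hp hq => simp only [map_add, hp, hq, TensorProduct.tmul_add]
    | tmul a b =>
      have key : ∀ y : A ⊗[k] A, c (Algebra.TensorProduct.assoc k k k A A A (y ⊗ₜ b)) =
          LinearMap.mul' k A (D.antipode.rTensor A y) ⊗ₜ b := fun y => by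
        induction y with
        | zero => simp
        | tmul p q => simp [c]
        | add p q hp hq => simp only [TensorProduct.add_tmul, map_add, hp, hq]
      rw [HopfData.comulL_tmul, key, hD.antipode_left]
      simp [Algebra.algebraMap_eq_smul_one, TensorProduct.smul_tmul]
  have h2 : ∀ x y : A ⊗[k] A, c (leg₁₃ k A x * leg₂₃ k A y) = D.antipode.rTensor A x * y :=
    fun x y => by
      induction x with
      | zero => simp
      | add p q hp hq => simp only [map_add, add_mul, hp, hq]
      | tmul a b =>
        induction y with
        | zero => simp
        | add p q hp hq => simp only [map_add, mul_add, hp, hq]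
        | tmul s t => simp [c]
  have h := congrArg c hR.comulL
  rw [h1, h2, hR.counitL hD] at h
  exact Units.eq_inv_of_mul_eq_one_right h.symm

/-- `(id ⊗ S) R⁻¹ = R`. -/
theorem HopfData.IsQuasitriangular.antipode_lTensor (hD : D.IsHopf) (hR : D.IsQuasitriangular R) :
    D.antipode.lTensor A (↑R⁻¹ : A ⊗[k] A) = (R : A ⊗[k] A) := by
  -- The map `a ⊗ b ⊗ c ↦ a ⊗ b S(c)` turns `(id ⊗ Δ)R⁻¹ = R₁₂⁻¹ R₁₃⁻¹` into `1 = R⁻¹ ((id ⊗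
  -- S)R⁻¹)`.
  let c : A ⊗[k] (A ⊗[k] A) →ₗ[k] A ⊗[k] A :=
    (LinearMap.mul' k A ∘ₗ D.antipode.lTensor A).lTensor A
  have h1 : ∀ x : A ⊗[k] A, c (D.comulR x) = D.counitR x ⊗ₜ 1 := fun x => by
    induction x with
    | zero => simp
    | add p q hp hq => simp only [map_add, hp, hq, TensorProduct.add_tmul]
    | tmul a b =>
      simp only [c, HopfData.comulR_tmul, LinearMap.lTensor_tmul, LinearMap.comp_apply,
        hD.antipode_right]
      simp [Algebra.algebraMap_eq_smul_one, TensorProduct.smul_tmul]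
  have h2 : ∀ x y : A ⊗[k] A, c (leg₁₂ k A x * leg₁₃ k A y) = x * D.antipode.lTensor A y :=
    fun x y => by
      induction x with
      | zero => simp
      | add p q hp hq => simp only [map_add, add_mul, hp, hq]
      | tmul a b =>
        induction y with
        | zero => simp
        | add p q hp hq => simp only [map_add, mul_add, hp, hq]
        | tmul s t => simp [c]
  have h3 : D.comulR (↑R⁻¹ : A ⊗[k] A) =
      leg₁₂ k A (↑R⁻¹ : A ⊗[k] A) * leg₁₃ k A (↑R⁻¹ : A ⊗[k] A) := by
    refine left_inv_eq_right_inv (a := D.comulR (R : A ⊗[k] A)) ?_ ?_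
    · rw [← map_mul, Units.inv_mul, map_one]
    · rw [hR.comulR, mul_assoc, ← mul_assoc (leg₁₂ k A _), ← map_mul (leg₁₂ k A), Units.mul_inv,
        map_one, one_mul, ← map_mul, Units.mul_inv, map_one]
  have h4 : D.counitR (↑R⁻¹ : A ⊗[k] A) = 1 := by
    have := map_mul D.counitR (R : A ⊗[k] A) (↑R⁻¹ : A ⊗[k] A)
    rw [Units.mul_inv, map_one, hR.counitR hD, one_mul] at this
    exact this.symm
  have h := congrArg c h3
  rw [h1, h2, h4] at h
  have h5 := Units.eq_inv_of_mul_eq_one_left h.symm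
  rw [h5, inv_inv]

/-- The twist of a quasitriangular Hopf algebra is quasitriangular. -/
theorem HopfData.IsQuasitriangular.twist {χ R' : (A ⊗[k] A)ˣ} (hR : D.IsQuasitriangular R)
    (hχ : D.IsCocycle χ) (hR' : (R' : A ⊗[k] A) = twistR χ (R : A ⊗[k] A)) :
    (D.twist χ).IsQuasitriangular R' := by
  have hv : (R' : A ⊗[k] A) = flipHom k A χ * R * (↑χ⁻¹ : A ⊗[k] A) := hR'
  have hf : flipHom k A (↑χ⁻¹ : A ⊗[k] A) * flipHom k A (χ : A ⊗[k] A) = 1 := by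
    rw [← map_mul, Units.inv_mul, map_one]
  have hx : (↑χ⁻¹ : A ⊗[k] A) * χ = 1 := Units.inv_mul _
  have canc : ∀ (f : A ⊗[k] A →ₐ[k] A ⊗[k] (A ⊗[k] A)) (z : A ⊗[k] (A ⊗[k] A)),
      f (↑χ⁻¹ : A ⊗[k] A) * (f (χ : A ⊗[k] A) * z) = z := fun f z => by
    rw [← mul_assoc, ← map_mul, hx, map_one, one_mul]
  have canc' : ∀ (f : A ⊗[k] A →ₐ[k] A ⊗[k] (A ⊗[k] A)) (z : A ⊗[k] (A ⊗[k] A)),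
      f (χ : A ⊗[k] A) * (f (↑χ⁻¹ : A ⊗[k] A) * z) = z := fun f z => by
    rw [← mul_assoc, ← map_mul, Units.mul_inv, map_one, one_mul]
  refine ⟨fun h => ?_, ?_, ?_⟩
  · change flipHom k A ((D.twist χ).comul h) * _ = _
    rw [twist_comul, hv]
    simp only [map_mul]
    calc _ = flipHom k A χ * flipHom k A (D.comul h) * (flipHom k A (↑χ⁻¹ : A ⊗[k] A) *
          flipHom k A (χ : A ⊗[k] A)) * R * (↑χ⁻¹ : A ⊗[k] A) := by simp only [mul_assoc]
      _ = flipHom k A χ * (flipHom k A (D.comul h) * R) * (↑χ⁻¹ : A ⊗[k] A) := by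
          rw [hf, mul_one]; simp only [mul_assoc]
      _ = flipHom k A χ * R * 1 * D.comul h * (↑χ⁻¹ : A ⊗[k] A) := by
          rw [hR.flip_comul]; simp only [mul_assoc, one_mul]
      _ = _ := by rw [← hx]; simp only [mul_assoc]
  · change (D.twist χ).comulL _ = leg₁₃ k A _ * leg₂₃ k A _
    -- `e1` is the cocycle identity with its legs permuted cyclically, `e2` moves `R₁₃` past an
    -- iterated coproduct by the intertwining axiom, and `e3` is the cocycle identity with factors
    -- moved across. Together they separate the expression into its `13` and `23` parts.
    have e1 : leg₁₂ k A χ * D.comulL (flipHom k A χ) =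
        leg₁₃ k A (flipHom k A χ) * perm₂₃ k A (perm₁₂ k A (D.comulL (χ : A ⊗[k] A))) := by
      have := congrArg (fun z => perm₂₃ k A (perm₁₂ k A z)) hχ.eq
      simp only [map_mul, perm₁₂_leg₁₂, perm₁₂_leg₂₃, perm₂₃_leg₁₂, perm₂₃_leg₁₃,
        ← comulL_flip] at this
      exact this.symm
    have e2 : perm₂₃ k A (perm₁₂ k A (D.comulL (χ : A ⊗[k] A))) * leg₁₃ k A R =
        leg₁₃ k A R * perm₂₃ k A (D.comulL (χ : A ⊗[k] A)) := by
      rw [← perm₂₃_leg₁₂, ← map_mul, hR.perm₁₂_comulL, map_mul]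
    have e3 : D.comulL (χ : A ⊗[k] A) * D.comulR (↑χ⁻¹ : A ⊗[k] A) =
        leg₁₂ k A (↑χ⁻¹ : A ⊗[k] A) * leg₂₃ k A (χ : A ⊗[k] A) := by
      rw [← canc (leg₁₂ k A) (D.comulL (χ : A ⊗[k] A)), hχ.eq, mul_assoc, mul_assoc,
        ← map_mul D.comulR, Units.mul_inv, map_one, mul_one]
    rw [comulL_twist, hv]
    simp only [map_mul]
    calc _ = (leg₁₂ k A χ * D.comulL (flipHom k A χ)) * D.comulL (R : A ⊗[k] A) *
          (D.comulL (↑χ⁻¹ : A ⊗[k] A) * leg₁₂ k A (↑χ⁻¹ : A ⊗[k] A)) := by simp only [mul_assoc]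
      _ = leg₁₃ k A (flipHom k A χ) *
          (perm₂₃ k A (perm₁₂ k A (D.comulL (χ : A ⊗[k] A))) * leg₁₃ k A R) *
          (leg₂₃ k A R * D.comulR (↑χ⁻¹ : A ⊗[k] A)) * leg₂₃ k A (↑χ⁻¹ : A ⊗[k] A) := by
          rw [e1, hχ.inv_eq, hR.comulL]; simp only [mul_assoc]
      _ = leg₁₃ k A (flipHom k A χ) * leg₁₃ k A R *
          perm₂₃ k A (D.comulL (χ : A ⊗[k] A) * D.comulR (↑χ⁻¹ : A ⊗[k] A)) * leg₂₃ k A R *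
            leg₂₃ k A (↑χ⁻¹ : A ⊗[k] A) := by
          rw [e2, ← hR.perm₂₃_comulR, map_mul]; simp only [mul_assoc]
      _ = _ := by
          rw [e3, map_mul, perm₂₃_leg₁₂, perm₂₃_leg₂₃]; simp only [mul_assoc]
  · change (D.twist χ).comulR _ = leg₁₃ k A _ * leg₁₂ k A _
    have e1 : leg₂₃ k A χ * D.comulR (flipHom k A χ) =
        leg₁₃ k A (flipHom k A χ) * perm₁₂ k A (perm₂₃ k A (D.comulR (χ : A ⊗[k] A))) := by
      have := congrArg (fun z => perm₁₂ k A (perm₂₃ k A z)) hχ.eq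
      simp only [map_mul, perm₂₃_leg₁₂, perm₂₃_leg₂₃, perm₁₂_leg₁₃, perm₁₂_leg₂₃,
        ← comulR_flip] at this
      exact this
    have e2 : perm₁₂ k A (perm₂₃ k A (D.comulR (χ : A ⊗[k] A))) * leg₁₃ k A R =
        leg₁₃ k A R * perm₁₂ k A (D.comulR (χ : A ⊗[k] A)) := by
      rw [← perm₁₂_leg₂₃, ← map_mul, hR.perm₂₃_comulR, map_mul]
    have e3 : D.comulR (χ : A ⊗[k] A) * D.comulL (↑χ⁻¹ : A ⊗[k] A) =
        leg₂₃ k A (↑χ⁻¹ : A ⊗[k] A) * leg₁₂ k A (χ : A ⊗[k] A) := by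
      rw [← canc (leg₂₃ k A) (D.comulR (χ : A ⊗[k] A)), ← hχ.eq, mul_assoc, mul_assoc,
        ← map_mul D.comulL, Units.mul_inv, map_one, mul_one]
    rw [comulR_twist, hv]
    simp only [map_mul]
    calc _ = (leg₂₃ k A χ * D.comulR (flipHom k A χ)) * D.comulR (R : A ⊗[k] A) *
          (D.comulR (↑χ⁻¹ : A ⊗[k] A) * leg₂₃ k A (↑χ⁻¹ : A ⊗[k] A)) := by simp only [mul_assoc]
      _ = leg₁₃ k A (flipHom k A χ) *
          (perm₁₂ k A (perm₂₃ k A (D.comulR (χ : A ⊗[k] A))) * leg₁₃ k A R) *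
          (leg₁₂ k A R * D.comulL (↑χ⁻¹ : A ⊗[k] A)) * leg₁₂ k A (↑χ⁻¹ : A ⊗[k] A) := by
          rw [e1, ← hχ.inv_eq, hR.comulR]; simp only [mul_assoc]
      _ = leg₁₃ k A (flipHom k A χ) * leg₁₃ k A R *
          perm₁₂ k A (D.comulR (χ : A ⊗[k] A) * D.comulL (↑χ⁻¹ : A ⊗[k] A)) * leg₁₂ k A R *
            leg₁₂ k A (↑χ⁻¹ : A ⊗[k] A) := by
          rw [e2, ← hR.perm₁₂_comulL, map_mul]; simp only [mul_assoc]
      _ = _ := by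
          rw [e3, map_mul, perm₁₂_leg₁₂, perm₁₂_leg₂₃]; simp only [mul_assoc]

end Quasitriangular

/-! ### Tensor products of quasitriangular Hopf algebras -/

section TensorQT

variable {k : Type u} [CommRing k] {A : Type v} [Ring A] [Algebra k A]
  {A' : Type w} [Ring A'] [Algebra k A']

variable (k A A') in
/-- `(a ⊗ b) ⊗ (a' ⊗ b') ↦ (a ⊗ a') ⊗ (b ⊗ b')`. -/
abbrev shuffle : (A ⊗[k] A) ⊗[k] (A' ⊗[k] A') →ₐ[k] (A ⊗[k] A') ⊗[k] (A ⊗[k] A') :=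
  (Algebra.TensorProduct.tensorTensorTensorComm k k k k A A A' A').toAlgHom

variable (k A A') in
/-- `(a ⊗ b ⊗ c) ⊗ (a' ⊗ b' ⊗ c') ↦ (a ⊗ a') ⊗ (b ⊗ b') ⊗ (c ⊗ c')`. -/
def shuffle₃ : (A ⊗[k] (A ⊗[k] A)) ⊗[k] (A' ⊗[k] (A' ⊗[k] A')) →ₐ[k]
    (A ⊗[k] A') ⊗[k] ((A ⊗[k] A') ⊗[k] (A ⊗[k] A')) :=
  (Algebra.TensorProduct.map (AlgHom.id k _) (shuffle k A A')).comp
    (Algebra.TensorProduct.tensorTensorTensorComm k k k k A (A ⊗[k] A) A' (A' ⊗[k] A')).toAlgHom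

@[simp] theorem shuffle_tmul (a b : A) (a' b' : A') :
    shuffle k A A' ((a ⊗ₜ b) ⊗ₜ (a' ⊗ₜ b')) = (a ⊗ₜ a') ⊗ₜ (b ⊗ₜ b') := rfl

@[simp] theorem shuffle₃_tmul (a b c : A) (a' b' c' : A') :
    shuffle₃ k A A' ((a ⊗ₜ (b ⊗ₜ c)) ⊗ₜ (a' ⊗ₜ (b' ⊗ₜ c'))) =
      (a ⊗ₜ a') ⊗ₜ ((b ⊗ₜ b') ⊗ₜ (c ⊗ₜ c')) := rfl

/-- Two linear maps on a fourfold tensor product agree if they agree on pure tensors. -/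
theorem fourfold_ext {M : Type*} [AddCommGroup M] [Module k M]
    {f g : (A ⊗[k] A) ⊗[k] (A' ⊗[k] A') →ₗ[k] M}
    (h : ∀ a b a' b', f ((a ⊗ₜ b) ⊗ₜ (a' ⊗ₜ b')) = g ((a ⊗ₜ b) ⊗ₜ (a' ⊗ₜ b'))) : f = g := by
  refine TensorProduct.ext_fourfold' h

theorem leg₁₂_shuffle (x : A ⊗[k] A) (x' : A' ⊗[k] A') :
    leg₁₂ k _ (shuffle k A A' (x ⊗ₜ x')) = shuffle₃ k A A' (leg₁₂ k A x ⊗ₜ leg₁₂ k A' x') :=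
  LinearMap.congr_fun (fourfold_ext (k := k) (f := ((leg₁₂ k _).comp (shuffle k A A')).toLinearMap)
    (g := ((shuffle₃ k A A').comp
      (Algebra.TensorProduct.map (leg₁₂ k A) (leg₁₂ k A'))).toLinearMap)
    fun _ _ _ _ => rfl) (x ⊗ₜ x')

theorem leg₁₃_shuffle (x : A ⊗[k] A) (x' : A' ⊗[k] A') :
    leg₁₃ k _ (shuffle k A A' (x ⊗ₜ x')) = shuffle₃ k A A' (leg₁₃ k A x ⊗ₜ leg₁₃ k A' x') :=
  LinearMap.congr_fun (fourfold_ext (k := k) (f := ((leg₁₃ k _).comp (shuffle k A A')).toLinearMap)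
    (g := ((shuffle₃ k A A').comp
      (Algebra.TensorProduct.map (leg₁₃ k A) (leg₁₃ k A'))).toLinearMap)
    fun _ _ _ _ => rfl) (x ⊗ₜ x')

theorem leg₂₃_shuffle (x : A ⊗[k] A) (x' : A' ⊗[k] A') :
    leg₂₃ k _ (shuffle k A A' (x ⊗ₜ x')) = shuffle₃ k A A' (leg₂₃ k A x ⊗ₜ leg₂₃ k A' x') :=
  LinearMap.congr_fun (fourfold_ext (k := k) (f := ((leg₂₃ k _).comp (shuffle k A A')).toLinearMap)
    (g := ((shuffle₃ k A A').comp
      (Algebra.TensorProduct.map (leg₂₃ k A) (leg₂₃ k A'))).toLinearMap)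
    fun _ _ _ _ => rfl) (x ⊗ₜ x')

theorem flip_shuffle (x : A ⊗[k] A) (x' : A' ⊗[k] A') :
    flipHom k _ (shuffle k A A' (x ⊗ₜ x')) =
      shuffle k A A' (flipHom k A x ⊗ₜ flipHom k A' x') :=
  LinearMap.congr_fun (fourfold_ext (k := k)
    (f := ((flipHom k _).comp (shuffle k A A')).toLinearMap)
    (g := ((shuffle k A A').comp
      (Algebra.TensorProduct.map (flipHom k A) (flipHom k A'))).toLinearMap)
    fun _ _ _ _ => rfl) (x ⊗ₜ x')

variable {D : HopfData k A} {D' : HopfData k A'}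

theorem tensor_comul_tmul (a : A) (a' : A') :
    (D.tensor D').comul (a ⊗ₜ a') = shuffle k A A' (D.comul a ⊗ₜ D'.comul a') := rfl

theorem comulL_shuffle (x : A ⊗[k] A) (x' : A' ⊗[k] A') :
    (D.tensor D').comulL (shuffle k A A' (x ⊗ₜ x')) =
      shuffle₃ k A A' (D.comulL x ⊗ₜ D'.comulL x') :=
  LinearMap.congr_fun (fourfold_ext (k := k)
    (f := ((D.tensor D').comulL.comp (shuffle k A A')).toLinearMap)
    (g := ((shuffle₃ k A A').comp
      (Algebra.TensorProduct.map D.comulL D'.comulL)).toLinearMap)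
    fun a b a' b' => by
      change Algebra.TensorProduct.assoc k k k _ _ _ (shuffle k A A' (D.comul a ⊗ₜ D'.comul a') ⊗ₜ
        (b ⊗ₜ b')) = shuffle₃ k A A' (Algebra.TensorProduct.assoc k k k _ _ _ (D.comul a ⊗ₜ b) ⊗ₜ
          Algebra.TensorProduct.assoc k k k _ _ _ (D'.comul a' ⊗ₜ b'))
      generalize D.comul a = y
      generalize D'.comul a' = y'
      induction y with
      | zero => simp
      | add p q hp hq => simp only [map_add, TensorProduct.add_tmul, hp, hq]
      | tmul s t =>
        induction y' with
        | zero => simp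
        | add p q hp hq => simp only [map_add, TensorProduct.add_tmul, TensorProduct.tmul_add, hp, hq]
        | tmul s' t' => rfl) (x ⊗ₜ x')

theorem comulR_shuffle (x : A ⊗[k] A) (x' : A' ⊗[k] A') :
    (D.tensor D').comulR (shuffle k A A' (x ⊗ₜ x')) =
      shuffle₃ k A A' (D.comulR x ⊗ₜ D'.comulR x') :=
  LinearMap.congr_fun (fourfold_ext (k := k)
    (f := ((D.tensor D').comulR.comp (shuffle k A A')).toLinearMap)
    (g := ((shuffle₃ k A A').comp
      (Algebra.TensorProduct.map D.comulR D'.comulR)).toLinearMap)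
    fun _ _ _ _ => rfl) (x ⊗ₜ x')

/-- Every axiom splits into the same axiom in each factor, as the shuffles are algebra maps
compatible with legs, flips and coproducts. -/
theorem HopfData.IsQuasitriangular.tensor {R : (A ⊗[k] A)ˣ} {R' : (A' ⊗[k] A')ˣ}
    (hR : D.IsQuasitriangular R) (hR' : D'.IsQuasitriangular R')
    {T : ((A ⊗[k] A') ⊗[k] (A ⊗[k] A'))ˣ}
    (hT : (T : (A ⊗[k] A') ⊗[k] (A ⊗[k] A')) = shuffle k A A' ((R : A ⊗[k] A) ⊗ₜ (R' : A' ⊗[k] A'))) :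
    (D.tensor D').IsQuasitriangular T := by
  refine ⟨fun h => ?_, ?_, ?_⟩
  · change flipHom k _ ((D.tensor D').comul h) * _ = _
    induction h with
    | zero => simp
    | add p q hp hq => simp only [map_add, add_mul, mul_add, hp, hq]
    | tmul a a' =>
      rw [tensor_comul_tmul, flip_shuffle, hT, ← map_mul, ← map_mul,
        Algebra.TensorProduct.tmul_mul_tmul, Algebra.TensorProduct.tmul_mul_tmul, hR.flip_comul,
        hR'.flip_comul]
  · change (D.tensor D').comulL _ = leg₁₃ k _ _ * leg₂₃ k _ _
    rw [hT, comulL_shuffle, hR.comulL, hR'.comulL, leg₁₃_shuffle, leg₂₃_shuffle, ← map_mul,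
      Algebra.TensorProduct.tmul_mul_tmul]
  · change (D.tensor D').comulR _ = leg₁₃ k _ _ * leg₁₂ k _ _
    rw [hT, comulR_shuffle, hR.comulR, hR'.comulR, leg₁₃_shuffle, leg₁₂_shuffle, ← map_mul,
      Algebra.TensorProduct.tmul_mul_tmul]

end TensorQT

end QPoincare

end

noncomputable section

namespace QPoincare

/-! ### The dilatonic extension of a quasitriangular Hopf algebra -/

section DilatonQT

variable (k : Type u) [CommRing k]

/-- All structure maps are algebra maps on `k[ξ]`, the antipode included by commutativity, so each
axiom needs checking only at `ξ`. -/
theorem isHopf_dilatonLine : (dilatonLine k).IsHopf where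
  coassoc := by
    have : (dilatonLine k).comulL.comp (dilatonLine k).comul =
        (dilatonLine k).comulR.comp (dilatonLine k).comul := by
      ext
      simp [dilatonLine, HopfData.comulL, HopfData.comulR, TensorProduct.add_tmul,
        TensorProduct.tmul_add, Algebra.TensorProduct.one_def, add_assoc]
    exact congrArg AlgHom.toLinearMap this
  counit_left a := by
    have : (Algebra.TensorProduct.map (dilatonLine k).counit (AlgHom.id k _)).comp
        (dilatonLine k).comul = Algebra.TensorProduct.includeRight := by
      ext
      simp [dilatonLine]
    exact DFunLike.congr_fun this a
  counit_right a := by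
    have : (Algebra.TensorProduct.map (AlgHom.id k _) (dilatonLine k).counit).comp
        (dilatonLine k).comul = Algebra.TensorProduct.includeLeft := by
      ext
      simp [dilatonLine]
    exact DFunLike.congr_fun this a
  antipode_left a := by
    have : (Algebra.TensorProduct.lmul' k).comp ((Algebra.TensorProduct.map
        (Polynomial.aeval (-Polynomial.X : Polynomial k)) (AlgHom.id k _)).comp
        (dilatonLine k).comul) = (Algebra.ofId k (Polynomial k)).comp (dilatonLine k).counit := by
      ext
      simp [dilatonLine]
    exact DFunLike.congr_fun this a
  antipode_right a := by
    have : (Algebra.TensorProduct.lmul' k).comp ((Algebra.TensorProduct.map (AlgHom.id k _)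
        (Polynomial.aeval (-Polynomial.X : Polynomial k))).comp
        (dilatonLine k).comul) = (Algebra.ofId k (Polynomial k)).comp (dilatonLine k).counit := by
      ext
      simp [dilatonLine]
    exact DFunLike.congr_fun this a

variable {k}

theorem isNilpotent_line {s : k} (hs : IsNilpotent s) :
    IsNilpotent (-(s • ((Polynomial.X : Polynomial k) ⊗ₜ[k] (Polynomial.X : Polynomial k)))) := by
  obtain ⟨n, hn⟩ := hs
  have h : IsNilpotent (s • ((Polynomial.X : Polynomial k) ⊗ₜ[k] (Polynomial.X : Polynomial k))) :=
    ⟨n, by rw [smul_pow, hn, zero_smul]⟩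
  exact h.neg

theorem shuffle_eq_mul {A : Type v} [Ring A] [Algebra k A] {A' : Type w} [Ring A'] [Algebra k A']
    (x : A ⊗[k] A) (x' : A' ⊗[k] A') : shuffle k A A' (x ⊗ₜ x') =
    Algebra.TensorProduct.map (Algebra.TensorProduct.includeLeft : A →ₐ[k] A ⊗[k] A')
      (Algebra.TensorProduct.includeLeft : A →ₐ[k] A ⊗[k] A') x *
    Algebra.TensorProduct.map (Algebra.TensorProduct.includeRight : A' →ₐ[k] A ⊗[k] A')
      (Algebra.TensorProduct.includeRight : A' →ₐ[k] A ⊗[k] A') x' := by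
  have h1 : shuffle k A A' (x ⊗ₜ 1) =
      Algebra.TensorProduct.map (Algebra.TensorProduct.includeLeft : A →ₐ[k] A ⊗[k] A')
        (Algebra.TensorProduct.includeLeft : A →ₐ[k] A ⊗[k] A') x := by
    induction x with
    | zero => simp
    | tmul a b => rfl
    | add p q hp hq => simp only [map_add, TensorProduct.add_tmul, hp, hq]
  have h2 : shuffle k A A' (1 ⊗ₜ x') =
      Algebra.TensorProduct.map (Algebra.TensorProduct.includeRight : A' →ₐ[k] A ⊗[k] A')
        (Algebra.TensorProduct.includeRight : A' →ₐ[k] A ⊗[k] A') x' := by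
    induction x' with
    | zero => simp
    | tmul a b => rfl
    | add p q hp hq => simp only [map_add, TensorProduct.tmul_add, hp, hq]
  rw [← h1, ← h2, ← map_mul, Algebra.TensorProduct.tmul_mul_tmul, mul_one, one_mul]

variable [Algebra ℚ k]

/-- `λ^{-ξ⊗ξ}` as a unit. -/
def lineR {s : k} (hs : IsNilpotent s) : (Polynomial k ⊗[k] Polynomial k)ˣ :=
  (IsNilpotent.isUnit_exp (isNilpotent_line hs)).unit

theorem lineR_val {s : k} (hs : IsNilpotent s) : (lineR hs : Polynomial k ⊗[k] Polynomial k) =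
    IsNilpotent.exp (-(s • ((Polynomial.X : Polynomial k) ⊗ₜ[k] (Polynomial.X : Polynomial k)))) :=
  rfl

/-- `k[ξ]` is commutative and cocommutative, which settles the intertwining axiom. Since `ξ` is
primitive the exponent is additive in each leg, and the exponential of a sum of commuting nilpotents
is the product of the exponentials. -/
theorem isQuasitriangular_lineR {s : k} (hs : IsNilpotent s) :
    (dilatonLine k).IsQuasitriangular (lineR hs) := by
  have hn := isNilpotent_line hs
  have hc : ∀ a b : Polynomial k ⊗[k] (Polynomial k ⊗[k] Polynomial k), Commute a b :=
    fun a b => mul_comm a b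
  refine ⟨fun h => ?_, ?_, ?_⟩
  · change flipHom k _ _ * _ = _
    have : (flipHom k (Polynomial k)).comp (dilatonLine k).comul = (dilatonLine k).comul := by
      ext
      simp [dilatonLine, add_comm]
    rw [mul_comm, ← AlgHom.comp_apply, this]
  · change (dilatonLine k).comulL _ = leg₁₃ k _ _ * leg₂₃ k _ _
    rw [lineR_val, IsNilpotent.map_exp hn, IsNilpotent.map_exp hn, IsNilpotent.map_exp hn,
      ← IsNilpotent.exp_add_of_commute (hc _ _) (hn.map _) (hn.map _)]
    congr 1
    simp [HopfData.comulL_tmul, dilatonLine, TensorProduct.add_tmul, smul_add,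
      TensorProduct.tmul_neg, add_comm]
  · change (dilatonLine k).comulR _ = leg₁₃ k _ _ * leg₁₂ k _ _
    rw [lineR_val, IsNilpotent.map_exp hn, IsNilpotent.map_exp hn, IsNilpotent.map_exp hn,
      ← IsNilpotent.exp_add_of_commute (hc _ _) (hn.map _) (hn.map _)]
    congr 1
    simp [HopfData.comulR_tmul, dilatonLine, TensorProduct.tmul_add, smul_add]

variable {K : Type v} [Ring K] [Algebra k K]

theorem dilR_eq_shuffle {s : k} (hs : IsNilpotent s) (R : K ⊗[k] K) :
    dilR s R = shuffle k K (Polynomial k) (R ⊗ₜ (lineR hs : Polynomial k ⊗[k] Polynomial k)) := by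
  rw [shuffle_eq_mul]
  rfl

/-- The quasitriangular structure of the dilatonic extension as a unit. -/
def dilUnit {s : k} (hs : IsNilpotent s) (R : (K ⊗[k] K)ˣ) : (Dil k K ⊗[k] Dil k K)ˣ :=
  Units.map (Algebra.TensorProduct.map (dilIncl k K) (dilIncl k K) : K ⊗[k] K →* _) R *
    Units.map (Algebra.TensorProduct.map
      (Algebra.TensorProduct.includeRight : Polynomial k →ₐ[k] Dil k K)
      (Algebra.TensorProduct.includeRight : Polynomial k →ₐ[k] Dil k K) :
        Polynomial k ⊗[k] Polynomial k →* _) (lineR hs)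

theorem dilUnit_val {s : k} (hs : IsNilpotent s) (R : (K ⊗[k] K)ˣ) :
    (dilUnit hs R : Dil k K ⊗[k] Dil k K) = dilR s (R : K ⊗[k] K) := rfl

theorem isQuasitriangular_dilUnit {D : HopfData k K} {s : k} (hs : IsNilpotent s)
    {R : (K ⊗[k] K)ˣ} (hR : D.IsQuasitriangular R) :
    D.dil.IsQuasitriangular (dilUnit hs R) :=
  hR.tensor (isQuasitriangular_lineR hs) (by rw [dilUnit_val, dilR_eq_shuffle hs])

end DilatonQT

/-! ### Two copies of a quasitriangular Hopf algebra and the cocycle -/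

section Wick

variable {k : Type u} [CommRing k] {A : Type v} [Ring A] [Algebra k A]
  {D : HopfData k A} {R : (A ⊗[k] A)ˣ}

/-- `R₁₃ R₂₄` as a unit. -/
def tensorUnit (R : (A ⊗[k] A)ˣ) : ((A ⊗[k] A) ⊗[k] (A ⊗[k] A))ˣ where
  val := tensorR (R : A ⊗[k] A)
  inv := tensorR (↑R⁻¹ : A ⊗[k] A)
  val_inv := by
    rw [tensorR, tensorR, ← map_mul, Algebra.TensorProduct.tmul_mul_tmul, Units.mul_inv,
      ← Algebra.TensorProduct.one_def, map_one]
  inv_val := by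
    rw [tensorR, tensorR, ← map_mul, Algebra.TensorProduct.tmul_mul_tmul, Units.inv_mul,
      ← Algebra.TensorProduct.one_def, map_one]

theorem tensorUnit_val (R : (A ⊗[k] A)ˣ) :
    (tensorUnit R : (A ⊗[k] A) ⊗[k] (A ⊗[k] A)) = tensorR (R : A ⊗[k] A) := rfl

theorem isQuasitriangular_tensorUnit (hR : D.IsQuasitriangular R) :
    (D.tensor D).IsQuasitriangular (tensorUnit R) :=
  hR.tensor hR (tensorUnit_val R)

variable (k A) in
/-- `a ⊗ b ↦ (1 ⊗ a) ⊗ (b ⊗ 1)`. -/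
abbrev innerLegs : A ⊗[k] A →ₐ[k] (A ⊗[k] A) ⊗[k] (A ⊗[k] A) :=
  Algebra.TensorProduct.map
    (Algebra.TensorProduct.includeRight : A →ₐ[k] A ⊗[k] A)
    (Algebra.TensorProduct.includeLeft : A →ₐ[k] A ⊗[k] A)

theorem wickCocycle_val (R : (A ⊗[k] A)ˣ) :
    (wickCocycle R : (A ⊗[k] A) ⊗[k] (A ⊗[k] A)) = innerLegs k A (↑R⁻¹ : A ⊗[k] A) := rfl

theorem HopfData.IsQuasitriangular.comulL_inv (hR : D.IsQuasitriangular R) :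
    D.comulL (↑R⁻¹ : A ⊗[k] A) = leg₂₃ k A (↑R⁻¹ : A ⊗[k] A) * leg₁₃ k A (↑R⁻¹ : A ⊗[k] A) := by
  refine left_inv_eq_right_inv (a := D.comulL (R : A ⊗[k] A)) ?_ ?_
  · rw [← map_mul, Units.inv_mul, map_one]
  · rw [hR.comulL, mul_assoc, ← mul_assoc (leg₂₃ k A _), ← map_mul (leg₂₃ k A), Units.mul_inv,
      map_one, one_mul, ← map_mul, Units.mul_inv, map_one]

theorem HopfData.IsQuasitriangular.comulR_inv (hR : D.IsQuasitriangular R) :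
    D.comulR (↑R⁻¹ : A ⊗[k] A) = leg₁₂ k A (↑R⁻¹ : A ⊗[k] A) * leg₁₃ k A (↑R⁻¹ : A ⊗[k] A) := by
  refine left_inv_eq_right_inv (a := D.comulR (R : A ⊗[k] A)) ?_ ?_
  · rw [← map_mul, Units.inv_mul, map_one]
  · rw [hR.comulR, mul_assoc, ← mul_assoc (leg₁₂ k A _), ← map_mul (leg₁₂ k A), Units.mul_inv,
      map_one, one_mul, ← map_mul, Units.mul_inv, map_one]

/-- `R₂₃⁻¹` is a quantum 2-cocycle for the tensor square. -/
theorem isCocycle_wickCocycle (hD : D.IsHopf) (hR : D.IsQuasitriangular R) :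
    (D.tensor D).IsCocycle (wickCocycle R) := by
  constructor
  · change leg₁₂ k _ _ * (D.tensor D).comulL _ = leg₂₃ k _ _ * (D.tensor D).comulR _
    rw [wickCocycle_val]
    let a₁ : A →ₐ[k] A ⊗[k] A := Algebra.TensorProduct.includeLeft
    let a₂ : A →ₐ[k] A ⊗[k] A := Algebra.TensorProduct.includeRight
    have hL : ∀ x : A ⊗[k] A, (D.tensor D).comulL (innerLegs k A x) =
        Algebra.TensorProduct.map a₂ (Algebra.TensorProduct.map a₂ a₁) (D.comulL x) := fun x => by
      induction x with
      | zero => simp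
      | add p q hp hq => simp only [map_add, hp, hq]
      | tmul a b =>
        change Algebra.TensorProduct.assoc k k k _ _ _ ((D.tensor D).comul (1 ⊗ₜ a) ⊗ₜ (b ⊗ₜ 1)) =
          Algebra.TensorProduct.map a₂ (Algebra.TensorProduct.map a₂ a₁)
            (Algebra.TensorProduct.assoc k k k _ _ _ (D.comul a ⊗ₜ b))
        rw [tensor_comul_tmul, map_one, Algebra.TensorProduct.one_def]
        induction D.comul a with
        | zero => simp
        | add p q hp hq => simp only [map_add, TensorProduct.add_tmul, TensorProduct.tmul_add, hp, hq]
        | tmul s t => rfl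
    have hRR : ∀ x : A ⊗[k] A, (D.tensor D).comulR (innerLegs k A x) =
        Algebra.TensorProduct.map a₂ (Algebra.TensorProduct.map a₁ a₁) (D.comulR x) := fun x => by
      induction x with
      | zero => simp
      | add p q hp hq => simp only [map_add, hp, hq]
      | tmul a b =>
        change (1 ⊗ₜ a) ⊗ₜ (D.tensor D).comul (b ⊗ₜ 1) =
          Algebra.TensorProduct.map a₂ (Algebra.TensorProduct.map a₁ a₁) (a ⊗ₜ D.comul b)
        rw [tensor_comul_tmul, map_one, Algebra.TensorProduct.one_def]
        induction D.comul b with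
        | zero => simp
        | add p q hp hq => simp only [map_add, TensorProduct.add_tmul, TensorProduct.tmul_add, hp, hq]
        | tmul s t => rfl
    -- Number the six legs `(1,2),(3,4),(5,6)`. By the hexagons the left side is `R₂₃⁻¹ R₄₅⁻¹ R₂₅⁻¹`
    -- and the right side `R₄₅⁻¹ R₂₃⁻¹ R₂₅⁻¹`. The last factors agree (`e1`) and the first two have
    -- disjoint legs (`e2`).
    rw [hL, hRR, hR.comulL_inv, hR.comulR_inv, map_mul, map_mul, ← mul_assoc, ← mul_assoc]
    have e1 : ∀ x : A ⊗[k] A, Algebra.TensorProduct.map a₂ (Algebra.TensorProduct.map a₂ a₁)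
        (leg₁₃ k A x) = Algebra.TensorProduct.map a₂ (Algebra.TensorProduct.map a₁ a₁)
        (leg₁₃ k A x) := fun x => by
      induction x with
      | zero => simp
      | add p q hp hq => simp only [map_add, hp, hq]
      | tmul a b => rfl
    have e2 : ∀ x y : A ⊗[k] A, leg₁₂ k _ (innerLegs k A x) *
        Algebra.TensorProduct.map a₂ (Algebra.TensorProduct.map a₂ a₁) (leg₂₃ k A y) =
        leg₂₃ k _ (innerLegs k A y) *
        Algebra.TensorProduct.map a₂ (Algebra.TensorProduct.map a₁ a₁) (leg₁₂ k A x) := fun x y => by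
      induction x with
      | zero => simp
      | add p q hp hq => simp only [map_add, add_mul, mul_add, hp, hq]
      | tmul a b =>
        induction y with
        | zero => simp
        | add p q hp hq => simp only [map_add, add_mul, mul_add, hp, hq]
        | tmul c d => simp [a₁, a₂]
    rw [e1, e2]
  · change (D.tensor D).counitL _ = 1
    rw [wickCocycle_val]
    have h1 : ∀ x : A ⊗[k] A, (D.tensor D).counitL (innerLegs k A x) = D.counitL x ⊗ₜ 1 := fun x => by
      induction x with
      | zero => simp
      | add p q hp hq => simp only [map_add, TensorProduct.add_tmul, hp, hq]
      | tmul a b =>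
        simp [HopfData.tensor, TensorProduct.smul_tmul']
    have h2 : D.counitL (↑R⁻¹ : A ⊗[k] A) = 1 := by
      have := map_mul D.counitL (R : A ⊗[k] A) (↑R⁻¹ : A ⊗[k] A)
      rw [Units.mul_inv, map_one, hR.counitL hD, one_mul] at this
      exact this.symm
    rw [h1, h2]
    rfl

end Wick

/-! ### Cocycles in a larger Hopf algebra -/

section CocycleMap

variable {k : Type u} [CommRing k] {K : Type v} [Ring K] [Algebra k K]
  {X : Type w} [Ring X] [Algebra k X] {D : HopfData k K} {E : HopfData k X}

/-- Needed twice: for `H ⊗ H` inside its dilatonic extension, and for that extension inside the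
bosonisation. Both sides of the cocycle identity are images under `f ⊗ f ⊗ f`, so `f` need not be
injective. -/
theorem HopfData.IsCocycle.map {χ : (K ⊗[k] K)ˣ} (hχ : D.IsCocycle χ) (f : K →ₐ[k] X)
    (hc : ∀ h, E.comul (f h) = Algebra.TensorProduct.map f f (D.comul h))
    (he : ∀ h, E.counit (f h) = D.counit h) :
    E.IsCocycle (Units.map (Algebra.TensorProduct.map f f : K ⊗[k] K →* X ⊗[k] X) χ) := by
  have e12 : ∀ x : K ⊗[k] K, leg₁₂ k X (Algebra.TensorProduct.map f f x) =
      Algebra.TensorProduct.map f (Algebra.TensorProduct.map f f) (leg₁₂ k K x) := fun x => by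
    induction x with
    | zero => simp
    | add p q hp hq => simp only [map_add, hp, hq]
    | tmul a b => simp
  have e23 : ∀ x : K ⊗[k] K, leg₂₃ k X (Algebra.TensorProduct.map f f x) =
      Algebra.TensorProduct.map f (Algebra.TensorProduct.map f f) (leg₂₃ k K x) := fun x => by
    simp
  have eL : ∀ x : K ⊗[k] K, E.comulL (Algebra.TensorProduct.map f f x) =
      Algebra.TensorProduct.map f (Algebra.TensorProduct.map f f) (D.comulL x) := fun x => by
    induction x with
    | zero => simp
    | add p q hp hq => simp only [map_add, hp, hq]
    | tmul a b =>
      rw [Algebra.TensorProduct.map_tmul, HopfData.comulL_tmul, hc, HopfData.comulL_tmul]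
      induction D.comul a with
      | zero => simp
      | add p q hp hq => simp only [map_add, TensorProduct.add_tmul, hp, hq]
      | tmul s t => simp
  have eR : ∀ x : K ⊗[k] K, E.comulR (Algebra.TensorProduct.map f f x) =
      Algebra.TensorProduct.map f (Algebra.TensorProduct.map f f) (D.comulR x) := fun x => by
    induction x with
    | zero => simp
    | add p q hp hq => simp only [map_add, hp, hq]
    | tmul a b =>
      rw [Algebra.TensorProduct.map_tmul, HopfData.comulR_tmul, hc, HopfData.comulR_tmul,
        Algebra.TensorProduct.map_tmul]
  constructor
  · change leg₁₂ k X (Algebra.TensorProduct.map f f _) * E.comulL (Algebra.TensorProduct.map f f _) =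
      leg₂₃ k X (Algebra.TensorProduct.map f f _) * E.comulR (Algebra.TensorProduct.map f f _)
    rw [e12, e23, eL, eR, ← map_mul, ← map_mul, hχ.eq]
  · change E.counitL (Algebra.TensorProduct.map f f _) = 1
    have : ∀ x : K ⊗[k] K, E.counitL (Algebra.TensorProduct.map f f x) = f (D.counitL x) :=
      fun x => by
        induction x with
        | zero => simp
        | add p q hp hq => simp only [map_add, hp, hq]
        | tmul a b => simp [he]
    rw [this, hχ.counitL, map_one]

end CocycleMap

/-! ### The rotation quantum groups -/

section Rotations

variable {k : Type u} [CommRing k] {H : Type v} [Ring H] [Algebra k H]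
  {D : HopfData k H} {R : (H ⊗[k] H)ˣ}

theorem dil_comul_incl {K : Type v} [Ring K] [Algebra k K] (D : HopfData k K) (x : K) :
    D.dil.comul (dilIncl k K x) =
      Algebra.TensorProduct.map (dilIncl k K) (dilIncl k K) (D.comul x) := by
  change shuffle k K (Polynomial k) (D.comul x ⊗ₜ (dilatonLine k).comul 1) = _
  rw [map_one]
  induction D.comul x with
  | zero => simp
  | add p q hp hq => simp only [map_add, TensorProduct.add_tmul, hp, hq]
  | tmul s t => rfl

theorem dil_counit_incl {K : Type v} [Ring K] [Algebra k K] (D : HopfData k K) (x : K) :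
    D.dil.counit (dilIncl k K x) = D.counit x := by
  simp [HopfData.dil, HopfData.tensor, dilIncl]

theorem isHopf_eucRot (hD : D.IsHopf) : (eucRot D).IsHopf :=
  (hD.tensor hD).tensor (isHopf_dilatonLine k)

theorem isCocycle_dilCocycle (hD : D.IsHopf) (hR : D.IsQuasitriangular R) :
    (eucRot D).IsCocycle (dilCocycle R) :=
  (isCocycle_wickCocycle hD hR).map (dilIncl k (H ⊗[k] H)) (dil_comul_incl _) (dil_counit_incl _)

theorem isHopf_minkRot (hD : D.IsHopf) (hR : D.IsQuasitriangular R) : (minkRot D R).IsHopf :=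
  ((isCocycle_wickCocycle hD hR).isHopf_twist (hD.tensor hD)).tensor (isHopf_dilatonLine k)

/-- Both sides are Hopf algebras with the same counit, so only coproducts have to be compared. The
cocycle has trivial polynomial component, hence conjugation by it leaves the dilaton alone. From
here on the Minkowski rotations can be treated as one twist of the Euclidean ones. -/
theorem minkRot_eq_twist (hD : D.IsHopf) (hR : D.IsQuasitriangular R) :
    minkRot D R = (eucRot D).twist (dilCocycle R) := by
  refine (isHopf_minkRot hD hR).ext
    ((isCocycle_dilCocycle hD hR).isHopf_twist (isHopf_eucRot hD)) ?_ rfl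
  have key : ∀ (x : H ⊗[k] H) (y : Polynomial k), (minkRot D R).comul (x ⊗ₜ y) =
      ((eucRot D).twist (dilCocycle R)).comul (x ⊗ₜ y) := fun x y => by
    rw [twist_comul]
    change shuffle k _ _ (((wickCocycle R : (H ⊗[k] H) ⊗[k] (H ⊗[k] H)) * (D.tensor D).comul x *
      (↑(wickCocycle R)⁻¹ : (H ⊗[k] H) ⊗[k] (H ⊗[k] H))) ⊗ₜ (dilatonLine k).comul y) =
      (dilCocycle R : Dil k (H ⊗[k] H) ⊗[k] Dil k (H ⊗[k] H)) * shuffle k _ _ ((D.tensor D).comul x ⊗ₜ (dilatonLine k).comul y) * _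
    have h1 : ∀ z : (H ⊗[k] H) ⊗[k] (H ⊗[k] H), shuffle k _ (Polynomial k) (z ⊗ₜ 1) =
        Algebra.TensorProduct.map (dilIncl k (H ⊗[k] H)) (dilIncl k (H ⊗[k] H)) z := fun z => by
      induction z with
      | zero => simp
      | tmul a b => rfl
      | add p q hp hq => simp only [map_add, TensorProduct.add_tmul, hp, hq]
    have h2 : (dilCocycle R : Dil k (H ⊗[k] H) ⊗[k] Dil k (H ⊗[k] H)) =
        shuffle k _ _ ((wickCocycle R : (H ⊗[k] H) ⊗[k] (H ⊗[k] H)) ⊗ₜ 1) := (h1 _).symm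
    have h3 : (↑(dilCocycle R)⁻¹ : Dil k (H ⊗[k] H) ⊗[k] Dil k (H ⊗[k] H)) =
        shuffle k _ _ ((↑(wickCocycle R)⁻¹ : (H ⊗[k] H) ⊗[k] (H ⊗[k] H)) ⊗ₜ 1) := (h1 _).symm
    rw [h2, h3, ← map_mul, ← map_mul, Algebra.TensorProduct.tmul_mul_tmul,
      Algebra.TensorProduct.tmul_mul_tmul, one_mul, mul_one]
  refine AlgHom.toLinearMap_injective (TensorProduct.ext' key)

variable [Algebra ℚ k]

/-- The factor `λ^{-ξ⊗ξ}` commutes with the image of `(H ⊗ H) ⊗ (H ⊗ H)`, in particular with `χ⁻¹`.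
-/
theorem minkRotR_eq_twistR {s : k} (hs : IsNilpotent s) (R : (H ⊗[k] H)ˣ) :
    minkRotR s R = twistR (dilCocycle R) (eucRotR s R) := by
  let f : (H ⊗[k] H) ⊗[k] (H ⊗[k] H) →ₐ[k] _ :=
    Algebra.TensorProduct.map (dilIncl k (H ⊗[k] H)) (dilIncl k (H ⊗[k] H))
  let g : Polynomial k ⊗[k] Polynomial k →ₐ[k] Dil k (H ⊗[k] H) ⊗[k] Dil k (H ⊗[k] H) :=
    Algebra.TensorProduct.map
      (Algebra.TensorProduct.includeRight : Polynomial k →ₐ[k] Dil k (H ⊗[k] H))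
      (Algebra.TensorProduct.includeRight : Polynomial k →ₐ[k] Dil k (H ⊗[k] H))
  have hc : ∀ x y, f x * g y = g y * f x := fun x y => by
    have h1 := shuffle_eq_mul x y
    change _ = f x * g y at h1
    have h2 : g y = shuffle k _ _ (1 ⊗ₜ y) := by rw [shuffle_eq_mul, map_one, one_mul]
    have h3 : f x = shuffle k _ (Polynomial k) (x ⊗ₜ 1) := by
      rw [shuffle_eq_mul, map_one, mul_one]
      rfl
    rw [← h1, h2, h3, ← map_mul, Algebra.TensorProduct.tmul_mul_tmul, one_mul, mul_one]
  have hfl : ∀ x, flipHom k _ (f x) = f (flipHom k _ x) := fun x => by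
    induction x with
    | zero => simp
    | tmul a b => rfl
    | add p q hp hq => simp only [map_add, hp, hq]
  change f (flipHom k _ (wickCocycle R : (H ⊗[k] H) ⊗[k] (H ⊗[k] H)) *
      tensorR (R : H ⊗[k] H) * (↑(wickCocycle R)⁻¹ : (H ⊗[k] H) ⊗[k] (H ⊗[k] H))) *
      g (lineR hs : Polynomial k ⊗[k] Polynomial k) =
    flipHom k _ (f (wickCocycle R : (H ⊗[k] H) ⊗[k] (H ⊗[k] H))) * (f (tensorR (R : H ⊗[k] H)) *
      g (lineR hs : Polynomial k ⊗[k] Polynomial k)) *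
      f (↑(wickCocycle R)⁻¹ : (H ⊗[k] H) ⊗[k] (H ⊗[k] H))
  rw [hfl, map_mul, map_mul, mul_assoc, hc]
  simp only [mul_assoc]

/-- The quasitriangular structure of `(H ⊗ H)~` as a unit. -/
def eucUnit {s : k} (hs : IsNilpotent s) (R : (H ⊗[k] H)ˣ) :
    (Dil k (H ⊗[k] H) ⊗[k] Dil k (H ⊗[k] H))ˣ :=
  (dilUnit hs (tensorUnit R)).copy (eucRotR s R)
    (by rw [dilUnit_val, tensorUnit_val]; rfl) _ rfl

theorem eucUnit_val {s : k} (hs : IsNilpotent s) (R : (H ⊗[k] H)ˣ) :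
    (eucUnit hs R : Dil k (H ⊗[k] H) ⊗[k] Dil k (H ⊗[k] H)) = eucRotR s R := rfl

theorem isQuasitriangular_eucUnit {s : k} (hs : IsNilpotent s) (hR : D.IsQuasitriangular R) :
    (eucRot D).IsQuasitriangular (eucUnit hs R) := by
  rw [eucUnit, Units.copy_eq]
  exact isQuasitriangular_dilUnit hs (isQuasitriangular_tensorUnit hR)

/-- The quasitriangular structure of `(H ⋈ H)~` as a unit. -/
def minkUnit {s : k} (hs : IsNilpotent s) (R : (H ⊗[k] H)ˣ) :
    (Dil k (H ⊗[k] H) ⊗[k] Dil k (H ⊗[k] H))ˣ :=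
  -- The copy replaces the product `χ₂₁ R χ⁻¹` by `minkRotR s R` as underlying element, so that
  -- braided groups over this unit have by definition the type required of `B(R)`.
  (Units.map (flipHom k (Dil k (H ⊗[k] H)) : _ →* _) (dilCocycle R) * eucUnit hs R *
    (dilCocycle R)⁻¹).copy (minkRotR s R)
    (by rw [minkRotR_eq_twistR hs, ← eucUnit_val hs]; rfl) _ rfl

theorem minkUnit_val {s : k} (hs : IsNilpotent s) (R : (H ⊗[k] H)ˣ) :
    (minkUnit hs R : Dil k (H ⊗[k] H) ⊗[k] Dil k (H ⊗[k] H)) = minkRotR s R := rfl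

theorem isQuasitriangular_minkUnit {s : k} (hs : IsNilpotent s) (hD : D.IsHopf)
    (hR : D.IsQuasitriangular R) : (minkRot D R).IsQuasitriangular (minkUnit hs R) := by
  rw [minkRot_eq_twist hD hR]
  exact (isQuasitriangular_eucUnit hs hR).twist (isCocycle_dilCocycle hD hR)
    (by rw [minkUnit_val, minkRotR_eq_twistR hs, eucUnit_val])

end Rotations

end QPoincare

end

noncomputable section

namespace QPoincare

/-! ### Quadratic algebras -/

section QuadraticAlgebra

variable {k : Type u} [CommRing k] {ι : Type}

/-- The generators of an algebra given by generators and relations. -/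
def gen (rel : FreeAlgebra k ι → FreeAlgebra k ι → Prop) (x : ι) : RingQuot rel :=
  RingQuot.mkAlgHom k rel (FreeAlgebra.ι k x)

variable {rel : FreeAlgebra k ι → FreeAlgebra k ι → Prop}

/-- Words are stripped of one generator at a time from the left, so the product step only has to
deal with `gen x * b`. -/
theorem gen_induction {P : RingQuot rel → Prop} (one : P 1) (add : ∀ a b, P a → P b → P (a + b))
    (smul : ∀ (r : k) a, P a → P (r • a)) (mul : ∀ x b, P b → P (gen rel x * b))
    (b : RingQuot rel) : P b := by
  obtain ⟨a, rfl⟩ := RingQuot.mkAlgHom_surjective k rel b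
  suffices h : ∀ b, P b → P (RingQuot.mkAlgHom k rel a * b) by simpa using h 1 one
  induction a using FreeAlgebra.induction with
  | grade0 r =>
    intro b hb
    rw [AlgHom.commutes, ← Algebra.smul_def]
    exact smul r b hb
  | grade1 x => exact fun b hb => mul x b hb
  | mul a c ha hc =>
    intro b hb
    rw [map_mul, mul_assoc]
    exact ha _ (hc _ hb)
  | add a c ha hc =>
    intro b hb
    rw [map_add, add_mul]
    exact add _ _ (ha _ hb) (hc _ hb)

theorem gen_algHom_ext {X : Type*} [Ring X] [Algebra k X] {f g : RingQuot rel →ₐ[k] X}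
    (h : ∀ x, f (gen rel x) = g (gen rel x)) : f = g := by
  refine RingQuot.ringQuot_ext' k f g (FreeAlgebra.hom_ext (funext fun x => h x))

variable [Fintype ι]

/-- The quadratic expression `∑ c(x, y) f(x) f(y)`. -/
def quad {X : Type*} [Ring X] [Algebra k X] (f : ι → X) : (ι × ι → k) →ₗ[k] X :=
  Fintype.linearCombination k fun z => f z.1 * f z.2

theorem quad_apply {X : Type*} [Ring X] [Algebra k X] (f : ι → X) (c : ι × ι → k) :
    quad f c = ∑ z, c z • (f z.1 * f z.2) := rfl

theorem map_quad {X Y : Type*} [Ring X] [Algebra k X] [Ring Y] [Algebra k Y] (φ : X →ₐ[k] Y)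
    (f : ι → X) (c : ι × ι → k) : φ (quad f c) = quad (fun x => φ (f x)) c := by
  simp [quad_apply, map_sum]

/-- The relations `rel` are quadratic, with coefficients in `L`. -/
structure IsQuadratic (rel : FreeAlgebra k ι → FreeAlgebra k ι → Prop)
    (L : Submodule k (ι × ι → k)) : Prop where
  of_rel : ∀ a b, rel a b → ∃ c ∈ L, a - b = quad (FreeAlgebra.ι k) c
  quad_eq_zero : ∀ c ∈ L, quad (gen rel) c = 0

variable {L : Submodule k (ι × ι → k)}

/-- The universal property of a quadratic algebra. -/
def IsQuadratic.lift (hL : IsQuadratic rel L) {X : Type*} [Ring X] [Algebra k X] (f : ι → X)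
    (hf : ∀ c ∈ L, quad f c = 0) : RingQuot rel →ₐ[k] X :=
  RingQuot.liftAlgHom k ⟨FreeAlgebra.lift k f, fun {a b} h => by
    obtain ⟨c, hc, e⟩ := hL.of_rel a b h
    rw [← sub_eq_zero, ← map_sub, e, map_quad]
    simpa using hf c hc⟩

@[simp] theorem IsQuadratic.lift_gen (hL : IsQuadratic rel L) {X : Type*} [Ring X] [Algebra k X]
    (f : ι → X) (hf : ∀ c ∈ L, quad f c = 0) (x : ι) : hL.lift f hf (gen rel x) = f x := by
  simp [IsQuadratic.lift, gen]

end QuadraticAlgebra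

/-! ### Actions on quadratic algebras -/

section Action

variable {k : Type u} [CommRing k] {K : Type v} [Ring K] [Algebra k K] {ι : Type} [Fintype ι]
  [DecidableEq ι]

/-- The tensor square of a matrix representation. -/
def tensorRep (ρ : K →ₐ[k] Matrix ι ι k) : K ⊗[k] K →ₐ[k] Matrix (ι × ι) (ι × ι) k :=
  (Matrix.kroneckerAlgEquiv ι ι k).toAlgHom.comp (Algebra.TensorProduct.map ρ ρ)

theorem tensorRep_tmul (ρ : K →ₐ[k] Matrix ι ι k) (a b : K) :
    tensorRep ρ (a ⊗ₜ b) = ρ a ⊗ₖ ρ b := by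
  simp [tensorRep]

/-- The action on a family `f` indexed by the basis of a matrix representation. -/
def rotate {X : Type*} [AddCommMonoid X] [Module k X] (ρ : K →ₐ[k] Matrix ι ι k) (f : ι → X)
    (x : ι) : K →ₗ[k] X where
  toFun a := ∑ y, ρ a y x • f y
  map_add' a b := by simp [add_smul, Finset.sum_add_distrib]
  map_smul' r a := by simp [smul_smul, Finset.smul_sum]

theorem rotate_apply {X : Type*} [AddCommMonoid X] [Module k X] (ρ : K →ₐ[k] Matrix ι ι k)
    (f : ι → X) (x : ι) (a : K) : rotate ρ f x a = ∑ y, ρ a y x • f y := rfl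

theorem rotate_one {X : Type*} [AddCommMonoid X] [Module k X] (ρ : K →ₐ[k] Matrix ι ι k)
    (f : ι → X) (x : ι) : rotate ρ f x 1 = f x := by
  simp [rotate_apply, Matrix.one_apply]

theorem rotate_mul {X : Type*} [AddCommMonoid X] [Module k X] (ρ : K →ₐ[k] Matrix ι ι k)
    (f : ι → X) (x : ι) (a b : K) :
    rotate ρ f x (a * b) = ∑ y, ρ b y x • rotate ρ f y a := by
  simp only [rotate_apply, map_mul, Matrix.mul_apply, Finset.sum_smul, Finset.smul_sum, smul_smul]
  rw [Finset.sum_comm]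
  exact Finset.sum_congr rfl fun y _ => Finset.sum_congr rfl fun z _ => by rw [mul_comm]

theorem map_rotate {X Y : Type*} [AddCommMonoid X] [Module k X] [AddCommMonoid Y] [Module k Y]
    (φ : X →ₗ[k] Y) (ρ : K →ₐ[k] Matrix ι ι k) (f : ι → X) (x : ι) (a : K) :
    φ (rotate ρ f x a) = rotate ρ (fun y => φ (f y)) x a := by
  simp [rotate_apply, map_sum]

/-- Bilinear expressions in rotated families. -/
theorem sum_rotate {X Y Z : Type*} [AddCommMonoid X] [Module k X] [AddCommMonoid Y] [Module k Y]
    [AddCommMonoid Z] [Module k Z] (ρ : K →ₐ[k] Matrix ι ι k) (f : ι → X) (g : ι → Y)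
    (m : X →ₗ[k] Y →ₗ[k] Z) (c : ι × ι → k) (t : K ⊗[k] K) :
    ∑ z, c z • TensorProduct.lift (m.compl₁₂ (rotate ρ f z.1) (rotate ρ g z.2)) t =
      ∑ z, (tensorRep ρ t).mulVec c z • m (f z.1) (g z.2) := by
  induction t with
  | zero => simp
  | add p q hp hq =>
    simp only [map_add, smul_add, Finset.sum_add_distrib, hp, hq, Matrix.add_mulVec, Pi.add_apply,
      add_smul]
  | tmul a b =>
    simp only [TensorProduct.lift.tmul, LinearMap.compl₁₂_apply, rotate_apply, map_sum, map_smul,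
      LinearMap.sum_apply, LinearMap.smul_apply, Finset.smul_sum, smul_smul, tensorRep_tmul,
      Matrix.mulVec, dotProduct, Finset.sum_smul]
    conv_rhs => rw [Finset.sum_comm]
    refine Finset.sum_congr rfl fun z _ => ?_
    rw [Fintype.sum_prod_type_right]
    refine Finset.sum_congr rfl fun y _ => Finset.sum_congr rfl fun x _ => ?_
    rw [Matrix.kroneckerMap_apply]
    congr 1
    ring

theorem sum_rotate_mul {X : Type*} [Ring X] [Algebra k X] (ρ : K →ₐ[k] Matrix ι ι k) (f : ι → X)
    (c : ι × ι → k) (t : K ⊗[k] K) :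
    ∑ z, c z • LinearMap.mul' k X (TensorProduct.map (rotate ρ f z.1) (rotate ρ f z.2) t) =
      quad f ((tensorRep ρ t).mulVec c) := by
  rw [quad_apply]
  refine Eq.trans (Finset.sum_congr rfl fun z _ => ?_) (sum_rotate ρ f f (LinearMap.mul k X) c t)
  congr 1
  induction t with
  | zero => simp
  | add p q hp hq => simp only [map_add, hp, hq]
  | tmul a b => simp

variable {rel : FreeAlgebra k ι → FreeAlgebra k ι → Prop} {L : Submodule k (ι × ι → k)}
  {D : HopfData k K}

/-- The action on the generators extends to the quadratic algebra if the relations are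
invariant. -/
theorem IsQuadratic.exists_action (hL : IsQuadratic rel L) (hD : D.IsHopf)
    (ρ : K →ₐ[k] Matrix ι ι k)
    (hinv : ∀ h, ∀ c ∈ L, (tensorRep ρ (D.comul h)).mulVec c ∈ L) :
    ∃ a : RingQuot rel →ₗ[k] K →ₗ[k] RingQuot rel,
      (∀ h, a 1 h = algebraMap k _ (D.counit h)) ∧
      (∀ h b c, a (b * c) h = LinearMap.mul' k _ (TensorProduct.map (a b) (a c) (D.comul h))) ∧
      ∀ x, a (gen rel x) = rotate ρ (gen rel) x := by
  let _ := hD.hopfAlgebra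
  -- An action making `B` a module algebra amounts to a multiplicative map from `B` to `Hom(K, B)`
  -- with the convolution product, `b ↦ (h ↦ h ▷ b)`. Such a map can be prescribed on generators,
  -- and invariance of the relations is what makes it well defined.
  let δ : RingQuot rel →ₐ[k] WithConv (K →ₗ[k] RingQuot rel) :=
    hL.lift (fun x => WithConv.toConv (rotate ρ (gen rel) x)) fun c hc => by
      rw [quad_apply]
      refine WithConv.ofConv_injective (LinearMap.ext fun h => ?_)
      have h1 := sum_rotate_mul ρ (gen rel) c (D.comul h)
      rw [hL.quad_eq_zero _ (hinv h c hc)] at h1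
      refine Eq.trans ?_ h1
      rw [WithConv.ofConv_sum, LinearMap.sum_apply]
      rfl
  refine ⟨(WithConv.linearEquiv k _).toLinearMap ∘ₗ δ.toLinearMap, fun h => ?_, fun h b c => ?_,
    fun x => ?_⟩
  · simp only [LinearMap.comp_apply, AlgHom.toLinearMap_apply, map_one]
    rfl
  · simp only [LinearMap.comp_apply, AlgHom.toLinearMap_apply, map_mul]
    rfl
  · simp only [LinearMap.comp_apply, AlgHom.toLinearMap_apply, δ, IsQuadratic.lift_gen]
    rfl

/-- A quadratic algebra with invariant relations as a module algebra. -/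
theorem IsQuadratic.exists_moduleAlgebra (hL : IsQuadratic rel L) (hD : D.IsHopf)
    (ρ : K →ₐ[k] Matrix ι ι k)
    (hinv : ∀ h, ∀ c ∈ L, (tensorRep ρ (D.comul h)).mulVec c ∈ L) :
    ∃ M : ModuleAlgebra D (RingQuot rel), ∀ h x, M.act h (gen rel x) = rotate ρ (gen rel) x h := by
  obtain ⟨a, a_one, a_mul, a_gen⟩ := hL.exists_action hD ρ hinv
  -- The convolution map alone does not see the product of `K`. The module axiom holds on generators
  -- because `ρ` is multiplicative, and passes to products because `Δ` is.
  have act_mul : ∀ b h g, a b (h * g) = a (a b g) h := by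
    intro b
    induction b using gen_induction with
    | one =>
      intro h g
      rw [a_one, a_one, map_mul, Algebra.algebraMap_eq_smul_one (D.counit g), map_smul,
        LinearMap.smul_apply, a_one, mul_comm, map_mul, Algebra.smul_def]
    | add b c hb hc => intro h g; simp only [map_add, LinearMap.add_apply, hb, hc]
    | smul r b hb => intro h g; simp only [map_smul, LinearMap.smul_apply, hb]
    | mul x c hc =>
      intro h g
      have hx : ∀ h g, a (gen rel x) (h * g) = a (a (gen rel x) g) h := fun h g => by
        simp only [a_gen, rotate_mul]
        rw [rotate_apply, map_sum, LinearMap.sum_apply]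
        exact Finset.sum_congr rfl fun y _ => by rw [map_smul, LinearMap.smul_apply, a_gen]
      rw [a_mul, a_mul, map_mul]
      generalize D.comul g = t
      induction t with
      | zero => simp
      | add p q hp hq => simp only [map_add, mul_add, LinearMap.add_apply, hp, hq]
      | tmul s t =>
        rw [TensorProduct.map_tmul, LinearMap.mul'_apply, a_mul]
        generalize D.comul h = t'
        induction t' with
        | zero => simp
        | add p q hp hq => simp only [map_add, add_mul, hp, hq]
        | tmul s' t' => simp [hx, hc]
  have act_one : ∀ b, a b 1 = b := by
    intro b
    induction b using gen_induction with
    | one => rw [a_one, map_one, map_one]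
    | add b c hb hc => simp only [map_add, LinearMap.add_apply, hb, hc]
    | smul r b hb => simp only [map_smul, LinearMap.smul_apply, hb]
    | mul x c hc =>
      rw [a_mul, map_one, Algebra.TensorProduct.one_def, TensorProduct.map_tmul,
        LinearMap.mul'_apply, hc, a_gen, rotate_one]
  let act : K →ₐ[k] Module.End k (RingQuot rel) :=
    AlgHom.ofLinearMap a.flip (LinearMap.ext fun b => act_one b)
      (fun h g => LinearMap.ext fun b => act_mul b h g)
  refine ⟨⟨act, fun h => a_one h, fun h x => ?_⟩, fun h x => by
    change a (gen rel x) h = _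
    rw [a_gen]⟩
  induction x with
  | zero => simp
  | add p q hp hq => simp only [map_add, hp, hq]
  | tmul b c =>
    change a (b * c) h = _
    rw [a_mul]
    generalize D.comul h = t
    induction t with
    | zero => simp
    | add p q hp hq => simp only [map_add, LinearMap.add_apply, hp, hq]
    | tmul s t => rfl

end Action

end QPoincare

end

noncomputable section

namespace QPoincare

/-! ### The semidirect product algebra -/

section Semidirect

variable {k : Type u} [CommRing k] {K : Type v} [Ring K] [Algebra k K] {D : HopfData k K}
  {B : Type w} [Ring B] [Algebra k B] (M : ModuleAlgebra D B)

theorem act_mul_tmul (h : K) (b c : B) : M.act h (b * c) =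
    LinearMap.mul' k B (TensorProduct.map (M.act.toLinearMap.flip b) (M.act.toLinearMap.flip c)
      (D.comul h)) := by
  have := M.act_mul h (b ⊗ₜ c)
  rw [LinearMap.mul'_apply] at this
  rw [this]
  generalize D.comul h = t
  induction t with
  | zero => simp
  | add p q hp hq => simp only [map_add, LinearMap.add_apply, hp, hq]
  | tmul s t => rfl

/-! ### The cross relation in an arbitrary target algebra -/

section Cov

variable {X : Type*} [Semiring X] [Algebra k X]

/-- `s ⊗ t ↦ f(s ▷ b) φ(t)`. -/
def ModuleAlgebra.cross (f : B →ₗ[k] X) (φ : K →ₗ[k] X) (b : B) : K ⊗[k] K →ₗ[k] X :=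
  LinearMap.mul' k X ∘ₗ TensorProduct.map (f ∘ₗ M.act.toLinearMap.flip b) φ

@[simp] theorem cross_tmul (f : B →ₗ[k] X) (φ : K →ₗ[k] X) (b : B) (s t : K) :
    M.cross f φ b (s ⊗ₜ t) = f (M.act s b) * φ t := rfl

/-- The cross relation `φ(h) f(b) = f(h₍₁₎ ▷ b) φ(h₍₂₎)`. -/
def ModuleAlgebra.Cov (f : B →ₗ[k] X) (φ : K →ₗ[k] X) (b : B) : Prop :=
  ∀ h, φ h * f b = M.cross f φ b (D.comul h)

variable {M}

/-- Moving `φ(h)` past `f(s ▷ b)` multiplies the tensor by `Δ h` on the left. The hypothesis covers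
all translates of `b`, since these are the elements that `φ(h)` meets. -/
theorem ModuleAlgebra.Cov.comul_mul {f : B →ₗ[k] X} {φ : K →ₐ[k] X} {b : B}
    (hc : ∀ a, M.Cov f φ.toLinearMap (M.act a b)) (h : K) (T : K ⊗[k] K) :
    φ h * M.cross f φ.toLinearMap b T = M.cross f φ.toLinearMap b (D.comul h * T) := by
  induction T with
  | zero => simp
  | add p q hp hq => simp only [map_add, mul_add, hp, hq]
  | tmul s t =>
    have := hc s h
    rw [AlgHom.toLinearMap_apply] at this
    rw [cross_tmul, ← mul_assoc, this]
    generalize D.comul h = y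
    induction y with
    | zero => simp
    | add p q hp hq => simp only [map_add, add_mul, hp, hq]
    | tmul a c => simp [mul_assoc]

theorem ModuleAlgebra.cross_mul_right (f : B →ₗ[k] X) (φ : K →ₐ[k] X) (b : B) (T : K ⊗[k] K)
    (h : K) : M.cross f φ.toLinearMap b T * φ h =
      M.cross f φ.toLinearMap b (T * 1 ⊗ₜ h) := by
  induction T with
  | zero => simp
  | add p q hp hq => simp only [map_add, add_mul, hp, hq]
  | tmul s t => simp [mul_assoc]

theorem ModuleAlgebra.cross_mul_left (f : B →ₗ[k] X) (φ : K →ₗ[k] X) (b : B) (T : K ⊗[k] K)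
    (h : K) : M.cross f φ b (T * h ⊗ₜ 1) = M.cross f φ (M.act h b) T := by
  induction T with
  | zero => simp
  | add p q hp hq => simp only [map_add, add_mul, hp, hq]
  | tmul s t => simp

theorem ModuleAlgebra.cov_one (hD : D.IsHopf) (f : B →ₐ[k] X) (φ : K →ₐ[k] X) :
    M.Cov f.toLinearMap φ.toLinearMap 1 := fun h => by
  have key : ∀ T : K ⊗[k] K, M.cross f.toLinearMap φ.toLinearMap 1 T = φ (D.counitL T) := fun T => by
    induction T with
    | zero => simp
    | add p q hp hq => simp only [map_add, hp, hq]
    | tmul s t => simp [M.act_one, Algebra.smul_def]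
  rw [key, hD.counitL_comul]
  simp

theorem ModuleAlgebra.Cov.add {f : B →ₗ[k] X} {φ : K →ₗ[k] X} {b c : B} (hb : M.Cov f φ b)
    (hc : M.Cov f φ c) : M.Cov f φ (b + c) := fun h => by
  rw [map_add, mul_add, hb, hc]
  generalize D.comul h = t
  induction t with
  | zero => simp
  | add p q hp hq =>
    simp only [map_add] at hp hq ⊢
    rw [← hp, ← hq]
    abel
  | tmul s t => simp [add_mul]

theorem ModuleAlgebra.Cov.smul {f : B →ₗ[k] X} {φ : K →ₗ[k] X} {b : B} (hb : M.Cov f φ b)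
    (r : k) : M.Cov f φ (r • b) := fun h => by
  rw [map_smul, mul_smul_comm, hb]
  generalize D.comul h = t
  induction t with
  | zero => simp
  | add p q hp hq => simp only [map_add, smul_add, hp, hq]
  | tmul s t => simp

/-- Moving `φ(h)` first past `f(b)` and then past `f(c)` produces `(id ⊗ Δ)Δ h`, whereas acting on
the product `b c` produces `(Δ ⊗ id)Δ h`; coassociativity identifies them. Hence the cross relation
need only be verified on generators. -/
theorem ModuleAlgebra.Cov.mul (hD : D.IsHopf) {f : B →ₐ[k] X} {φ : K →ₐ[k] X} {b c : B}
    (hb : M.Cov f.toLinearMap φ.toLinearMap b) (hc : M.Cov f.toLinearMap φ.toLinearMap c) :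
    M.Cov f.toLinearMap φ.toLinearMap (b * c) := fun h => by
  let Z : K ⊗[k] (K ⊗[k] K) →ₗ[k] X := LinearMap.mul' k X ∘ₗ
    TensorProduct.map (f.toLinearMap ∘ₗ M.act.toLinearMap.flip b)
      (M.cross f.toLinearMap φ.toLinearMap c)
  have h1 : M.cross f.toLinearMap φ.toLinearMap b (D.comul h) * f c = Z (D.comulR (D.comul h)) := by
    generalize D.comul h = t
    induction t with
    | zero => simp
    | add p q hp hq => simp only [map_add, add_mul, hp, hq]
    | tmul s t =>
      have := hc t
      simp only [AlgHom.toLinearMap_apply] at this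
      rw [cross_tmul, AlgHom.toLinearMap_apply, AlgHom.toLinearMap_apply, mul_assoc, this]
      rfl
  have h2 : M.cross f.toLinearMap φ.toLinearMap (b * c) (D.comul h) =
      Z (D.comulL (D.comul h)) := by
    generalize D.comul h = t
    induction t with
    | zero => simp
    | add p q hp hq => simp only [map_add, hp, hq]
    | tmul s t =>
      rw [cross_tmul, act_mul_tmul, HopfData.comulL_tmul]
      generalize D.comul s = y
      induction y with
      | zero => simp
      | add p q hp hq => simp only [map_add, add_mul, TensorProduct.add_tmul, hp, hq]
      | tmul a d => simp [Z, mul_assoc]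
  have h3 := hb h
  simp only [AlgHom.toLinearMap_apply] at h3
  rw [h2, hD.comulL_comul, ← h1]
  simp only [AlgHom.toLinearMap_apply, map_mul]
  rw [← mul_assoc, h3]

end Cov

theorem bos_cov (b : B) : M.Cov (inB M).toLinearMap (inK M).toLinearMap b := fun h => by
  have := RingQuot.mkAlgHom_rel k (BosRel.cross (M := M) h b)
  rw [map_mul] at this
  refine this.trans ?_
  generalize D.comul h = t
  induction t with
  | zero => simp
  | add p q hp hq => simp only [map_add, hp, hq]
  | tmul s t =>
    rw [TensorProduct.map_tmul, LinearMap.mul'_apply, map_mul]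
    rfl

theorem bos_comul_mul (b : B) (h : K) (T : K ⊗[k] K) :
    inK M h * M.cross (inB M).toLinearMap (inK M).toLinearMap b T =
      M.cross (inB M).toLinearMap (inK M).toLinearMap b (D.comul h * T) :=
  ModuleAlgebra.Cov.comul_mul (fun a => bos_cov M (M.act a b)) h T

theorem inK_mul_inB (h : K) (b : B) : inK M h * inB M b =
    M.cross (inB M).toLinearMap (inK M).toLinearMap b (D.comul h) := bos_cov M b h

/-! ### Universal property and spanning set of the semidirect product -/

section Lift

variable {X : Type*} [Semiring X] [Algebra k X]

/-- The universal property of the semidirect product. -/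
def bosLift (f : B →ₐ[k] X) (φ : K →ₐ[k] X) (h : ∀ b, M.Cov f.toLinearMap φ.toLinearMap b) :
    Bos M →ₐ[k] X :=
  RingQuot.liftAlgHom k ⟨TensorAlgebra.lift k (f.toLinearMap.coprod φ.toLinearMap),
    fun {x y} r => by
      cases r with
      | one_left => simp
      | mul_left b c => simp
      | one_right => simp
      | mul_right h g => simp
      | cross g b =>
        have := h b g
        simp only [AlgHom.toLinearMap_apply] at this
        simp only [map_mul, TensorAlgebra.lift_ι_apply, LinearMap.coprod_apply, map_zero, zero_add,
          add_zero, AlgHom.toLinearMap_apply, this]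
        generalize D.comul g = t
        induction t with
        | zero => simp
        | add p q hp hq => simp only [map_add, hp, hq]
        | tmul s t => simp⟩

@[simp] theorem bosLift_inB (f : B →ₐ[k] X) (φ : K →ₐ[k] X)
    (h : ∀ b, M.Cov f.toLinearMap φ.toLinearMap b) (b : B) : bosLift M f φ h (inB M b) = f b := by
  change bosLift M f φ h (RingQuot.mkAlgHom k _ (TensorAlgebra.ι k (b, 0))) = f b
  simp [bosLift]

@[simp] theorem bosLift_inK (f : B →ₐ[k] X) (φ : K →ₐ[k] X)
    (h : ∀ b, M.Cov f.toLinearMap φ.toLinearMap b) (a : K) : bosLift M f φ h (inK M a) = φ a := by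
  change bosLift M f φ h (RingQuot.mkAlgHom k _ (TensorAlgebra.ι k (0, a))) = φ a
  simp [bosLift]

theorem bos_ι (b : B) (h : K) : RingQuot.mkAlgHom k (BosRel M) (TensorAlgebra.ι k (b, h)) =
    inB M b + inK M h := by
  change _ = RingQuot.mkAlgHom k (BosRel M) (TensorAlgebra.ι k (b, 0)) +
    RingQuot.mkAlgHom k (BosRel M) (TensorAlgebra.ι k (0, h))
  rw [← map_add, ← map_add, Prod.mk_add_mk, add_zero, zero_add]

variable {M}

theorem bos_algHom_ext {f g : Bos M →ₐ[k] X} (hB : ∀ b, f (inB M b) = g (inB M b))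
    (hK : ∀ h, f (inK M h) = g (inK M h)) : f = g := by
  refine RingQuot.ringQuot_ext' k f g (TensorAlgebra.hom_ext (LinearMap.ext fun x => ?_))
  obtain ⟨b, h⟩ := x
  simp only [LinearMap.comp_apply, AlgHom.toLinearMap_apply, AlgHom.comp_apply]
  rw [bos_ι, map_add, map_add, hB, hK]

/-- The semidirect product is generated by `B` and `K`. -/
theorem bos_mul_induction {P : Bos M → Prop} (one : P 1) (add : ∀ x y, P x → P y → P (x + y))
    (smul : ∀ (r : k) x, P x → P (r • x)) (mulB : ∀ b x, P x → P (inB M b * x))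
    (mulK : ∀ h x, P x → P (inK M h * x)) (x : Bos M) : P x := by
  obtain ⟨a, rfl⟩ := RingQuot.mkAlgHom_surjective k _ x
  suffices h : ∀ y, P y → P (RingQuot.mkAlgHom k _ a * y) by simpa using h 1 one
  induction a using TensorAlgebra.induction with
  | algebraMap r =>
    intro y hy
    rw [AlgHom.commutes, ← Algebra.smul_def]
    exact smul r y hy
  | ι x =>
    intro y hy
    obtain ⟨b, h⟩ := x
    rw [bos_ι, add_mul]
    exact add _ _ (mulB _ _ hy) (mulK _ _ hy)
  | mul a c ha hc =>
    intro y hy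
    rw [map_mul, mul_assoc]
    exact ha _ (hc _ hy)
  | add a c ha hc =>
    intro y hy
    rw [map_add, add_mul]
    exact add _ _ (ha _ hy) (hc _ hy)

/-- The semidirect product is spanned by products `b h`. -/
theorem bos_induction {P : Bos M → Prop} (add : ∀ x y, P x → P y → P (x + y))
    (mul : ∀ b h, P (inB M b * inK M h)) (x : Bos M) : P x := by
  have zero : P 0 := by simpa using mul 0 0
  -- The span contains `1` and is stable under left multiplication by `B`, and by `K` because of the
  -- cross relation; it is therefore everything.
  let Q : Submodule k (Bos M) := Submodule.span k {x | ∃ b h, x = inB M b * inK M h}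
  have hQ : x ∈ Q := by
    refine bos_mul_induction ?_ (fun x y hx hy => Q.add_mem hx hy) (fun r x hx => Q.smul_mem r hx)
      (fun b x hx => ?_) (fun h x hx => ?_) x
    · exact Submodule.subset_span ⟨1, 1, by simp⟩
    · induction hx using Submodule.span_induction with
      | mem x hx =>
        obtain ⟨c, g, rfl⟩ := hx
        exact Submodule.subset_span ⟨b * c, g, by rw [map_mul, mul_assoc]⟩
      | zero => simp
      | add x y _ _ hx hy => rw [mul_add]; exact Q.add_mem hx hy
      | smul r x _ hx => rw [mul_smul_comm]; exact Q.smul_mem r hx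
    · induction hx using Submodule.span_induction with
      | mem x hx =>
        obtain ⟨c, g, rfl⟩ := hx
        rw [← mul_assoc, inK_mul_inB]
        generalize D.comul h = t
        induction t with
        | zero => simp
        | add p q hp hq => rw [map_add, add_mul]; exact Q.add_mem hp hq
        | tmul s t =>
          exact Submodule.subset_span ⟨M.act s c, t * g, by simp [mul_assoc]⟩
      | zero => simp
      | add x y _ _ hx hy => rw [mul_add]; exact Q.add_mem hx hy
      | smul r x _ hx => rw [mul_smul_comm]; exact Q.smul_mem r hx
  have smul : ∀ (r : k) b h, P (r • (inB M b * inK M h)) := fun r b h => by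
    rw [← smul_mul_assoc, ← map_smul]
    exact mul _ _
  obtain ⟨n, c, g, e⟩ := Submodule.mem_span_set'.mp hQ
  rw [← e]
  refine Finset.sum_induction _ P add zero fun i _ => ?_
  obtain ⟨b, h, hb⟩ := (g i).2
  rw [hb]
  exact smul _ b h

end Lift

end Semidirect

end QPoincare

end

noncomputable section

namespace QPoincare

/-! ### The structure maps of the bosonisation -/

section Bosonisation

variable {k : Type u} [CommRing k] {K : Type v} [Ring K] [Algebra k K] {D : HopfData k K}
  {B : Type w} [Ring B] [Algebra k B] (M : ModuleAlgebra D B)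

/-- `K → (B ⋊ K) ⊗ (B ⋊ K)`, the coproduct of `K`. -/
def bosComulK : K →ₐ[k] Bos M ⊗[k] Bos M :=
  (Algebra.TensorProduct.map (inK M) (inK M)).comp D.comul

/-- `b ↦ b ⊗ 1`. -/
def bosFst : B →ₐ[k] Bos M ⊗[k] Bos M := Algebra.TensorProduct.includeLeft.comp (inB M)

theorem bosFst_apply (b : B) : bosFst M b = inB M b ⊗ₜ 1 := rfl

/-- `s ⊗ t ↦ t ⊗ (s ▷ b)`, linear in `b`. -/
def bosCoact : B →ₗ[k] K ⊗[k] K →ₗ[k] Bos M ⊗[k] Bos M where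
  toFun b := (TensorProduct.comm k (Bos M) (Bos M)).toLinearMap ∘ₗ
    TensorProduct.map ((inB M).toLinearMap ∘ₗ M.act.toLinearMap.flip b) (inK M).toLinearMap
  map_add' b c := by ext; simp [TensorProduct.tmul_add]
  map_smul' r b := by ext; simp

@[simp] theorem bosCoact_tmul (b : B) (s t : K) :
    bosCoact M b (s ⊗ₜ t) = inK M t ⊗ₜ inB M (M.act s b) := rfl

/-- `s ⊗ t ↦ S(t) (s ▷ b)`, linear in `b`. -/
def bosAnti : B →ₗ[k] K ⊗[k] K →ₗ[k] Bos M where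
  toFun b := LinearMap.mul' k (Bos M) ∘ₗ (TensorProduct.comm k (Bos M) (Bos M)).toLinearMap ∘ₗ
    TensorProduct.map ((inB M).toLinearMap ∘ₗ M.act.toLinearMap.flip b)
      ((inK M).toLinearMap ∘ₗ D.antipode)
  map_add' b c := by ext; simp [mul_add]
  map_smul' r b := by ext; simp

@[simp] theorem bosAnti_tmul (b : B) (s t : K) :
    bosAnti M b (s ⊗ₜ t) = inK M (D.antipode t) * inB M (M.act s b) := rfl

/-- Only the first leg of `Δ h` has to pass `b`, which yields `(Δ ⊗ id)Δ h`; the cross relation asks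
for `(id ⊗ Δ)Δ h`. This is coassociativity. -/
theorem cov_bosFst (hD : D.IsHopf) (b : B) :
    M.Cov (bosFst M).toLinearMap (bosComulK M).toLinearMap b := fun h => by
  let Y : K ⊗[k] (K ⊗[k] K) →ₗ[k] Bos M ⊗[k] Bos M :=
    TensorProduct.map (M.cross (inB M).toLinearMap (inK M).toLinearMap b) (inK M).toLinearMap ∘ₗ
      (TensorProduct.assoc k K K K).symm.toLinearMap
  have h1 : ∀ T : K ⊗[k] K, Algebra.TensorProduct.map (inK M) (inK M) T * (inB M b ⊗ₜ 1) =
      Y (D.comulL T) := fun T => by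
    induction T with
    | zero => simp
    | add p q hp hq => simp only [map_add, add_mul, hp, hq]
    | tmul s t =>
      rw [Algebra.TensorProduct.map_tmul, Algebra.TensorProduct.tmul_mul_tmul, mul_one,
        inK_mul_inB, HopfData.comulL_tmul]
      change _ = TensorProduct.map _ _ ((TensorProduct.assoc k K K K).symm
        ((TensorProduct.assoc k K K K) (D.comul s ⊗ₜ t)))
      rw [LinearEquiv.symm_apply_apply]
      rfl
  have h2 : ∀ T : K ⊗[k] K, M.cross (bosFst M).toLinearMap (bosComulK M).toLinearMap b T =
      Y (D.comulR T) := fun T => by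
    induction T with
    | zero => simp
    | add p q hp hq => simp only [map_add, hp, hq]
    | tmul s t =>
      rw [cross_tmul, HopfData.comulR_tmul]
      change inB M _ ⊗ₜ 1 * Algebra.TensorProduct.map (inK M) (inK M) (D.comul t) = _
      generalize D.comul t = y
      induction y with
      | zero => simp
      | add p q hp hq => simp only [map_add, mul_add, TensorProduct.tmul_add, hp, hq]
      | tmul a c => simp [Y]
  rw [h2, ← hD.comulL_comul, ← h1]
  rfl

variable {R : (K ⊗[k] K)ˣ}

/-- `b ↦ R⁽²⁾ ⊗ R⁽¹⁾ ▷ b` is multiplicative. -/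
theorem bosCoact_mul (hR : D.IsQuasitriangular R) (b c : B) :
    bosCoact M b R * bosCoact M c R = bosCoact M (b * c) R := by
  -- `Z(s ⊗ s' ⊗ t) = t ⊗ (s ▷ b)(s' ▷ c)`. The hexagon `(Δ ⊗ id)R = R₁₃ R₂₃` splits the action on
  -- the product `b c`.
  let Z : K ⊗[k] (K ⊗[k] K) →ₗ[k] Bos M ⊗[k] Bos M :=
    (TensorProduct.comm k (Bos M) (Bos M)).toLinearMap ∘ₗ
    TensorProduct.map ((inB M).toLinearMap ∘ₗ LinearMap.mul' k B ∘ₗ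
      TensorProduct.map (M.act.toLinearMap.flip b) (M.act.toLinearMap.flip c))
      (inK M).toLinearMap ∘ₗ (TensorProduct.assoc k K K K).symm.toLinearMap
  have h1 : ∀ x y : K ⊗[k] K, Z (leg₁₃ k K x * leg₂₃ k K y) =
      bosCoact M b x * bosCoact M c y := fun x y => by
    induction x with
    | zero => simp
    | add p q hp hq => simp only [map_add, add_mul, hp, hq]
    | tmul s t =>
      induction y with
      | zero => simp
      | add p q hp hq => simp only [map_add, mul_add, hp, hq]
      | tmul s' t' => simp [Z]
  have h2 : ∀ x : K ⊗[k] K, Z (D.comulL x) = bosCoact M (b * c) x := fun x => by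
    induction x with
    | zero => simp
    | add p q hp hq => simp only [map_add, hp, hq]
    | tmul s t =>
      rw [bosCoact_tmul, act_mul_tmul, HopfData.comulL_tmul]
      generalize D.comul s = y
      induction y with
      | zero => simp
      | add p q hp hq => simp only [map_add, TensorProduct.add_tmul, TensorProduct.tmul_add, hp, hq]
      | tmul a d => simp [Z]
  rw [← h1, ← hR.comulL, h2]

/-- `b ⊗ c ↦ b R⁽²⁾ ⊗ R⁽¹⁾ ▷ c`. -/
def bosPair (R : K ⊗[k] K) : B ⊗[k] B →ₗ[k] Bos M ⊗[k] Bos M :=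
  LinearMap.mul' k _ ∘ₗ TensorProduct.map (bosFst M).toLinearMap ((bosCoact M).flip R)

@[simp] theorem bosPair_tmul (R : K ⊗[k] K) (b c : B) :
    bosPair M R (b ⊗ₜ c) = bosFst M b * bosCoact M c R := rfl

theorem bosComulMap_eq (R : K ⊗[k] K) (y : B ⊗[k] B) :
    bosComulMap M (R ⊗ₜ y) = bosPair M R y := by
  induction y with
  | zero => simp
  | add p q hp hq => simp only [map_add, TensorProduct.tmul_add, hp, hq]
  | tmul b c =>
    induction R with
    | zero => simp
    | add p q hp hq =>
      simp only [bosPair_tmul] at hp hq ⊢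
      simp only [map_add, TensorProduct.add_tmul, mul_add, hp, hq]
    | tmul s t => simp [bosComulMap, bosFst_apply]

theorem braiding_tmul (R : K ⊗[k] K) (b c : B) : M.braiding R (b ⊗ₜ c) =
    TensorProduct.comm k B B (TensorProduct.map (M.act.toLinearMap.flip b)
      (M.act.toLinearMap.flip c) R) := by
  induction R with
  | zero => simp [ModuleAlgebra.braiding]
  | add p q hp hq =>
    simp only [ModuleAlgebra.braiding, LinearMap.comp_apply] at hp hq ⊢
    simp only [map_add, LinearMap.add_apply, hp, hq]
  | tmul s t => rfl

/-- Moving `R⁽²⁾` past `c` brings in `(id ⊗ Δ)R = R₁₃ R₁₂`: the factor `R₁₂` performs the braiding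
of `b` with `c` and `R₁₃` remains as the coaction. This is the source of the braided product. -/
theorem bosCoact_mul_bosFst (hR : D.IsQuasitriangular R) (b c : B) :
    bosCoact M b R * bosFst M c = bosPair M R (M.braiding R (b ⊗ₜ c)) := by
  let Y : K ⊗[k] (K ⊗[k] K) →ₗ[k] Bos M ⊗[k] Bos M :=
    (TensorProduct.comm k (Bos M) (Bos M)).toLinearMap ∘ₗ
    TensorProduct.map ((inB M).toLinearMap ∘ₗ M.act.toLinearMap.flip b)
      (M.cross (inB M).toLinearMap (inK M).toLinearMap c)
  have h1 : ∀ x : K ⊗[k] K, bosCoact M b x * bosFst M c = Y (D.comulR x) := fun x => by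
    induction x with
    | zero => simp
    | add p q hp hq => simp only [map_add, add_mul, hp, hq]
    | tmul s t =>
      rw [bosCoact_tmul, bosFst_apply, Algebra.TensorProduct.tmul_mul_tmul, mul_one, inK_mul_inB]
      rfl
  have h2 : ∀ x y : K ⊗[k] K, Y (leg₁₃ k K x * leg₁₂ k K y) =
      bosPair M x (TensorProduct.comm k B B (TensorProduct.map (M.act.toLinearMap.flip b)
        (M.act.toLinearMap.flip c) y)) := fun x y => by
    induction y with
    | zero => simp
    | add p q hp hq => simp only [map_add, mul_add, hp, hq]
    | tmul s t =>
      rw [TensorProduct.map_tmul, TensorProduct.comm_tmul, bosPair_tmul]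
      induction x with
      | zero => simp
      | add p q hp hq => simp only [map_add, add_mul, mul_add, hp, hq]
      | tmul s' t' => simp [Y, bosFst_apply]
  rw [h1, hR.comulR, h2, braiding_tmul]

/-- After the cross relation in the second leg, the claim is `Δᵒᵖ R = R Δ` in the first two legs of
the iterated coproduct of `h`. -/
theorem cov_bosCoact (hD : D.IsHopf) (hR : D.IsQuasitriangular R) (b : B) :
    M.Cov ((bosCoact M).flip R) (bosComulK M).toLinearMap b := fun h => by
  let Y : K ⊗[k] (K ⊗[k] K) →ₗ[k] Bos M ⊗[k] Bos M :=
    TensorProduct.map (inK M).toLinearMap (M.cross (inB M).toLinearMap (inK M).toLinearMap b) ∘ₗ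
      (perm₁₂ k K).toLinearMap
  have h1 : ∀ x T : K ⊗[k] K, Algebra.TensorProduct.map (inK M) (inK M) T * bosCoact M b x =
      Y (perm₁₂ k K (D.comulR T) * leg₁₂ k K x) := fun x T => by
    induction x with
    | zero => simp
    | add p q hp hq => simp only [map_add, mul_add, hp, hq]
    | tmul s' t' =>
      induction T with
      | zero => simp
      | add p q hp hq => simp only [map_add, add_mul, hp, hq]
      | tmul s t =>
        rw [Algebra.TensorProduct.map_tmul, bosCoact_tmul, Algebra.TensorProduct.tmul_mul_tmul,
          inK_mul_inB, HopfData.comulR_tmul, ← map_mul]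
        generalize D.comul t = y
        induction y with
        | zero => simp
        | add p q hp hq => simp only [map_add, add_mul, TensorProduct.tmul_add, hp, hq]
        | tmul a d => simp [Y]
  have h2 : ∀ x T : K ⊗[k] K, M.cross ((bosCoact M).flip x) (bosComulK M).toLinearMap b T =
      Y (leg₁₂ k K x * D.comulR T) := fun x T => by
    induction T with
    | zero => simp
    | add p q hp hq => simp only [map_add, mul_add, hp, hq]
    | tmul s t =>
      rw [cross_tmul, HopfData.comulR_tmul, LinearMap.flip_apply]
      change _ * Algebra.TensorProduct.map (inK M) (inK M) (D.comul t) = _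
      induction x with
      | zero => simp
      | add p q hp hq => simp only [map_add, add_mul, hp, hq]
      | tmul s' t' =>
        generalize D.comul t = y
        induction y with
        | zero => simp
        | add p q hp hq => simp only [map_add, mul_add, TensorProduct.tmul_add, hp, hq]
        | tmul a d => simp [Y]
  rw [h2, ← hD.comulL_comul, ← hR.perm₁₂_comulL, hD.comulL_comul, ← h1]
  rfl

/-! ### The antipode -/

/-- The claim is `S(h₍₁₎)(h₍₂₎ ▷ b) = b S(h)`. As functions of `h`, both sides convolved on the
right with the inclusion of `K` equal `ε(h) b`, and that inclusion is convolution invertible with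
inverse `S`. -/
theorem bosAnti_flip_comul (hD : D.IsHopf) (b : B) (h : K) :
    bosAnti M b (flipHom k K (D.comul h)) = inB M b * inK M (D.antipode h) := by
  let _ := hD.hopfAlgebra
  let i : WithConv (K →ₗ[k] Bos M) := WithConv.toConv (inK M).toLinearMap
  let j : WithConv (K →ₗ[k] Bos M) := WithConv.toConv ((inK M).toLinearMap ∘ₗ D.antipode)
  let f : WithConv (K →ₗ[k] Bos M) := WithConv.toConv
    (bosAnti M b ∘ₗ (flipHom k K).toLinearMap ∘ₗ D.comul.toLinearMap)
  let g : WithConv (K →ₗ[k] Bos M) := WithConv.toConv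
    (LinearMap.mulLeft k (inB M b) ∘ₗ (inK M).toLinearMap ∘ₗ D.antipode)
  have hij : i * j = 1 := by
    ext h
    have : ∀ T : K ⊗[k] K, LinearMap.mul' k _ (TensorProduct.map (inK M).toLinearMap
        ((inK M).toLinearMap ∘ₗ D.antipode) T) =
        inK M (LinearMap.mul' k K (D.antipode.lTensor K T)) := fun T => by
      induction T with
      | zero => simp
      | add p q hp hq => simp only [map_add, hp, hq]
      | tmul s t => simp
    refine (this (D.comul h)).trans ?_
    rw [hD.antipode_right]
    exact AlgHom.commutes _ _
  have hf : f * i = WithConv.toConv (LinearMap.smulRight D.counit.toLinearMap (inB M b)) := by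
    ext h
    let Y : K ⊗[k] (K ⊗[k] K) →ₗ[k] Bos M := LinearMap.mul' k _ ∘ₗ
      TensorProduct.map ((inK M).toLinearMap ∘ₗ D.antipode)
        (M.cross (inB M).toLinearMap (inK M).toLinearMap b)
    have h1 : ∀ T : K ⊗[k] K, LinearMap.mul' k _ (TensorProduct.map
        (bosAnti M b ∘ₗ (flipHom k K).toLinearMap ∘ₗ D.comul.toLinearMap) (inK M).toLinearMap T) =
        Y (D.comulL T) := fun T => by
      induction T with
      | zero => simp
      | add p q hp hq => simp only [map_add, hp, hq]
      | tmul s t =>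
        rw [HopfData.comulL_tmul, TensorProduct.map_tmul, LinearMap.mul'_apply]
        simp only [LinearMap.comp_apply, AlgHom.toLinearMap_apply]
        generalize D.comul s = y
        induction y with
        | zero => simp
        | add p q hp hq => simp only [map_add, add_mul, TensorProduct.add_tmul, hp, hq]
        | tmul a d => simp [Y, mul_assoc]
    have h2 : ∀ T : K ⊗[k] K, Y (D.comulR T) =
        inK M (LinearMap.mul' k K (D.antipode.rTensor K T)) * inB M b := fun T => by
      induction T with
      | zero => simp
      | add p q hp hq => simp only [map_add, add_mul, hp, hq]
      | tmul s t =>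
        rw [HopfData.comulR_tmul]
        change inK M (D.antipode s) * M.cross _ _ _ _ = _
        rw [← inK_mul_inB]
        simp [mul_assoc]
    refine (h1 (D.comul h)).trans ?_
    rw [hD.comulL_comul, h2, hD.antipode_left, AlgHom.commutes, ← Algebra.smul_def]
    rfl
  have hg : g * i = WithConv.toConv (LinearMap.smulRight D.counit.toLinearMap (inB M b)) := by
    ext h
    have : ∀ T : K ⊗[k] K, LinearMap.mul' k _ (TensorProduct.map
        (LinearMap.mulLeft k (inB M b) ∘ₗ (inK M).toLinearMap ∘ₗ D.antipode)
        (inK M).toLinearMap T) =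
        inB M b * inK M (LinearMap.mul' k K (D.antipode.rTensor K T)) := fun T => by
      induction T with
      | zero => simp
      | add p q hp hq => simp only [map_add, mul_add, hp, hq]
      | tmul s t => simp [mul_assoc]
    refine (this (D.comul h)).trans ?_
    rw [hD.antipode_left, AlgHom.commutes, ← Algebra.commutes, ← Algebra.smul_def]
    rfl
  have hfg : f = g := by
    rw [← mul_one f, ← mul_one g, ← hij, ← mul_assoc, ← mul_assoc, hf, hg]
  exact DFunLike.congr_fun (congrArg WithConv.ofConv hfg) h

theorem bosAnti_flip_comul_mul (hD : D.IsHopf) (b : B) (h : K) (T : K ⊗[k] K) :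
    bosAnti M b (flipHom k K (D.comul h) * T) = bosAnti M b T * inK M (D.antipode h) := by
  induction T with
  | zero => simp
  | add p q hp hq => simp only [map_add, mul_add, add_mul, hp, hq]
  | tmul s t =>
    rw [bosAnti_tmul, mul_assoc, ← bosAnti_flip_comul M hD]
    generalize flipHom k K (D.comul h) = y
    induction y with
    | zero => simp
    | add p q hp hq => simp only [map_add, mul_add, add_mul, hp, hq]
    | tmul a d => simp [hD.antipode_mul, mul_assoc]

theorem bosAnti_mul_tmul (hD : D.IsHopf) (b : B) (s t : K) (T : K ⊗[k] K) :
    bosAnti M b (T * s ⊗ₜ t) = inK M (D.antipode t) * bosAnti M (M.act s b) T := by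
  induction T with
  | zero => simp
  | add p q hp hq => simp only [map_add, mul_add, add_mul, hp, hq]
  | tmul s' t' => simp [hD.antipode_mul, mul_assoc]

/-- `s ⊗ t ↦ S(t) f(s)`. -/
def antiCross (f : K →ₗ[k] Bos M) : K ⊗[k] K →ₗ[k] Bos M :=
  LinearMap.mul' k _ ∘ₗ (TensorProduct.comm k (Bos M) (Bos M)).toLinearMap ∘ₗ
    TensorProduct.map f ((inK M).toLinearMap ∘ₗ D.antipode)

@[simp] theorem antiCross_tmul (f : K →ₗ[k] Bos M) (s t : K) :
    antiCross M f (s ⊗ₜ t) = inK M (D.antipode t) * f s := rfl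

/-- For `λ(b) = S(R⁽²⁾)(R⁽¹⁾ ▷ b)` this is the cross relation with respect to `S` in the opposite
algebra, which lets `-λ` on generators extend to an antipode. It combines `S(h₍₁₎)(h₍₂₎ ▷ b) = b
S(h)` with the intertwining axiom. -/
theorem bosAnti_mul_antipode (hD : D.IsHopf) (hR : D.IsQuasitriangular R) (b : B) (h : K) :
    bosAnti M b R * inK M (D.antipode h) =
      antiCross M ((bosAnti M).flip R ∘ₗ M.act.toLinearMap.flip b) (D.comul h) := by
  rw [← bosAnti_flip_comul_mul M hD, hR.flip_comul]
  generalize D.comul h = y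
  induction y with
  | zero => simp
  | add p q hp hq => simp only [map_add, mul_add, hp, hq]
  | tmul a d =>
    rw [bosAnti_mul_tmul M hD]
    rfl

/-- `S(R⁽²⁾) λ(b) (R⁽¹⁾ ▷ c) = λ(b c)` for `λ(b) = S(R⁽²⁾) (R⁽¹⁾ ▷ b)`. -/
theorem bosAnti_mul (hD : D.IsHopf) (hR : D.IsQuasitriangular R) (b c : B) :
    antiCross M (LinearMap.mulLeft k (bosAnti M b R) ∘ₗ (inB M).toLinearMap ∘ₗ
      M.act.toLinearMap.flip c) R = bosAnti M (b * c) R := by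
  let Z : K ⊗[k] (K ⊗[k] K) →ₗ[k] Bos M :=
    LinearMap.mul' k _ ∘ₗ (TensorProduct.comm k (Bos M) (Bos M)).toLinearMap ∘ₗ
    TensorProduct.map ((inB M).toLinearMap ∘ₗ LinearMap.mul' k B ∘ₗ
      TensorProduct.map (M.act.toLinearMap.flip b) (M.act.toLinearMap.flip c))
      ((inK M).toLinearMap ∘ₗ D.antipode) ∘ₗ (TensorProduct.assoc k K K K).symm.toLinearMap
  have h1 : ∀ x y : K ⊗[k] K, Z (leg₁₃ k K x * leg₂₃ k K y) =
      antiCross M (LinearMap.mulLeft k (bosAnti M b x) ∘ₗ (inB M).toLinearMap ∘ₗ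
      M.act.toLinearMap.flip c) y := fun x y => by
    induction y with
    | zero => simp
    | add p q hp hq => simp only [map_add, mul_add, hp, hq]
    | tmul s t =>
      rw [antiCross_tmul]
      simp only [LinearMap.comp_apply, LinearMap.mulLeft_apply]
      induction x with
      | zero => simp
      | add p q hp hq => simp only [map_add, add_mul, mul_add, hp, hq]
      | tmul s' t' => simp [Z, hD.antipode_mul, mul_assoc]
  have h2 : ∀ x : K ⊗[k] K, Z (D.comulL x) = bosAnti M (b * c) x := fun x => by
    induction x with
    | zero => simp
    | add p q hp hq => simp only [map_add, hp, hq]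
    | tmul s t =>
      rw [bosAnti_tmul, act_mul_tmul, HopfData.comulL_tmul]
      generalize D.comul s = y
      induction y with
      | zero => simp
      | add p q hp hq => simp only [map_add, TensorProduct.add_tmul, mul_add, hp, hq]
      | tmul a d => simp [Z]
  rw [← h1, ← hR.comulL, h2]

/-- `b ↦ S(R⁽²⁾) (R⁽¹⁾ ▷ b)` is braided-antimultiplicative. -/
theorem bosAnti_mul_bosAnti (hD : D.IsHopf) (hR : D.IsQuasitriangular R) (b c : B) :
    bosAnti M c R * bosAnti M b R =
      bosAnti M (LinearMap.mul' k B (M.braiding R (b ⊗ₜ c))) R := by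
  let Q : K ⊗[k] (K ⊗[k] K) →ₗ[k] Bos M :=
    LinearMap.mul' k _ ∘ₗ (TensorProduct.comm k (Bos M) (Bos M)).toLinearMap ∘ₗ
      TensorProduct.map ((inB M).toLinearMap ∘ₗ M.act.toLinearMap.flip b)
        (antiCross M ((bosAnti M).flip R ∘ₗ M.act.toLinearMap.flip c))
  have h1 : ∀ x : K ⊗[k] K, bosAnti M c R * bosAnti M b x = Q (D.comulR x) := fun x => by
    induction x with
    | zero => simp
    | add p q hp hq => simp only [map_add, mul_add, hp, hq]
    | tmul s t =>
      rw [bosAnti_tmul, ← mul_assoc, bosAnti_mul_antipode M hD hR, HopfData.comulR_tmul]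
      rfl
  have h2 : ∀ x y : K ⊗[k] K, Q (leg₁₃ k K x * leg₁₂ k K y) =
      TensorProduct.lift (LinearMap.mk₂ k (fun s t => antiCross M
        (LinearMap.mulLeft k (bosAnti M (M.act t c) R) ∘ₗ (inB M).toLinearMap ∘ₗ
        M.act.toLinearMap.flip (M.act s b)) x)
        (fun s s' t => by
          induction x with
          | zero => simp
          | add p q hp hq =>
            rw [LinearMap.map_add, LinearMap.map_add, LinearMap.map_add, hp, hq]
            abel
          | tmul a d => simp [mul_add])
        (fun r s t => by
          induction x with
          | zero => simp
          | add p q hp hq => simp only [map_add, smul_add, hp, hq]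
          | tmul a d => simp)
        (fun s t t' => by
          induction x with
          | zero => simp
          | add p q hp hq =>
            rw [LinearMap.map_add, LinearMap.map_add, LinearMap.map_add, hp, hq]
            abel
          | tmul a d => simp [mul_add, add_mul])
        (fun r s t => by
          induction x with
          | zero => simp
          | add p q hp hq => simp only [map_add, smul_add, hp, hq]
          | tmul a d => simp)) y := fun x y => by
    induction y with
    | zero => simp
    | add p q hp hq => simp only [map_add, mul_add, hp, hq]
    | tmul s t =>
      rw [TensorProduct.lift.tmul, LinearMap.mk₂_apply]
      induction x with
      | zero => simp
      | add p q hp hq => simp only [map_add, add_mul, hp, hq]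
      | tmul s' t' => simp [Q, mul_assoc]
  -- In `(id ⊗ Δ)R = R₁₃ R₁₂` the factor `R₁₂` supplies the braiding; the factor `R₁₃` is reabsorbed
  -- afterwards by `bosAnti_mul`.
  rw [h1, hR.comulR, h2, braiding_tmul]
  have h3 : ∀ y : K ⊗[k] K, ∀ f : K →ₗ[k] K →ₗ[k] Bos M,
      (∀ s t, f s t = bosAnti M (M.act t c * M.act s b) R) → TensorProduct.lift f y =
      bosAnti M (LinearMap.mul' k B (TensorProduct.comm k B B (TensorProduct.map
        (M.act.toLinearMap.flip b) (M.act.toLinearMap.flip c) y))) R := fun y f hf => by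
    induction y with
    | zero => simp
    | add p q hp hq => simp only [map_add, LinearMap.add_apply, hp, hq]
    | tmul s t => simp [hf]
  refine h3 _ _ fun s t => ?_
  rw [LinearMap.mk₂_apply, bosAnti_mul M hD hR]

/-- `R⁽²⁾ λ(R⁽¹⁾ ▷ b) = b`. -/
theorem inK_mul_bosAnti (hD : D.IsHopf) (hR : D.IsQuasitriangular R) (b : B) :
    LinearMap.mul' k _ (TensorProduct.comm k _ _ (TensorProduct.map
      ((bosAnti M).flip R ∘ₗ M.act.toLinearMap.flip b) (inK M).toLinearMap (R : K ⊗[k] K))) =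
      inB M b := by
  -- `Q(a ⊗ c ⊗ d) = c S(d) (a ▷ b)`. The left side is `Q(R₁₃ R₁₂) = Q((id ⊗ Δ)R)`, where `c S(d)`
  -- collapses to a counit.
  let Q : K ⊗[k] (K ⊗[k] K) →ₗ[k] Bos M :=
    LinearMap.mul' k _ ∘ₗ (TensorProduct.comm k (Bos M) (Bos M)).toLinearMap ∘ₗ
      TensorProduct.map ((inB M).toLinearMap ∘ₗ M.act.toLinearMap.flip b)
        ((inK M).toLinearMap ∘ₗ LinearMap.mul' k K ∘ₗ D.antipode.lTensor K)
  have h1 : ∀ x y : K ⊗[k] K, LinearMap.mul' k _ (TensorProduct.comm k _ _ (TensorProduct.map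
      ((bosAnti M).flip x ∘ₗ M.act.toLinearMap.flip b) (inK M).toLinearMap y)) =
      Q (leg₁₃ k K x * leg₁₂ k K y) := fun x y => by
    induction y with
    | zero => simp
    | add p q hp hq => simp only [map_add, mul_add, hp, hq]
    | tmul s t =>
      simp only [TensorProduct.map_tmul, TensorProduct.comm_tmul, LinearMap.mul'_apply,
        LinearMap.comp_apply, LinearMap.flip_apply]
      induction x with
      | zero => simp
      | add p q hp hq => simp only [map_add, add_mul, mul_add, hp, hq]
      | tmul s' t' => simp [Q, mul_assoc]
  have h2 : ∀ x : K ⊗[k] K, Q (D.comulR x) = inB M (M.act (D.counitR x) b) := fun x => by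
    induction x with
    | zero => simp
    | add p q hp hq => simp only [map_add, LinearMap.add_apply, hp, hq]
    | tmul s t =>
      rw [HopfData.comulR_tmul]
      simp only [Q, LinearMap.comp_apply, TensorProduct.map_tmul, hD.antipode_right,
        LinearEquiv.coe_coe, TensorProduct.comm_tmul, LinearMap.mul'_apply,
        AlgHom.toLinearMap_apply, AlgHom.commutes, ← Algebra.smul_def]
      simp
  rw [h1, ← hR.comulR, h2, hR.counitR hD]
  simp

end Bosonisation

end QPoincare

end

noncomputable section

namespace QPoincare

/-! ### The Hopf algebra structure on the bosonisation of a quadratic algebra -/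

section QuadraticBosonisation

variable {k : Type u} [CommRing k] {K : Type v} [Ring K] [Algebra k K] {D : HopfData k K}
  {ι : Type} {rel : FreeAlgebra k ι → FreeAlgebra k ι → Prop}

/-- The elements satisfying the cross relation contain `1` and are closed under linear combinations
and products. -/
theorem cov_of_gen {M : ModuleAlgebra D (RingQuot rel)} {X : Type*} [Semiring X] [Algebra k X] (hD : D.IsHopf) {f : RingQuot rel →ₐ[k] X}
    {φ : K →ₐ[k] X} (h : ∀ x, M.Cov f.toLinearMap φ.toLinearMap (gen rel x)) (b : RingQuot rel) :
    M.Cov f.toLinearMap φ.toLinearMap b := by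
  induction b using gen_induction with
  | one => exact ModuleAlgebra.cov_one hD f φ
  | add a b ha hb => exact ha.add hb
  | smul r a ha => exact ha.smul r
  | mul x b hb => exact (h x).mul hD hb

/-- The antipode of `K` as an algebra map to the opposite of the semidirect product. -/
def bosAntiK (M : ModuleAlgebra D (RingQuot rel)) (hD : D.IsHopf) : K →ₐ[k] (Bos M)ᵐᵒᵖ :=
  AlgHom.ofLinearMap ((MulOpposite.opLinearEquiv k).toLinearMap ∘ₗ (inK M).toLinearMap ∘ₗ
    D.antipode) (by simp [hD.antipode_one]) fun a b => by simp [hD.antipode_mul]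

theorem bosAntiK_apply (M : ModuleAlgebra D (RingQuot rel)) (hD : D.IsHopf) (h : K) :
    bosAntiK M hD h = MulOpposite.op (inK M (D.antipode h)) := rfl

/-! ### Coproduct, counit and antipode of the bosonisation, extended from generators -/

section Fintype

variable [Fintype ι]

/-- The quadratic expression `∑ c(x, y) p_x ⊗ p_y`. -/
def quadTensor (rel : FreeAlgebra k ι → FreeAlgebra k ι → Prop) (c : ι × ι → k) :
    RingQuot rel ⊗[k] RingQuot rel := ∑ z, c z • (gen rel z.1 ⊗ₜ[k] gen rel z.2)

theorem mul_quadTensor (c : ι × ι → k) :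
    LinearMap.mul' k _ (quadTensor rel c) = quad (gen rel) c := by
  simp [quadTensor, quad_apply, map_sum]

variable [DecidableEq ι]

/-- The data of a quadratic algebra on which `D` acts by `ρ` on the generators, with relations
antisymmetric for the braiding of `R`. -/
structure IsAdditive (rel : FreeAlgebra k ι → FreeAlgebra k ι → Prop) (L : Submodule k (ι × ι → k))
    (ρ : K →ₐ[k] Matrix ι ι k) (R : K ⊗[k] K) (M : ModuleAlgebra D (RingQuot rel)) : Prop where
  quadratic : IsQuadratic rel L
  act_gen : ∀ h x, M.act h (gen rel x) = rotate ρ (gen rel) x h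
  antisymm : ∀ c ∈ L, ∀ x y, (tensorRep ρ R).mulVec c (x, y) = -c (y, x)

variable {L : Submodule k (ι × ι → k)} {ρ : K →ₐ[k] Matrix ι ι k} {R : (K ⊗[k] K)ˣ}
  {M : ModuleAlgebra D (RingQuot rel)}

namespace IsAdditive

/-- The braiding is the flip after the action of `R`, so the antisymmetry of the coefficients says
that the relation tensor is an eigenvector with eigenvalue `-1`. This is the only input special to
additive braided groups. -/
theorem braiding_quadTensor (hM : IsAdditive rel L ρ (R : K ⊗[k] K) M) {c : ι × ι → k}
    (hc : c ∈ L) : M.braiding (R : K ⊗[k] K) (quadTensor rel c) = (-1 : k) • quadTensor rel c := by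
  have e : ∀ x, M.act.toLinearMap.flip (gen rel x) = rotate ρ (gen rel) x := fun x =>
    LinearMap.ext fun h => hM.act_gen h x
  have h1 := sum_rotate ρ (gen rel) (gen rel) (TensorProduct.mk k (RingQuot rel) (RingQuot rel)) c
    (R : K ⊗[k] K)
  have h2 : M.braiding (R : K ⊗[k] K) (quadTensor rel c) = TensorProduct.comm k _ _
      (∑ z, (tensorRep ρ (R : K ⊗[k] K)).mulVec c z • (gen rel z.1 ⊗ₜ[k] gen rel z.2)) := by
    simp only [TensorProduct.mk_apply] at h1
    rw [← h1, quadTensor, map_sum, map_sum]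
    refine Finset.sum_congr rfl fun z _ => ?_
    rw [map_smul, map_smul, braiding_tmul, e, e]
    rfl
  rw [h2, quadTensor, map_sum, Finset.smul_sum]
  refine Fintype.sum_equiv (Equiv.prodComm ι ι) _ _ fun z => ?_
  obtain ⟨x, y⟩ := z
  rw [hM.antisymm c hc]
  simp [smul_smul]

/-- The coproduct on `B`. -/
def comulB (hM : IsAdditive rel L ρ (R : K ⊗[k] K) M) (hR : D.IsQuasitriangular R) :
    RingQuot rel →ₐ[k] Bos M ⊗[k] Bos M :=
  hM.quadratic.lift (fun x => bosFst M (gen rel x) + bosCoact M (gen rel x) R) fun c hc => by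
    -- Of the four terms of the expanded product the two pure ones are images of the relation and
    -- vanish (`h1`, `h2`). The mixed ones are `bosPair` of the relation tensor and of its braiding
    -- (`h3`, `h4`), hence opposite.
    have h1 : ∑ z, c z • (bosFst M (gen rel z.1) * bosFst M (gen rel z.2)) = 0 := by
      have := congrArg (bosFst M) (hM.quadratic.quad_eq_zero c hc)
      simpa [quad_apply, map_sum] using this
    have h2 : ∑ z, c z • (bosCoact M (gen rel z.1) R * bosCoact M (gen rel z.2) R) = 0 := by
      have := congrArg (fun b => bosCoact M b (R : K ⊗[k] K)) (hM.quadratic.quad_eq_zero c hc)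
      simp only [quad_apply, map_sum, map_smul, map_zero, LinearMap.sum_apply,
        LinearMap.smul_apply, LinearMap.zero_apply] at this
      simpa only [bosCoact_mul M hR] using this
    have h3 : ∑ z, c z • (bosFst M (gen rel z.1) * bosCoact M (gen rel z.2) R) =
        bosPair M R (quadTensor rel c) := by simp [quadTensor, map_sum]
    have h4 : ∑ z, c z • (bosCoact M (gen rel z.1) R * bosFst M (gen rel z.2)) =
        bosPair M R (M.braiding (R : K ⊗[k] K) (quadTensor rel c)) := by
      simp [quadTensor, map_sum, bosCoact_mul_bosFst M hR]
    rw [hM.braiding_quadTensor hc, map_smul, ← h3] at h4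
    simp only [quad_apply, add_mul, mul_add, smul_add, Finset.sum_add_distrib, h1, h2, h4]
    module

theorem comulB_gen (hM : IsAdditive rel L ρ (R : K ⊗[k] K) M) (hR : D.IsQuasitriangular R)
    (x : ι) : hM.comulB hR (gen rel x) = bosFst M (gen rel x) + bosCoact M (gen rel x) R :=
  hM.quadratic.lift_gen _ _ _

theorem comulB_act (hM : IsAdditive rel L ρ (R : K ⊗[k] K) M) (hR : D.IsQuasitriangular R)
    (h : K) (x : ι) : hM.comulB hR (M.act h (gen rel x)) =
      bosFst M (M.act h (gen rel x)) + bosCoact M (M.act h (gen rel x)) R := by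
  simp only [hM.act_gen, rotate_apply, map_sum, map_smul, hM.comulB_gen hR, smul_add,
    Finset.sum_add_distrib, LinearMap.sum_apply, LinearMap.smul_apply]

theorem cov_comulB (hM : IsAdditive rel L ρ (R : K ⊗[k] K) M) (hD : D.IsHopf)
    (hR : D.IsQuasitriangular R) (b : RingQuot rel) :
    M.Cov (hM.comulB hR).toLinearMap (bosComulK M).toLinearMap b := by
  refine cov_of_gen hD (fun x h => ?_) b
  have h1 := cov_bosFst M hD (gen rel x) h
  have h2 := cov_bosCoact M hD hR (gen rel x) h
  have h3 : ∀ T : K ⊗[k] K,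
      M.cross (hM.comulB hR).toLinearMap (bosComulK M).toLinearMap
        (gen rel x) T =
      M.cross (bosFst M).toLinearMap (bosComulK M).toLinearMap
        (gen rel x) T +
      M.cross ((bosCoact M).flip R) (bosComulK M).toLinearMap
        (gen rel x) T := fun T => by
    induction T with
    | zero => simp
    | add p q hp hq =>
      rw [LinearMap.map_add, LinearMap.map_add, LinearMap.map_add, hp, hq]
      abel
    | tmul s t =>
      simp only [cross_tmul, AlgHom.toLinearMap_apply, hM.comulB_act hR, add_mul,
        LinearMap.flip_apply]
  rw [h3, ← h1, ← h2, ← mul_add]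
  congr 1
  exact hM.comulB_gen hR x

/-- The coproduct of the bosonisation. -/
def comul (hM : IsAdditive rel L ρ (R : K ⊗[k] K) M) (hD : D.IsHopf)
    (hR : D.IsQuasitriangular R) : Bos M →ₐ[k] Bos M ⊗[k] Bos M :=
  bosLift M (hM.comulB hR) (bosComulK M) (hM.cov_comulB hD hR)

/-- The counit of `B`. -/
def counitB (hM : IsAdditive rel L ρ (R : K ⊗[k] K) M) : RingQuot rel →ₐ[k] k :=
  hM.quadratic.lift (fun _ => 0) fun c _ => by simp [quad_apply]

theorem counitB_gen (hM : IsAdditive rel L ρ (R : K ⊗[k] K) M) (x : ι) :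
    hM.counitB (gen rel x) = 0 := hM.quadratic.lift_gen _ _ _

theorem counitB_act (hM : IsAdditive rel L ρ (R : K ⊗[k] K) M) (h : K) (x : ι) :
    hM.counitB (M.act h (gen rel x)) = 0 := by
  simp [hM.act_gen, rotate_apply, map_sum, hM.counitB_gen]

theorem cov_counitB (hM : IsAdditive rel L ρ (R : K ⊗[k] K) M) (hD : D.IsHopf)
    (b : RingQuot rel) : M.Cov hM.counitB.toLinearMap D.counit.toLinearMap b := by
  refine cov_of_gen hD (fun x h => ?_) b
  have h3 : ∀ T : K ⊗[k] K,
      M.cross hM.counitB.toLinearMap D.counit.toLinearMap (gen rel x) T = 0 := fun T => by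
    induction T with
    | zero => simp
    | add p q hp hq => rw [map_add, hp, hq, add_zero]
    | tmul s t => simp [hM.counitB_act]
  rw [h3]
  simp [hM.counitB_gen]

/-- The counit of the bosonisation. -/
def counit (hM : IsAdditive rel L ρ (R : K ⊗[k] K) M) (hD : D.IsHopf) : Bos M →ₐ[k] k :=
  bosLift M hM.counitB D.counit (hM.cov_counitB hD)

/-- The antipode on `B`. -/
def antiB (hM : IsAdditive rel L ρ (R : K ⊗[k] K) M) (hD : D.IsHopf)
    (hR : D.IsQuasitriangular R) : RingQuot rel →ₐ[k] (Bos M)ᵐᵒᵖ :=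
  hM.quadratic.lift (fun x => MulOpposite.op (-bosAnti M (gen rel x) R)) fun c hc => by
    -- In the opposite algebra `p_x p_y` goes to `λ(p_y) λ(p_x)`, where `λ(b) = S(R⁽²⁾)(R⁽¹⁾ ▷ b)`
    -- and the two signs cancel. By `bosAnti_mul_bosAnti` the sum is `λ` of the product of the
    -- braided relation tensor, which is minus the relation.
    have h1 : bosAnti M (LinearMap.mul' k _ (M.braiding (R : K ⊗[k] K) (quadTensor rel c))) R =
        0 := by
      rw [hM.braiding_quadTensor hc, map_smul, mul_quadTensor,
        hM.quadratic.quad_eq_zero c hc]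
      simp
    rw [quad_apply]
    refine (MulOpposite.opLinearEquiv k).symm.injective ?_
    rw [map_zero, ← h1, quadTensor]
    simp only [map_sum, map_smul, LinearMap.sum_apply, LinearMap.smul_apply,
      ← bosAnti_mul_bosAnti M hD hR]
    refine Finset.sum_congr rfl fun z _ => ?_
    congr 1
    exact neg_mul_neg (bosAnti M (gen rel z.2) (R : K ⊗[k] K)) _

theorem antiB_gen (hM : IsAdditive rel L ρ (R : K ⊗[k] K) M) (hD : D.IsHopf)
    (hR : D.IsQuasitriangular R) (x : ι) :
    hM.antiB hD hR (gen rel x) = MulOpposite.op (-bosAnti M (gen rel x) R) :=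
  hM.quadratic.lift_gen _ _ _

theorem antiB_act (hM : IsAdditive rel L ρ (R : K ⊗[k] K) M) (hD : D.IsHopf)
    (hR : D.IsQuasitriangular R) (h : K) (x : ι) :
    hM.antiB hD hR (M.act h (gen rel x)) =
      MulOpposite.op (-bosAnti M (M.act h (gen rel x)) R) := by
  simp only [hM.act_gen, rotate_apply, map_sum, map_smul, hM.antiB_gen hD hR,
    LinearMap.sum_apply, LinearMap.smul_apply]
  refine (MulOpposite.opLinearEquiv k).symm.injective ?_
  simp [Finset.sum_neg_distrib]

theorem cov_antiB (hM : IsAdditive rel L ρ (R : K ⊗[k] K) M) (hD : D.IsHopf)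
    (hR : D.IsQuasitriangular R) (b : RingQuot rel) :
    M.Cov (hM.antiB hD hR).toLinearMap (bosAntiK M hD).toLinearMap b := by
  refine cov_of_gen hD (fun x h => ?_) b
  have h3 : ∀ T : K ⊗[k] K,
      M.cross (hM.antiB hD hR).toLinearMap (bosAntiK M hD).toLinearMap (gen rel x) T =
      MulOpposite.op (-antiCross M ((bosAnti M).flip R ∘ₗ M.act.toLinearMap.flip (gen rel x)) T) :=
    fun T => by
    induction T with
    | zero => simp
    | add p q hp hq => rw [map_add, hp, hq, map_add, neg_add, MulOpposite.op_add]
    | tmul s t =>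
      rw [cross_tmul, AlgHom.toLinearMap_apply, hM.antiB_act, AlgHom.toLinearMap_apply,
        bosAntiK_apply, ← MulOpposite.op_mul, antiCross_tmul]
      exact congrArg _ (mul_neg (inK M (D.antipode t)) _)
  rw [h3, ← bosAnti_mul_antipode M hD hR, AlgHom.toLinearMap_apply, AlgHom.toLinearMap_apply,
    hM.antiB_gen, bosAntiK_apply, ← MulOpposite.op_mul]
  exact congrArg _ (neg_mul (bosAnti M (gen rel x) (R : K ⊗[k] K)) _)

/-- The antipode of the bosonisation. -/
def anti (hM : IsAdditive rel L ρ (R : K ⊗[k] K) M) (hD : D.IsHopf)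
    (hR : D.IsQuasitriangular R) : Bos M →ₐ[k] (Bos M)ᵐᵒᵖ :=
  bosLift M (hM.antiB hD hR) (bosAntiK M hD) (hM.cov_antiB hD hR)

/-- The Hopf algebra structure on the bosonisation. -/
def bosHopf (hM : IsAdditive rel L ρ (R : K ⊗[k] K) M) (hD : D.IsHopf)
    (hR : D.IsQuasitriangular R) : HopfData k (Bos M) where
  comul := hM.comul hD hR
  counit := hM.counit hD
  antipode := (MulOpposite.opLinearEquiv k).symm.toLinearMap ∘ₗ (hM.anti hD hR).toLinearMap

variable (hM : IsAdditive rel L ρ (R : K ⊗[k] K) M) (hD : D.IsHopf) (hR : D.IsQuasitriangular R)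

theorem comul_inK (h : K) : (hM.bosHopf hD hR).comul (inK M h) =
    Algebra.TensorProduct.map (inK M) (inK M) (D.comul h) :=
  bosLift_inK _ _ _ (hM.cov_comulB hD hR) _

theorem comul_gen (x : ι) : (hM.bosHopf hD hR).comul (inB M (gen rel x)) =
    bosFst M (gen rel x) + bosCoact M (gen rel x) R :=
  (bosLift_inB _ _ _ (hM.cov_comulB hD hR) _).trans (hM.comulB_gen hR x)

theorem comul_act_gen (h : K) (x : ι) :
    (hM.bosHopf hD hR).comul (inB M (M.act h (gen rel x))) =
      bosFst M (M.act h (gen rel x)) + bosCoact M (M.act h (gen rel x)) R :=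
  (bosLift_inB _ _ _ (hM.cov_comulB hD hR) _).trans (hM.comulB_act hR h x)

theorem counit_inK (h : K) : (hM.bosHopf hD hR).counit (inK M h) = D.counit h :=
  bosLift_inK _ _ _ (hM.cov_counitB hD) _

theorem counit_gen (x : ι) : (hM.bosHopf hD hR).counit (inB M (gen rel x)) = 0 :=
  (bosLift_inB _ _ _ (hM.cov_counitB hD) _).trans (hM.counitB_gen x)

theorem counit_act_gen (h : K) (x : ι) :
    (hM.bosHopf hD hR).counit (inB M (M.act h (gen rel x))) = 0 :=
  (bosLift_inB _ _ _ (hM.cov_counitB hD) _).trans (hM.counitB_act h x)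

theorem antipode_mul (a b : Bos M) : (hM.bosHopf hD hR).antipode (a * b) =
    (hM.bosHopf hD hR).antipode b * (hM.bosHopf hD hR).antipode a := by
  simp [bosHopf]

theorem antipode_inK (h : K) : (hM.bosHopf hD hR).antipode (inK M h) = inK M (D.antipode h) := by
  change MulOpposite.unop (hM.anti hD hR _) = _
  rw [anti, bosLift_inK]
  rfl

theorem antipode_gen (x : ι) : (hM.bosHopf hD hR).antipode (inB M (gen rel x)) =
    -bosAnti M (gen rel x) R := by
  change MulOpposite.unop (hM.anti hD hR _) = _
  rw [anti, bosLift_inB, antiB_gen]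
  rfl

theorem antipode_act_gen (h : K) (x : ι) :
    (hM.bosHopf hD hR).antipode (inB M (M.act h (gen rel x))) =
      -bosAnti M (M.act h (gen rel x)) R := by
  change MulOpposite.unop (hM.anti hD hR _) = _
  rw [anti, bosLift_inB, antiB_act]
  rfl

end IsAdditive

end Fintype

end QuadraticBosonisation

end QPoincare

end

noncomputable section

namespace QPoincare

/-! ### Hopf algebra axioms for the bosonisation -/

section QuadraticBosonisation

variable {k : Type u} [CommRing k] {K : Type v} [Ring K] [Algebra k K] {D : HopfData k K}
  {ι : Type} {rel : FreeAlgebra k ι → FreeAlgebra k ι → Prop} [Fintype ι] [DecidableEq ι]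
  {L : Submodule k (ι × ι → k)} {ρ : K →ₐ[k] Matrix ι ι k} {R : (K ⊗[k] K)ˣ}
  {M : ModuleAlgebra D (RingQuot rel)}

theorem HopfData.isHopf_of_algHom {A : Type*} [Ring A] [Algebra k A] {E : HopfData k A}
    (hc : E.comulL.comp E.comul = E.comulR.comp E.comul)
    (hl : E.counitL.comp E.comul = AlgHom.id k A) (hr : E.counitR.comp E.comul = AlgHom.id k A)
    (hal : ∀ a, E.adL (E.comul a) 1 = algebraMap k A (E.counit a))
    (har : ∀ a, E.adR (E.comul a) 1 = algebraMap k A (E.counit a)) : E.IsHopf where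
  coassoc := LinearMap.ext fun a => DFunLike.congr_fun hc a
  counit_left a := (TensorProduct.lid k A).injective <| by
    rw [TensorProduct.lid_tmul, one_smul]
    exact DFunLike.congr_fun hl a
  counit_right a := (TensorProduct.rid k A).injective <| by
    rw [TensorProduct.rid_tmul, one_smul]
    exact DFunLike.congr_fun hr a
  antipode_left a := by rw [← E.adL_apply_one, hal]
  antipode_right a := by rw [← E.adR_apply_one, har]

namespace IsAdditive

variable (hM : IsAdditive rel L ρ (R : K ⊗[k] K) M) (hD : D.IsHopf) (hR : D.IsQuasitriangular R)

theorem comulL_inK (x : K ⊗[k] K) :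
    (hM.bosHopf hD hR).comulL (Algebra.TensorProduct.map (inK M) (inK M) x) =
      Algebra.TensorProduct.map (inK M) (Algebra.TensorProduct.map (inK M) (inK M))
        (D.comulL x) := by
  induction x with
  | zero => simp
  | add p q hp hq => simp only [map_add, hp, hq]
  | tmul s t =>
    rw [Algebra.TensorProduct.map_tmul, HopfData.comulL_tmul, HopfData.comulL_tmul, hM.comul_inK]
    generalize D.comul s = y
    induction y with
    | zero => simp
    | add p q hp hq => simp only [map_add, TensorProduct.add_tmul, hp, hq]
    | tmul a b => simp

theorem comulR_inK (x : K ⊗[k] K) :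
    (hM.bosHopf hD hR).comulR (Algebra.TensorProduct.map (inK M) (inK M) x) =
      Algebra.TensorProduct.map (inK M) (Algebra.TensorProduct.map (inK M) (inK M))
        (D.comulR x) := by
  induction x with
  | zero => simp
  | add p q hp hq => simp only [map_add, hp, hq]
  | tmul s t =>
    rw [Algebra.TensorProduct.map_tmul, HopfData.comulR_tmul, HopfData.comulR_tmul, hM.comul_inK,
      Algebra.TensorProduct.map_tmul]

set_option maxHeartbeats 800000 in
-- Both composites are algebra maps, so generators suffice. On `p` the terms `p ⊗ 1 ⊗ 1` and the
-- coaction in the first two legs match, and the remaining term is `(id ⊗ Δ)R = R₁₃ R₁₂`.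
theorem comulL_comul : (hM.bosHopf hD hR).comulL.comp (hM.bosHopf hD hR).comul =
    (hM.bosHopf hD hR).comulR.comp (hM.bosHopf hD hR).comul := by
  refine bos_algHom_ext (DFunLike.congr_fun
    (f := ((hM.bosHopf hD hR).comulL.comp (hM.bosHopf hD hR).comul).comp (inB M))
    (g := ((hM.bosHopf hD hR).comulR.comp (hM.bosHopf hD hR).comul).comp (inB M))
    (gen_algHom_ext fun x => ?_)) fun h => ?_
  · simp only [AlgHom.comp_apply, hM.comul_gen, map_add]
    let V : K ⊗[k] (K ⊗[k] K) →ₗ[k] Bos M ⊗[k] (Bos M ⊗[k] Bos M) :=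
      (TensorProduct.assoc k (Bos M) (Bos M) (Bos M)).toLinearMap ∘ₗ
      (TensorProduct.comm k (Bos M) (Bos M ⊗[k] Bos M)).toLinearMap ∘ₗ
      TensorProduct.map ((inB M).toLinearMap ∘ₗ M.act.toLinearMap.flip (gen rel x))
        (TensorProduct.map (inK M).toLinearMap (inK M).toLinearMap)
    have h1 : (hM.bosHopf hD hR).comulL (bosFst M (gen rel x)) =
        inB M (gen rel x) ⊗ₜ (1 ⊗ₜ 1) +
          leg₁₂ k (Bos M) (bosCoact M (gen rel x) R) := by
      rw [bosFst_apply, HopfData.comulL_tmul, hM.comul_gen, TensorProduct.add_tmul, map_add,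
        bosFst_apply, Algebra.TensorProduct.assoc_tmul]
      congr 1
      generalize (bosCoact M (gen rel x) (R : K ⊗[k] K)) = y
      induction y with
      | zero => simp
      | add p q hp hq => simp only [map_add, TensorProduct.add_tmul, hp, hq]
      | tmul a b => simp
    have h2 : (hM.bosHopf hD hR).comulR (bosFst M (gen rel x)) =
        inB M (gen rel x) ⊗ₜ (1 ⊗ₜ 1) := by
      rw [bosFst_apply, HopfData.comulR_tmul, map_one, Algebra.TensorProduct.one_def]
    have h3 : ∀ y : K ⊗[k] K, (hM.bosHopf hD hR).comulL (bosCoact M (gen rel x) y) =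
        V (D.comulR y) := fun y => by
      induction y with
      | zero => simp
      | add p q hp hq => simp only [map_add, hp, hq]
      | tmul s t =>
        rw [bosCoact_tmul, HopfData.comulL_tmul, hM.comul_inK, HopfData.comulR_tmul]
        generalize D.comul t = y
        induction y with
        | zero => simp
        | add p q hp hq => simp only [map_add, TensorProduct.add_tmul, TensorProduct.tmul_add, hp, hq]
        | tmul a b => simp [V]
    have h4 : ∀ y : K ⊗[k] K, (hM.bosHopf hD hR).comulR (bosCoact M (gen rel x) y) =
        leg₁₂ k (Bos M) (bosCoact M (gen rel x) y) +
        V (leg₁₃ k K R * leg₁₂ k K y) := fun y => by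
      induction y with
      | zero => simp
      | add p q hp hq =>
        rw [map_add, map_add, hp, hq, map_add, map_add, mul_add, map_add]
        exact add_add_add_comm _ _ _ _
      | tmul s t =>
        rw [bosCoact_tmul, HopfData.comulR_tmul, hM.comul_act_gen, TensorProduct.tmul_add]
        congr 1
        generalize (R : K ⊗[k] K) = y
        induction y with
        | zero => simp
        | add p q hp hq => simp only [map_add, add_mul, TensorProduct.tmul_add, hp, hq]
        | tmul a b => simp [V]
    rw [h1, h2, h3, h4, ← hR.comulR, add_assoc]
  · simp only [AlgHom.comp_apply, hM.comul_inK]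
    rw [hM.comulL_inK, hM.comulR_inK, hD.comulL_comul]

theorem counitL_comul : (hM.bosHopf hD hR).counitL.comp (hM.bosHopf hD hR).comul =
    AlgHom.id k _ := by
  refine bos_algHom_ext (DFunLike.congr_fun
    (f := ((hM.bosHopf hD hR).counitL.comp (hM.bosHopf hD hR).comul).comp (inB M))
    (g := (AlgHom.id k _).comp (inB M)) (gen_algHom_ext fun x => ?_)) fun h => ?_
  · simp only [AlgHom.comp_apply, hM.comul_gen, map_add, bosFst_apply, HopfData.counitL_tmul,
      hM.counit_gen, zero_smul, zero_add, AlgHom.id_apply]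
    have h1 : ∀ y : K ⊗[k] K, (hM.bosHopf hD hR).counitL (bosCoact M (gen rel x) y) =
        inB M (M.act (D.counitR y) (gen rel x)) := fun y => by
      induction y with
      | zero => simp
      | add p q hp hq => simp only [map_add, LinearMap.add_apply, hp, hq]
      | tmul s t => simp [hM.counit_inK]
    rw [h1, hR.counitR hD]
    simp
  · simp only [AlgHom.comp_apply, hM.comul_inK]
    have h1 : ∀ y : K ⊗[k] K, (hM.bosHopf hD hR).counitL (Algebra.TensorProduct.map (inK M) (inK M)
        y) = inK M (D.counitL y) := fun y => by
      induction y with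
      | zero => simp
      | add p q hp hq => simp only [map_add, hp, hq]
      | tmul s t => simp [hM.counit_inK]
    rw [h1, hD.counitL_comul]
    rfl

theorem counitR_comul : (hM.bosHopf hD hR).counitR.comp (hM.bosHopf hD hR).comul =
    AlgHom.id k _ := by
  refine bos_algHom_ext (DFunLike.congr_fun
    (f := ((hM.bosHopf hD hR).counitR.comp (hM.bosHopf hD hR).comul).comp (inB M))
    (g := (AlgHom.id k _).comp (inB M)) (gen_algHom_ext fun x => ?_)) fun h => ?_
  · simp only [AlgHom.comp_apply, hM.comul_gen, map_add, bosFst_apply, HopfData.counitR_tmul,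
      map_one, one_smul, AlgHom.id_apply]
    have h1 : ∀ y : K ⊗[k] K, (hM.bosHopf hD hR).counitR (bosCoact M (gen rel x) y) = 0 :=
      fun y => by
      induction y with
      | zero => simp
      | add p q hp hq => simp only [map_add, hp, hq, add_zero]
      | tmul s t => simp [hM.counit_act_gen]
    rw [h1, add_zero]
  · simp only [AlgHom.comp_apply, hM.comul_inK]
    have h1 : ∀ y : K ⊗[k] K, (hM.bosHopf hD hR).counitR (Algebra.TensorProduct.map (inK M) (inK M)
        y) = inK M (D.counitR y) := fun y => by
      induction y with
      | zero => simp
      | add p q hp hq => simp only [map_add, hp, hq]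
      | tmul s t => simp [hM.counit_inK]
    rw [h1, hD.counitR_comul]
    rfl

theorem adL_inK (y : K ⊗[k] K) : (hM.bosHopf hD hR).adL
    (Algebra.TensorProduct.map (inK M) (inK M) y) 1 =
      inK M (LinearMap.mul' k K (D.antipode.rTensor K y)) := by
  rw [HopfData.adL_apply_one]
  induction y with
  | zero => simp
  | add p q hp hq => simp only [map_add, hp, hq]
  | tmul s t => simp [hM.antipode_inK]

theorem adR_inK (y : K ⊗[k] K) : (hM.bosHopf hD hR).adR
    (Algebra.TensorProduct.map (inK M) (inK M) y) 1 =
      inK M (LinearMap.mul' k K (D.antipode.lTensor K y)) := by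
  rw [HopfData.adR_apply_one]
  induction y with
  | zero => simp
  | add p q hp hq => simp only [map_add, hp, hq]
  | tmul s t => simp [hM.antipode_inK]

theorem antipode_one : (hM.bosHopf hD hR).antipode 1 = 1 := by
  rw [← map_one (inK M), hM.antipode_inK, hD.antipode_one]

theorem adL_comul_gen (x : ι) :
    (hM.bosHopf hD hR).adL ((hM.bosHopf hD hR).comul (inB M (gen rel x))) 1 = 0 := by
  rw [HopfData.adL_apply_one, hM.comul_gen, map_add, map_add, bosFst_apply, LinearMap.rTensor_tmul,
    LinearMap.mul'_apply, hM.antipode_gen, mul_one]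
  have h1 : ∀ y : K ⊗[k] K, LinearMap.mul' k _ ((hM.bosHopf hD hR).antipode.rTensor _
      (bosCoact M (gen rel x) y)) = bosAnti M (gen rel x) y := fun y => by
    induction y with
    | zero => simp
    | add p q hp hq => simp only [map_add, hp, hq]
    | tmul s t => simp [hM.antipode_inK]
  rw [h1, neg_add_cancel]

/-- The left version holds by the choice `S(p) = -S(R⁽²⁾)(R⁽¹⁾ ▷ p)`; the right version is a
separate fact, the inversion formula `inK_mul_bosAnti`. -/
theorem adR_comul_gen (x : ι) :
    (hM.bosHopf hD hR).adR ((hM.bosHopf hD hR).comul (inB M (gen rel x))) 1 = 0 := by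
  rw [HopfData.adR_apply_one, hM.comul_gen, map_add, map_add, bosFst_apply, LinearMap.lTensor_tmul,
    LinearMap.mul'_apply, hM.antipode_one, mul_one]
  have h1 : ∀ y : K ⊗[k] K, LinearMap.mul' k _ ((hM.bosHopf hD hR).antipode.lTensor _
      (bosCoact M (gen rel x) y)) = -LinearMap.mul' k _ (TensorProduct.comm k _ _ (TensorProduct.map
      ((bosAnti M).flip R ∘ₗ M.act.toLinearMap.flip (gen rel x)) (inK M).toLinearMap y)) :=
    fun y => by
    induction y with
    | zero => simp
    | add p q hp hq => simp only [map_add, hp, hq, neg_add]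
    | tmul s t =>
      simp only [bosCoact_tmul, LinearMap.lTensor_tmul, LinearMap.mul'_apply, hM.antipode_act_gen]
      exact mul_neg (inK M t) _
  rw [h1, inK_mul_bosAnti M hD hR, add_neg_cancel]

/-- The bosonisation is a Hopf algebra. -/
theorem isHopf_bosHopf : (hM.bosHopf hD hR).IsHopf := by
  have hal : ∀ x y w, (hM.bosHopf hD hR).adL (x * y) w =
      (hM.bosHopf hD hR).adL y ((hM.bosHopf hD hR).adL x w) :=
    HopfData.adL_mul_of (hM.antipode_mul hD hR)
  have har : ∀ x y w, (hM.bosHopf hD hR).adR (x * y) w =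
      (hM.bosHopf hD hR).adR x ((hM.bosHopf hD hR).adR y w) :=
    HopfData.adR_mul_of (hM.antipode_mul hD hR)
  -- The antipode axiom is not an identity of algebra maps. It passes from `a` and `b` to `a b`
  -- because `adL` is an action and the inner value `ε(a)` is a scalar.
  have hl : ∀ a b, (hM.bosHopf hD hR).adL ((hM.bosHopf hD hR).comul a) 1 =
      algebraMap k _ ((hM.bosHopf hD hR).counit a) →
      (hM.bosHopf hD hR).adL ((hM.bosHopf hD hR).comul b) 1 =
      algebraMap k _ ((hM.bosHopf hD hR).counit b) →
      (hM.bosHopf hD hR).adL ((hM.bosHopf hD hR).comul (a * b)) 1 =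
      algebraMap k _ ((hM.bosHopf hD hR).counit (a * b)) := fun a b ha hb => by
    rw [map_mul, hal, ha, HopfData.adL_algebraMap, hb, map_mul, map_mul, Algebra.smul_def]
  have hr : ∀ a b, (hM.bosHopf hD hR).adR ((hM.bosHopf hD hR).comul a) 1 =
      algebraMap k _ ((hM.bosHopf hD hR).counit a) →
      (hM.bosHopf hD hR).adR ((hM.bosHopf hD hR).comul b) 1 =
      algebraMap k _ ((hM.bosHopf hD hR).counit b) →
      (hM.bosHopf hD hR).adR ((hM.bosHopf hD hR).comul (a * b)) 1 =
      algebraMap k _ ((hM.bosHopf hD hR).counit (a * b)) := fun a b ha hb => by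
    rw [map_mul, har, hb, HopfData.adR_algebraMap, ha, map_mul, map_mul, Algebra.smul_def,
      Algebra.commutes]
  refine HopfData.isHopf_of_algHom (hM.comulL_comul hD hR) (hM.counitL_comul hD hR)
    (hM.counitR_comul hD hR) (fun a => ?_) (fun a => ?_)
  · induction a using bos_induction with
    | add x y hx hy =>
      simp only [HopfData.adL_apply_one] at hx hy ⊢
      simp only [map_add, hx, hy]
    | mul b h =>
      refine hl _ _ ?_ ?_
      · induction b using gen_induction with
        | one => simp [HopfData.adL_apply_one, Algebra.TensorProduct.one_def, hM.antipode_one]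
        | add x y hx hy =>
          simp only [HopfData.adL_apply_one] at hx hy ⊢
          simp only [map_add, hx, hy]
        | smul r x hx =>
          simp only [HopfData.adL_apply_one] at hx ⊢
          simp only [map_smul, hx, smul_eq_mul, map_mul]
          rw [Algebra.smul_def]
        | mul x b hb =>
          rw [map_mul]
          refine hl _ _ ?_ hb
          rw [hM.adL_comul_gen, hM.counit_gen, map_zero]
      · rw [hM.comul_inK, hM.adL_inK, hD.antipode_left, hM.counit_inK]
        exact AlgHom.commutes _ _
  · induction a using bos_induction with
    | add x y hx hy =>
      simp only [HopfData.adR_apply_one] at hx hy ⊢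
      simp only [map_add, hx, hy]
    | mul b h =>
      refine hr _ _ ?_ ?_
      · induction b using gen_induction with
        | one => simp [HopfData.adR_apply_one, Algebra.TensorProduct.one_def, hM.antipode_one]
        | add x y hx hy =>
          simp only [HopfData.adR_apply_one] at hx hy ⊢
          simp only [map_add, hx, hy]
        | smul r x hx =>
          simp only [HopfData.adR_apply_one] at hx ⊢
          simp only [map_smul, hx, smul_eq_mul, map_mul]
          rw [Algebra.smul_def]
        | mul x b hb =>
          rw [map_mul]
          refine hr _ _ ?_ hb
          rw [hM.adR_comul_gen, hM.counit_gen, map_zero]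
      · rw [hM.comul_inK, hM.adR_inK, hD.antipode_right, hM.counit_inK]
        exact AlgHom.commutes _ _

end IsAdditive

end QuadraticBosonisation

end QPoincare

end

noncomputable section

namespace QPoincare

/-! ### The braided group inside the bosonisation -/

section Projection

variable {k : Type u} [CommRing k] {K : Type v} [Ring K] [Algebra k K] {D : HopfData k K}
  {B : Type w} [Ring B] [Algebra k B] (M : ModuleAlgebra D B)

theorem cov_lmul (b : B) :
    M.Cov (Algebra.lmul k B).toLinearMap M.act.toLinearMap b := fun h => LinearMap.ext fun c => by
  change M.act h (b * c) = _
  rw [act_mul_tmul]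
  generalize D.comul h = t
  induction t with
  | zero => simp
  | add p q hp hq => simp only [map_add, LinearMap.add_apply, hp, hq]
  | tmul s t => rfl

/-- The semidirect product acts on `B`. -/
def bosRep : Bos M →ₐ[k] Module.End k B := bosLift M (Algebra.lmul k B) M.act (cov_lmul M)

theorem bosRep_inB (b : B) : bosRep M (inB M b) = Algebra.lmul k B b :=
  bosLift_inB M _ _ (cov_lmul M) b

theorem bosRep_inK (h : K) : bosRep M (inK M h) = M.act h := bosLift_inK M _ _ (cov_lmul M) h

/-- The projection `b h ↦ b ε(h)`. -/
def bosProj : Bos M →ₗ[k] B := LinearMap.applyₗ 1 ∘ₗ (bosRep M).toLinearMap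

theorem bosProj_inB_mul (b : B) (x : Bos M) : bosProj M (inB M b * x) = b * bosProj M x := by
  simp [bosProj, bosRep_inB]

theorem bosProj_inK_mul (h : K) (x : Bos M) : bosProj M (inK M h * x) = M.act h (bosProj M x) := by
  simp [bosProj, bosRep_inK]

theorem bosProj_mul_inK (x : Bos M) (h : K) :
    bosProj M (x * inK M h) = D.counit h • bosProj M x := by
  simp [bosProj, bosRep_inK, M.act_one, Algebra.algebraMap_eq_smul_one]

theorem bosProj_one : bosProj M 1 = 1 := by
  simp [bosProj]

@[simp] theorem bosProj_inB (b : B) : bosProj M (inB M b) = b := by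
  have := bosProj_inB_mul M b 1
  rwa [mul_one, bosProj_one, mul_one] at this

variable {R : (K ⊗[k] K)ˣ}

/-- The leg of `R` lying in `K` is evaluated by the counit and `(id ⊗ ε)R = 1`. Thus `B ⊗ B` embeds
in the tensor square of the bosonisation, and braided identities may be verified there. -/
theorem map_bosProj_bosPair (hD : D.IsHopf) (hR : D.IsQuasitriangular R) (y : B ⊗[k] B) :
    TensorProduct.map (bosProj M) (bosProj M) (bosPair M R y) = y := by
  induction y with
  | zero => simp
  | add p q hp hq => simp only [map_add, hp, hq]
  | tmul b c =>
    have h1 : ∀ x : K ⊗[k] K, TensorProduct.map (bosProj M) (bosProj M)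
        (bosFst M b * bosCoact M c x) = b ⊗ₜ M.act (D.counitR x) c := fun x => by
      induction x with
      | zero => simp
      | add p q hp hq => simp only [map_add, mul_add, LinearMap.add_apply, TensorProduct.tmul_add,
          hp, hq]
      | tmul s t =>
        rw [bosFst_apply, bosCoact_tmul, Algebra.TensorProduct.tmul_mul_tmul, one_mul,
          TensorProduct.map_tmul, bosProj_mul_inK, bosProj_inB, bosProj_inB, HopfData.counitR_tmul,
          map_smul, LinearMap.smul_apply, TensorProduct.smul_tmul]
    rw [bosPair_tmul, h1, hR.counitR hD]
    simp

theorem bosPair_injective (hD : D.IsHopf) (hR : D.IsQuasitriangular R) :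
    Function.Injective (bosPair M (R : K ⊗[k] K)) :=
  Function.LeftInverse.injective (map_bosProj_bosPair M hD hR)

/-- `b ⊗ c ↦ b R⁽²⁾ ⊗ R⁽¹⁾ ▷ c` is multiplicative on the braided tensor product. -/
theorem bosPair_mul (hR : D.IsQuasitriangular R) (y z : B ⊗[k] B) :
    bosPair M R y * bosPair M R z = bosPair M R (M.braidedMul (R : K ⊗[k] K) (y ⊗ₜ z)) := by
  induction y with
  | zero => simp
  | add p q hp hq => simp only [map_add, add_mul, TensorProduct.add_tmul, hp, hq]
  | tmul a b =>
    induction z with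
    | zero => simp
    | add p q hp hq => simp only [map_add, mul_add, TensorProduct.tmul_add, hp, hq]
    | tmul c d =>
      have h1 : ∀ y : B ⊗[k] B, bosFst M a * bosPair M R y * bosCoact M d R =
          bosPair M R (TensorProduct.map (LinearMap.mul' k B) (LinearMap.mul' k B)
            ((TensorProduct.assoc k B B (B ⊗[k] B)).symm
            (a ⊗ₜ (TensorProduct.assoc k B B B (y ⊗ₜ d))))) := fun y => by
        induction y with
        | zero => simp
        | add p q hp hq => simp only [map_add, mul_add, add_mul, TensorProduct.add_tmul,
            TensorProduct.tmul_add, hp, hq]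
        | tmul x y =>
          simp only [bosPair_tmul, TensorProduct.assoc_tmul, TensorProduct.assoc_symm_tmul,
            TensorProduct.map_tmul, LinearMap.mul'_apply, map_mul, ← bosCoact_mul M hR, mul_assoc]
      rw [bosPair_tmul, bosPair_tmul, mul_assoc, ← mul_assoc (bosCoact M b _),
        bosCoact_mul_bosFst M hR, ← mul_assoc, h1]
      rfl

theorem bosCoact_one (hD : D.IsHopf) (hR : D.IsQuasitriangular R) :
    bosCoact M 1 (R : K ⊗[k] K) = 1 := by
  have h1 : ∀ x : K ⊗[k] K, bosCoact M 1 x = inK M (D.counitL x) ⊗ₜ 1 := fun x => by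
    induction x with
    | zero => simp
    | add p q hp hq => simp only [map_add, TensorProduct.add_tmul, hp, hq]
    | tmul s t =>
      rw [bosCoact_tmul, M.act_one, AlgHom.commutes, Algebra.algebraMap_eq_smul_one]
      simp [TensorProduct.smul_tmul']
  rw [h1, hR.counitL hD, map_one, Algebra.TensorProduct.one_def]

theorem bosAnti_one (hD : D.IsHopf) (hR : D.IsQuasitriangular R) :
    bosAnti M 1 (R : K ⊗[k] K) = 1 := by
  have h1 : ∀ x : K ⊗[k] K, bosAnti M 1 x = inK M (D.antipode (D.counitL x)) := fun x => by
    induction x with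
    | zero => simp
    | add p q hp hq => simp only [map_add, hp, hq]
    | tmul s t =>
      rw [bosAnti_tmul, M.act_one, AlgHom.commutes, Algebra.algebraMap_eq_smul_one]
      simp
  rw [h1, hR.counitL hD, hD.antipode_one, map_one]

theorem bosPair_one (hD : D.IsHopf) (hR : D.IsQuasitriangular R) :
    bosPair M (R : K ⊗[k] K) (1 ⊗ₜ 1) = 1 := by
  rw [bosPair_tmul, bosCoact_one M hD hR, map_one, one_mul]

theorem actTensor_tmul (s t : K) (b c : B) :
    actTensor M.act (s ⊗ₜ t) (b ⊗ₜ c) = M.act s b ⊗ₜ M.act t c := rfl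

/-- The braiding is equivariant. -/
theorem braiding_actTensor (hR : D.IsQuasitriangular R) (h : K) (y : B ⊗[k] B) :
    M.braiding (R : K ⊗[k] K) (actTensor M.act (D.comul h) y) =
      actTensor M.act (D.comul h) (M.braiding (R : K ⊗[k] K) y) := by
  have h1 : ∀ (x : K ⊗[k] K) (y : B ⊗[k] B), TensorProduct.comm k B B (actTensor M.act x y) =
      actTensor M.act (TensorProduct.comm k K K x) (TensorProduct.comm k B B y) := fun x y => by
    induction x with
    | zero => simp
    | add p q hp hq => simp only [map_add, LinearMap.add_apply, hp, hq]
    | tmul s t =>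
      induction y with
      | zero => simp
      | add p q hp hq => simp only [map_add, hp, hq]
      | tmul b c => rfl
  simp only [ModuleAlgebra.braiding, LinearMap.comp_apply, LinearEquiv.coe_coe]
  rw [← Module.End.mul_apply, ← map_mul, ← hR.intertwine, map_mul, Module.End.mul_apply, h1]
  congr 2
  generalize D.comul h = t
  induction t with
  | zero => simp
  | add p q hp hq => simp only [map_add, hp, hq]
  | tmul s t => rfl

theorem HopfData.IsHopf.exists_antipode_algHom (hD : D.IsHopf) :
    ∃ S : K →ₐ[k] Kᵐᵒᵖ, ∀ h, S h = MulOpposite.op (D.antipode h) :=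
  ⟨AlgHom.ofLinearMap ((MulOpposite.opLinearEquiv k).toLinearMap ∘ₗ D.antipode)
    (by simp [hD.antipode_one]) fun a b => by simp [hD.antipode_mul], fun _ => rfl⟩

/-- `R⁽²⁾ u R⁽¹⁾ = 1`. -/
theorem drinfeldU_inv (hD : D.IsHopf) (hR : D.IsQuasitriangular R) :
    LinearMap.mul' k K (TensorProduct.comm k K K
      ((LinearMap.mulLeft k (drinfeldU D (R : K ⊗[k] K))).rTensor K R)) = 1 := by
  obtain ⟨S, hS⟩ := HopfData.IsHopf.exists_antipode_algHom hD
  -- The product is computed in `K ⊗ Kᵐᵒᵖ`, where `j = id ⊗ S` is an algebra map. The element `R⁽²⁾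
  -- u R⁽¹⁾` is the image under `m` of `j(R) o(R)`, and `o(R) = j(R⁻¹)` because `R = (id ⊗ S)R⁻¹`.
  let j : K ⊗[k] K →ₐ[k] K ⊗[k] Kᵐᵒᵖ := Algebra.TensorProduct.map (AlgHom.id k K) S
  let o : K ⊗[k] K →ₗ[k] K ⊗[k] Kᵐᵒᵖ := (MulOpposite.opLinearEquiv k).toLinearMap.lTensor K
  let m : K ⊗[k] Kᵐᵒᵖ →ₗ[k] K := LinearMap.mul' k K ∘ₗ (TensorProduct.comm k K K).toLinearMap ∘ₗ
    (MulOpposite.opLinearEquiv k).symm.toLinearMap.lTensor K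
  have h1 : ∀ x : K ⊗[k] K, j x = o (D.antipode.lTensor K x) := fun x => by
    induction x with
    | zero => simp
    | add p q hp hq => simp only [map_add, hp, hq]
    | tmul s t => simp [j, o, hS]
  have h2 : ∀ x y : K ⊗[k] K, m (j x * o y) = LinearMap.mul' k K (TensorProduct.comm k K K
      ((LinearMap.mulLeft k (drinfeldU D x)).rTensor K y)) := fun x y => by
    induction y with
    | zero => simp
    | add p q hp hq => simp only [map_add, mul_add, hp, hq]
    | tmul s t =>
      simp only [LinearMap.rTensor_tmul, LinearMap.mulLeft_apply, TensorProduct.comm_tmul,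
        LinearMap.mul'_apply, drinfeldU]
      induction x with
      | zero => simp
      | add p q hp hq => simp only [map_add, mul_add, add_mul, hp, hq]
      | tmul a b => simp [m, j, o, hS, mul_assoc]
  have h3 : o R = j (↑R⁻¹ : K ⊗[k] K) := by rw [h1, hR.antipode_lTensor hD]
  rw [← h2, h3, ← map_mul, Units.mul_inv, map_one]
  simp [m, Algebra.TensorProduct.one_def]

/-- `S(R⁽²⁾) (R⁽¹⁾ ▷ b) = (u R⁽¹⁾ ▷ b) S(R⁽²⁾)`. -/
theorem bosAnti_eq (hD : D.IsHopf) (hR : D.IsQuasitriangular R) (b : B) :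
    bosAnti M b R = LinearMap.mul' k _ (TensorProduct.map
      ((inB M).toLinearMap ∘ₗ M.act.toLinearMap.flip b ∘ₗ
        LinearMap.mulLeft k (drinfeldU D (R : K ⊗[k] K)))
      ((inK M).toLinearMap ∘ₗ D.antipode) (R : K ⊗[k] K)) := by
  set u := drinfeldU D (R : K ⊗[k] K) with hu
  -- `Q(s ⊗ a ⊗ c) = S(a) (c u s ▷ b)`. By `b S(h) = S(h₍₁₎)(h₍₂₎ ▷ b)` the right side is `Q((id ⊗
  -- Δ)R) = Q(R₁₃ R₁₂)`, in which `R₁₃` contributes `R⁽²⁾ u R⁽¹⁾ = 1`.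
  let Q : K ⊗[k] (K ⊗[k] K) →ₗ[k] Bos M := TensorProduct.lift
    ((bosAnti M).compl₁₂ (M.act.toLinearMap.flip b ∘ₗ LinearMap.mulLeft k u)
      (flipHom k K).toLinearMap)
  have h1 : ∀ x : K ⊗[k] K, LinearMap.mul' k _ (TensorProduct.map
      ((inB M).toLinearMap ∘ₗ M.act.toLinearMap.flip b ∘ₗ LinearMap.mulLeft k u)
      ((inK M).toLinearMap ∘ₗ D.antipode) x) = Q (D.comulR x) := fun x => by
    induction x with
    | zero => simp
    | add p q hp hq => simp only [map_add, hp, hq]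
    | tmul s t =>
      rw [HopfData.comulR_tmul]
      simp only [Q, TensorProduct.lift.tmul, LinearMap.compl₁₂_apply, AlgHom.toLinearMap_apply]
      rw [bosAnti_flip_comul M hD]
      rfl
  have h2 : ∀ x y : K ⊗[k] K, Q (leg₁₃ k K x * leg₁₂ k K y) =
      bosAnti M b (LinearMap.mul' k K (TensorProduct.comm k K K
        ((LinearMap.mulLeft k u).rTensor K x)) ⊗ₜ 1 * y) := fun x y => by
    induction y with
    | zero => simp
    | add p q hp hq => simp only [map_add, mul_add, hp, hq]
    | tmul s t =>
      induction x with
      | zero => simp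
      | add p q hp hq => simp only [map_add, add_mul, TensorProduct.add_tmul, hp, hq]
      | tmul a c => simp [Q, flipHom]
  rw [h1, hR.comulR, h2, hu, drinfeldU_inv hD hR, ← Algebra.TensorProduct.one_def, one_mul]

/-- By `inK_mul_bosAnti` an element `b` is recovered from the values of `λ` on all its translates `h
▷ b`. The braided antipode is defined and its identities are proved through this injectivity. -/
theorem bosAnti_act_injective (hD : D.IsHopf) (hR : D.IsQuasitriangular R) {v w : B}
    (h : ∀ h, bosAnti M (M.act h v) R = bosAnti M (M.act h w) R) : v = w := by
  have h1 : ((bosAnti M).flip (R : K ⊗[k] K) ∘ₗ M.act.toLinearMap.flip v) =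
      ((bosAnti M).flip (R : K ⊗[k] K) ∘ₗ M.act.toLinearMap.flip w) := LinearMap.ext h
  have h2 := inK_mul_bosAnti M hD hR v
  rw [h1, inK_mul_bosAnti M hD hR w] at h2
  simpa using (congrArg (bosProj M) h2).symm

end Projection

end QPoincare

end

noncomputable section

namespace QPoincare

/-! ### The braided group read off from its bosonisation -/

section BraidedGroup

variable {k : Type u} [CommRing k] {K : Type v} [Ring K] [Algebra k K] {D : HopfData k K}
  {ι : Type} {rel : FreeAlgebra k ι → FreeAlgebra k ι → Prop} [Fintype ι] [DecidableEq ι]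
  {L : Submodule k (ι × ι → k)} {ρ : K →ₐ[k] Matrix ι ι k} {R : (K ⊗[k] K)ˣ}
  {M : ModuleAlgebra D (RingQuot rel)}

namespace IsAdditive

variable (hM : IsAdditive rel L ρ (R : K ⊗[k] K) M) (hD : D.IsHopf) (hR : D.IsQuasitriangular R)

/-- The braided coproduct. -/
def braidedComul : RingQuot rel →ₗ[k] RingQuot rel ⊗[k] RingQuot rel :=
  TensorProduct.map (bosProj M) (bosProj M) ∘ₗ (hM.bosHopf hD hR).comul.toLinearMap ∘ₗ
    (inB M).toLinearMap

theorem braidedComul_eq_of {b : RingQuot rel} {y : RingQuot rel ⊗[k] RingQuot rel}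
    (h : (hM.bosHopf hD hR).comul (inB M b) = bosPair M R y) : hM.braidedComul hD hR b = y := by
  rw [← map_bosProj_bosPair M hD hR y, ← h]
  rfl

theorem comul_gen_eq_bosPair (x : ι) : (hM.bosHopf hD hR).comul (inB M (gen rel x)) =
    bosPair M R (gen rel x ⊗ₜ 1 + 1 ⊗ₜ gen rel x) := by
  rw [hM.comul_gen, map_add, bosPair_tmul, bosPair_tmul, bosCoact_one M hD hR, map_one, mul_one,
    one_mul]

/-- The image of `bosPair` contains the coproducts of `1` and of the generators, and is closed under
products by `bosPair_mul`. So the coproduct of `B` stays in this image, and projecting it loses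
nothing. -/
theorem comul_inB (b : RingQuot rel) : (hM.bosHopf hD hR).comul (inB M b) =
    bosPair M R (hM.braidedComul hD hR b) := by
  obtain ⟨y, hy⟩ : ∃ y, (hM.bosHopf hD hR).comul (inB M b) = bosPair M R y := by
    induction b using gen_induction with
    | one => exact ⟨1 ⊗ₜ 1, by rw [bosPair_one M hD hR, map_one, map_one]⟩
    | add a b ha hb =>
      obtain ⟨y, hy⟩ := ha
      obtain ⟨z, hz⟩ := hb
      exact ⟨y + z, by simp only [map_add, hy, hz]⟩
    | smul r a ha =>
      obtain ⟨y, hy⟩ := ha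
      exact ⟨r • y, by simp only [map_smul, hy]⟩
    | mul x b hb =>
      obtain ⟨y, hy⟩ := hb
      exact ⟨_, by rw [map_mul, map_mul, hy, hM.comul_gen_eq_bosPair, bosPair_mul M hR]⟩
  rw [hy, hM.braidedComul_eq_of hD hR hy]

theorem braidedComul_gen (x : ι) :
    hM.braidedComul hD hR (gen rel x) = gen rel x ⊗ₜ 1 + 1 ⊗ₜ gen rel x :=
  hM.braidedComul_eq_of hD hR (hM.comul_gen_eq_bosPair hD hR x)

/-- The projection `b h ↦ b ε(h)` is a map of coalgebras onto `B`; coassociativity and the counit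
axioms of `B` descend along it. -/
theorem map_bosProj_comul (x : Bos M) : TensorProduct.map (bosProj M) (bosProj M)
    ((hM.bosHopf hD hR).comul x) = hM.braidedComul hD hR (bosProj M x) := by
  induction x using bos_induction with
  | add x y hx hy => simp only [map_add, hx, hy]
  | mul b h =>
    have h1 : ∀ (y : Bos M ⊗[k] Bos M) (T : K ⊗[k] K), TensorProduct.map (bosProj M) (bosProj M)
        (y * Algebra.TensorProduct.map (inK M) (inK M) T) = D.counit (D.counitL T) •
          TensorProduct.map (bosProj M) (bosProj M) y := fun y T => by
      induction T with
      | zero => simp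
      | add p q hp hq => simp only [map_add, mul_add, add_smul, hp, hq]
      | tmul s t =>
        induction y with
        | zero => simp
        | add p q hp hq => simp only [map_add, add_mul, smul_add, hp, hq]
        | tmul a c =>
          rw [Algebra.TensorProduct.map_tmul, Algebra.TensorProduct.tmul_mul_tmul,
            TensorProduct.map_tmul, TensorProduct.map_tmul, bosProj_mul_inK, bosProj_mul_inK,
            TensorProduct.smul_tmul_smul, HopfData.counitL_tmul, map_smul, smul_eq_mul]
    rw [map_mul, hM.comul_inK, h1, hD.counitL_comul, bosProj_mul_inK, map_smul, bosProj_inB]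
    rfl

/-- The braided counit. -/
def braidedCounit : RingQuot rel →ₗ[k] k :=
  (hM.bosHopf hD hR).counit.toLinearMap ∘ₗ (inB M).toLinearMap

theorem braidedCounit_bosProj (x : Bos M) :
    hM.braidedCounit hD hR (bosProj M x) = (hM.bosHopf hD hR).counit x := by
  induction x using bos_induction with
  | add x y hx hy => simp only [map_add, hx, hy]
  | mul b h =>
    rw [map_mul (hM.bosHopf hD hR).counit, hM.counit_inK, bosProj_mul_inK, map_smul, bosProj_inB,
      smul_eq_mul, mul_comm]
    rfl

theorem braidedComul_act (h : K) (b : RingQuot rel) : hM.braidedComul hD hR (M.act h b) =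
    actTensor M.act (D.comul h) (hM.braidedComul hD hR b) := by
  have h1 : ∀ (T : K ⊗[k] K) (y : Bos M ⊗[k] Bos M), TensorProduct.map (bosProj M) (bosProj M)
      (Algebra.TensorProduct.map (inK M) (inK M) T * y) = actTensor M.act T
        (TensorProduct.map (bosProj M) (bosProj M) y) := fun T y => by
    induction T with
    | zero => simp
    | add p q hp hq => simp only [map_add, add_mul, LinearMap.add_apply, hp, hq]
    | tmul s t =>
      induction y with
      | zero => simp
      | add p q hp hq => simp only [map_add, mul_add, hp, hq]
      | tmul a c =>
        rw [Algebra.TensorProduct.map_tmul, Algebra.TensorProduct.tmul_mul_tmul,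
          TensorProduct.map_tmul, TensorProduct.map_tmul, bosProj_inK_mul, bosProj_inK_mul]
        rfl
  have h2 : M.act h b = bosProj M (inK M h * inB M b) := by rw [bosProj_inK_mul, bosProj_inB]
  rw [h2, ← hM.map_bosProj_comul, map_mul, hM.comul_inK, h1]
  rfl

theorem braidedCounit_act (h : K) (b : RingQuot rel) : hM.braidedCounit hD hR (M.act h b) =
    D.counit h * hM.braidedCounit hD hR b := by
  have h2 : M.act h b = bosProj M (inK M h * inB M b) := by rw [bosProj_inK_mul, bosProj_inB]
  rw [h2, hM.braidedCounit_bosProj, map_mul, hM.counit_inK]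
  rfl

/-- The requirement for all translates `h ▷ b` determines `w` and makes `b ↦ w` linear and
equivariant. It is stable under products since `λ` is braided-antimultiplicative and the braiding is
equivariant. -/
theorem exists_antipode (b : RingQuot rel) : ∃ w, ∀ h,
    (hM.bosHopf hD hR).antipode (inB M (M.act h b)) = bosAnti M (M.act h w) R := by
  induction b using gen_induction with
  | one =>
    refine ⟨1, fun h => ?_⟩
    rw [M.act_one, Algebra.algebraMap_eq_smul_one, map_smul, map_smul, map_smul,
      LinearMap.smul_apply, bosAnti_one M hD hR, map_one, hM.antipode_one]
  | add a b ha hb =>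
    obtain ⟨y, hy⟩ := ha
    obtain ⟨z, hz⟩ := hb
    exact ⟨y + z, fun h => by simp only [map_add, LinearMap.add_apply, hy, hz]⟩
  | smul r a ha =>
    obtain ⟨y, hy⟩ := ha
    exact ⟨r • y, fun h => by simp only [map_smul, LinearMap.smul_apply, hy]⟩
  | mul x b hb =>
    obtain ⟨w, hw⟩ := hb
    have hx : ∀ h, (hM.bosHopf hD hR).antipode (inB M (M.act h (gen rel x))) =
        bosAnti M (M.act h ((-1 : k) • gen rel x)) R := fun h => by
      rw [hM.antipode_act_gen]
      simp only [map_smul, LinearMap.smul_apply]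
      rw [neg_one_smul]
    generalize (-1 : k) • gen rel x = v at hx
    refine ⟨LinearMap.mul' k _ (M.braiding (R : K ⊗[k] K) (v ⊗ₜ w)), fun h => ?_⟩
    rw [M.act_mul, ← braiding_actTensor M hR, act_mul_tmul]
    generalize D.comul h = t
    induction t with
    | zero => simp
    | add p q hp hq => simp only [map_add, LinearMap.add_apply, hp, hq]
    | tmul s t =>
      rw [actTensor_tmul, ← bosAnti_mul_bosAnti M hD hR, ← hw, ← hx, ← hM.antipode_mul, ← map_mul]
      rfl

/-- The braided antipode. -/
def braidedAntipode : RingQuot rel →ₗ[k] RingQuot rel where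
  toFun b := (hM.exists_antipode hD hR b).choose
  map_add' b c := bosAnti_act_injective M hD hR fun h => by
    rw [← (hM.exists_antipode hD hR (b + c)).choose_spec h]
    simp only [map_add, LinearMap.add_apply, ← (hM.exists_antipode hD hR b).choose_spec h,
      ← (hM.exists_antipode hD hR c).choose_spec h]
  map_smul' r b := bosAnti_act_injective M hD hR fun h => by
    rw [← (hM.exists_antipode hD hR (r • b)).choose_spec h]
    simp only [map_smul, LinearMap.smul_apply, ← (hM.exists_antipode hD hR b).choose_spec h,
      RingHom.id_apply]

theorem antipode_act (h : K) (b : RingQuot rel) :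
    (hM.bosHopf hD hR).antipode (inB M (M.act h b)) =
      bosAnti M (M.act h (hM.braidedAntipode hD hR b)) R :=
  (hM.exists_antipode hD hR b).choose_spec h

theorem antipode_inB (b : RingQuot rel) : (hM.bosHopf hD hR).antipode (inB M b) =
    bosAnti M (hM.braidedAntipode hD hR b) R := by
  have := hM.antipode_act hD hR 1 b
  simpa only [map_one, Module.End.one_apply] using this

theorem braidedAntipode_act (h : K) (b : RingQuot rel) :
    hM.braidedAntipode hD hR (M.act h b) = M.act h (hM.braidedAntipode hD hR b) :=
  bosAnti_act_injective M hD hR fun g => by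
    rw [← hM.antipode_act, ← Module.End.mul_apply, ← Module.End.mul_apply, ← map_mul,
      ← hM.antipode_act]

/-- The ordinary axiom on `inB b` becomes the braided one, because `R⁽²⁾ λ(R⁽¹⁾ ▷ c) = c` removes
the quasitriangular structure; the result is then projected to `B`. -/
theorem mul_braidedAntipode_right (b : RingQuot rel) :
    LinearMap.mul' k _ ((hM.braidedAntipode hD hR).lTensor _ (hM.braidedComul hD hR b)) =
      algebraMap k _ (hM.braidedCounit hD hR b) := by
  have h1 : ∀ y : RingQuot rel ⊗[k] RingQuot rel,
      LinearMap.mul' k _ ((hM.bosHopf hD hR).antipode.lTensor _ (bosPair M R y)) =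
      inB M (LinearMap.mul' k _ ((hM.braidedAntipode hD hR).lTensor _ y)) := fun y => by
    induction y with
    | zero => simp
    | add p q hp hq => simp only [map_add, hp, hq]
    | tmul b c =>
      have h2 : ∀ x : K ⊗[k] K, LinearMap.mul' k _ ((hM.bosHopf hD hR).antipode.lTensor _
          (bosFst M b * bosCoact M c x)) = inB M b * LinearMap.mul' k _ (TensorProduct.comm k _ _
          (TensorProduct.map ((bosAnti M).flip R ∘ₗ
            M.act.toLinearMap.flip (hM.braidedAntipode hD hR c)) (inK M).toLinearMap x)) :=
        fun x => by
        induction x with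
        | zero => simp
        | add p q hp hq => simp only [map_add, mul_add, hp, hq]
        | tmul s t =>
          rw [bosFst_apply, bosCoact_tmul, Algebra.TensorProduct.tmul_mul_tmul, one_mul,
            LinearMap.lTensor_tmul, LinearMap.mul'_apply, hM.antipode_act, mul_assoc]
          rfl
      rw [bosPair_tmul, h2, inK_mul_bosAnti M hD hR, LinearMap.lTensor_tmul, LinearMap.mul'_apply,
        map_mul]
  have h2 := (hM.isHopf_bosHopf hD hR).antipode_right (inB M b)
  rw [hM.comul_inB, h1] at h2
  have h3 := congrArg (bosProj M) h2
  rwa [bosProj_inB, ← AlgHom.commutes (inB M), bosProj_inB] at h3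

theorem bosAnti_braidedAntipode_mul (b : RingQuot rel) :
    bosAnti M (LinearMap.mul' k _ ((hM.braidedAntipode hD hR).rTensor _
      (hM.braidedComul hD hR b))) R = algebraMap k _ (hM.braidedCounit hD hR b) := by
  have h1 : ∀ y : RingQuot rel ⊗[k] RingQuot rel,
      LinearMap.mul' k _ ((hM.bosHopf hD hR).antipode.rTensor _ (bosPair M R y)) =
      bosAnti M (LinearMap.mul' k _ ((hM.braidedAntipode hD hR).rTensor _ y)) R := fun y => by
    induction y with
    | zero => simp
    | add p q hp hq => simp only [map_add, LinearMap.add_apply, hp, hq]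
    | tmul b c =>
      have h2 : ∀ x : K ⊗[k] K, LinearMap.mul' k _ ((hM.bosHopf hD hR).antipode.rTensor _
          (bosFst M b * bosCoact M c x)) =
          antiCross M (LinearMap.mulLeft k (bosAnti M (hM.braidedAntipode hD hR b) R) ∘ₗ
            (inB M).toLinearMap ∘ₗ M.act.toLinearMap.flip c) x := fun x => by
        induction x with
        | zero => simp
        | add p q hp hq => simp only [map_add, mul_add, hp, hq]
        | tmul s t =>
          rw [bosFst_apply, bosCoact_tmul, Algebra.TensorProduct.tmul_mul_tmul, one_mul,
            LinearMap.rTensor_tmul, LinearMap.mul'_apply, hM.antipode_mul, hM.antipode_inK,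
            hM.antipode_inB, mul_assoc]
          rfl
      rw [bosPair_tmul, h2, bosAnti_mul M hD hR, LinearMap.rTensor_tmul, LinearMap.mul'_apply]
  have h2 := (hM.isHopf_bosHopf hD hR).antipode_left (inB M b)
  rw [hM.comul_inB, h1] at h2
  exact h2

/-- The ordinary axiom gives the identity only under `λ`. Equivariance gives it for all translates
of `b` as well, and `bosAnti_act_injective` removes `λ`. -/
theorem mul_braidedAntipode_left (b : RingQuot rel) :
    LinearMap.mul' k _ ((hM.braidedAntipode hD hR).rTensor _ (hM.braidedComul hD hR b)) =
      algebraMap k _ (hM.braidedCounit hD hR b) := by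
  refine bosAnti_act_injective M hD hR fun h => ?_
  have h1 : M.act h (LinearMap.mul' k _ ((hM.braidedAntipode hD hR).rTensor _
      (hM.braidedComul hD hR b))) = LinearMap.mul' k _ ((hM.braidedAntipode hD hR).rTensor _
      (hM.braidedComul hD hR (M.act h b))) := by
    rw [M.act_mul, hM.braidedComul_act]
    congr 1
    generalize hM.braidedComul hD hR b = y
    generalize D.comul h = t
    induction t with
    | zero => simp
    | add p q hp hq => simp only [map_add, LinearMap.add_apply, hp, hq]
    | tmul s t =>
      induction y with
      | zero => simp
      | add p q hp hq => simp only [map_add, hp, hq]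
      | tmul a c =>
        rw [LinearMap.rTensor_tmul, actTensor_tmul, actTensor_tmul, LinearMap.rTensor_tmul,
          hM.braidedAntipode_act]
  rw [h1, hM.bosAnti_braidedAntipode_mul, hM.braidedCounit_act, Algebra.algebraMap_eq_smul_one,
    Algebra.algebraMap_eq_smul_one, map_smul, M.act_one, Algebra.algebraMap_eq_smul_one,
    map_smul, map_smul, LinearMap.smul_apply, LinearMap.smul_apply, bosAnti_one M hD hR, smul_smul,
    mul_comm]

theorem braidedComul_coassoc : (TensorProduct.assoc k _ _ _).toLinearMap ∘ₗ
    (hM.braidedComul hD hR).rTensor (RingQuot rel) ∘ₗ hM.braidedComul hD hR =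
      (hM.braidedComul hD hR).lTensor (RingQuot rel) ∘ₗ hM.braidedComul hD hR := by
  refine LinearMap.ext fun b => ?_
  let P : Bos M ⊗[k] (Bos M ⊗[k] Bos M) →ₗ[k]
      RingQuot rel ⊗[k] (RingQuot rel ⊗[k] RingQuot rel) :=
    TensorProduct.map (bosProj M) (TensorProduct.map (bosProj M) (bosProj M))
  have h1 : ∀ x : Bos M ⊗[k] Bos M, TensorProduct.assoc k _ _ _
      ((hM.braidedComul hD hR).rTensor (RingQuot rel)
        (TensorProduct.map (bosProj M) (bosProj M) x)) =
      P ((hM.bosHopf hD hR).comulL x) := fun x => by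
    induction x with
    | zero => simp
    | add p q hp hq => simp only [map_add, hp, hq]
    | tmul a c =>
      rw [TensorProduct.map_tmul, LinearMap.rTensor_tmul, ← hM.map_bosProj_comul,
        HopfData.comulL_tmul]
      generalize (hM.bosHopf hD hR).comul a = y
      induction y with
      | zero => simp
      | add p q hp hq => simp only [map_add, TensorProduct.add_tmul, hp, hq]
      | tmul d e => rfl
  have h2 : ∀ x : Bos M ⊗[k] Bos M, (hM.braidedComul hD hR).lTensor (RingQuot rel)
        (TensorProduct.map (bosProj M) (bosProj M) x) =
      P ((hM.bosHopf hD hR).comulR x) := fun x => by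
    induction x with
    | zero => simp
    | add p q hp hq => simp only [map_add, hp, hq]
    | tmul a c =>
      rw [TensorProduct.map_tmul, LinearMap.lTensor_tmul, ← hM.map_bosProj_comul,
        HopfData.comulR_tmul]
      rfl
  refine (h1 ((hM.bosHopf hD hR).comul (inB M b))).trans (Eq.trans ?_
    (h2 ((hM.bosHopf hD hR).comul (inB M b))).symm)
  rw [(hM.isHopf_bosHopf hD hR).comulL_comul]

theorem braidedCounit_left (b : RingQuot rel) :
    (hM.braidedCounit hD hR).rTensor _ (hM.braidedComul hD hR b) = 1 ⊗ₜ b := by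
  have h1 : ∀ x : Bos M ⊗[k] Bos M, (hM.braidedCounit hD hR).rTensor (RingQuot rel)
        (TensorProduct.map (bosProj M) (bosProj M) x) =
      (bosProj M).lTensor k ((hM.bosHopf hD hR).counit.toLinearMap.rTensor _ x) := fun x => by
    induction x with
    | zero => simp
    | add p q hp hq => simp only [map_add, hp, hq]
    | tmul a c =>
      rw [TensorProduct.map_tmul, LinearMap.rTensor_tmul, hM.braidedCounit_bosProj]
      rfl
  refine (h1 ((hM.bosHopf hD hR).comul (inB M b))).trans ?_
  rw [(hM.isHopf_bosHopf hD hR).counit_left, LinearMap.lTensor_tmul, bosProj_inB]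

theorem braidedCounit_right (b : RingQuot rel) :
    (hM.braidedCounit hD hR).lTensor _ (hM.braidedComul hD hR b) = b ⊗ₜ 1 := by
  have h1 : ∀ x : Bos M ⊗[k] Bos M, (hM.braidedCounit hD hR).lTensor (RingQuot rel)
        (TensorProduct.map (bosProj M) (bosProj M) x) =
      (bosProj M).rTensor k ((hM.bosHopf hD hR).counit.toLinearMap.lTensor _ x) := fun x => by
    induction x with
    | zero => simp
    | add p q hp hq => simp only [map_add, hp, hq]
    | tmul a c =>
      rw [TensorProduct.map_tmul, LinearMap.lTensor_tmul, hM.braidedCounit_bosProj]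
      rfl
  refine (h1 ((hM.bosHopf hD hR).comul (inB M b))).trans ?_
  rw [(hM.isHopf_bosHopf hD hR).counit_right, LinearMap.rTensor_tmul, bosProj_inB]

/-- The additive braided group structure on a quadratic algebra. -/
def braidedGroup : BraidedGroup D (R : K ⊗[k] K) (RingQuot rel) where
  toModuleAlgebra := M
  comul := hM.braidedComul hD hR
  counit := hM.braidedCounit hD hR
  antipode := hM.braidedAntipode hD hR
  comul_act := hM.braidedComul_act hD hR
  counit_act := hM.braidedCounit_act hD hR
  antipode_act := hM.braidedAntipode_act hD hR
  coassoc := hM.braidedComul_coassoc hD hR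
  counit_left := hM.braidedCounit_left hD hR
  counit_right := hM.braidedCounit_right hD hR
  comul_one := hM.braidedComul_eq_of hD hR (by rw [bosPair_one M hD hR, map_one, map_one])
  comul_mul b c := hM.braidedComul_eq_of hD hR (by
    rw [map_mul, map_mul, hM.comul_inB, hM.comul_inB, bosPair_mul M hR])
  counit_one := by simp [braidedCounit]
  counit_mul b c := by simp [braidedCounit]
  antipode_left := hM.mul_braidedAntipode_left hD hR
  antipode_right := hM.mul_braidedAntipode_right hD hR

theorem isBosonisation : IsBosonisation (hM.braidedGroup hD hR) (hM.bosHopf hD hR) where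
  isHopf := hM.isHopf_bosHopf hD hR
  comul_inK := hM.comul_inK hD hR
  counit_inK := hM.counit_inK hD hR
  antipode_inK := hM.antipode_inK hD hR
  comul_inB b := (hM.comul_inB hD hR b).trans (bosComulMap_eq M _ _).symm
  counit_inB _ := rfl
  antipode_inB b := (hM.antipode_inB hD hR b).trans (bosAnti_eq M hD hR _)

end IsAdditive

end BraidedGroup

end QPoincare

end

noncomputable section

namespace QPoincare

/-! ### Twisting the bosonisation -/

section Gauge

variable {k : Type u} [CommRing k] {K : Type v} [Ring K] [Algebra k K] {D D' : HopfData k K}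

/-- `χ` intertwines the coproducts of `D` and `D'` and is coherent:
`(id ⊗ Δ') χ χ₂₃ = (Δ' ⊗ id) χ χ₁₂`. -/
structure HopfData.IsGauge (D D' : HopfData k K) (χ : K ⊗[k] K) : Prop where
  intertwine : ∀ h, D'.comul h * χ = χ * D.comul h
  coherence : D'.comulR χ * leg₂₃ k K χ = D'.comulL χ * leg₁₂ k K χ

/-- Written with the twisted coproduct, coherence is the cocycle identity after the cancellation of
`χ⁻¹ χ`. -/
theorem HopfData.IsCocycle.isGauge {χ : (K ⊗[k] K)ˣ} (hχ : D.IsCocycle χ) :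
    D.IsGauge (D.twist χ) (χ : K ⊗[k] K) where
  intertwine h := by rw [twist_comul, mul_assoc, Units.inv_mul, mul_one]
  coherence := by
    rw [comulL_twist, comulR_twist, mul_assoc, mul_assoc _ (leg₁₂ k K _), ← map_mul, ← map_mul,
      Units.inv_mul, map_one, map_one, mul_one, mul_one, hχ.eq]

/-- Coherence of `χ⁻¹` is the inverted cocycle identity. The notion of gauge is thus symmetric, and
one construction serves for both the isomorphism and its inverse. -/
theorem HopfData.IsCocycle.isGauge_inv {χ : (K ⊗[k] K)ˣ} (hχ : D.IsCocycle χ) :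
    (D.twist χ).IsGauge D (↑χ⁻¹ : K ⊗[k] K) where
  intertwine h := by rw [twist_comul, mul_assoc, ← mul_assoc, Units.inv_mul, one_mul]
  coherence := hχ.inv_eq.symm

variable {B : Type w} [Ring B] [Algebra k B] (M : ModuleAlgebra D' B)

/-- `b ↦ (χ⁽¹⁾ ▷ b) χ⁽²⁾`. -/
def gaugeB (χ : K ⊗[k] K) (b : B) : Bos M := M.cross (inB M).toLinearMap (inK M).toLinearMap b χ

variable {χ : K ⊗[k] K}

theorem cross_gauge (b : B) (s t : K) :
    M.cross (inB M).toLinearMap (inK M).toLinearMap b (χ * s ⊗ₜ t) =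
      gaugeB M χ (M.act s b) * inK M t := by
  rw [gaugeB, ← ModuleAlgebra.cross_mul_left, ModuleAlgebra.cross_mul_right, mul_assoc,
    Algebra.TensorProduct.tmul_mul_tmul, mul_one, one_mul]

theorem inK_mul_gaugeB (hχ : D.IsGauge D' χ) (h : K) (b : B) : inK M h * gaugeB M χ b =
    M.cross (inB M).toLinearMap (inK M).toLinearMap b (χ * D.comul h) := by
  rw [gaugeB, bos_comul_mul, hχ.intertwine]

/-- Moving `χ⁽²⁾` past the second factor produces `(id ⊗ Δ')χ χ₂₃`. Coherence turns this into `(Δ' ⊗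
id)χ χ₁₂`, where `Δ'` acts on a product and `χ₁₂` modifies that product. The elements `(χ⁽¹⁾ ▷ b)
χ⁽²⁾` therefore multiply like `B` with its product deformed by `χ`. -/
theorem gaugeB_mul (hχ : D.IsGauge D' χ) (b c : B) : gaugeB M χ b * gaugeB M χ c =
    gaugeB M χ (LinearMap.mul' k B (actTensor M.act χ (b ⊗ₜ c))) := by
  let Ω : K ⊗[k] (K ⊗[k] K) →ₗ[k] Bos M := LinearMap.mul' k _ ∘ₗ
    TensorProduct.map ((inB M).toLinearMap ∘ₗ M.act.toLinearMap.flip b)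
      (M.cross (inB M).toLinearMap (inK M).toLinearMap c)
  have h1 : ∀ x y : K ⊗[k] K, gaugeB M x b * gaugeB M y c =
      Ω (D'.comulR x * leg₂₃ k K y) := fun x y => by
    simp only [gaugeB]
    induction x with
    | zero => simp
    | add p q hp hq => simp only [map_add, add_mul, hp, hq]
    | tmul s t =>
      rw [cross_tmul, mul_assoc, AlgHom.toLinearMap_apply, AlgHom.toLinearMap_apply, bos_comul_mul,
        HopfData.comulR_tmul, Algebra.TensorProduct.includeRight_apply,
        Algebra.TensorProduct.tmul_mul_tmul, mul_one]
      rfl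
  have h2 : ∀ x y : K ⊗[k] K, Ω (D'.comulL x * leg₁₂ k K y) =
      gaugeB M x (LinearMap.mul' k B (actTensor M.act y (b ⊗ₜ c))) := fun x y => by
    simp only [gaugeB]
    induction x with
    | zero => simp
    | add p q hp hq => simp only [map_add, add_mul, hp, hq]
    | tmul s t =>
      rw [cross_tmul, M.act_mul, ← Module.End.mul_apply, ← map_mul, HopfData.comulL_tmul]
      have h3 : ∀ y : K ⊗[k] K, leg₁₂ k K y = Algebra.TensorProduct.assoc k k k K K K (y ⊗ₜ 1) :=
        fun y => by
        induction y with
        | zero => simp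
        | add p q hp hq => simp only [map_add, TensorProduct.add_tmul, hp, hq]
        | tmul a d => rfl
      rw [h3, ← map_mul, Algebra.TensorProduct.tmul_mul_tmul, mul_one]
      generalize D'.comul s * y = z
      induction z with
      | zero => simp
      | add p q hp hq => simp only [map_add, add_mul, TensorProduct.add_tmul, LinearMap.add_apply,
          hp, hq]
      | tmul a d => simp [Ω, actTensor_tmul, mul_assoc]
  rw [h1, hχ.coherence, h2]

end Gauge

/-! ### The isomorphism of semidirect products induced by a gauge -/

section GaugeMap

variable {k : Type u} [CommRing k] {K : Type v} [Ring K] [Algebra k K] {D D' : HopfData k K}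
  {ι : Type} [Fintype ι] [DecidableEq ι] {rel rel' : FreeAlgebra k ι → FreeAlgebra k ι → Prop}
  {L L' : Submodule k (ι × ι → k)} {ρ : K →ₐ[k] Matrix ι ι k} {R R' χ : K ⊗[k] K}
  {M : ModuleAlgebra D (RingQuot rel)} {M' : ModuleAlgebra D' (RingQuot rel')}

theorem gaugeB_rotate (hM' : IsAdditive rel' L' ρ R' M') (h : K) (x : ι) :
    gaugeB M' χ (M'.act h (gen rel' x)) = rotate ρ (fun y => gaugeB M' χ (gen rel' y)) x h := by
  rw [hM'.act_gen, rotate_apply, rotate_apply]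
  simp only [gaugeB]
  induction χ with
  | zero => simp
  | add p q hp hq => simp only [map_add, smul_add, Finset.sum_add_distrib, hp, hq]
  | tmul s t => simp [map_sum, Finset.sum_mul]

/-- The map of `B` to the twisted bosonisation. -/
def gaugeAlg (hM : IsAdditive rel L ρ R M) (hM' : IsAdditive rel' L' ρ R' M')
    (hχ : D.IsGauge D' χ) (hL : ∀ c ∈ L, (tensorRep ρ χ).mulVec c ∈ L') :
    RingQuot rel →ₐ[k] Bos M' :=
  hM.quadratic.lift (fun x => gaugeB M' χ (gen rel' x)) fun c hc => by
    have e : ∀ x, M'.act.toLinearMap.flip (gen rel' x) = rotate ρ (gen rel') x := fun x =>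
      LinearMap.ext fun h => hM'.act_gen h x
    have h2 : ∀ (t : K ⊗[k] K) (x y : ι), LinearMap.mul' k _ (actTensor M'.act t
        (gen rel' x ⊗ₜ gen rel' y)) = LinearMap.mul' k _
        (TensorProduct.map (rotate ρ (gen rel') x) (rotate ρ (gen rel') y) t) := fun t x y => by
      rw [← e, ← e]
      induction t with
      | zero => simp
      | add p q hp hq => simp only [map_add, LinearMap.add_apply, hp, hq]
      | tmul s t => rfl
    -- By `gaugeB_mul` a quadratic expression with coefficients `c` becomes `gaugeB` of the one with
    -- coefficients `χ c`, which is a relation of the target by `hL`.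
    have h1 := sum_rotate_mul ρ (gen rel') c χ
    rw [hM'.quadratic.quad_eq_zero _ (hL c hc)] at h1
    rw [quad_apply]
    simp only [gaugeB_mul M' hχ, h2]
    have h3 : ∀ (z : ι × ι → RingQuot rel') (t : K ⊗[k] K), ∑ i, c i • gaugeB M' t (z i) =
        gaugeB M' t (∑ i, c i • z i) := fun z t => by
      simp only [gaugeB]
      induction t with
      | zero => simp
      | add p q hp hq => simp only [map_add, smul_add, Finset.sum_add_distrib, hp, hq]
      | tmul s t => simp [map_sum, Finset.sum_mul]
    rw [h3, h1, gaugeB]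
    generalize χ = t
    induction t with
    | zero => simp
    | add p q hp hq => rw [map_add, hp, hq, add_zero]
    | tmul s t => simp

variable (hM : IsAdditive rel L ρ R M) (hM' : IsAdditive rel' L' ρ R' M')
    (hχ : D.IsGauge D' χ) (hL : ∀ c ∈ L, (tensorRep ρ χ).mulVec c ∈ L')

theorem gaugeAlg_gen (x : ι) : gaugeAlg hM hM' hχ hL (gen rel x) = gaugeB M' χ (gen rel' x) :=
  hM.quadratic.lift_gen _ _ _

theorem gaugeAlg_act (h : K) (x : ι) : gaugeAlg hM hM' hχ hL (M.act h (gen rel x)) =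
    gaugeB M' χ (M'.act h (gen rel' x)) := by
  rw [hM.act_gen, gaugeB_rotate hM', ← AlgHom.toLinearMap_apply, map_rotate]
  simp only [AlgHom.toLinearMap_apply, gaugeAlg_gen]

theorem cross_gaugeAlg (x : ι) (T : K ⊗[k] K) :
    M.cross (gaugeAlg hM hM' hχ hL).toLinearMap (inK M').toLinearMap (gen rel x) T =
      M'.cross (inB M').toLinearMap (inK M').toLinearMap (gen rel' x) (χ * T) := by
  induction T with
  | zero => simp
  | add p q hp hq => simp only [map_add, mul_add, hp, hq]
  | tmul s t =>
    rw [cross_gauge, cross_tmul, AlgHom.toLinearMap_apply, gaugeAlg_act]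
    rfl

theorem cov_gaugeAlg (hD : D.IsHopf) (b : RingQuot rel) :
    M.Cov (gaugeAlg hM hM' hχ hL).toLinearMap (inK M').toLinearMap b := by
  refine cov_of_gen hD (fun x h => ?_) b
  rw [cross_gaugeAlg, ← inK_mul_gaugeB M' hχ, AlgHom.toLinearMap_apply, AlgHom.toLinearMap_apply,
    gaugeAlg_gen]

/-- The algebra map of the bosonisation to its twist. -/
def gaugeMap (hD : D.IsHopf) : Bos M →ₐ[k] Bos M' :=
  bosLift M (gaugeAlg hM hM' hχ hL) (inK M') (cov_gaugeAlg hM hM' hχ hL hD)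

theorem gaugeMap_inK (hD : D.IsHopf) (h : K) : gaugeMap hM hM' hχ hL hD (inK M h) = inK M' h :=
  bosLift_inK _ _ _ (cov_gaugeAlg hM hM' hχ hL hD) h

theorem gaugeMap_inB (hD : D.IsHopf) (b : RingQuot rel) :
    gaugeMap hM hM' hχ hL hD (inB M b) = gaugeAlg hM hM' hχ hL b :=
  bosLift_inB _ _ _ (cov_gaugeAlg hM hM' hχ hL hD) b

theorem gaugeMap_gen (hD : D.IsHopf) (x : ι) :
    gaugeMap hM hM' hχ hL hD (inB M (gen rel x)) = gaugeB M' χ (gen rel' x) := by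
  rw [gaugeMap_inB, gaugeAlg_gen]

theorem gaugeMap_cross (hD : D.IsHopf) (x : ι) (T : K ⊗[k] K) :
    gaugeMap hM hM' hχ hL hD
      (M.cross (inB M).toLinearMap (inK M).toLinearMap (gen rel x) T) =
      M'.cross (inB M').toLinearMap (inK M').toLinearMap (gen rel' x) (χ * T) := by
  rw [← cross_gaugeAlg hM hM' hχ hL]
  induction T with
  | zero => simp
  | add p q hp hq => simp only [map_add, hp, hq]
  | tmul s t =>
    simp only [cross_tmul, AlgHom.toLinearMap_apply, map_mul, gaugeMap_inB, gaugeMap_inK]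

/-- A gauge map sends the cross term of a tensor `T` to that of `χ T`, so two of them compose to the
cross term of `χ' χ = 1`. -/
theorem gaugeMap_comp (hD : D.IsHopf) (hD' : D'.IsHopf) {χ' : K ⊗[k] K}
    (hχ' : D'.IsGauge D χ') (hL' : ∀ c ∈ L', (tensorRep ρ χ').mulVec c ∈ L) (h : χ' * χ = 1) :
    (gaugeMap hM' hM hχ' hL' hD').comp (gaugeMap hM hM' hχ hL hD) = AlgHom.id k _ := by
  refine bos_algHom_ext (DFunLike.congr_fun
    (f := ((gaugeMap hM' hM hχ' hL' hD').comp (gaugeMap hM hM' hχ hL hD)).comp (inB M))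
    (g := (AlgHom.id k _).comp (inB M)) (gen_algHom_ext fun x => ?_)) fun h => ?_
  · simp only [AlgHom.comp_apply, gaugeMap_gen]
    rw [gaugeB, gaugeMap_cross, h]
    simp [Algebra.TensorProduct.one_def]
  · simp only [AlgHom.comp_apply, gaugeMap_inK]
    rfl

end GaugeMap

end QPoincare

end

noncomputable section

namespace QPoincare

/-! ### Compatibility of the isomorphism with the coproducts -/

section GaugeHopf

variable {k : Type u} [CommRing k]

/-- A bialgebra isomorphism of Hopf algebras respects the antipodes. -/
theorem isHopfIso_of_bialgebra {A : Type v} {A' : Type w} [Ring A] [Algebra k A] [Ring A']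
    [Algebra k A'] {E : HopfData k A} {E' : HopfData k A'} (hE : E.IsHopf) (hE' : E'.IsHopf)
    (θ : A ≃ₐ[k] A')
    (hc : ∀ a, E'.comul (θ a) = Algebra.TensorProduct.map θ.toAlgHom θ.toAlgHom (E.comul a))
    (he : ∀ a, E'.counit (θ a) = E.counit a) : IsHopfIso E E' θ := by
  refine ⟨hc, he, fun a => ?_⟩
  let _ := hE.hopfAlgebra
  have h : WithConv.toConv (E'.antipode ∘ₗ θ.toLinearMap) =
      WithConv.toConv (θ.toLinearMap ∘ₗ E.antipode) := by
    refine left_inv_eq_right_inv (a := WithConv.toConv θ.toLinearMap) ?_ ?_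
    · ext a
      have h1 : ∀ T : A ⊗[k] A, LinearMap.mul' k A' (TensorProduct.map
          (E'.antipode ∘ₗ θ.toLinearMap) θ.toLinearMap T) = LinearMap.mul' k A'
          (E'.antipode.rTensor A' (Algebra.TensorProduct.map θ.toAlgHom θ.toAlgHom T)) :=
        fun T => by
        induction T with
        | zero => simp
        | add p q hp hq => simp only [map_add, hp, hq]
        | tmul s t => rfl
      refine (h1 (E.comul a)).trans ?_
      rw [← hc, hE'.antipode_left, he]
      rfl
    · ext a
      have h1 : ∀ T : A ⊗[k] A, LinearMap.mul' k A' (TensorProduct.map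
          θ.toLinearMap (θ.toLinearMap ∘ₗ E.antipode) T) = θ (LinearMap.mul' k A
          (E.antipode.lTensor A T)) :=
        fun T => by
        induction T with
        | zero => simp
        | add p q hp hq => simp only [map_add, hp, hq]
        | tmul s t => simp
      refine (h1 (E.comul a)).trans ?_
      rw [hE.antipode_right, AlgEquiv.commutes]
      rfl
  exact LinearMap.congr_fun (WithConv.toConv_injective h) a

variable {K : Type v} [Ring K] [Algebra k K] {D D' : HopfData k K}

/-- The `p ⊗ 1` part of the identity `Δ'(θ p) χ = χ (θ ⊗ θ)(Δ p)`: the two sides are the two sides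
of coherence. -/
theorem bosFst_gauge {B : Type w} [Ring B] [Algebra k B] (M : ModuleAlgebra D' B) {χ : K ⊗[k] K}
    (hχ : D.IsGauge D' χ) (b : B) :
    M.cross (bosFst M).toLinearMap (bosComulK M).toLinearMap b χ *
        Algebra.TensorProduct.map (inK M) (inK M) χ =
      Algebra.TensorProduct.map (inK M) (inK M) χ * gaugeB M χ b ⊗ₜ 1 := by
  let Y : K ⊗[k] (K ⊗[k] K) →ₗ[k] Bos M ⊗[k] Bos M :=
    TensorProduct.map (M.cross (inB M).toLinearMap (inK M).toLinearMap b) (inK M).toLinearMap ∘ₗ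
      (TensorProduct.assoc k K K K).symm.toLinearMap
  have h1 : ∀ x y : K ⊗[k] K, M.cross (bosFst M).toLinearMap (bosComulK M).toLinearMap b x *
      Algebra.TensorProduct.map (inK M) (inK M) y = Y (D'.comulR x * leg₂₃ k K y) := fun x y => by
    induction x with
    | zero => simp
    | add p q hp hq => simp only [map_add, add_mul, hp, hq]
    | tmul s t =>
      rw [cross_tmul, mul_assoc, HopfData.comulR_tmul, Algebra.TensorProduct.includeRight_apply,
        Algebra.TensorProduct.tmul_mul_tmul, mul_one]
      change inB M _ ⊗ₜ 1 * (Algebra.TensorProduct.map (inK M) (inK M) (D'.comul t) *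
        Algebra.TensorProduct.map (inK M) (inK M) y) = _
      rw [← map_mul]
      generalize D'.comul t * y = z
      induction z with
      | zero => simp
      | add p q hp hq => simp only [map_add, mul_add, TensorProduct.tmul_add, hp, hq]
      | tmul a c => simp [Y]
  have h2 : ∀ x y : K ⊗[k] K, Algebra.TensorProduct.map (inK M) (inK M) x * gaugeB M y b ⊗ₜ 1 =
      Y (D'.comulL x * leg₁₂ k K y) := fun x y => by
    have h3 : leg₁₂ k K y = Algebra.TensorProduct.assoc k k k K K K (y ⊗ₜ 1) := by
      induction y with
      | zero => simp
      | add p q hp hq => simp only [map_add, TensorProduct.add_tmul, hp, hq]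
      | tmul a d => rfl
    induction x with
    | zero => simp
    | add p q hp hq => simp only [map_add, add_mul, hp, hq]
    | tmul s t =>
      rw [Algebra.TensorProduct.map_tmul, Algebra.TensorProduct.tmul_mul_tmul, mul_one, gaugeB,
        bos_comul_mul, HopfData.comulL_tmul, h3, ← map_mul, Algebra.TensorProduct.tmul_mul_tmul,
        mul_one]
      change _ = TensorProduct.map _ _ ((TensorProduct.assoc k K K K).symm
        ((TensorProduct.assoc k K K K) ((D'.comul s * y) ⊗ₜ t)))
      rw [LinearEquiv.symm_apply_apply]
      rfl
  rw [h1, hχ.coherence, ← h2]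

/-- The coaction part of the same identity. Besides coherence it uses the intertwining axiom for
`R'` and the relation `R' χ = χ₂₁ R` of the quasitriangular structures. The family `G` is left
abstract because in the application the translates are taken in the source algebra and then mapped
by `θ`. -/
theorem bosCoact_gauge {B : Type w} [Ring B] [Algebra k B] (M : ModuleAlgebra D' B) {χ : K ⊗[k] K}
    (hχ : D.IsGauge D' χ) {R : K ⊗[k] K} {R' : (K ⊗[k] K)ˣ} (hR' : D'.IsQuasitriangular R')
    (hRR' : (R' : K ⊗[k] K) * χ = flipHom k K χ * R) (b : B) (G : K →ₗ[k] Bos M)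
    (hG : ∀ s, G s = gaugeB M χ (M.act s b)) :
    M.cross ((bosCoact M).flip R') (bosComulK M).toLinearMap b χ *
        Algebra.TensorProduct.map (inK M) (inK M) χ =
      Algebra.TensorProduct.map (inK M) (inK M) χ *
        TensorProduct.comm k _ _ (TensorProduct.map G (inK M).toLinearMap R) := by
  let Y : K ⊗[k] (K ⊗[k] K) →ₗ[k] Bos M ⊗[k] Bos M :=
    TensorProduct.map (inK M).toLinearMap (M.cross (inB M).toLinearMap (inK M).toLinearMap b) ∘ₗ
      (perm₁₂ k K).toLinearMap
  have h1 : ∀ r x y : K ⊗[k] K, M.cross ((bosCoact M).flip r) (bosComulK M).toLinearMap b x *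
      Algebra.TensorProduct.map (inK M) (inK M) y =
      Y (leg₁₂ k K r * (D'.comulR x * leg₂₃ k K y)) := fun r x y => by
    induction x with
    | zero => simp
    | add p q hp hq => simp only [map_add, add_mul, mul_add, hp, hq]
    | tmul s t =>
      rw [cross_tmul, mul_assoc, HopfData.comulR_tmul,
        Algebra.TensorProduct.includeRight_apply (A := K) (b := y),
        Algebra.TensorProduct.tmul_mul_tmul, mul_one]
      change _ * (Algebra.TensorProduct.map (inK M) (inK M) (D'.comul t) *
        Algebra.TensorProduct.map (inK M) (inK M) y) = _
      rw [← map_mul, LinearMap.flip_apply]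
      generalize D'.comul t * y = z
      induction r with
      | zero => simp
      | add p q hp hq => simp only [map_add, add_mul, hp, hq]
      | tmul a c =>
        induction z with
        | zero => simp
        | add p q hp hq => simp only [map_add, mul_add, TensorProduct.tmul_add, hp, hq]
        | tmul d e => simp [Y]
  have h2 : ∀ x r : K ⊗[k] K, Algebra.TensorProduct.map (inK M) (inK M) x *
        TensorProduct.comm k _ _ (TensorProduct.map G (inK M).toLinearMap r) =
      Y (perm₁₂ k K (D'.comulR x * leg₂₃ k K χ) * leg₁₂ k K r) := fun x r => by
    induction x with
    | zero => simp
    | add p q hp hq => simp only [map_add, add_mul, hp, hq]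
    | tmul s t =>
      induction r with
      | zero => simp
      | add p q hp hq => simp only [map_add, mul_add, hp, hq]
      | tmul a c =>
        rw [TensorProduct.map_tmul, TensorProduct.comm_tmul, hG, Algebra.TensorProduct.map_tmul,
          Algebra.TensorProduct.tmul_mul_tmul, HopfData.comulR_tmul,
          Algebra.TensorProduct.includeRight_apply, Algebra.TensorProduct.tmul_mul_tmul, mul_one,
          gaugeB, bos_comul_mul, ← ModuleAlgebra.cross_mul_left]
        generalize D'.comul t * χ = z
        induction z with
        | zero => simp
        | add p q hp hq => simp only [map_add, add_mul, TensorProduct.tmul_add, hp, hq]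
        | tmul d e => simp [Y]
  rw [h1, h2, hχ.coherence, ← mul_assoc, ← hR'.perm₁₂_comulL, mul_assoc, ← map_mul, hRR',
    map_mul (leg₁₂ k K), map_mul (perm₁₂ k K), perm₁₂_leg₁₂, mul_assoc]

variable {ι : Type} [Fintype ι] [DecidableEq ι]
  {rel rel' : FreeAlgebra k ι → FreeAlgebra k ι → Prop}
  {L L' : Submodule k (ι × ι → k)} {ρ : K →ₐ[k] Matrix ι ι k} {R R' : (K ⊗[k] K)ˣ}
  {χ : (K ⊗[k] K)ˣ}
  {M : ModuleAlgebra D (RingQuot rel)} {M' : ModuleAlgebra D' (RingQuot rel')}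
  (hM : IsAdditive rel L ρ (R : K ⊗[k] K) M) (hM' : IsAdditive rel' L' ρ (R' : K ⊗[k] K) M')
  (hχ : D.IsGauge D' (χ : K ⊗[k] K))
  (hL : ∀ c ∈ L, (tensorRep ρ (χ : K ⊗[k] K)).mulVec c ∈ L')
  (hD : D.IsHopf) (hD' : D'.IsHopf) (hR : D.IsQuasitriangular R) (hR' : D'.IsQuasitriangular R')

theorem comul_gaugeB (x : ι) (T : K ⊗[k] K) :
    (hM'.bosHopf hD' hR').comul (M'.cross (inB M').toLinearMap (inK M').toLinearMap
      (gen rel' x) T) =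
      M'.cross (bosFst M').toLinearMap (bosComulK M').toLinearMap (gen rel' x) T +
      M'.cross ((bosCoact M').flip R') (bosComulK M').toLinearMap (gen rel' x) T := by
  induction T with
  | zero => simp
  | add p q hp hq =>
    rw [map_add, map_add, hp, hq, map_add, map_add, add_add_add_comm]
  | tmul s t =>
    simp only [cross_tmul, AlgHom.toLinearMap_apply]
    rw [map_mul, hM'.comul_act_gen, hM'.comul_inK, add_mul]
    rfl

/-- Both sides are algebra maps, so they are compared on `K`, where the intertwining of the
coproducts suffices, and on the generators of `B`, where `bosFst_gauge` and `bosCoact_gauge` account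
for the two terms of `Δ p`. -/
theorem comul_gaugeMap (hRR' : (R' : K ⊗[k] K) * χ = flipHom k K χ * R) (a : Bos M) :
    (hM'.bosHopf hD' hR').comul (gaugeMap hM hM' hχ hL hD a) =
      Algebra.TensorProduct.map (gaugeMap hM hM' hχ hL hD) (gaugeMap hM hM' hχ hL hD)
        (((hM.bosHopf hD hR).twist (bosUnit M χ)).comul a) := by
  set θ := gaugeMap hM hM' hχ hL hD with hθ
  refine DFunLike.congr_fun (f := (hM'.bosHopf hD' hR').comul.comp θ)
    (g := (Algebra.TensorProduct.map θ θ).comp ((hM.bosHopf hD hR).twist (bosUnit M χ)).comul)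
    ?_ a
  have hX : ∀ y : K ⊗[k] K, Algebra.TensorProduct.map θ θ
      (Algebra.TensorProduct.map (inK M) (inK M) y) =
      Algebra.TensorProduct.map (inK M') (inK M') y := fun y => by
    induction y with
    | zero => simp
    | add p q hp hq => simp only [map_add, hp, hq]
    | tmul s t => simp [hθ, gaugeMap_inK]
  have hXi : ∀ z : Bos M' ⊗[k] Bos M', z * Algebra.TensorProduct.map (inK M') (inK M')
      (χ : K ⊗[k] K) * Algebra.TensorProduct.map (inK M') (inK M') (↑χ⁻¹ : K ⊗[k] K) = z :=
    fun z => by rw [mul_assoc, ← map_mul, Units.mul_inv, map_one, mul_one]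
  have hT : ∀ a, Algebra.TensorProduct.map θ θ (((hM.bosHopf hD hR).twist (bosUnit M χ)).comul a) =
      Algebra.TensorProduct.map (inK M') (inK M') (χ : K ⊗[k] K) *
      Algebra.TensorProduct.map θ θ ((hM.bosHopf hD hR).comul a) *
      Algebra.TensorProduct.map (inK M') (inK M') (↑χ⁻¹ : K ⊗[k] K) := fun a => by
    rw [twist_comul, map_mul, map_mul, ← hX, ← hX]
    rfl
  refine bos_algHom_ext (DFunLike.congr_fun
    (f := ((hM'.bosHopf hD' hR').comul.comp θ).comp (inB M))
    (g := ((Algebra.TensorProduct.map θ θ).comp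
      ((hM.bosHopf hD hR).twist (bosUnit M χ)).comul).comp (inB M))
    (gen_algHom_ext fun x => ?_)) fun h => ?_
  · simp only [AlgHom.comp_apply]
    have hG : ∀ y : K ⊗[k] K, Algebra.TensorProduct.map θ θ (bosCoact M (gen rel x) y) =
        TensorProduct.comm k _ _ (TensorProduct.map ((gaugeAlg hM hM' hχ hL).toLinearMap ∘ₗ
          M.act.toLinearMap.flip (gen rel x)) (inK M').toLinearMap y) := fun y => by
      induction y with
      | zero => simp
      | add p q hp hq => simp only [map_add, hp, hq]
      | tmul s t =>
        rw [bosCoact_tmul, Algebra.TensorProduct.map_tmul, hθ, gaugeMap_inK, gaugeMap_inB]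
        rfl
    rw [hT, hM.comul_gen, map_add, hG, bosFst_apply, Algebra.TensorProduct.map_tmul, map_one, hθ,
      gaugeMap_gen, mul_add, ← bosFst_gauge M' hχ, ← bosCoact_gauge M' hχ hR' hRR' (gen rel' x) _
        (gaugeAlg_act hM hM' hχ hL · x), ← add_mul, hXi, gaugeB, comul_gaugeB]
  · simp only [AlgHom.comp_apply]
    rw [hT, hM.comul_inK, hX, hθ, gaugeMap_inK, hM'.comul_inK, ← map_mul, ← hχ.intertwine, map_mul,
      hXi]

theorem counit_gaugeMap (hc : ∀ h, D'.counit h = D.counit h) (a : Bos M) :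
    (hM'.bosHopf hD' hR').counit (gaugeMap hM hM' hχ hL hD a) = (hM.bosHopf hD hR).counit a := by
  refine DFunLike.congr_fun (f := (hM'.bosHopf hD' hR').counit.comp (gaugeMap hM hM' hχ hL hD))
    (g := (hM.bosHopf hD hR).counit) ?_ a
  refine bos_algHom_ext (DFunLike.congr_fun
    (f := ((hM'.bosHopf hD' hR').counit.comp (gaugeMap hM hM' hχ hL hD)).comp (inB M))
    (g := (hM.bosHopf hD hR).counit.comp (inB M))
    (gen_algHom_ext fun x => ?_)) fun h => ?_
  · simp only [AlgHom.comp_apply]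
    rw [gaugeMap_gen, hM.counit_gen, gaugeB]
    generalize (χ : K ⊗[k] K) = T
    induction T with
    | zero => simp
    | add p q hp hq => rw [map_add, map_add, hp, hq, add_zero]
    | tmul s t => simp [hM'.counit_act_gen]
  · simp only [AlgHom.comp_apply]
    rw [gaugeMap_inK, hM.counit_inK, hM'.counit_inK, hc]

/-- The isomorphism of the bosonisation with its twist. -/
def gaugeEquiv (hχ' : D'.IsGauge D (↑χ⁻¹ : K ⊗[k] K))
    (hL' : ∀ c ∈ L', (tensorRep ρ (↑χ⁻¹ : K ⊗[k] K)).mulVec c ∈ L) : Bos M ≃ₐ[k] Bos M' :=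
  AlgEquiv.ofAlgHom (gaugeMap hM hM' hχ hL hD) (gaugeMap hM' hM hχ' hL' hD')
    (gaugeMap_comp hM' hM hχ' hL' hD' hD hχ hL (Units.mul_inv χ))
    (gaugeMap_comp hM hM' hχ hL hD hD' hχ' hL' (Units.inv_mul χ))

theorem IsAdditive.isCocycle_bosUnit (hc : D.IsCocycle χ) :
    (hM.bosHopf hD hR).IsCocycle (bosUnit M χ) :=
  hc.map (inK M) (hM.comul_inK hD hR) (hM.counit_inK hD hR)

theorem isHopfIso_gaugeEquiv (hc : ∀ h, D'.counit h = D.counit h)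
    (hχ' : D'.IsGauge D (↑χ⁻¹ : K ⊗[k] K))
    (hL' : ∀ c ∈ L', (tensorRep ρ (↑χ⁻¹ : K ⊗[k] K)).mulVec c ∈ L)
    (hRR' : (R' : K ⊗[k] K) * χ = flipHom k K χ * R) (hχc : D.IsCocycle χ) :
    IsHopfIso ((hM.bosHopf hD hR).twist (bosUnit M χ)) (hM'.bosHopf hD' hR')
      (gaugeEquiv hM hM' hχ hL hD hD' hχ' hL') :=
  isHopfIso_of_bialgebra
    ((hM.isCocycle_bosUnit hD hR hχc).isHopf_twist (hM.isHopf_bosHopf hD hR))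
    (hM'.isHopf_bosHopf hD' hR') _ (comul_gaugeMap hM hM' hχ hL hD hD' hR hR' hRR')
    (counit_gaugeMap hM hM' hχ hL hD hD' hR hR' hc)

end GaugeHopf

end QPoincare

end

noncomputable section

namespace QPoincare

/-! ### The relations of the momenta -/

section Coefficients

variable {k : Type u} [CommRing k] {N : ℕ}

theorem permP_mul (A : Matrix (Fin N × Fin N) (Fin N × Fin N) k) (u v : Fin N × Fin N) :
    (permP k N * A) u v = A u.swap v := by
  rw [Matrix.mul_apply, Finset.sum_eq_single u.swap]
  · simp [permP, Matrix.one_apply]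
  · intro w _ hw
    have : u ≠ w.swap := fun h => hw (by rw [h, Prod.swap_swap])
    simp [permP, this]
  · simp

theorem mul_permP (A : Matrix (Fin N × Fin N) (Fin N × Fin N) k) (u v : Fin N × Fin N) :
    (A * permP k N) u v = A u v.swap := by
  rw [Matrix.mul_apply, Finset.sum_eq_single v.swap]
  · simp [permP, Matrix.one_apply]
  · intro w _ hw
    simp [permP, hw]
  · simp

theorem permP_mul_permP : permP k N * permP k N = 1 := by
  ext u v
  rw [permP_mul]
  simp [permP, Matrix.one_apply]

theorem permP_mul_cancel (A : Matrix (Fin N × Fin N) (Fin N × Fin N) k) :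
    permP k N * (permP k N * A) = A := by
  rw [← mul_assoc, permP_mul_permP, one_mul]

theorem transpose_permP : (permP k N).transpose = permP k N := by
  ext u v
  simp only [Matrix.transpose_apply, permP, Matrix.submatrix_apply, id, Matrix.one_apply]
  congr 1
  exact propext ⟨fun h => by rw [h, Prod.swap_swap], fun h => by rw [h, Prod.swap_swap]⟩

/-- The coefficients `c(x, y)`, `x = (a, j)`, `y = (b, l)`, of a quadratic expression as a matrix
with rows `(a, b)` and columns `(j, l)`. -/
def coeffMat : ((Fin N × Fin N) × (Fin N × Fin N) → k) →ₗ[k]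
    Matrix (Fin N × Fin N) (Fin N × Fin N) k where
  toFun c := Matrix.of fun u v => c ((u.1, v.1), (u.2, v.2))
  map_add' _ _ := rfl
  map_smul' _ _ := rfl

theorem coeffMat_apply (c : (Fin N × Fin N) × (Fin N × Fin N) → k) (u v : Fin N × Fin N) :
    coeffMat c u v = c ((u.1, v.1), (u.2, v.2)) := rfl

theorem coeffMat_injective : Function.Injective (coeffMat (k := k) (N := N)) := fun c d h => by
  funext z
  exact congrFun (congrFun h (z.1.1, z.2.1)) (z.1.2, z.2.2)

/-- The reason for arranging coefficients as matrices: the first copy acts on the row indices `(a,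
b)` and the second on the column indices `(j, l)`, so the joint action is a two-sided
multiplication. -/
theorem coeffMat_kronecker (A₁ A₂ B₁ B₂ : Matrix (Fin N) (Fin N) k)
    (c : (Fin N × Fin N) × (Fin N × Fin N) → k) :
    coeffMat (((A₁ ⊗ₖ A₂) ⊗ₖ (B₁ ⊗ₖ B₂)).mulVec c) =
      (A₁ ⊗ₖ B₁) * coeffMat c * (A₂ ⊗ₖ B₂).transpose := by
  ext ⟨a, b⟩ ⟨j, l⟩
  simp only [coeffMat_apply, Matrix.mulVec, dotProduct, Matrix.mul_apply, Fintype.sum_prod_type,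
    Matrix.kroneckerMap_apply, Matrix.transpose_apply, Finset.sum_mul]
  have e : ∀ F : Fin N → Fin N → Fin N → Fin N → k, ∑ x, ∑ y, ∑ z, ∑ w, F x y z w =
      ∑ y, ∑ w, ∑ x, ∑ z, F x y z w := fun F => by
    rw [Finset.sum_comm]
    refine Finset.sum_congr rfl fun y _ => ?_
    rw [Finset.sum_comm' (t' := Finset.univ) (s' := fun _ => Finset.univ) (by simp)]
    rw [Finset.sum_comm]
    conv_lhs => enter [2, x]; rw [Finset.sum_comm]
    rw [Finset.sum_comm]
  rw [e]
  refine Finset.sum_congr rfl fun _ _ => Finset.sum_congr rfl fun _ _ =>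
    Finset.sum_congr rfl fun _ _ => Finset.sum_congr rfl fun _ _ => ?_
  ring

variable (R : Matrix (Fin N × Fin N) (Fin N × Fin N) k)

/-- The coefficients of `R₂₁ p₁ p₂ - p₂ p₁ R`. -/
def eucCoeff (x y : Fin N × Fin N) (z : (Fin N × Fin N) × (Fin N × Fin N)) : k :=
  R x.swap (z.2.1, z.1.1) * (if (z.1.2, z.2.2) = y then 1 else 0) -
    (if (z.2.1, z.1.1) = x then 1 else 0) * R (z.2.2, z.1.2) y

/-- The coefficients of `R₂₁ p₁ R p₂ - p₂ R₂₁ p₁ R`. -/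
def minkCoeff (x y : Fin N × Fin N) (z : (Fin N × Fin N) × (Fin N × Fin N)) : k :=
  (∑ b, R x.swap (b, z.1.1) * R (z.1.2, b) (y.1, z.2.1)) * (if z.2.2 = y.2 then 1 else 0) -
    (if z.1.1 = x.2 then 1 else 0) * ∑ e, R (z.1.2, x.1) (e, z.2.1) * R (z.2.2, e) y

/-- The defining relations are the values of `E ↦ P Rᵀ E - E Rᵀ P` at `E = P e_{xy}`, with `e_{xy}`
the matrix units. -/
theorem coeffMat_eucCoeff (x y : Fin N × Fin N) : coeffMat (eucCoeff R x y) =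
    permP k N * R.transpose * (permP k N * Matrix.single x y 1) -
      permP k N * Matrix.single x y 1 * (R.transpose * permP k N) := by
  ext u v
  have h1 : (permP k N * R.transpose * (permP k N * Matrix.single x y (1 : k))) u v =
      R x.swap u.swap * if v = y then 1 else 0 := by
    rw [mul_assoc, permP_mul, Matrix.mul_apply, Finset.sum_eq_single x.swap]
    · rw [permP_mul, Prod.swap_swap, Matrix.transpose_apply]
      simp [Matrix.single_apply, eq_comm]
    · intro w _ hw
      have : x ≠ w.swap := fun h => hw (by rw [h, Prod.swap_swap])
      rw [permP_mul]
      simp [this]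
    · simp
  have h2 : (permP k N * Matrix.single x y (1 : k) * (R.transpose * permP k N)) u v =
      (if u.swap = x then 1 else 0) * R v.swap y := by
    rw [mul_assoc, permP_mul, ← mul_assoc, mul_permP, Matrix.mul_apply, Finset.sum_eq_single y]
    · simp [Matrix.single_apply, eq_comm]
    · intro w _ hw
      simp [hw.symm]
    · simp
  rw [Matrix.sub_apply, h1, h2]
  rfl

/-- The span of the relations of `Ā(R)`. -/
def eucSpan : Submodule k ((Fin N × Fin N) × (Fin N × Fin N) → k) :=
  Submodule.span k (Set.range fun z : (Fin N × Fin N) × (Fin N × Fin N) => eucCoeff R z.1 z.2)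

/-- The span of the relations of `B(R)`. -/
def minkSpan : Submodule k ((Fin N × Fin N) × (Fin N × Fin N) → k) :=
  Submodule.span k (Set.range fun z : (Fin N × Fin N) × (Fin N × Fin N) => minkCoeff R z.1 z.2)

theorem mul_freeP₁ (A : Matrix (Fin N × Fin N) (Fin N × Fin N) (FreeAlgebra k (Fin N × Fin N)))
    (x : Fin N × Fin N) (m n : Fin N) : (A * freeP₁ k N) x (m, n) =
      ∑ a, A x (a, n) * FreeAlgebra.ι k (a, m) := by
  simp [Matrix.mul_apply, freeP₁, freeP, Fintype.sum_prod_type, Matrix.one_apply]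

theorem mul_freeP₂ (A : Matrix (Fin N × Fin N) (Fin N × Fin N) (FreeAlgebra k (Fin N × Fin N)))
    (x : Fin N × Fin N) (m n : Fin N) : (A * freeP₂ k N) x (m, n) =
      ∑ b, A x (m, b) * FreeAlgebra.ι k (b, n) := by
  simp [Matrix.mul_apply, freeP₂, freeP, Fintype.sum_prod_type, Matrix.one_apply]

theorem freeP₂_apply (i j m n : Fin N) : freeP₂ k N (i, j) (m, n) =
    if i = m then FreeAlgebra.ι k (j, n) else 0 := by
  simp [freeP₂, freeP, Matrix.one_apply]

theorem mul_scalarMat (A : Matrix (Fin N × Fin N) (Fin N × Fin N) (FreeAlgebra k (Fin N × Fin N)))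
    (x y : Fin N × Fin N) : (A * scalarMat R) x y = ∑ i, ∑ j, R (i, j) y • A x (i, j) := by
  simp only [Matrix.mul_apply, scalarMat, Matrix.map_apply, Fintype.sum_prod_type,
    ← Algebra.commutes, ← Algebra.smul_def]

theorem scalarMat_apply (x y : Fin N × Fin N) :
    scalarMat R x y = algebraMap k (FreeAlgebra k (Fin N × Fin N)) (R x y) := rfl

theorem freeP₂_mul_scalarMat (i j m n : Fin N) : (freeP₂ k N * scalarMat R) (i, j) (m, n) =
    ∑ b, R (i, b) (m, n) • FreeAlgebra.ι k (j, b) := by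
  rw [mul_scalarMat]
  simp [freeP₂_apply]

theorem quad_eucCoeff (x y : Fin N × Fin N) :
    (scalarMat (flipR R) * freeP₁ k N * freeP₂ k N) x y -
      (freeP₂ k N * freeP₁ k N * scalarMat R) x y =
    quad (FreeAlgebra.ι k) (eucCoeff R x y) := by
  obtain ⟨i, j⟩ := x
  obtain ⟨m, n⟩ := y
  simp only [quad_apply, eucCoeff, sub_smul, Finset.sum_sub_distrib, Fintype.sum_prod_type,
    Prod.mk.injEq, Prod.swap_prod_mk]
  congr 1
  · rw [mul_freeP₂]
    simp only [mul_freeP₁, Finset.sum_mul, scalarMat, flipR, Matrix.map_apply,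
      Matrix.submatrix_apply, Prod.swap_prod_mk, ← Algebra.smul_def, smul_mul_assoc]
    rw [Finset.sum_comm]
    simp [ite_and]
  · rw [mul_scalarMat]
    simp only [mul_freeP₁, freeP₂_apply]
    simp [ite_and]
    rw [Finset.sum_comm]

theorem quad_minkCoeff (x y : Fin N × Fin N) :
    (scalarMat (flipR R) * freeP₁ k N * scalarMat R * freeP₂ k N) x y -
      (freeP₂ k N * scalarMat (flipR R) * freeP₁ k N * scalarMat R) x y =
    quad (FreeAlgebra.ι k) (minkCoeff R x y) := by
  obtain ⟨i, j⟩ := x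
  obtain ⟨m, n⟩ := y
  simp only [quad_apply, minkCoeff, sub_smul, Finset.sum_sub_distrib, Fintype.sum_prod_type,
    Prod.swap_prod_mk]
  congr 1
  · rw [mul_freeP₂]
    simp only [mul_scalarMat, mul_freeP₁, scalarMat_apply, flipR, Finset.sum_mul, Finset.smul_sum,
      Matrix.submatrix_apply, Prod.swap_prod_mk, ← Algebra.smul_def, smul_mul_assoc, smul_smul,
      mul_ite, mul_one, mul_zero, ite_smul, zero_smul, Finset.sum_ite_eq', Finset.sum_smul,
      Finset.mem_univ, if_true]
    have e : ∀ F : Fin N → Fin N → Fin N → Fin N → FreeAlgebra k (Fin N × Fin N),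
        ∑ x, ∑ y, ∑ z, ∑ w, F x y z w = ∑ w, ∑ y, ∑ x, ∑ z, F x y z w := fun F => by
      conv_lhs => enter [2, x, 2, y]; rw [Finset.sum_comm]
      conv_lhs => enter [2, x]; rw [Finset.sum_comm]
      rw [Finset.sum_comm]
      conv_lhs => enter [2, w]; rw [Finset.sum_comm]
    rw [e]
    simp only [mul_comm]
  · rw [mul_scalarMat]
    simp only [mul_freeP₁, freeP₂_mul_scalarMat, flipR, Finset.sum_mul, Finset.smul_sum,
      Matrix.submatrix_apply, Prod.swap_prod_mk, smul_mul_assoc, smul_smul,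
      ite_mul, one_mul, zero_mul, ite_smul, zero_smul, Finset.sum_smul]
    have e : ∀ F : Fin N → Fin N → Fin N → Fin N → FreeAlgebra k (Fin N × Fin N),
        ∑ x, ∑ y, ∑ z, ∑ w, F x y z w = ∑ w, ∑ z, ∑ x, ∑ y, F x y z w := fun F => by
      conv_lhs => enter [2, x, 2, y]; rw [Finset.sum_comm]
      conv_lhs => enter [2, x]; rw [Finset.sum_comm]
      rw [Finset.sum_comm]
      conv_lhs => enter [2, w, 2, x]; rw [Finset.sum_comm]
      conv_lhs => enter [2, w]; rw [Finset.sum_comm]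
    rw [e]
    conv_rhs => rw [Finset.sum_eq_single j (fun x _ hx => by simp [hx]) (by simp)]
    simp only [if_true, mul_comm]

theorem isQuadratic_span {ι κ : Type} [Fintype ι]
    {rel : FreeAlgebra k ι → FreeAlgebra k ι → Prop} (c : κ → ι × ι → k) (l r : κ → FreeAlgebra k ι)
    (of_rel : ∀ a b, rel a b → ∃ z, a = l z ∧ b = r z) (rel_of : ∀ z, rel (l z) (r z))
    (h : ∀ z, l z - r z = quad (FreeAlgebra.ι k) (c z)) :
    IsQuadratic rel (Submodule.span k (Set.range c)) where
  of_rel a b hab := by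
    obtain ⟨z, rfl, rfl⟩ := of_rel a b hab
    exact ⟨c z, Submodule.subset_span ⟨z, rfl⟩, h z⟩
  quad_eq_zero d hd := by
    have hle : Submodule.span k (Set.range c) ≤ LinearMap.ker (quad (gen rel)) := by
      rw [Submodule.span_le]
      rintro _ ⟨z, rfl⟩
      have e := RingQuot.mkAlgHom_rel k (rel_of z)
      rw [← sub_eq_zero, ← map_sub, h z, map_quad] at e
      exact e
    exact hle hd

theorem isQuadratic_eucRel : IsQuadratic (EucRel R) (eucSpan R) :=
  isQuadratic_span _ (fun z => (scalarMat (flipR R) * freeP₁ k N * freeP₂ k N) z.1 z.2)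
    (fun z => (freeP₂ k N * freeP₁ k N * scalarMat R) z.1 z.2)
    (fun a b h => by obtain ⟨x, y⟩ := h; exact ⟨(x, y), rfl, rfl⟩)
    (fun z => .rel z.1 z.2) fun z => quad_eucCoeff R z.1 z.2

theorem isQuadratic_minkRel : IsQuadratic (MinkRel R) (minkSpan R) :=
  isQuadratic_span _
    (fun z => (scalarMat (flipR R) * freeP₁ k N * scalarMat R * freeP₂ k N) z.1 z.2)
    (fun z => (freeP₂ k N * scalarMat (flipR R) * freeP₁ k N * scalarMat R) z.1 z.2)
    (fun a b h => by obtain ⟨x, y⟩ := h; exact ⟨(x, y), rfl, rfl⟩)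
    (fun z => .rel z.1 z.2) fun z => quad_minkCoeff R z.1 z.2

/-- The matrices `P e_{xy}` span all matrices, so the span of the relations is the whole image of `E
↦ P Rᵀ E - E Rᵀ P`. Invariance and antisymmetry become matrix identities in an arbitrary `E`. -/
theorem mem_eucSpan_iff (c : (Fin N × Fin N) × (Fin N × Fin N) → k) :
    c ∈ eucSpan R ↔ ∃ E, coeffMat c =
      permP k N * R.transpose * E - E * (R.transpose * permP k N) := by
  constructor
  · intro h
    induction h using Submodule.span_induction with
    | mem c h =>
      obtain ⟨z, rfl⟩ := h
      exact ⟨_, coeffMat_eucCoeff R z.1 z.2⟩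
    | zero => exact ⟨0, by simp⟩
    | add c d _ _ hc hd =>
      obtain ⟨E, hE⟩ := hc
      obtain ⟨F, hF⟩ := hd
      exact ⟨E + F, by rw [map_add, hE, hF, mul_add, add_mul]; abel⟩
    | smul r c _ hc =>
      obtain ⟨E, hE⟩ := hc
      exact ⟨r • E, by rw [map_smul, hE, smul_sub, mul_smul_comm, smul_mul_assoc]⟩
  · rintro ⟨E, hE⟩
    -- The relation with indices `x`, `y` comes from `P e_{xy}`, and `E = P (P E)`, so the
    -- coefficients are the entries of `P E`.
    have e : c = ∑ x, ∑ y, (permP k N * E) x y • eucCoeff R x y := by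
      apply coeffMat_injective
      have h1 : ∀ (r : k) x y, r • (permP k N * R.transpose * (permP k N * Matrix.single x y 1)) =
          permP k N * R.transpose * (permP k N * Matrix.single x y r) := fun r x y => by
        rw [← mul_smul_comm, ← mul_smul_comm, Matrix.smul_single, smul_eq_mul, mul_one]
      have h2 : ∀ (r : k) x y, r • (permP k N * Matrix.single x y 1 * (R.transpose * permP k N)) =
          permP k N * Matrix.single x y r * (R.transpose * permP k N) := fun r x y => by
        rw [← smul_mul_assoc, ← mul_smul_comm, Matrix.smul_single, smul_eq_mul, mul_one]
      rw [hE]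
      simp only [map_sum, map_smul, coeffMat_eucCoeff, smul_sub, Finset.sum_sub_distrib, h1, h2,
        ← Finset.mul_sum, ← Finset.sum_mul, ← Matrix.matrix_eq_sum_single, permP_mul_cancel]
    rw [e]
    exact Submodule.sum_mem _ fun x _ => Submodule.sum_mem _ fun y _ =>
      Submodule.smul_mem _ _ (Submodule.subset_span ⟨(x, y), rfl⟩)

variable {R}

/-- The transposed Hecke condition, multiplied out; it applies to `Rᵀ P` since `P` is symmetric. -/
theorem IsHecke.sq {q : kˣ} (hR : IsHecke q R) :
    R.transpose * permP k N * (R.transpose * permP k N) =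
      ((q : k) - (↑q⁻¹ : k)) • (R.transpose * permP k N) + 1 := by
  have h := congrArg Matrix.transpose (show _ = _ from hR)
  simp only [Matrix.transpose_mul, Matrix.transpose_add, Matrix.transpose_sub, Matrix.transpose_smul,
    Matrix.transpose_one, transpose_permP, Matrix.transpose_zero] at h
  rw [add_mul, mul_sub, mul_sub, mul_smul_comm, smul_mul_assoc, smul_mul_smul_comm, mul_one, one_mul,
    mul_one, Units.inv_mul, one_smul] at h
  rw [sub_smul, ← sub_eq_zero, ← h]
  abel

/-- The relations of `Ā(R)` are antisymmetric for the braiding. -/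
theorem IsHecke.antisymm {q : kˣ} (hR : IsHecke q R)
    {c : (Fin N × Fin N) × (Fin N × Fin N) → k} (hc : c ∈ eucSpan R) (u v : Fin N × Fin N) :
    (R.transpose * coeffMat c * R.transpose) u v = -coeffMat c u.swap v.swap := by
  obtain ⟨E, hE⟩ := (mem_eucSpan_iff R c).mp hc
  set g' := R.transpose * permP k N with hg'
  set g := permP k N * R.transpose with hg
  have hsq' : g' * g' = ((q : k) - (↑q⁻¹ : k)) • g' + 1 := hR.sq
  have hgg' : g = permP k N * g' * permP k N := by
    rw [hg, hg', mul_assoc, mul_assoc, permP_mul_permP, mul_one]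
  have hsq : g * g = ((q : k) - (↑q⁻¹ : k)) • g + 1 := by
    have : g * g = permP k N * (g' * g') * permP k N := by
      rw [hgg']
      simp only [mul_assoc, permP_mul_cancel]
    rw [this, hsq', mul_add, add_mul, mul_one, permP_mul_permP, mul_smul_comm, smul_mul_assoc,
      ← hgg']
  -- For `C = g E - E g'` one has `g C g' = g² E g' - g E g'²`. Both squares obey the same quadratic
  -- relation, so the terms with `q - q⁻¹` cancel and `E g' - g E = -C` is left.
  have key : g * coeffMat c * g' = -coeffMat c := by
    have : g * coeffMat c * g' = g * g * E * g' - g * E * (g' * g') := by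
      rw [hE, mul_sub, sub_mul]
      simp only [mul_assoc]
    rw [this, hsq, hsq', hE, add_mul, add_mul, mul_add, one_mul, mul_one, smul_mul_assoc,
      smul_mul_assoc, mul_smul_comm]
    abel
  have h1 : R.transpose * coeffMat c * R.transpose =
      permP k N * (g * coeffMat c * g') * permP k N := by
    rw [hg, hg']
    simp only [mul_assoc, permP_mul_cancel, permP_mul_permP, mul_one]
  rw [h1, mul_permP, permP_mul, key, Matrix.neg_apply]

end Coefficients

end QPoincare

end

noncomputable section

namespace QPoincare

/-! ### The representation on the momenta -/

section Representation

variable {k : Type u} [CommRing k] {H : Type v} [Ring H] [Algebra k H] {N : ℕ}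
  {D : HopfData k H} {W : (H ⊗[k] H)ˣ} (hD : D.IsHopf)
  (T : H →ₐ[k] Matrix (Fin N) (Fin N) k)

theorem tensorRep_flip {K : Type v} [Ring K] [Algebra k K] {ι : Type} [Fintype ι] [DecidableEq ι]
    (ρ : K →ₐ[k] Matrix ι ι k) (x : K ⊗[k] K) (u v : ι × ι) :
    tensorRep ρ (flipHom k K x) u v = tensorRep ρ x u.swap v.swap := by
  induction x with
  | zero => simp
  | add x y hx hy => simp only [map_add, Matrix.add_apply, hx, hy]
  | tmul a b => simp [tensorRep_tmul, mul_comm]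

theorem tensorRep_comm (x : H ⊗[k] H) :
    tensorRep T (flipHom k H x) = permP k N * tensorRep T x * permP k N := by
  ext u v
  rw [tensorRep_flip, mul_permP, permP_mul]

/-- The action of the coproduct commutes with `P R`. -/
theorem tensorRep_comul_comm (hW : D.IsQuasitriangular W) {μ : k} (hμ : IsUnit μ)
    {Q : Matrix (Fin N × Fin N) (Fin N × Fin N) k} (hQ : tensorRep T (W : H ⊗[k] H) = μ • Q) (h : H) :
    tensorRep T (D.comul h) * (permP k N * Q) = permP k N * Q * tensorRep T (D.comul h) := by
  have e := congrArg (tensorRep T) (hW.intertwine h)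
  rw [map_mul, map_mul, hQ, mul_smul_comm, smul_mul_assoc, hμ.smul_left_cancel] at e
  have e' : permP k N * tensorRep T (D.comul h) * permP k N * Q = Q * tensorRep T (D.comul h) := by
    rw [← e, ← tensorRep_comm]
    rfl
  rw [mul_assoc, ← e']
  simp only [mul_assoc, permP_mul_cancel]

/-- The contragredient representation `h ↦ T(S h)ᵀ`. -/
def contraRep : H →ₐ[k] Matrix (Fin N) (Fin N) k :=
  AlgHom.ofLinearMap
    ((Matrix.transposeLinearEquiv (Fin N) (Fin N) k k).toLinearMap ∘ₗ T.toLinearMap ∘ₗ D.antipode)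
    (by simp [hD.antipode_one])
    (fun a b => by simp [hD.antipode_mul, Matrix.transpose_mul])

theorem contraRep_apply (h : H) : contraRep hD T h = (T (D.antipode h)).transpose := rfl

theorem tensorRep_contraRep (x : H ⊗[k] H) : tensorRep (contraRep hD T) x =
    (tensorRep T (TensorProduct.map D.antipode D.antipode x)).transpose := by
  induction x with
  | zero => simp
  | add x y hx hy => simp only [map_add, Matrix.transpose_add, hx, hy]
  | tmul a b =>
    rw [TensorProduct.map_tmul, tensorRep_tmul, tensorRep_tmul, contraRep_apply, contraRep_apply,
      Matrix.kroneckerMap_transpose]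

/-- `(S ⊗ S) R = R`. -/
theorem HopfData.IsQuasitriangular.map_antipode (hD : D.IsHopf) (hW : D.IsQuasitriangular W) :
    TensorProduct.map D.antipode D.antipode (W : H ⊗[k] H) = W := by
  rw [← LinearMap.lTensor_comp_rTensor, LinearMap.comp_apply, hW.antipode_rTensor hD,
    hW.antipode_lTensor hD]

/-- The contragredient representation sees `Rᵀ` with the same scalar, because `(S ⊗ S)𝓡 = 𝓡`. -/
theorem tensorRep_contraRep_of {μ : k} {R : Matrix (Fin N × Fin N) (Fin N × Fin N) k}
    (hW : D.IsQuasitriangular W) (hT : tensorRep T (W : H ⊗[k] H) = μ • R) :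
    tensorRep (contraRep hD T) (W : H ⊗[k] H) = μ • R.transpose := by
  rw [tensorRep_contraRep, hW.map_antipode hD, hT, Matrix.transpose_smul]

/-- The representation of the dilatonic extension of two copies of `H` on the momenta. -/
def momentumRep : Dil k (H ⊗[k] H) →ₐ[k] Matrix (Fin N × Fin N) (Fin N × Fin N) k :=
  Algebra.TensorProduct.lift
    ((Matrix.kroneckerAlgEquiv (Fin N) (Fin N) k).toAlgHom.comp
      (Algebra.TensorProduct.map (contraRep hD T) T))
    ((Algebra.ofId k _).comp (Polynomial.aeval (-1 : k)))
    fun _ p => Algebra.commute_algebraMap_right (Polynomial.aeval (-1 : k) p) _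

theorem momentumRep_tmul (h g : H) (p : Polynomial k) :
    momentumRep hD T ((h ⊗ₜ g) ⊗ₜ p) = p.eval (-1) • (contraRep hD T h ⊗ₖ T g) := by
  change Matrix.kroneckerAlgEquiv (Fin N) (Fin N) k (contraRep hD T h ⊗ₜ T g) *
    algebraMap k _ (Polynomial.aeval (-1) p) = _
  rw [← Algebra.commutes, ← Algebra.smul_def]
  simp

theorem coeffMat_tensorRep (x y : H ⊗[k] H) (c : (Fin N × Fin N) × (Fin N × Fin N) → k) :
    coeffMat ((tensorRep (momentumRep hD T)
      (Algebra.TensorProduct.map (dilIncl k (H ⊗[k] H)) (dilIncl k (H ⊗[k] H))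
        (shuffle k H H (x ⊗ₜ y)))).mulVec c) =
      tensorRep (contraRep hD T) x * coeffMat c * (tensorRep T y).transpose := by
  induction x with
  | zero => simp
  | add x x' hx hx' =>
    simp only [TensorProduct.add_tmul, map_add, Matrix.add_mulVec, hx, hx', add_mul]
  | tmul a b =>
    induction y with
    | zero => simp
    | add y y' hy hy' =>
      simp only [TensorProduct.tmul_add, map_add, Matrix.add_mulVec, hy, hy', mul_add,
        Matrix.transpose_add]
    | tmul a' b' =>
      rw [shuffle_tmul, Algebra.TensorProduct.map_tmul, tensorRep_tmul, tensorRep_tmul,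
        tensorRep_tmul, ← coeffMat_kronecker]
      simp [dilIncl, momentumRep_tmul]

/-- The evaluation of polynomials at `ξ = -1` in both tensor factors. -/
def dilEval (k : Type u) [CommRing k] : Polynomial k ⊗[k] Polynomial k →ₐ[k] k :=
  (Algebra.TensorProduct.lmul' k).comp
    (Algebra.TensorProduct.map (Polynomial.aeval (-1)) (Polynomial.aeval (-1)))

theorem tensorRep_dilaton (z : Polynomial k ⊗[k] Polynomial k) :
    tensorRep (momentumRep hD T) (Algebra.TensorProduct.map
      (Algebra.TensorProduct.includeRight : Polynomial k →ₐ[k] Dil k (H ⊗[k] H))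
      (Algebra.TensorProduct.includeRight : Polynomial k →ₐ[k] Dil k (H ⊗[k] H)) z) =
      algebraMap k _ (dilEval k z) := by
  induction z with
  | zero => simp
  | add x y hx hy => simp only [map_add, hx, hy]
  | tmul p p' =>
    rw [Algebra.TensorProduct.map_tmul, tensorRep_tmul]
    simp only [Algebra.TensorProduct.includeRight_apply, Algebra.TensorProduct.one_def,
      momentumRep_tmul, map_one]
    rw [Matrix.one_kronecker_one, Matrix.smul_kronecker, Matrix.kronecker_smul,
      Matrix.one_kronecker_one, smul_smul, Algebra.algebraMap_eq_smul_one]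
    simp [dilEval, Polynomial.aeval_def, Polynomial.eval₂_eq_eval_map]

/-- The matrices that preserve a space of coefficients. -/
def stabilizer {ι : Type} [Fintype ι] [DecidableEq ι] (L : Submodule k (ι → k)) :
    Subalgebra k (Matrix ι ι k) where
  carrier := {A | ∀ c ∈ L, A.mulVec c ∈ L}
  mul_mem' {A B} hA hB c hc := by rw [← Matrix.mulVec_mulVec]; exact hA _ (hB _ hc)
  add_mem' {A B} hA hB c hc := by rw [Matrix.add_mulVec]; exact L.add_mem (hA _ hc) (hB _ hc)
  algebraMap_mem' r c hc := by
    rw [Algebra.algebraMap_eq_smul_one, Matrix.smul_mulVec, Matrix.one_mulVec]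
    exact L.smul_mem r hc

variable {μ : k} {R : Matrix (Fin N × Fin N) (Fin N × Fin N) k}

/-- The elements preserving the relations form a subalgebra, so the two copies of `H` and the
polynomials in `ξ` can be treated separately. The dilaton acts by scalars; the coproduct of either
copy of `H` commutes with the matrix `P Rᵀ` or `Rᵀ P` on its side. -/
theorem eucSpan_invariant (hW : D.IsQuasitriangular W) (hμ : IsUnit μ)
    (hT : tensorRep T (W : H ⊗[k] H) = μ • R) (h : Dil k (H ⊗[k] H)) :
    ∀ c ∈ eucSpan R, (tensorRep (momentumRep hD T) ((eucRot D).comul h)).mulVec c ∈ eucSpan R := by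
  let S := (stabilizer (eucSpan R)).comap ((tensorRep (momentumRep hD T)).comp (eucRot D).comul)
  suffices hS : h ∈ S from hS
  have h1 : ∀ x : H ⊗[k] H, dilIncl k (H ⊗[k] H) x ∈ S := fun x => by
    induction x with
    | zero => rw [map_zero]; exact S.zero_mem
    | add x y hx hy => rw [map_add]; exact S.add_mem hx hy
    | tmul a b =>
      intro c hc
      obtain ⟨E, hE⟩ := (mem_eucSpan_iff R c).mp hc
      have ha := tensorRep_comul_comm (contraRep hD T) hW hμ (tensorRep_contraRep_of hD T hW hT) a
      have hb := congrArg Matrix.transpose (tensorRep_comul_comm T hW hμ hT b)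
      simp only [Matrix.transpose_mul, transpose_permP] at hb
      -- As `E ↦ P Rᵀ E - E Rᵀ P` is equivariant, the witness is the rotated `E`.
      refine (mem_eucSpan_iff R _).mpr ⟨tensorRep (contraRep hD T) (D.comul a) * E *
        (tensorRep T (D.comul b)).transpose, ?_⟩
      change coeffMat ((tensorRep (momentumRep hD T) ((D.tensor D).dil.comul _)).mulVec c) = _
      rw [dil_comul_incl, tensor_comul_tmul, coeffMat_tensorRep, hE, mul_sub, sub_mul]
      refine congrArg₂ (· - ·) ?_ ?_
      · rw [← mul_assoc, ha]
        simp only [mul_assoc]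
      · simp only [mul_assoc] at hb ⊢
        rw [hb]
  have h2 : ∀ p : Polynomial k, (1 : H ⊗[k] H) ⊗ₜ[k] p ∈ S := fun p => by
    intro c hc
    change (tensorRep (momentumRep hD T)
      (shuffle k (H ⊗[k] H) (Polynomial k) ((D.tensor D).comul 1 ⊗ₜ (dilatonLine k).comul p))).mulVec
      c ∈ _
    rw [map_one, shuffle_eq_mul, map_one, one_mul, tensorRep_dilaton,
      Algebra.algebraMap_eq_smul_one, Matrix.smul_mulVec, Matrix.one_mulVec]
    exact Submodule.smul_mem _ _ hc
  induction h using TensorProduct.induction_on with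
  | zero => exact S.zero_mem
  | add x y hx hy => exact S.add_mem hx hy
  | tmul x p =>
    have e : (x ⊗ₜ[k] p : Dil k (H ⊗[k] H)) = dilIncl k (H ⊗[k] H) x * 1 ⊗ₜ[k] p := by
      simp [dilIncl]
    rw [e]
    exact S.mul_mem (h1 x) (h2 p)

/-- The cocycle acts by `R` on the inner indices. -/
theorem tensorRep_dilCocycle (hW : D.IsQuasitriangular W) (hT : tensorRep T (W : H ⊗[k] H) = μ • R)
    (c : (Fin N × Fin N) × (Fin N × Fin N) → k) (a j b l : Fin N) :
    (tensorRep (momentumRep hD T) (dilCocycle W : _ ⊗[k] _)).mulVec c ((a, j), (b, l)) =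
      ∑ j', ∑ b', μ * R (j, b') (j', b) * c ((a, j'), (b', l)) := by
  have key : ∀ x : H ⊗[k] H, (tensorRep (momentumRep hD T)
      (Algebra.TensorProduct.map (dilIncl k (H ⊗[k] H)) (dilIncl k (H ⊗[k] H))
        (innerLegs k H x))).mulVec c ((a, j), (b, l)) =
      ∑ j', ∑ b', tensorRep T (D.antipode.lTensor H x) (j, b') (j', b) * c ((a, j'), (b', l)) := by
    intro x
    induction x with
    | zero => simp
    | add x y hx hy =>
      simp only [map_add, Matrix.add_mulVec, Pi.add_apply, hx, hy, Matrix.add_apply, add_mul,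
        Finset.sum_add_distrib]
    | tmul h g =>
      simp only [innerLegs, Algebra.TensorProduct.map_tmul, dilIncl, tensorRep_tmul,
        Algebra.TensorProduct.includeLeft_apply, Algebra.TensorProduct.includeRight_apply,
        momentumRep_tmul, Polynomial.eval_one, one_smul, map_one, LinearMap.lTensor_tmul,
        Matrix.mulVec, dotProduct, Fintype.sum_prod_type, Matrix.kroneckerMap_apply,
        contraRep_apply, Matrix.transpose_apply, Matrix.one_apply]
      simp
  have := key (↑W⁻¹ : H ⊗[k] H)
  rw [hW.antipode_lTensor hD, hT] at this
  exact this

/-- The heart of the comparison. The cocycle acts only on the two inner indices of a product of two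
momenta and inserts `μ R` there, so `p₁ p₂` becomes `μ p₁ R p₂` and `p₂ p₁` becomes `μ p₂ R₂₁ p₁`.
It matches the relations one by one. -/
theorem tensorRep_eucCoeff (hW : D.IsQuasitriangular W) (hT : tensorRep T (W : H ⊗[k] H) = μ • R)
    (x y : Fin N × Fin N) :
    (tensorRep (momentumRep hD T) (dilCocycle W : _ ⊗[k] _)).mulVec (eucCoeff R x y) =
      μ • minkCoeff R x y := by
  funext ⟨⟨a, j⟩, ⟨b, l⟩⟩
  rw [tensorRep_dilCocycle hD T hW hT]
  obtain ⟨m, n⟩ := x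
  obtain ⟨m', n'⟩ := y
  simp only [eucCoeff, minkCoeff, Pi.smul_apply, smul_eq_mul, mul_sub, Finset.sum_sub_distrib,
    Prod.mk.injEq, ite_and, mul_ite, ite_mul, mul_one, mul_zero, one_mul, zero_mul,
    Prod.swap_prod_mk, Finset.mul_sum]
  congr 1
  · rw [Finset.sum_eq_single m' (fun x _ hx => by simp [hx]) (by simp)]
    simp only [if_true]
    split_ifs
    · exact Finset.sum_congr rfl fun _ _ => by ring
    · simp
  · simp only [Finset.sum_ite_eq', Finset.mem_univ, if_true]
    split_ifs
    · exact Finset.sum_congr rfl fun _ _ => by ring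
    · simp

theorem tensorRep_mem_minkSpan (hW : D.IsQuasitriangular W)
    (hT : tensorRep T (W : H ⊗[k] H) = μ • R) :
    ∀ c ∈ eucSpan R,
      (tensorRep (momentumRep hD T) (dilCocycle W : _ ⊗[k] _)).mulVec c ∈ minkSpan R := by
  have hle : eucSpan R ≤ (minkSpan R).comap
      (Matrix.mulVecLin (tensorRep (momentumRep hD T) (dilCocycle W : _ ⊗[k] _))) := by
    rw [eucSpan, Submodule.span_le]
    rintro _ ⟨z, rfl⟩
    rw [SetLike.mem_coe, Submodule.mem_comap, Matrix.mulVecLin_apply,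
      tensorRep_eucCoeff hD T hW hT]
    exact Submodule.smul_mem _ _ (Submodule.subset_span ⟨z, rfl⟩)
  exact hle

/-- The factor `μ = λ^{1/2}` is a unit, so each Minkowski relation is `χ` applied to a multiple of a
Euclidean one, and `χ⁻¹` undoes this. -/
theorem tensorRep_mem_eucSpan (hW : D.IsQuasitriangular W) (hμ : IsUnit μ)
    (hT : tensorRep T (W : H ⊗[k] H) = μ • R) :
    ∀ c ∈ minkSpan R,
      (tensorRep (momentumRep hD T) (↑(dilCocycle W)⁻¹ : _ ⊗[k] _)).mulVec c ∈ eucSpan R := by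
  have hle : minkSpan R ≤ (eucSpan R).comap
      (Matrix.mulVecLin (tensorRep (momentumRep hD T) (↑(dilCocycle W)⁻¹ : _ ⊗[k] _))) := by
    rw [minkSpan, Submodule.span_le]
    rintro _ ⟨z, rfl⟩
    dsimp only
    obtain ⟨μ, rfl⟩ := hμ
    have e : minkCoeff R z.1 z.2 = (↑μ⁻¹ : k) •
        (tensorRep (momentumRep hD T) (dilCocycle W : _ ⊗[k] _)).mulVec (eucCoeff R z.1 z.2) := by
      rw [tensorRep_eucCoeff hD T hW hT, smul_smul, Units.inv_mul, one_smul]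
    rw [SetLike.mem_coe, Submodule.mem_comap, Matrix.mulVecLin_apply, e, Matrix.mulVec_smul, Matrix.mulVec_mulVec, ← map_mul, Units.inv_mul, map_one,
      Matrix.one_mulVec]
    exact Submodule.smul_mem _ _ (Submodule.subset_span ⟨z, rfl⟩)
  exact hle

/-- The twisted coproduct is `χ Δ χ⁻¹`: go to the Euclidean relations by `χ⁻¹`, use invariance
there, and return. -/
theorem minkSpan_invariant (hW : D.IsQuasitriangular W) (hμ : IsUnit μ)
    (hT : tensorRep T (W : H ⊗[k] H) = μ • R) (h : Dil k (H ⊗[k] H)) :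
    ∀ c ∈ minkSpan R,
      (tensorRep (momentumRep hD T) ((minkRot D W).comul h)).mulVec c ∈ minkSpan R := by
  intro c hc
  rw [minkRot_eq_twist hD hW, twist_comul, map_mul, map_mul, ← Matrix.mulVec_mulVec,
    ← Matrix.mulVec_mulVec]
  exact tensorRep_mem_minkSpan hD T hW hT _ (eucSpan_invariant hD T hW hμ hT _ _
    (tensorRep_mem_eucSpan hD T hW hμ hT c hc))

variable [Algebra ℚ k]

/-- The normalisation `λ^{1/2} λ^{1/2} λ⁻¹ = 1`, for which the dilaton is introduced. -/
theorem exp_half_mul {s : k} (hs : IsNilpotent s) :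
    IsNilpotent.exp ((1 / 2 : ℚ) • s) * IsNilpotent.exp ((1 / 2 : ℚ) • s) * IsNilpotent.exp (-s) = 1 := by
  have h2 : IsNilpotent ((1 / 2 : ℚ) • s) := hs.smul _
  rw [← IsNilpotent.exp_add_of_commute (Commute.all _ _) h2 h2, ← add_smul]
  norm_num
  exact IsNilpotent.exp_mul_exp_neg_self hs

/-- Each copy of `H` contributes `λ^{1/2}`, and the dilaton, being `-1` on both momenta, contributes
`λ⁻¹`. The scalars cancel and leave `C ↦ Rᵀ C Rᵀ`, to which the Hecke condition applies. -/
theorem eucSpan_antisymm (hW : D.IsQuasitriangular W) {s : k} (hs : IsNilpotent s)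
    (hT : tensorRep T (W : H ⊗[k] H) = IsNilpotent.exp ((1 / 2 : ℚ) • s) • R)
    {q : kˣ} (hR : IsHecke q R) :
    ∀ c ∈ eucSpan R, ∀ x y,
      (tensorRep (momentumRep hD T) (eucRotR s W)).mulVec c (x, y) = -c (y, x) := by
  intro c hc x y
  have he : dilEval k (IsNilpotent.exp
      (-(s • ((Polynomial.X : Polynomial k) ⊗ₜ[k] (Polynomial.X : Polynomial k))))) =
      IsNilpotent.exp (-s) := by
    rw [IsNilpotent.map_exp (isNilpotent_line hs)]
    congr 1
    simp [dilEval]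
  have h1 : coeffMat ((tensorRep (momentumRep hD T) (eucRotR s W)).mulVec c) =
      R.transpose * coeffMat c * R.transpose := by
    rw [eucRotR, dilR, map_mul, tensorRep_dilaton, he, ← Algebra.commutes,
      Algebra.algebraMap_eq_smul_one, smul_mul_assoc, one_mul, Matrix.smul_mulVec, map_smul]
    change _ • coeffMat ((tensorRep (momentumRep hD T)
      (Algebra.TensorProduct.map (dilIncl k (H ⊗[k] H)) (dilIncl k (H ⊗[k] H))
        (shuffle k H H ((W : H ⊗[k] H) ⊗ₜ (W : H ⊗[k] H))))).mulVec c) = _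
    rw [coeffMat_tensorRep, tensorRep_contraRep_of hD T hW hT, hT, Matrix.transpose_smul,
      smul_mul_assoc, smul_mul_smul_comm, smul_smul, mul_comm, exp_half_mul hs, one_smul]
  have h2 := hR.antisymm hc (x.1, y.1) (x.2, y.2)
  rw [← h1] at h2
  exact h2

/-- Write `c = χ d` with `d` a Euclidean relation. Then `χ₂₁ R χ⁻¹` sends `c` to `χ₂₁ R d`, which is
`χ₂₁` applied to minus the flip of `d`, that is, minus the flip of `c`. -/
theorem minkSpan_antisymm (hW : D.IsQuasitriangular W) {s : k} (hs : IsNilpotent s)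
    (hT : tensorRep T (W : H ⊗[k] H) = IsNilpotent.exp ((1 / 2 : ℚ) • s) • R)
    {q : kˣ} (hR : IsHecke q R) :
    ∀ c ∈ minkSpan R, ∀ x y,
      (tensorRep (momentumRep hD T) (minkRotR s W)).mulVec c (x, y) = -c (y, x) := by
  intro c hc x y
  have hμ : IsUnit (IsNilpotent.exp ((1 / 2 : ℚ) • s)) := IsNilpotent.isUnit_exp (hs.smul _)
  set d := (tensorRep (momentumRep hD T) (↑(dilCocycle W)⁻¹ : _ ⊗[k] _)).mulVec c with hd
  have hdL : d ∈ eucSpan R := tensorRep_mem_eucSpan hD T hW hμ hT c hc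
  have hc' : c = (tensorRep (momentumRep hD T) (dilCocycle W : _ ⊗[k] _)).mulVec d := by
    rw [hd, Matrix.mulVec_mulVec, ← map_mul, Units.mul_inv, map_one, Matrix.one_mulVec]
  have h1 : (tensorRep (momentumRep hD T) (eucRotR s W)).mulVec d = fun z => -d z.swap :=
    funext fun z => eucSpan_antisymm hD T hW hs hT hR d hdL z.1 z.2
  rw [minkRotR_eq_twistR hs, twistR, map_mul, map_mul, ← Matrix.mulVec_mulVec,
    ← Matrix.mulVec_mulVec, ← hd, h1, hc']
  change Matrix.mulVec (tensorRep _ (flipHom k _ _)) _ _ = _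
  simp only [Matrix.mulVec, dotProduct, tensorRep_flip, mul_neg, Finset.sum_neg_distrib,
    Prod.swap_prod_mk]
  congr 1
  exact Fintype.sum_equiv (Equiv.prodComm _ _) _ _ fun z => rfl

end Representation

end QPoincare

end

noncomputable section

namespace QPoincare

/-! ### Reductions -/

section Reduction

variable {k' : Type v} {k : Type u} [CommRing k'] [CommRing k] {σ : k' →+* k}

/-- The universal reduction of an algebra. -/
theorem exists_reduction (hσ : Function.Surjective σ) (A' : Type w) [Ring A'] [Algebra k' A'] :
    ∃ (Q : Type (max u w)) (_ : Ring Q) (_ : Algebra k Q) (mk : A' →ₛₗ[σ] Q), mk 1 = 1 ∧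
      (∀ x y, mk (x * y) = mk x * mk y) ∧
      ∀ x, mk x = 0 → x ∈ RingHom.ker σ • (⊤ : Submodule k' A') := by
  -- The universal reduction is `k ⊗_{k'} A'`. Right exactness of the tensor product identifies the
  -- kernel of `x ↦ 1 ⊗ x` with the image of `ker σ ⊗ A'`.
  let _ := σ.toAlgebra
  let f : A' →ₐ[k'] k ⊗[k'] A' := Algebra.TensorProduct.includeRight
  refine ⟨k ⊗[k'] A', inferInstance, inferInstance, ⟨⟨f, map_add f⟩, fun r x => ?_⟩, map_one f,
    map_mul f, fun x hx => ?_⟩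
  · change (1 : k) ⊗ₜ[k'] (r • x) = σ r • ((1 : k) ⊗ₜ[k'] x)
    rw [TensorProduct.smul_tmul', ← TensorProduct.smul_tmul]
    rfl
  · have hex : Function.Exact (RingHom.ker σ).subtype (Algebra.linearMap k' k) := fun r => by
      constructor
      · intro h
        exact ⟨⟨r, h⟩, rfl⟩
      · rintro ⟨s, rfl⟩
        exact s.2
    have h1 := rTensor_exact A' hex (show Function.Surjective (Algebra.linearMap k' k) from hσ)
    have h2 : (Algebra.linearMap k' k).rTensor A' (1 ⊗ₜ x) = 0 := by
      rw [LinearMap.rTensor_tmul, Algebra.linearMap_apply, map_one]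
      exact hx
    obtain ⟨z, hz⟩ := (h1 _).mp h2
    have h3 : ∀ z : RingHom.ker σ ⊗[k'] A', TensorProduct.lid k' A'
        ((RingHom.ker σ).subtype.rTensor A' z) ∈ RingHom.ker σ • (⊤ : Submodule k' A') := fun z => by
      induction z with
      | zero => simp
      | add x y hx hy => rw [map_add, map_add]; exact Submodule.add_mem _ hx hy
      | tmul i a =>
        rw [LinearMap.rTensor_tmul, TensorProduct.lid_tmul]
        exact Submodule.smul_mem_smul i.2 Submodule.mem_top
    have h4 := h3 z
    rwa [hz, TensorProduct.lid_tmul, one_smul] at h4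

variable {A' A : Type*} [Ring A'] [Algebra k' A'] [Ring A] [Algebra k A]
  {B' B : Type*} [Ring B'] [Algebra k' B'] [Ring B] [Algebra k B]
  {π : A' →ₛₗ[σ] A} {ϖ : B' →ₛₗ[σ] B}

/-- A reduction as a ring homomorphism. -/
def IsReduction.ringHom (hπ : IsReduction π) : A' →+* A where
  toFun := π
  map_one' := hπ.map_one
  map_mul' := hπ.map_mul
  map_zero' := map_zero π
  map_add' := map_add π

theorem IsReduction.ringHom_apply (hπ : IsReduction π) (x : A') : hπ.ringHom x = π x := rfl

/-- Every semilinear map kills `(ker σ) A'`, which contains the kernel of a reduction; hence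
semilinear maps factor through reductions. -/
theorem IsReduction.map_eq_zero (hπ : IsReduction π) {Q : Type*} [AddCommGroup Q] [Module k Q]
    (f : A' →ₛₗ[σ] Q) {x : A'} (hx : π x = 0) : f x = 0 := by
  refine Submodule.smul_induction_on (hπ.ker x hx) (fun r hr y _ => ?_) fun y z hy hz => ?_
  · rw [map_smulₛₗ, RingHom.mem_ker.mp hr, zero_smul]
  · rw [map_add, hy, hz, add_zero]

theorem IsReduction.map_eq (hπ : IsReduction π) {Q : Type*} [AddCommGroup Q] [Module k Q]
    (f : A' →ₛₗ[σ] Q) {x y : A'} (h : π x = π y) : f x = f y := by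
  rw [← sub_eq_zero, ← map_sub]
  exact hπ.map_eq_zero f (by rw [map_sub, h, sub_self])

/-- The linear map induced on the reduction. -/
def IsReduction.descend (hπ : IsReduction π) (hσ : Function.Surjective σ) {Q : Type*}
    [AddCommGroup Q] [Module k Q] (f : A' →ₛₗ[σ] Q) : A →ₗ[k] Q where
  toFun a := f (Function.surjInv hπ.surjective a)
  map_add' a b := by
    rw [← map_add]
    exact hπ.map_eq f (by simp [Function.surjInv_eq])
  map_smul' r a := by
    obtain ⟨r, rfl⟩ := hσ r
    rw [RingHom.id_apply, ← map_smulₛₗ]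
    exact hπ.map_eq f (by simp [Function.surjInv_eq])

theorem IsReduction.descend_apply (hπ : IsReduction π) (hσ : Function.Surjective σ) {Q : Type*}
    [AddCommGroup Q] [Module k Q] (f : A' →ₛₗ[σ] Q) (x : A') : hπ.descend hσ f (π x) = f x :=
  hπ.map_eq f (by simp [Function.surjInv_eq])

theorem map_tensor_mul (hπ : ∀ x y, π (x * y) = π x * π y) (hϖ : ∀ x y, ϖ (x * y) = ϖ x * ϖ y)
    (x y : A' ⊗[k'] B') :
    TensorProduct.map π ϖ (x * y) = TensorProduct.map π ϖ x * TensorProduct.map π ϖ y := by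
  induction x with
  | zero => simp
  | add x z hx hz => simp only [add_mul, map_add, hx, hz]
  | tmul a b =>
    induction y with
    | zero => simp
    | add x z hx hz => simp only [mul_add, map_add, hx, hz]
    | tmul c d => simp [hπ, hϖ]

/-- The kernel is found without any flatness: the universal reduction of `A' ⊗ B'` is descended one
argument at a time to a map out of `A ⊗ B`, so whatever dies in `A ⊗ B` dies in the universal
reduction. -/
theorem IsReduction.tensor (hπ : IsReduction π) (hϖ : IsReduction ϖ) (hσ : Function.Surjective σ) :
    IsReduction (TensorProduct.map π ϖ) where
  map_one := by
    rw [Algebra.TensorProduct.one_def, TensorProduct.map_tmul, hπ.map_one, hϖ.map_one]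
    rfl
  map_mul := map_tensor_mul hπ.map_mul hϖ.map_mul
  surjective y := by
    induction y with
    | zero => exact ⟨0, map_zero _⟩
    | add x y hx hy =>
      obtain ⟨a, rfl⟩ := hx
      obtain ⟨b, rfl⟩ := hy
      exact ⟨a + b, map_add _ _ _⟩
    | tmul x y =>
      obtain ⟨a, rfl⟩ := hπ.surjective x
      obtain ⟨b, rfl⟩ := hϖ.surjective y
      exact ⟨a ⊗ₜ b, TensorProduct.map_tmul _ _ _ _⟩
  ker x hx := by
    obtain ⟨Q, _, _, mk, -, -, hmk⟩ := exists_reduction hσ (A' ⊗[k'] B')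
    let right : A' → B →ₗ[k] Q := fun a => hϖ.descend hσ
      (mk.comp (TensorProduct.mk k' A' B' a))
    have hright : ∀ a b, right a (ϖ b) = mk (a ⊗ₜ b) := fun a b => hϖ.descend_apply hσ _ b
    let left : A' →ₛₗ[σ] (B →ₗ[k] Q) :=
      { toFun := right
        map_add' := fun a a' => LinearMap.ext fun b => by
          obtain ⟨b, rfl⟩ := hϖ.surjective b
          simp only [LinearMap.add_apply, hright, TensorProduct.add_tmul, map_add]
        map_smul' := fun r a => LinearMap.ext fun b => by
          obtain ⟨b, rfl⟩ := hϖ.surjective b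
          simp only [LinearMap.smul_apply, hright, ← TensorProduct.smul_tmul', map_smulₛₗ] }
    have key : ∀ x, TensorProduct.lift (hπ.descend hσ left) (TensorProduct.map π ϖ x) = mk x := by
      intro x
      induction x with
      | zero => simp
      | add x y hx hy => simp only [map_add, hx, hy]
      | tmul a b =>
        rw [TensorProduct.map_tmul, TensorProduct.lift.tmul, hπ.descend_apply]
        exact hright a b
    exact hmk x (by rw [← key, hx, map_zero])

/-- The reduction of polynomials. -/
def polyRed (σ : k' →+* k) : Polynomial k' →ₛₗ[σ] Polynomial k where
  toFun := Polynomial.map σ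
  map_add' _ _ := Polynomial.map_add σ
  map_smul' r p := by simp [Polynomial.smul_eq_C_mul]

theorem polyRed_apply (p : Polynomial k') : polyRed σ p = p.map σ := rfl

theorem isReduction_polyRed (hσ : Function.Surjective σ) : IsReduction (polyRed σ) where
  map_one := Polynomial.map_one σ
  map_mul _ _ := Polynomial.map_mul σ
  surjective := Polynomial.map_surjective σ hσ
  ker p hp := by
    rw [p.as_sum_support_C_mul_X_pow]
    refine Submodule.sum_mem _ fun i _ => ?_
    rw [← Polynomial.smul_eq_C_mul]
    refine Submodule.smul_mem_smul ?_ Submodule.mem_top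
    rw [RingHom.mem_ker, ← Polynomial.coeff_map]
    exact congrArg (fun q => Polynomial.coeff q i) hp

end Reduction

end QPoincare

end

noncomputable section

namespace QPoincare

/-! ### Reduction of coproducts, tensor products and twists -/

section HopfReduction

variable {k' k : Type*} [CommRing k'] [CommRing k] {σ : k' →+* k}
  {A' A : Type*} [Ring A'] [Algebra k' A'] [Ring A] [Algebra k A]
  {B' B : Type*} [Ring B'] [Algebra k' B'] [Ring B] [Algebra k B]
  {π : A' →ₛₗ[σ] A} {ϖ : B' →ₛₗ[σ] B}

/-- The map `π` respects the coproduct and the counit. -/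
structure HopfData.Reduces (D' : HopfData k' A') (D : HopfData k A) (π : A' →ₛₗ[σ] A) : Prop where
  comul : ∀ x, D.comul (π x) = TensorProduct.map π π (D'.comul x)
  counit : ∀ x, D.counit (π x) = σ (D'.counit x)

theorem map_shuffle (x : A' ⊗[k'] A') (y : B' ⊗[k'] B') :
    TensorProduct.map (TensorProduct.map π ϖ) (TensorProduct.map π ϖ)
      (shuffle k' A' B' (x ⊗ₜ y)) =
    shuffle k A B (TensorProduct.map π π x ⊗ₜ TensorProduct.map ϖ ϖ y) := by
  induction x with
  | zero => simp
  | add x z hx hz => simp only [TensorProduct.add_tmul, map_add, hx, hz]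
  | tmul a b =>
    induction y with
    | zero => simp
    | add x z hx hz => simp only [TensorProduct.tmul_add, map_add, hx, hz]
    | tmul c d => rfl

theorem HopfData.Reduces.tensor {D₁' : HopfData k' A'} {D₁ : HopfData k A} {D₂' : HopfData k' B'}
    {D₂ : HopfData k B} (h₁ : D₁'.Reduces D₁ π) (h₂ : D₂'.Reduces D₂ ϖ) :
    (D₁'.tensor D₂').Reduces (D₁.tensor D₂) (TensorProduct.map π ϖ) where
  comul x := by
    induction x with
    | zero => simp
    | add x y hx hy => simp only [map_add, hx, hy]
    | tmul a b => rw [TensorProduct.map_tmul, tensor_comul_tmul, tensor_comul_tmul, h₁.comul,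
        h₂.comul, map_shuffle]
  counit x := by
    induction x with
    | zero => simp
    | add x y hx hy => simp only [map_add, hx, hy]
    | tmul a b => simp [HopfData.tensor, h₁.counit, h₂.counit]

theorem reduces_dilatonLine (hσ : Function.Surjective σ) :
    (dilatonLine k').Reduces (dilatonLine k) (polyRed σ) where
  comul x := by
    have hp := isReduction_polyRed hσ
    have e : ((dilatonLine k).comul : Polynomial k →+* _).comp hp.ringHom =
        (hp.tensor hp hσ).ringHom.comp ((dilatonLine k').comul : Polynomial k' →+* _) := by
      refine Polynomial.ringHom_ext (fun a => ?_) ?_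
      · change (dilatonLine k).comul ((Polynomial.C a).map σ) =
          TensorProduct.map (polyRed σ) (polyRed σ) ((dilatonLine k').comul (Polynomial.C a))
        rw [Polynomial.map_C, ← Polynomial.algebraMap_eq, ← Polynomial.algebraMap_eq,
          AlgHom.commutes, AlgHom.commutes, Algebra.algebraMap_eq_smul_one,
          Algebra.algebraMap_eq_smul_one, map_smulₛₗ, (hp.tensor hp hσ).map_one]
      · change (dilatonLine k).comul (Polynomial.X.map σ) =
          TensorProduct.map (polyRed σ) (polyRed σ) ((dilatonLine k').comul Polynomial.X)
        simp [dilatonLine, polyRed_apply]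
    exact congrArg (fun f => f x) e
  counit x := by
    simp [dilatonLine, polyRed_apply, Polynomial.aeval_def, Polynomial.eval₂_map,
      Polynomial.eval₂_at_zero, Polynomial.coeff_zero_eq_eval_zero]

theorem IsReduction.map_inv (hπ : IsReduction π) {u : A'ˣ} {v : Aˣ} (h : π u = v) :
    π (↑u⁻¹ : A') = (↑v⁻¹ : A) := by
  refine Units.eq_inv_of_mul_eq_one_right ?_
  rw [← h, ← hπ.map_mul, Units.inv_mul, hπ.map_one]

theorem HopfData.Reduces.twist {D' : HopfData k' A'} {D : HopfData k A} (h : D'.Reduces D π)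
    (hπ : IsReduction π) (hσ : Function.Surjective σ) {χ' : (A' ⊗[k'] A')ˣ} {χ : (A ⊗[k] A)ˣ}
    (hχ : TensorProduct.map π π (χ' : A' ⊗[k'] A') = χ) :
    (D'.twist χ').Reduces (D.twist χ) π where
  comul x := by
    have ht := hπ.tensor hπ hσ
    rw [twist_comul, twist_comul, ht.map_mul, ht.map_mul, hχ, ht.map_inv hχ, h.comul]
  counit := h.counit

end HopfReduction

/-! ### Reduction of the rotation quantum groups and their quasitriangular structures -/

section RotationReduction

variable {k' k : Type u} [CommRing k'] [CommRing k] {σ : k' →+* k}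
  {H' H : Type v} [Ring H'] [Algebra k' H'] [Ring H] [Algebra k H] (π : H' →ₛₗ[σ] H)

/-- The reduction of the dilatonic extension of two copies of `H`. -/
def rotRed : Dil k' (H' ⊗[k'] H') →ₛₗ[σ] Dil k (H ⊗[k] H) :=
  TensorProduct.map (TensorProduct.map π π) (polyRed σ)

variable {π}

theorem isReduction_rotRed (hπ : IsReduction π) (hσ : Function.Surjective σ) :
    IsReduction (rotRed π) :=
  (hπ.tensor hπ hσ).tensor (isReduction_polyRed hσ) hσ

theorem rotRed_tmul (h g : H') (p : Polynomial k') :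
    rotRed π ((h ⊗ₜ g) ⊗ₜ p) = (π h ⊗ₜ π g) ⊗ₜ p.map σ := rfl

theorem rotRed_dilIncl (x : H' ⊗[k'] H') : rotRed π (dilIncl k' (H' ⊗[k'] H') x) =
    dilIncl k (H ⊗[k] H) (TensorProduct.map π π x) := by
  change TensorProduct.map π π x ⊗ₜ[k] Polynomial.map σ 1 = _
  rw [Polynomial.map_one]
  rfl

theorem rotRed_includeRight (hπ : IsReduction π) (hσ : Function.Surjective σ) (p : Polynomial k') :
    rotRed π ((Algebra.TensorProduct.includeRight : Polynomial k' →ₐ[k'] Dil k' (H' ⊗[k'] H')) p) =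
    (Algebra.TensorProduct.includeRight : Polynomial k →ₐ[k] Dil k (H ⊗[k] H)) (polyRed σ p) := by
  change TensorProduct.map π π 1 ⊗ₜ[k] polyRed σ p = _
  rw [(hπ.tensor hπ hσ).map_one]
  rfl

theorem map_rotRed_dilIncl (x : (H' ⊗[k'] H') ⊗[k'] (H' ⊗[k'] H')) :
    TensorProduct.map (rotRed π) (rotRed π)
      (Algebra.TensorProduct.map (dilIncl k' (H' ⊗[k'] H')) (dilIncl k' (H' ⊗[k'] H')) x) =
    Algebra.TensorProduct.map (dilIncl k (H ⊗[k] H)) (dilIncl k (H ⊗[k] H))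
      (TensorProduct.map (TensorProduct.map π π) (TensorProduct.map π π) x) := by
  induction x with
  | zero => simp
  | add x y hx hy => simp only [map_add, hx, hy]
  | tmul a b => simp only [Algebra.TensorProduct.map_tmul, TensorProduct.map_tmul, rotRed_dilIncl]

theorem map_innerLegs (hπ : IsReduction π) (x : H' ⊗[k'] H') :
    TensorProduct.map (TensorProduct.map π π) (TensorProduct.map π π) (innerLegs k' H' x) =
      innerLegs k H (TensorProduct.map π π x) := by
  induction x with
  | zero => simp
  | add x y hx hy => simp only [map_add, hx, hy]
  | tmul a b => simp [innerLegs, hπ.map_one]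

theorem reduces_eucRot {D' : HopfData k' H'} {D : HopfData k H} (h : D'.Reduces D π)
    (hσ : Function.Surjective σ) : (eucRot D').Reduces (eucRot D) (rotRed π) :=
  (h.tensor h).tensor (reduces_dilatonLine hσ)

variable {W' : (H' ⊗[k'] H')ˣ} {W : (H ⊗[k] H)ˣ}

theorem map_wickCocycle (hπ : IsReduction π) (hσ : Function.Surjective σ)
    (hW : TensorProduct.map π π (W' : H' ⊗[k'] H') = W) :
    TensorProduct.map (TensorProduct.map π π) (TensorProduct.map π π)
      (wickCocycle W' : (H' ⊗[k'] H') ⊗[k'] (H' ⊗[k'] H')) = wickCocycle W := by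
  rw [wickCocycle_val, wickCocycle_val, map_innerLegs hπ, (hπ.tensor hπ hσ).map_inv hW]

theorem map_dilCocycle (hπ : IsReduction π) (hσ : Function.Surjective σ)
    (hW : TensorProduct.map π π (W' : H' ⊗[k'] H') = W) :
    TensorProduct.map (rotRed π) (rotRed π)
      (dilCocycle W' : Dil k' (H' ⊗[k'] H') ⊗[k'] Dil k' (H' ⊗[k'] H')) = dilCocycle W :=
  (map_rotRed_dilIncl _).trans (by rw [map_wickCocycle hπ hσ hW]; rfl)

theorem reduces_minkRot {D' : HopfData k' H'} {D : HopfData k H} (h : D'.Reduces D π)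
    (hπ : IsReduction π) (hσ : Function.Surjective σ)
    (hW : TensorProduct.map π π (W' : H' ⊗[k'] H') = W) :
    (minkRot D' W').Reduces (minkRot D W) (rotRed π) :=
  ((h.tensor h).twist (hπ.tensor hπ hσ) hσ (map_wickCocycle hπ hσ hW)).tensor
    (reduces_dilatonLine hσ)

variable [Algebra ℚ k'] [Algebra ℚ k]

/-- Ring homomorphisms preserve exponentials of nilpotent elements, so `λ^{-ξ⊗ξ}` is reduced by
reducing its exponent. -/
theorem map_dilR (hπ : IsReduction π) (hσ : Function.Surjective σ) {s' : k'} (hs' : IsNilpotent s')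
    {X' : (H' ⊗[k'] H') ⊗[k'] (H' ⊗[k'] H')} {X : (H ⊗[k] H) ⊗[k] (H ⊗[k] H)}
    (hX : TensorProduct.map (TensorProduct.map π π) (TensorProduct.map π π) X' = X) :
    TensorProduct.map (rotRed π) (rotRed π) (dilR s' X') = dilR (σ s') X := by
  have hp := isReduction_polyRed hσ
  have hr := isReduction_rotRed hπ hσ
  have h1 : TensorProduct.map (polyRed σ) (polyRed σ) (IsNilpotent.exp
      (-(s' • ((Polynomial.X : Polynomial k') ⊗ₜ[k'] (Polynomial.X : Polynomial k'))))) =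
      IsNilpotent.exp
        (-(σ s' • ((Polynomial.X : Polynomial k) ⊗ₜ[k] (Polynomial.X : Polynomial k)))) := by
    have := IsNilpotent.map_exp (isNilpotent_line hs') (hp.tensor hp hσ).ringHom
    simp only [IsReduction.ringHom_apply] at this
    rw [this, map_neg, map_smulₛₗ, TensorProduct.map_tmul, polyRed_apply, Polynomial.map_X]
  have h2 : ∀ z : Polynomial k' ⊗[k'] Polynomial k', TensorProduct.map (rotRed π) (rotRed π)
      (Algebra.TensorProduct.map
        (Algebra.TensorProduct.includeRight : Polynomial k' →ₐ[k'] Dil k' (H' ⊗[k'] H'))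
        (Algebra.TensorProduct.includeRight : Polynomial k' →ₐ[k'] Dil k' (H' ⊗[k'] H')) z) =
      Algebra.TensorProduct.map
        (Algebra.TensorProduct.includeRight : Polynomial k →ₐ[k] Dil k (H ⊗[k] H))
        (Algebra.TensorProduct.includeRight : Polynomial k →ₐ[k] Dil k (H ⊗[k] H))
        (TensorProduct.map (polyRed σ) (polyRed σ) z) := fun z => by
    induction z with
    | zero => simp
    | add x y hx hy => simp only [map_add, hx, hy]
    | tmul a b =>
      simp only [Algebra.TensorProduct.map_tmul, TensorProduct.map_tmul,
        rotRed_includeRight hπ hσ]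
  rw [dilR, dilR, (hr.tensor hr hσ).map_mul, map_rotRed_dilIncl, hX, h2, h1]

theorem map_eucRotR (hπ : IsReduction π) (hσ : Function.Surjective σ) {s' : k'}
    (hs' : IsNilpotent s') (hW : TensorProduct.map π π (W' : H' ⊗[k'] H') = W) :
    TensorProduct.map (rotRed π) (rotRed π) (eucRotR s' W') = eucRotR (σ s') W :=
  map_dilR hπ hσ hs' ((map_shuffle _ _).trans (by rw [hW]; rfl))

theorem map_minkRotR (hπ : IsReduction π) (hσ : Function.Surjective σ) {s' : k'}
    (hs' : IsNilpotent s') (hW : TensorProduct.map π π (W' : H' ⊗[k'] H') = W) :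
    TensorProduct.map (rotRed π) (rotRed π) (minkRotR s' W') = minkRotR (σ s') W := by
  have ht := hπ.tensor hπ hσ
  have htt := ht.tensor ht hσ
  refine map_dilR hπ hσ hs' ?_
  have hc : ∀ x : (H' ⊗[k'] H') ⊗[k'] (H' ⊗[k'] H'),
      TensorProduct.map (TensorProduct.map π π) (TensorProduct.map π π)
        (TensorProduct.comm k' (H' ⊗[k'] H') (H' ⊗[k'] H') x) =
      TensorProduct.comm k (H ⊗[k] H) (H ⊗[k] H)
        (TensorProduct.map (TensorProduct.map π π) (TensorProduct.map π π) x) := fun x => by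
    induction x with
    | zero => simp
    | add x y hx hy => simp only [map_add, hx, hy]
    | tmul a b => rfl
  rw [twistR, twistR, htt.map_mul, htt.map_mul, hc, map_wickCocycle hπ hσ hW,
    htt.map_inv (map_wickCocycle hπ hσ hW)]
  congr 2
  exact (map_shuffle _ _).trans (by rw [hW]; rfl)

end RotationReduction

end QPoincare

end

noncomputable section

namespace QPoincare

/-! ### Reduction of bosonisations -/

section BosGenerators

variable {k : Type u} [CommRing k] {K : Type v} [Ring K] [Algebra k K] {D : HopfData k K}
  {ι : Type} {rel : FreeAlgebra k ι → FreeAlgebra k ι → Prop}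
  {M : ModuleAlgebra D (RingQuot rel)}

/-- There is no scalar step, since scalars lie in the image of `K`. This suits properties of maps
that are only semilinear. -/
theorem bos_gen_induction {P : Bos M → Prop} (one : P 1) (add : ∀ x y, P x → P y → P (x + y))
    (mul : ∀ x y, P x → P y → P (x * y)) (genB : ∀ x, P (inB M (gen rel x)))
    (genK : ∀ h, P (inK M h)) (x : Bos M) : P x := by
  have smul : ∀ (r : k) x, P x → P (r • x) := fun r x hx => by
    have e : r • x = inK M (algebraMap k K r) * x := by
      rw [AlgHom.commutes, Algebra.smul_def]
    rw [e]
    exact mul _ _ (genK _) hx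
  refine bos_mul_induction one add smul (fun b x hx => mul _ _ ?_ hx)
    (fun h x hx => mul _ _ (genK h) hx) x
  induction b using gen_induction with
  | one => rw [map_one]; exact one
  | add a b ha hb => rw [map_add]; exact add _ _ ha hb
  | smul r a ha => rw [map_smul]; exact smul r _ ha
  | mul x b hb => rw [map_mul]; exact mul _ _ (genB x) hb

end BosGenerators

section BosReduction

variable {k : Type u} [CommRing k] {K : Type v} [Ring K] [Algebra k K] {D : HopfData k K}
  {ι : Type} [Fintype ι] [DecidableEq ι] {rel : FreeAlgebra k ι → FreeAlgebra k ι → Prop}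
  {L : Submodule k (ι × ι → k)} {ρ : K →ₐ[k] Matrix ι ι k}
  {M : ModuleAlgebra D (RingQuot rel)}

/-- `a ⊗ b ↦ ρ(a)_{yx} b`. -/
def contract (ρ : K →ₐ[k] Matrix ι ι k) (y x : ι) : K ⊗[k] K →ₗ[k] K :=
  TensorProduct.lift (LinearMap.lsmul k K ∘ₗ Matrix.entryLinearMap k k y x ∘ₗ ρ.toLinearMap)

@[simp] theorem contract_tmul (y x : ι) (a b : K) : contract ρ y x (a ⊗ₜ b) = ρ a y x • b := rfl

/-- The action on a generator is expressed by matrix coefficients, so the cross relation no longer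
mentions the module algebra and can be compared over different base rings. -/
theorem cross_gen {X : Type*} [Ring X] [Algebra k X]
    (hact : ∀ h x, M.act h (gen rel x) = rotate ρ (gen rel) x h)
    (f : RingQuot rel →ₗ[k] X) (φ : K →ₗ[k] X) (x : ι) (T : K ⊗[k] K) :
    M.cross f φ (gen rel x) T = ∑ y, f (gen rel y) * φ (contract ρ y x T) := by
  induction T with
  | zero => simp
  | add a b ha hb => simp only [map_add, ha, hb, mul_add, Finset.sum_add_distrib]
  | tmul a b =>
    simp [hact, rotate_apply, Finset.sum_mul]

theorem inK_mul_gen (hact : ∀ h x, M.act h (gen rel x) = rotate ρ (gen rel) x h) (h : K) (x : ι) :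
    inK M h * inB M (gen rel x) = ∑ y, inB M (gen rel y) * inK M (contract ρ y x (D.comul h)) := by
  rw [inK_mul_inB]
  exact cross_gen hact (inB M).toLinearMap (inK M).toLinearMap x (D.comul h)

/-- A map out of the bosonisation, semilinear over a map of base rings, is determined by its
values on the generators. -/
theorem exists_bos_semilinear {k₁ : Type*} [CommRing k₁] {σ : k →+* k₁} (hD : D.IsHopf)
    (hL : IsQuadratic rel L) (hact : ∀ h x, M.act h (gen rel x) = rotate ρ (gen rel) x h)
    {X : Type*} [Ring X] [Algebra k₁ X] (φ : K →ₛₗ[σ] X) (one : φ 1 = 1)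
    (mul : ∀ a b, φ (a * b) = φ a * φ b) (p : ι → X)
    (quad : ∀ c ∈ L, ∑ z : ι × ι, σ (c z) • (p z.1 * p z.2) = 0)
    (cov : ∀ h x, φ h * p x = ∑ y, p y * φ (contract ρ y x (D.comul h))) :
    ∃ f : Bos M →ₛₗ[σ] X, f 1 = 1 ∧ (∀ a b, f (a * b) = f a * f b) ∧
      (∀ h, f (inK M h) = φ h) ∧ ∀ x, f (inB M (gen rel x)) = p x := by
  -- Regarding `X` as a `k`-algebra through `σ` makes all maps linear, and the universal properties
  -- of the quadratic algebra and of the semidirect product apply.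
  let _ : Algebra k X := Algebra.compHom X σ
  let φ' : K →ₐ[k] X := AlgHom.ofLinearMap ⟨⟨φ, map_add φ⟩, fun r x => map_smulₛₗ φ r x⟩ one mul
  let g : RingQuot rel →ₐ[k] X := hL.lift p fun c hc => quad c hc
  have hg : ∀ x, g (gen rel x) = p x := fun x => hL.lift_gen _ _ x
  have hcov : ∀ x, M.Cov g.toLinearMap φ'.toLinearMap (gen rel x) := fun x h => by
    rw [cross_gen hact]
    simp only [AlgHom.toLinearMap_apply, hg]
    exact cov h x
  let f := bosLift M g φ' (cov_of_gen hD hcov)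
  refine ⟨⟨⟨f, map_add f⟩, fun r x => map_smul f r x⟩, map_one f, map_mul f, fun h => ?_,
    fun x => ?_⟩
  · exact bosLift_inK _ _ _ (cov_of_gen hD hcov) h
  · exact (bosLift_inB _ _ _ (cov_of_gen hD hcov) _).trans (hg x)

theorem bosCoact_gen (hact : ∀ h x, M.act h (gen rel x) = rotate ρ (gen rel) x h) (x : ι)
    (T : K ⊗[k] K) : bosCoact M (gen rel x) T =
      ∑ y, inK M (contract ρ y x T) ⊗ₜ[k] inB M (gen rel y) := by
  induction T with
  | zero => simp
  | add a b ha hb => simp only [map_add, ha, hb, TensorProduct.add_tmul, Finset.sum_add_distrib]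
  | tmul a b =>
    simp [hact, rotate_apply, TensorProduct.tmul_sum, TensorProduct.smul_tmul]

variable {k' : Type u} [CommRing k'] {σ : k' →+* k} {K' : Type v} [Ring K'] [Algebra k' K']
  {D' : HopfData k' K'} {rel' : FreeAlgebra k' ι → FreeAlgebra k' ι → Prop}
  {L' : Submodule k' (ι × ι → k')} {ρ' : K' →ₐ[k'] Matrix ι ι k'}
  {M' : ModuleAlgebra D' (RingQuot rel')} {π : K' →ₛₗ[σ] K}

theorem contract_map (hρ : ∀ h y x, ρ (π h) y x = σ (ρ' h y x)) (y x : ι) (T : K' ⊗[k'] K') :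
    contract ρ y x (TensorProduct.map π π T) = π (contract ρ' y x T) := by
  induction T with
  | zero => simp
  | add a b ha hb => simp only [map_add, ha, hb]
  | tmul a b => simp [hρ, map_smulₛₗ]

theorem inK_red_mul_gen (hact : ∀ h x, M.act h (gen rel x) = rotate ρ (gen rel) x h)
    (hΔ : D'.Reduces D π) (hρ : ∀ h y x, ρ (π h) y x = σ (ρ' h y x)) (h : K') (x : ι) :
    inK M (π h) * inB M (gen rel x) =
      ∑ y, inB M (gen rel y) * inK M (π (contract ρ' y x (D'.comul h))) := by
  simp only [inK_mul_gen hact, hΔ.comul, contract_map hρ]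

/-- The reduction of a bosonisation. -/
theorem exists_bosRed (hD' : D'.IsHopf) (hD : D.IsHopf) (hΔ : D'.Reduces D π)
    (hπ : IsReduction π) (hσ : Function.Surjective σ) (hL' : IsQuadratic rel' L')
    (hL : IsQuadratic rel L) (hact' : ∀ h x, M'.act h (gen rel' x) = rotate ρ' (gen rel') x h)
    (hact : ∀ h x, M.act h (gen rel x) = rotate ρ (gen rel) x h)
    (hρ : ∀ h y x, ρ (π h) y x = σ (ρ' h y x))
    (hLL : ∀ c, c ∈ L ↔ ∃ c' ∈ L', c = fun z => σ (c' z)) :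
    ∃ f : Bos M' →ₛₗ[σ] Bos M, IsReduction f ∧ (∀ h, f (inK M' h) = inK M (π h)) ∧
      ∀ x, f (inB M' (gen rel' x)) = inB M (gen rel x) := by
  obtain ⟨f, f_one, f_mul, f_K, f_B⟩ := exists_bos_semilinear (M := M') hD' hL' hact'
    ((inK M).toLinearMap.comp π) (by simp [hπ.map_one]) (fun a b => by simp [hπ.map_mul])
    (fun x => inB M (gen rel x))
    (fun c hc => by
      have h := hL.quad_eq_zero _ ((hLL _).mpr ⟨c, hc, rfl⟩)
      have h' := congrArg (inB M) h
      rw [map_quad, map_zero] at h'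
      exact h')
    (fun h x => inK_red_mul_gen hact hΔ hρ h x)
  refine ⟨f, ⟨f_one, f_mul, fun y => ?_, fun x hx => ?_⟩, f_K, f_B⟩
  · induction y using bos_gen_induction with
    | one => exact ⟨1, f_one⟩
    | add x y hx hy =>
      obtain ⟨a, rfl⟩ := hx
      obtain ⟨b, rfl⟩ := hy
      exact ⟨a + b, map_add f a b⟩
    | mul x y hx hy =>
      obtain ⟨a, rfl⟩ := hx
      obtain ⟨b, rfl⟩ := hy
      exact ⟨a * b, f_mul a b⟩
    | genB x => exact ⟨_, f_B x⟩
    | genK h =>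
      obtain ⟨h, rfl⟩ := hπ.surjective h
      exact ⟨_, f_K h⟩
  -- For the kernel, a map `g` from `Bos M` to the universal reduction of `Bos M'` is built on
  -- generators. It satisfies `g ∘ f = mk`, so `f y = 0` forces `mk y = 0`. The lifting of relations
  -- in `hLL` makes `g` well defined.
  · obtain ⟨Q, _, _, mk, mk_one, mk_mul, hmk⟩ := exists_reduction hσ (Bos M')
    let φ : K →ₗ[k] Q := hπ.descend hσ (mk.comp (inK M').toLinearMap)
    have hφ : ∀ h, φ (π h) = mk (inK M' h) := fun h => hπ.descend_apply hσ _ h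
    obtain ⟨g, g_one, g_mul, g_K, g_B⟩ := exists_bos_semilinear (M := M) hD hL hact φ
      (by rw [← hπ.map_one, hφ, map_one, mk_one])
      (fun a b => by
        obtain ⟨a, rfl⟩ := hπ.surjective a
        obtain ⟨b, rfl⟩ := hπ.surjective b
        rw [← hπ.map_mul, hφ, hφ, hφ, map_mul, mk_mul])
      (fun x => mk (inB M' (gen rel' x)))
      (fun c hc => by
        obtain ⟨c', hc', rfl⟩ := (hLL c).mp hc
        have h := congrArg (fun b => mk (inB M' b)) (hL'.quad_eq_zero c' hc')
        simp only [quad_apply, map_sum, map_smul, map_mul, map_zero, map_smulₛₗ, mk_mul] at h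
        exact h)
      (fun h x => by
        obtain ⟨h, rfl⟩ := hπ.surjective h
        simp only [hφ, hΔ.comul, contract_map hρ, ← mk_mul, ← map_sum, inK_mul_gen hact'])
    have key : ∀ y, g (f y) = mk y := fun y => by
      induction y using bos_gen_induction with
      | one => rw [f_one, g_one, mk_one]
      | add x y hx hy => rw [map_add, map_add, map_add, hx, hy]
      | mul x y hx hy => rw [f_mul, g_mul, mk_mul, hx, hy]
      | genB x => rw [f_B, g_B]
      | genK h => rw [f_K]; exact (g_K _).trans (hφ h)
    exact hmk x (by rw [← key, hx, map_zero])

variable {R' : (K' ⊗[k'] K')ˣ} {R : (K ⊗[k] K)ˣ}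

/-- The reduction respects the Hopf algebra structure of the bosonisation. -/
theorem reduces_bosHopf (hM' : IsAdditive rel' L' ρ' (R' : K' ⊗[k'] K') M')
    (hM : IsAdditive rel L ρ (R : K ⊗[k] K) M) (hD' : D'.IsHopf) (hD : D.IsHopf)
    (hR' : D'.IsQuasitriangular R') (hR : D.IsQuasitriangular R) (hΔ : D'.Reduces D π)
    (hσ : Function.Surjective σ) (hρ : ∀ h y x, ρ (π h) y x = σ (ρ' h y x))
    (hRR : TensorProduct.map π π (R' : K' ⊗[k'] K') = R) {f : Bos M' →ₛₗ[σ] Bos M}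
    (hf : IsReduction f) (f_K : ∀ h, f (inK M' h) = inK M (π h))
    (f_B : ∀ x, f (inB M' (gen rel' x)) = inB M (gen rel x)) :
    (hM'.bosHopf hD' hR').Reduces (hM.bosHopf hD hR) f where
  comul x := by
    have hff := hf.tensor hf hσ
    have hKK : ∀ T : K' ⊗[k'] K', Algebra.TensorProduct.map (inK M) (inK M)
        (TensorProduct.map π π T) =
        TensorProduct.map f f (Algebra.TensorProduct.map (inK M') (inK M') T) := fun T => by
      induction T with
      | zero => simp
      | add x y hx hy => simp only [map_add, hx, hy]
      | tmul a b => simp only [TensorProduct.map_tmul, Algebra.TensorProduct.map_tmul, f_K]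
    induction x using bos_gen_induction with
    | one => rw [hf.map_one, map_one, map_one, hff.map_one]
    | add x y hx hy => simp only [map_add, hx, hy]
    | mul x y hx hy => rw [hf.map_mul, map_mul, map_mul, hff.map_mul, hx, hy]
    | genB x =>
      rw [f_B, hM.comul_gen, hM'.comul_gen, map_add, bosCoact_gen hM.act_gen,
        bosCoact_gen hM'.act_gen, map_sum]
      congr 1
      · change inB M (gen rel x) ⊗ₜ[k] (1 : Bos M) =
          TensorProduct.map f f (inB M' (gen rel' x) ⊗ₜ[k'] (1 : Bos M'))
        rw [TensorProduct.map_tmul, f_B, hf.map_one]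
      · simp only [TensorProduct.map_tmul, f_B, f_K, ← hRR, contract_map hρ]
    | genK h => rw [f_K, hM.comul_inK, hM'.comul_inK, hΔ.comul, hKK]
  counit x := by
    induction x using bos_gen_induction with
    | one => rw [hf.map_one, map_one, map_one, map_one]
    | add x y hx hy => simp only [map_add, hx, hy]
    | mul x y hx hy => rw [hf.map_mul, map_mul, map_mul, map_mul, hx, hy]
    | genB x => rw [f_B, hM.counit_gen, hM'.counit_gen, map_zero]
    | genK h => rw [f_K, hM.counit_inK, hM'.counit_inK, hΔ.counit]

end BosReduction

end QPoincare

end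

noncomputable section

namespace QPoincare

/-! ### The spinorial Poincaré quantum groups -/

section Spinorial

variable {k : Type u} [CommRing k] [Algebra ℚ k] {H : Type v} [Ring H] [Algebra k H] {N : ℕ}

/-- A quasitriangular Hopf algebra with a matrix representation `T` in which the quasitriangular
structure is a `q`-Hecke matrix `R` up to the factor `λ^{1/2}`, `λ = exp s`. -/
structure IsSpinorial (D : HopfData k H) (W : (H ⊗[k] H)ˣ) (T : H →ₐ[k] Matrix (Fin N) (Fin N) k)
    (R : Matrix (Fin N × Fin N) (Fin N × Fin N) k) (s : k) : Prop where
  isHopf : D.IsHopf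
  isQuasitriangular : D.IsQuasitriangular W
  isNilpotent : IsNilpotent s
  tensorRep_eq : tensorRep T (W : H ⊗[k] H) = IsNilpotent.exp ((1 / 2 : ℚ) • s) • R
  exists_isHecke : ∃ q, IsHecke q R

namespace IsSpinorial

variable {D : HopfData k H} {W : (H ⊗[k] H)ˣ} {T : H →ₐ[k] Matrix (Fin N) (Fin N) k}
  {R : Matrix (Fin N × Fin N) (Fin N × Fin N) k} {s : k} (h : IsSpinorial D W T R s)

theorem isUnit_exp (h : IsSpinorial D W T R s) : IsUnit (IsNilpotent.exp ((1 / 2 : ℚ) • s)) :=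
  IsNilpotent.isUnit_exp (h.isNilpotent.smul _)

theorem exists_eucModule : ∃ M : ModuleAlgebra (eucRot D) (EucAlg R),
    ∀ a x, M.act a (gen (EucRel R) x) =
      rotate (momentumRep h.isHopf T) (gen (EucRel R)) x a :=
  (isQuadratic_eucRel R).exists_moduleAlgebra (isHopf_eucRot h.isHopf) _
    (eucSpan_invariant h.isHopf T h.isQuasitriangular h.isUnit_exp h.tensorRep_eq)

theorem exists_minkModule : ∃ M : ModuleAlgebra (minkRot D W) (MinkAlg R),
    ∀ a x, M.act a (gen (MinkRel R) x) =
      rotate (momentumRep h.isHopf T) (gen (MinkRel R)) x a :=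
  (isQuadratic_minkRel R).exists_moduleAlgebra (isHopf_minkRot h.isHopf h.isQuasitriangular) _
    (minkSpan_invariant h.isHopf T h.isQuasitriangular h.isUnit_exp h.tensorRep_eq)

/-- The action on the `q`-Euclidean momenta. -/
def eucModule : ModuleAlgebra (eucRot D) (EucAlg R) := h.exists_eucModule.choose

/-- The action on the `q`-Minkowski momenta. -/
def minkModule : ModuleAlgebra (minkRot D W) (MinkAlg R) := h.exists_minkModule.choose

theorem isAdditive_eucModule : IsAdditive (EucRel R) (eucSpan R) (momentumRep h.isHopf T)
    (eucUnit h.isNilpotent W : _ ⊗[k] _) h.eucModule where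
  quadratic := isQuadratic_eucRel R
  act_gen := h.exists_eucModule.choose_spec
  antisymm := by
    obtain ⟨q, hq⟩ := h.exists_isHecke
    exact eucSpan_antisymm h.isHopf T h.isQuasitriangular h.isNilpotent h.tensorRep_eq hq

theorem isAdditive_minkModule : IsAdditive (MinkRel R) (minkSpan R) (momentumRep h.isHopf T)
    (minkUnit h.isNilpotent W : _ ⊗[k] _) h.minkModule where
  quadratic := isQuadratic_minkRel R
  act_gen := h.exists_minkModule.choose_spec
  antisymm := by
    obtain ⟨q, hq⟩ := h.exists_isHecke
    exact minkSpan_antisymm h.isHopf T h.isQuasitriangular h.isNilpotent h.tensorRep_eq hq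

theorem isHopf_euc (h : IsSpinorial D W T R s) : (eucRot D).IsHopf := isHopf_eucRot h.isHopf

theorem isHopf_mink (h : IsSpinorial D W T R s) : (minkRot D W).IsHopf :=
  isHopf_minkRot h.isHopf h.isQuasitriangular

theorem isQuasitriangular_euc : (eucRot D).IsQuasitriangular (eucUnit h.isNilpotent W) :=
  isQuasitriangular_eucUnit h.isNilpotent h.isQuasitriangular

theorem isQuasitriangular_mink : (minkRot D W).IsQuasitriangular (minkUnit h.isNilpotent W) :=
  isQuasitriangular_minkUnit h.isNilpotent h.isHopf h.isQuasitriangular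

/-- The additive braided group `Ā(R)`. -/
def eucGroup : BraidedGroup (eucRot D) (eucRotR s W) (EucAlg R) :=
  h.isAdditive_eucModule.braidedGroup h.isHopf_euc h.isQuasitriangular_euc

/-- The additive braided group `B(R)`. -/
def minkGroup : BraidedGroup (minkRot D W) (minkRotR s W) (MinkAlg R) :=
  h.isAdditive_minkModule.braidedGroup h.isHopf_mink h.isQuasitriangular_mink

/-- The spinorial `q`-Euclidean Poincaré quantum group. -/
def eucPoincare : HopfData k (Bos h.eucGroup.toModuleAlgebra) :=
  h.isAdditive_eucModule.bosHopf h.isHopf_euc h.isQuasitriangular_euc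

/-- The spinorial `q`-Minkowski Poincaré quantum group. -/
def minkPoincare : HopfData k (Bos h.minkGroup.toModuleAlgebra) :=
  h.isAdditive_minkModule.bosHopf h.isHopf_mink h.isQuasitriangular_mink

theorem isBosonisation_euc : IsBosonisation h.eucGroup h.eucPoincare :=
  h.isAdditive_eucModule.isBosonisation h.isHopf_euc h.isQuasitriangular_euc

theorem isBosonisation_mink : IsBosonisation h.minkGroup h.minkPoincare :=
  h.isAdditive_minkModule.isBosonisation h.isHopf_mink h.isQuasitriangular_mink

theorem act_rotation {rel : FreeAlgebra k (Fin N × Fin N) → FreeAlgebra k (Fin N × Fin N) → Prop}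
    {t St : Matrix (Fin N) (Fin N) (Module.Dual k H)} (ht : ∀ i j a, t i j a = T a i j)
    (hSt : ∀ i j a, St i j a = T (D.antipode a) i j) (a b : H) (i j : Fin N) :
    rotate (momentumRep h.isHopf T) (gen rel) (i, j) (dilIncl k (H ⊗[k] H) (a ⊗ₜ b)) =
      ∑ m, ∑ n, (St i m a * t n j b) • gen rel (m, n) := by
  rw [rotate_apply, Fintype.sum_prod_type]
  refine Finset.sum_congr rfl fun m _ => Finset.sum_congr rfl fun n _ => ?_
  congr 1
  rw [hSt, ht]
  change momentumRep h.isHopf T ((a ⊗ₜ b) ⊗ₜ 1) (m, n) (i, j) = _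
  simp [momentumRep_tmul, contraRep_apply]

theorem act_dilaton {rel : FreeAlgebra k (Fin N × Fin N) → FreeAlgebra k (Fin N × Fin N) → Prop}
    (x : Fin N × Fin N) :
    rotate (momentumRep h.isHopf T) (gen rel) x (xi k (H ⊗[k] H)) = -gen rel x := by
  have e : momentumRep h.isHopf T (xi k (H ⊗[k] H)) = -1 := by
    rw [xi, Algebra.TensorProduct.one_def, momentumRep_tmul]
    simp
  simp [rotate_apply, e, Matrix.one_apply]

variable {t St : Matrix (Fin N) (Fin N) (Module.Dual k H)}

theorem isMomentum_euc (ht : ∀ i j a, t i j a = T a i j)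
    (hSt : ∀ i j a, St i j a = T (D.antipode a) i j) :
    IsMomentum t St h.eucGroup (eucP R) where
  act_rotation a b i j := (h.isAdditive_eucModule.act_gen _ (i, j)).trans
    (h.act_rotation ht hSt a b i j)
  act_dilaton i j := (h.isAdditive_eucModule.act_gen _ (i, j)).trans (h.act_dilaton (i, j))
  comul_p i j := h.isAdditive_eucModule.braidedComul_gen h.isHopf_euc h.isQuasitriangular_euc (i, j)

theorem isMomentum_mink (ht : ∀ i j a, t i j a = T a i j)
    (hSt : ∀ i j a, St i j a = T (D.antipode a) i j) :
    IsMomentum t St h.minkGroup (minkP R) where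
  act_rotation a b i j := (h.isAdditive_minkModule.act_gen _ (i, j)).trans
    (h.act_rotation ht hSt a b i j)
  act_dilaton i j := (h.isAdditive_minkModule.act_gen _ (i, j)).trans (h.act_dilaton (i, j))
  comul_p i j :=
    h.isAdditive_minkModule.braidedComul_gen h.isHopf_mink h.isQuasitriangular_mink (i, j)

theorem isCocycle (h : IsSpinorial D W T R s) : (eucRot D).IsCocycle (dilCocycle W) :=
  isCocycle_dilCocycle h.isHopf h.isQuasitriangular

theorem isGauge (h : IsSpinorial D W T R s) :
    (eucRot D).IsGauge (minkRot D W) (dilCocycle W : _ ⊗[k] _) := by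
  rw [minkRot_eq_twist h.isHopf h.isQuasitriangular]
  exact h.isCocycle.isGauge

theorem isGauge_inv (h : IsSpinorial D W T R s) :
    (minkRot D W).IsGauge (eucRot D) (↑(dilCocycle W)⁻¹ : _ ⊗[k] _) := by
  rw [minkRot_eq_twist h.isHopf h.isQuasitriangular]
  exact h.isCocycle.isGauge_inv

theorem isCocycle_bos : h.eucPoincare.IsCocycle (bosUnit _ (dilCocycle W)) :=
  h.isAdditive_eucModule.isCocycle_bosUnit h.isHopf_euc h.isQuasitriangular_euc h.isCocycle

/-- The isomorphism of the twisted `q`-Euclidean with the `q`-Minkowski Poincaré quantum group. -/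
def wick : Bos h.eucGroup.toModuleAlgebra ≃ₐ[k] Bos h.minkGroup.toModuleAlgebra :=
  gaugeEquiv h.isAdditive_eucModule h.isAdditive_minkModule h.isGauge
    (tensorRep_mem_minkSpan h.isHopf T h.isQuasitriangular h.tensorRep_eq) h.isHopf_euc
    h.isHopf_mink h.isGauge_inv
    (tensorRep_mem_eucSpan h.isHopf T h.isQuasitriangular h.isUnit_exp h.tensorRep_eq)

theorem isHopfIso_wick :
    IsHopfIso (h.eucPoincare.twist (bosUnit _ (dilCocycle W))) h.minkPoincare h.wick :=
  isHopfIso_gaugeEquiv h.isAdditive_eucModule h.isAdditive_minkModule h.isGauge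
    (tensorRep_mem_minkSpan h.isHopf T h.isQuasitriangular h.tensorRep_eq) h.isHopf_euc
    h.isHopf_mink h.isQuasitriangular_euc h.isQuasitriangular_mink
    (fun a => by rw [minkRot_eq_twist h.isHopf h.isQuasitriangular]; rfl) h.isGauge_inv
    (tensorRep_mem_eucSpan h.isHopf T h.isQuasitriangular h.isUnit_exp h.tensorRep_eq)
    (by
      rw [minkUnit_val, minkRotR_eq_twistR h.isNilpotent, twistR, Units.inv_mul_cancel_right]
      rfl)
    h.isCocycle

theorem wick_inK (a : Dil k (H ⊗[k] H)) : h.wick (inK _ a) = inK _ a :=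
  gaugeMap_inK h.isAdditive_eucModule h.isAdditive_minkModule h.isGauge
    (tensorRep_mem_minkSpan h.isHopf T h.isQuasitriangular h.tensorRep_eq) h.isHopf_euc a

theorem wick_gen (x : Fin N × Fin N) : h.wick (inB _ (gen (EucRel R) x)) =
    ∑ y, inB h.minkGroup.toModuleAlgebra (gen (MinkRel R) y) *
      inK h.minkGroup.toModuleAlgebra
        (contract (momentumRep h.isHopf T) y x (dilCocycle W : _ ⊗[k] _)) :=
  (gaugeMap_gen h.isAdditive_eucModule h.isAdditive_minkModule h.isGauge
    (tensorRep_mem_minkSpan h.isHopf T h.isQuasitriangular h.tensorRep_eq) h.isHopf_euc x).trans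
    (cross_gen h.isAdditive_minkModule.act_gen _ _ x _)

/-- The first leg of `χ` lies in the second copy of `H`: it leaves the row index of `p` alone and
pairs with `t` in the column index. The second leg stays behind in the first copy of `H`, and the
sum is `l⁻`. -/
theorem contract_dilCocycle (ht : ∀ i j a, t i j a = T a i j) (m n i j : Fin N) :
    contract (momentumRep h.isHopf T) (m, n) (i, j) (dilCocycle W : _ ⊗[k] _) =
      if m = i then dilIncl k (H ⊗[k] H) (lMinus t W n j ⊗ₜ 1) else 0 := by
  have key : ∀ x : H ⊗[k] H, contract (momentumRep h.isHopf T) (m, n) (i, j)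
      (Algebra.TensorProduct.map (dilIncl k (H ⊗[k] H)) (dilIncl k (H ⊗[k] H))
        (innerLegs k H x)) =
      if m = i then dilIncl k (H ⊗[k] H) (TensorProduct.lid k H ((t n j).rTensor H x) ⊗ₜ 1)
      else 0 := fun x => by
    induction x with
    | zero => simp
    | add x y hx hy =>
      simp only [map_add, hx, hy, TensorProduct.add_tmul]
      split_ifs <;> simp
    | tmul a b =>
      have e : momentumRep h.isHopf T (dilIncl k (H ⊗[k] H) (1 ⊗ₜ a)) (m, n) (i, j) =
          if m = i then T a n j else 0 := by
        change momentumRep h.isHopf T ((1 ⊗ₜ a) ⊗ₜ 1) (m, n) (i, j) = _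
        simp [momentumRep_tmul, Matrix.one_apply]
      simp only [innerLegs, Algebra.TensorProduct.map_tmul, contract_tmul,
        Algebra.TensorProduct.includeRight_apply, Algebra.TensorProduct.includeLeft_apply, e,
        LinearMap.rTensor_tmul, TensorProduct.lid_tmul, ht, ite_smul, zero_smul,
        ← TensorProduct.smul_tmul', map_smul]
  exact key _

theorem wick_p (ht : ∀ i j a, t i j a = T a i j) (i j : Fin N) :
    h.wick (inB _ (eucP R i j)) = ∑ a, inB h.minkGroup.toModuleAlgebra (minkP R i a) *
      inK h.minkGroup.toModuleAlgebra (dilIncl k (H ⊗[k] H) (lMinus t W a j ⊗ₜ 1)) := by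
  refine (h.wick_gen (i, j)).trans ?_
  rw [Fintype.sum_prod_type, Finset.sum_eq_single i]
  · simp only [h.contract_dilCocycle ht, if_true]
    rfl
  · intro m _ hm
    simp only [h.contract_dilCocycle ht, if_neg hm, map_zero, mul_zero, Finset.sum_const_zero]
  · simp

end IsSpinorial

end Spinorial

end QPoincare

end

noncomputable section

namespace QPoincare

/-! ### Reduction of the Poincaré quantum groups and of the isomorphism -/

section SpinorialReduction

variable {k' k : Type u} [CommRing k'] [CommRing k] {σ : k' →+* k} {N : ℕ}

/-- Surjectivity of `σ` allows the coefficients of a linear combination to be lifted, so every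
relation below is the reduction of a relation above. -/
theorem mem_span_range_iff_of_map (hσ : Function.Surjective σ) {ι κ : Type*} {c' : κ → ι → k'}
    {c : κ → ι → k} (hc : ∀ x, c x = fun z => σ (c' x z)) (d : ι → k) :
    d ∈ Submodule.span k (Set.range c) ↔
      ∃ d' ∈ Submodule.span k' (Set.range c'), d = fun z => σ (d' z) := by
  constructor
  · intro h
    induction h using Submodule.span_induction with
    | mem d h =>
      obtain ⟨x, rfl⟩ := h
      exact ⟨c' x, Submodule.subset_span ⟨x, rfl⟩, hc x⟩
    | zero => exact ⟨0, Submodule.zero_mem _, by ext; simp⟩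
    | add a b _ _ ha hb =>
      obtain ⟨a, ha, rfl⟩ := ha
      obtain ⟨b, hb, rfl⟩ := hb
      exact ⟨a + b, Submodule.add_mem _ ha hb, by ext; simp⟩
    | smul r a _ ha =>
      obtain ⟨a, ha, rfl⟩ := ha
      obtain ⟨r, rfl⟩ := hσ r
      exact ⟨r • a, Submodule.smul_mem _ _ ha, by ext; simp⟩
  · rintro ⟨d', h, rfl⟩
    induction h using Submodule.span_induction with
    | mem d h =>
      obtain ⟨x, rfl⟩ := h
      rw [← hc]
      exact Submodule.subset_span ⟨x, rfl⟩
    | zero =>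
      convert Submodule.zero_mem _ using 1
      ext
      simp
    | add a b _ _ ha hb =>
      convert Submodule.add_mem _ ha hb using 1
      ext
      simp
    | smul r a _ ha =>
      convert Submodule.smul_mem _ (σ r) ha using 1
      ext
      simp

variable {R' : Matrix (Fin N × Fin N) (Fin N × Fin N) k'}
  {R : Matrix (Fin N × Fin N) (Fin N × Fin N) k}

theorem eucCoeff_map (hR : ∀ u v, R u v = σ (R' u v)) (x y : Fin N × Fin N) :
    eucCoeff R x y = fun z => σ (eucCoeff R' x y z) := by
  funext z
  simp [eucCoeff, hR, apply_ite σ]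

theorem minkCoeff_map (hR : ∀ u v, R u v = σ (R' u v)) (x y : Fin N × Fin N) :
    minkCoeff R x y = fun z => σ (minkCoeff R' x y z) := by
  funext z
  simp [minkCoeff, hR, apply_ite σ]

variable {H' H : Type v} [Ring H'] [Algebra k' H'] [Ring H]
  [Algebra k H] {π : H' →ₛₗ[σ] H} {D' : HopfData k' H'} {D : HopfData k H}
  {W' : (H' ⊗[k'] H')ˣ} {W : (H ⊗[k] H)ˣ} {T' : H' →ₐ[k'] Matrix (Fin N) (Fin N) k'}
  {T : H →ₐ[k] Matrix (Fin N) (Fin N) k} {s' : k'} {s : k}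

theorem rotRed_xi (hπ : IsReduction π) (hσ : Function.Surjective σ) :
    rotRed π (xi k' (H' ⊗[k'] H')) = xi k (H ⊗[k] H) := by
  refine (rotRed_includeRight hπ hσ Polynomial.X).trans ?_
  rw [polyRed_apply, Polynomial.map_X]
  rfl

theorem momentumRep_rotRed (hD' : D'.IsHopf) (hD : D.IsHopf)
    (hT : ∀ a i j, T (π a) i j = σ (T' a i j))
    (hST : ∀ a i j, T (D.antipode (π a)) i j = σ (T' (D'.antipode a) i j))
    (a : Dil k' (H' ⊗[k'] H')) (x y : Fin N × Fin N) :
    momentumRep hD T (rotRed π a) x y = σ (momentumRep hD' T' a x y) := by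
  induction a using TensorProduct.induction_on with
  | zero => simp
  | add a b ha hb => simp only [map_add, Matrix.add_apply, ha, hb]
  | tmul a p =>
    induction a with
    | zero => simp
    | add a b ha hb => simp only [TensorProduct.add_tmul, map_add, Matrix.add_apply, ha, hb]
    | tmul a b =>
      have e : Polynomial.eval (-1) (p.map σ) = σ (Polynomial.eval (-1) p) := by
        rw [← Polynomial.eval_map_apply, map_neg, map_one]
      rw [rotRed_tmul, momentumRep_tmul, momentumRep_tmul, e]
      simp [contraRep_apply, hT, hST]

/-- Spinorial data over `k` that are the reduction of spinorial data over `k'`. -/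
structure IsSpinorialRed (π : H' →ₛₗ[σ] H) (D' : HopfData k' H') (D : HopfData k H)
    (W' : (H' ⊗[k'] H')ˣ) (W : (H ⊗[k] H)ˣ) (T' : H' →ₐ[k'] Matrix (Fin N) (Fin N) k')
    (T : H →ₐ[k] Matrix (Fin N) (Fin N) k) (R' : Matrix (Fin N × Fin N) (Fin N × Fin N) k')
    (R : Matrix (Fin N × Fin N) (Fin N × Fin N) k) (s' : k') (s : k) : Prop where
  surjective : Function.Surjective σ
  isReduction : IsReduction π
  reduces : D'.Reduces D π
  map_W : TensorProduct.map π π (W' : H' ⊗[k'] H') = W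
  map_T : ∀ a i j, T (π a) i j = σ (T' a i j)
  map_ST : ∀ a i j, T (D.antipode (π a)) i j = σ (T' (D'.antipode a) i j)
  map_R : ∀ u v, R u v = σ (R' u v)
  map_s : σ s' = s

namespace IsSpinorialRed

variable [Algebra ℚ k'] [Algebra ℚ k]
  (hr : IsSpinorialRed π D' D W' W T' T R' R s' s) (h' : IsSpinorial D' W' T' R' s')
  (h : IsSpinorial D W T R s)

theorem exists_eucRed (hr : IsSpinorialRed π D' D W' W T' T R' R s' s) :
    ∃ f : Bos h'.eucGroup.toModuleAlgebra →ₛₗ[σ] Bos h.eucGroup.toModuleAlgebra,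
    IsReduction f ∧ h'.eucPoincare.Reduces h.eucPoincare f ∧
      (∀ a, f (inK _ a) = inK _ (rotRed π a)) ∧
      ∀ x, f (inB _ (gen (EucRel R') x)) = inB _ (gen (EucRel R) x) := by
  have hρ := momentumRep_rotRed h'.isHopf h.isHopf hr.map_T hr.map_ST
  have hΔ := reduces_eucRot hr.reduces hr.surjective
  obtain ⟨f, hf, f_K, f_B⟩ := exists_bosRed (M' := h'.eucModule) (M := h.eucModule) h'.isHopf_euc
    h.isHopf_euc hΔ (isReduction_rotRed hr.isReduction hr.surjective) hr.surjective
    (isQuadratic_eucRel R') (isQuadratic_eucRel R) h'.isAdditive_eucModule.act_gen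
    h.isAdditive_eucModule.act_gen hρ
    (mem_span_range_iff_of_map hr.surjective fun z => eucCoeff_map hr.map_R z.1 z.2)
  refine ⟨f, hf, reduces_bosHopf h'.isAdditive_eucModule h.isAdditive_eucModule h'.isHopf_euc
    h.isHopf_euc h'.isQuasitriangular_euc h.isQuasitriangular_euc hΔ hr.surjective hρ ?_ hf f_K f_B,
    f_K, f_B⟩
  rw [eucUnit_val, eucUnit_val, ← hr.map_s]
  exact map_eucRotR hr.isReduction hr.surjective h'.isNilpotent hr.map_W

theorem exists_minkRed (hr : IsSpinorialRed π D' D W' W T' T R' R s' s) :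
    ∃ f : Bos h'.minkGroup.toModuleAlgebra →ₛₗ[σ] Bos h.minkGroup.toModuleAlgebra,
    IsReduction f ∧ h'.minkPoincare.Reduces h.minkPoincare f ∧
      (∀ a, f (inK _ a) = inK _ (rotRed π a)) ∧
      ∀ x, f (inB _ (gen (MinkRel R') x)) = inB _ (gen (MinkRel R) x) := by
  have hρ := momentumRep_rotRed h'.isHopf h.isHopf hr.map_T hr.map_ST
  have hΔ := reduces_minkRot hr.reduces hr.isReduction hr.surjective hr.map_W
  obtain ⟨f, hf, f_K, f_B⟩ := exists_bosRed (M' := h'.minkModule) (M := h.minkModule)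
    h'.isHopf_mink h.isHopf_mink hΔ (isReduction_rotRed hr.isReduction hr.surjective) hr.surjective
    (isQuadratic_minkRel R') (isQuadratic_minkRel R) h'.isAdditive_minkModule.act_gen
    h.isAdditive_minkModule.act_gen hρ
    (mem_span_range_iff_of_map hr.surjective fun z => minkCoeff_map hr.map_R z.1 z.2)
  refine ⟨f, hf, reduces_bosHopf h'.isAdditive_minkModule h.isAdditive_minkModule h'.isHopf_mink
    h.isHopf_mink h'.isQuasitriangular_mink h.isQuasitriangular_mink hΔ hr.surjective hρ ?_ hf f_K
    f_B, f_K, f_B⟩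
  rw [minkUnit_val, minkUnit_val, ← hr.map_s]
  exact map_minkRotR hr.isReduction hr.surjective h'.isNilpotent hr.map_W

/-- The reduction of the `q`-Euclidean Poincaré quantum group. -/
def eucRed : Bos h'.eucGroup.toModuleAlgebra →ₛₗ[σ] Bos h.eucGroup.toModuleAlgebra :=
  (hr.exists_eucRed h' h).choose

/-- The reduction of the `q`-Minkowski Poincaré quantum group. -/
def minkRed : Bos h'.minkGroup.toModuleAlgebra →ₛₗ[σ] Bos h.minkGroup.toModuleAlgebra :=
  (hr.exists_minkRed h' h).choose

theorem isReduction_eucRed : IsReduction (hr.eucRed h' h) := (hr.exists_eucRed h' h).choose_spec.1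

theorem isReduction_minkRed : IsReduction (hr.minkRed h' h) :=
  (hr.exists_minkRed h' h).choose_spec.1

theorem reduces_eucRed : h'.eucPoincare.Reduces h.eucPoincare (hr.eucRed h' h) :=
  (hr.exists_eucRed h' h).choose_spec.2.1

theorem reduces_minkRed : h'.minkPoincare.Reduces h.minkPoincare (hr.minkRed h' h) :=
  (hr.exists_minkRed h' h).choose_spec.2.1

theorem eucRed_inK (a : Dil k' (H' ⊗[k'] H')) :
    hr.eucRed h' h (inK _ a) = inK _ (rotRed π a) := (hr.exists_eucRed h' h).choose_spec.2.2.1 a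

theorem minkRed_inK (a : Dil k' (H' ⊗[k'] H')) :
    hr.minkRed h' h (inK _ a) = inK _ (rotRed π a) := (hr.exists_minkRed h' h).choose_spec.2.2.1 a

theorem eucRed_gen (x : Fin N × Fin N) :
    hr.eucRed h' h (inB _ (gen (EucRel R') x)) = inB _ (gen (EucRel R) x) :=
  (hr.exists_eucRed h' h).choose_spec.2.2.2 x

theorem minkRed_gen (x : Fin N × Fin N) :
    hr.minkRed h' h (inB _ (gen (MinkRel R') x)) = inB _ (gen (MinkRel R) x) :=
  (hr.exists_minkRed h' h).choose_spec.2.2.2 x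

theorem eucRed_rotation (a b : H') :
    hr.eucRed h' h (inK _ (dilIncl k' (H' ⊗[k'] H') (a ⊗ₜ b))) =
      inK _ (dilIncl k (H ⊗[k] H) (π a ⊗ₜ π b)) := by
  rw [eucRed_inK, rotRed_dilIncl, TensorProduct.map_tmul]

theorem eucRed_dilaton : hr.eucRed h' h (inK _ (xi k' (H' ⊗[k'] H'))) =
    inK _ (xi k (H ⊗[k] H)) := by
  rw [eucRed_inK, rotRed_xi hr.isReduction hr.surjective]

theorem minkRed_rotation (a b : H') :
    hr.minkRed h' h (inK _ (dilIncl k' (H' ⊗[k'] H') (a ⊗ₜ b))) =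
      inK _ (dilIncl k (H ⊗[k] H) (π a ⊗ₜ π b)) := by
  rw [minkRed_inK, rotRed_dilIncl, TensorProduct.map_tmul]

theorem minkRed_dilaton : hr.minkRed h' h (inK _ (xi k' (H' ⊗[k'] H'))) =
    inK _ (xi k (H ⊗[k] H)) := by
  rw [minkRed_inK, rotRed_xi hr.isReduction hr.surjective]

/-- The isomorphism is compatible with the reductions. -/
theorem wick_eucRed (x : Bos h'.eucGroup.toModuleAlgebra) :
    h.wick (hr.eucRed h' h x) = hr.minkRed h' h (h'.wick x) := by
  have hE := hr.isReduction_eucRed h' h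
  have hM := hr.isReduction_minkRed h' h
  have hρ := momentumRep_rotRed h'.isHopf h.isHopf hr.map_T hr.map_ST
  induction x using bos_gen_induction with
  | one => rw [hE.map_one, map_one, map_one, hM.map_one]
  | add x y hx hy => rw [map_add, map_add, map_add, map_add, hx, hy]
  | mul x y hx hy => rw [hE.map_mul, map_mul, map_mul, hM.map_mul, hx, hy]
  | genB x =>
    rw [eucRed_gen, h.wick_gen, h'.wick_gen, map_sum]
    refine Finset.sum_congr rfl fun y _ => ?_
    rw [hM.map_mul, minkRed_gen, minkRed_inK, ← contract_map hρ,
      map_dilCocycle hr.isReduction hr.surjective hr.map_W]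
  | genK a => rw [eucRed_inK, h.wick_inK, h'.wick_inK, minkRed_inK]

end IsSpinorialRed

end SpinorialReduction

/-! ### Truncated power series and the representation defined by the pairing -/

section Formal

/-- A series without constant term is divisible by the variable, so its power `n + 1` vanishes
modulo `t^(n+1)`. This makes `λ = exp s` a finite sum in each truncation. -/
theorem isNilpotent_red {s : ℂ⟦X⟧} (hs : PowerSeries.constantCoeff s = 0) (n : ℕ) :
    IsNilpotent (red n s) := by
  obtain ⟨r, rfl⟩ := PowerSeries.X_dvd_iff.mpr hs
  refine ⟨n + 1, ?_⟩
  rw [← map_pow, mul_pow]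
  exact Ideal.Quotient.eq_zero_iff_mem.mpr
    (Ideal.mul_mem_right _ _ (Ideal.mem_span_singleton_self _))

theorem truncProj_surjective (n : ℕ) : Function.Surjective (truncProj n) :=
  Ideal.Quotient.factor_surjective _

theorem IsHecke.map {k k' : Type*} [CommRing k] [CommRing k'] {N : ℕ} {q : kˣ}
    {R : Matrix (Fin N × Fin N) (Fin N × Fin N) k} (h : IsHecke q R) (f : k →+* k') :
    IsHecke (Units.map (f : k →* k') q) (R.map f) := by
  have hP : (permP k N).map f = permP k' N := by
    ext u v
    simp [permP, Matrix.one_apply, apply_ite f]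
  have e := congrArg f.mapMatrix (show _ = _ from h)
  have hsm : ∀ r : k, f.mapMatrix (r • (1 : Matrix (Fin N × Fin N) (Fin N × Fin N) k)) = f r • 1 := by
    intro r
    ext u v
    simp [Matrix.one_apply, apply_ite f]
  rw [map_mul, map_sub, map_add, map_mul, map_zero, hsm, hsm, RingHom.mapMatrix_apply, hP] at e
  exact e

variable {k k' : Type*} [CommRing k] [CommRing k'] [Algebra k k'] {A : Type*} [Ring A]
  [HopfAlgebra k A] {H : Type*} [Ring H] [HopfAlgebra k' H] {N : ℕ}

/-- The matrix representation given by a matrix of generators of a dually paired Hopf algebra. -/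
def IsHopfPairing.rep {pair : A →ₗ[k] Module.Dual k' H} (h : IsHopfPairing pair)
    (t : Matrix (Fin N) (Fin N) A)
    (ht_comul : ∀ i j, Coalgebra.comul (R := k) (t i j) = ∑ a, t i a ⊗ₜ[k] t a j)
    (ht_counit : ∀ i j, Coalgebra.counit (R := k) (t i j) = if i = j then 1 else 0) :
    H →ₐ[k'] Matrix (Fin N) (Fin N) k' :=
  AlgHom.ofLinearMap
    { toFun := fun x => Matrix.of fun i j => pair (t i j) x
      map_add' := fun x y => by ext; simp
      map_smul' := fun r x => by ext; simp }
    (by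
      ext i j
      simp [h.one_right, ht_counit, Matrix.one_apply, apply_ite (algebraMap k k')])
    (fun x y => by
      ext i j
      simp [h.mul_right, ht_comul, Matrix.mul_apply])

theorem tensorRep_apply_pairTwo {k : Type u} [CommRing k] {H : Type v} [Ring H] [Algebra k H]
    (T : H →ₐ[k] Matrix (Fin N) (Fin N) k) {t : Matrix (Fin N) (Fin N) (Module.Dual k H)}
    (ht : ∀ i j a, t i j a = T a i j) (x : H ⊗[k] H) (i j a b : Fin N) :
    tensorRep T x (i, j) (a, b) = pairTwo (t i a) (t j b) x := by
  induction x with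
  | zero => simp
  | add x y hx hy => simp only [map_add, Matrix.add_apply, hx, hy]
  | tmul x y => simp [tensorRep_tmul, pairTwo, ht]

end Formal

end QPoincare

end

/-! ### The theorem, assembled over all truncations -/

theorem proposition3p6
    -- the quasitriangular Hopf algebra `H`, complete over `ℂ⟦t⟧`
    {H : ℕ → Type u} [∀ n, Ring (H n)] [∀ n, HopfAlgebra (PowTrunc n) (H n)]
    (πH : ∀ n, H (n + 1) →ₛₗ[truncProj n] H n)
    (hH : IsFormalHopf (fun n => HopfData.of (PowTrunc n) (H n)) πH)
    (𝓡 : ∀ n, (H n ⊗[PowTrunc n] H n)ˣ)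
    (h𝓡 : ∀ n, (HopfData.of (PowTrunc n) (H n)).IsQuasitriangular (𝓡 n))
    (h𝓡_red : ∀ n, TensorProduct.map (πH n) (πH n) (𝓡 (n + 1) : H (n + 1) ⊗[PowTrunc (n + 1)] H (n + 1))
      = (𝓡 n : H n ⊗[PowTrunc n] H n))
    -- the dually paired Hopf algebra `A` with its matrix of generators `t`
    {A : Type v} [Ring A] [HopfAlgebra ℂ⟦X⟧ A]
    (pair : ∀ n, A →ₗ[ℂ⟦X⟧] Module.Dual (PowTrunc n) (H n))
    (hpair : ∀ n, IsHopfPairing (pair n))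
    (hpair_red : ∀ n a h, pair n a (πH n h) = truncProj n (pair (n + 1) a h))
    {N : ℕ} (t : Matrix (Fin N) (Fin N) A)
    (ht_comul : ∀ i j, Coalgebra.comul (R := ℂ⟦X⟧) (t i j) = ∑ a, t i a ⊗ₜ[ℂ⟦X⟧] t a j)
    (ht_counit : ∀ i j, Coalgebra.counit (R := ℂ⟦X⟧) (t i j) = if i = j then 1 else 0)
    -- the `q`-Hecke matrix `R` and the normalisation constant `λ = exp s`
    (q : ℂ⟦X⟧ˣ) (R : Matrix (Fin N × Fin N) (Fin N × Fin N) ℂ⟦X⟧) (hR : IsHecke q R)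
    (s : ℂ⟦X⟧) (hs : PowerSeries.constantCoeff s = 0)
    (hRt : ∀ n i j a b, pairTwo (pair n (t i a)) (pair n (t j b)) (𝓡 n : H n ⊗[PowTrunc n] H n) =
      IsNilpotent.exp ((1 / 2 : ℚ) • red n s) * red n (R (i, j) (a, b))) :
    -- the additive braided groups `Ā(R)` and `B(R)`
    ∃ (GE : ∀ n, BraidedGroup (eucRot (HopfData.of (PowTrunc n) (H n))) (eucRotR (red n s) (𝓡 n))
          (EucAlg (R.map (red n))))
      (GM : ∀ n, BraidedGroup (minkRot (HopfData.of (PowTrunc n) (H n)) (𝓡 n))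
          (minkRotR (red n s) (𝓡 n)) (MinkAlg (R.map (red n)))),
      (∀ n, IsMomentum (t.map (pair n))
        (t.map fun x => pair n (HopfAlgebraStruct.antipode ℂ⟦X⟧ x)) (GE n) (eucP (R.map (red n)))) ∧
      (∀ n, IsMomentum (t.map (pair n))
        (t.map fun x => pair n (HopfAlgebraStruct.antipode ℂ⟦X⟧ x)) (GM n) (minkP (R.map (red n)))) ∧
      -- their bosonisations, complete Hopf algebras over `ℂ⟦t⟧`
      ∃ (E : ∀ n, HopfData (PowTrunc n) (Bos (GE n).toModuleAlgebra))
        (M : ∀ n, HopfData (PowTrunc n) (Bos (GM n).toModuleAlgebra))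
        (πE : ∀ n, Bos (GE (n + 1)).toModuleAlgebra →ₛₗ[truncProj n] Bos (GE n).toModuleAlgebra)
        (πM : ∀ n, Bos (GM (n + 1)).toModuleAlgebra →ₛₗ[truncProj n] Bos (GM n).toModuleAlgebra),
        (∀ n, IsBosonisation (GE n) (E n)) ∧ (∀ n, IsBosonisation (GM n) (M n)) ∧
        IsFormalHopf E πE ∧ IsFormalHopf M πM ∧
        IsCanonical πH (fun n => (GE n).toModuleAlgebra) (fun n => eucP (R.map (red n))) πE ∧
        IsCanonical πH (fun n => (GM n).toModuleAlgebra) (fun n => minkP (R.map (red n))) πM ∧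
        -- the cocycle and the twisting
        (∀ n, ((HopfData.of (PowTrunc n) (H n)).tensor (HopfData.of (PowTrunc n) (H n))).IsCocycle
          (wickCocycle (𝓡 n))) ∧
        (∀ n, (E n).IsCocycle (bosUnit _ (dilCocycle (𝓡 n)))) ∧
        ∃ θ : ∀ n, Bos (GE n).toModuleAlgebra ≃ₐ[PowTrunc n] Bos (GM n).toModuleAlgebra,
          (∀ n, IsHopfIso ((E n).twist (bosUnit _ (dilCocycle (𝓡 n)))) (M n) (θ n)) ∧
          (∀ n x, θ n (πE n x) = πM n (θ (n + 1) x)) ∧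
          (∀ n x, θ n (inK _ x) = inK _ x) ∧
          (∀ n i j, θ n (inB _ (eucP (R.map (red n)) i j)) =
            ∑ a, inB _ (minkP (R.map (red n)) i a) *
              inK _ (dilIncl (PowTrunc n) (H n ⊗[PowTrunc n] H n)
                (lMinus (t.map (pair n)) (𝓡 n) a j ⊗ₜ[PowTrunc n] 1))) := by
  let T : ∀ n, H n →ₐ[PowTrunc n] Matrix (Fin N) (Fin N) (PowTrunc n) := fun n =>
    (hpair n).rep t ht_comul ht_counit
  have hT : ∀ n i j x, t.map (pair n) i j x = T n x i j := fun _ _ _ _ => rfl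
  -- Compatibility of the pairing with the antipodes, `⟨h, S t⟩ = ⟨S h, t⟩`, identifies the
  -- prescribed action of the first copy of `H` with the contragredient representation.
  have hST : ∀ n i j x, t.map (fun x => pair n (HopfAlgebraStruct.antipode ℂ⟦X⟧ x)) i j x =
      T n ((HopfData.of (PowTrunc n) (H n)).antipode x) i j := fun n i j x =>
    (hpair n).antipode (t i j) x
  have h : ∀ n, IsSpinorial (HopfData.of (PowTrunc n) (H n)) (𝓡 n) (T n) (R.map (red n))
      (red n s) := fun n =>
    { isHopf := hH.isHopf n
      isQuasitriangular := h𝓡 n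
      isNilpotent := isNilpotent_red hs n
      tensorRep_eq := by
        ext ⟨i, j⟩ ⟨a, b⟩
        exact (tensorRep_apply_pairTwo (T n) (hT n) _ i j a b).trans (hRt n i j a b)
      exists_isHecke := ⟨_, hR.map (red n)⟩ }
  have hr : ∀ n, IsSpinorialRed (πH n) (HopfData.of (PowTrunc (n + 1)) (H (n + 1)))
      (HopfData.of (PowTrunc n) (H n)) (𝓡 (n + 1)) (𝓡 n) (T (n + 1)) (T n)
      (R.map (red (n + 1))) (R.map (red n)) (red (n + 1) s) (red n s) := fun n =>
    { surjective := truncProj_surjective n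
      isReduction := hH.isReduction n
      reduces := ⟨hH.comul n, hH.counit n⟩
      map_W := h𝓡_red n
      map_T := fun a i j => hpair_red n (t i j) a
      map_ST := fun a i j => by
        rw [← hST, ← hST]
        exact hpair_red n _ a
      map_R := fun _ _ => rfl
      map_s := rfl }
  refine ⟨fun n => (h n).eucGroup, fun n => (h n).minkGroup,
    fun n => (h n).isMomentum_euc (hT n) (hST n), fun n => (h n).isMomentum_mink (hT n) (hST n),
    fun n => (h n).eucPoincare, fun n => (h n).minkPoincare,
    fun n => (hr n).eucRed (h (n + 1)) (h n), fun n => (hr n).minkRed (h (n + 1)) (h n),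
    fun n => (h n).isBosonisation_euc, fun n => (h n).isBosonisation_mink, ?_, ?_, ?_, ?_,
    fun n => isCocycle_wickCocycle (h n).isHopf (h n).isQuasitriangular,
    fun n => (h n).isCocycle_bos, fun n => (h n).wick, fun n => (h n).isHopfIso_wick,
    fun n => (hr n).wick_eucRed (h (n + 1)) (h n), fun n => (h n).wick_inK,
    fun n => (h n).wick_p (hT n)⟩
  · exact
      { isHopf := fun n => (h n).isBosonisation_euc.isHopf
        isReduction := fun n => (hr n).isReduction_eucRed _ _
        comul := fun n => ((hr n).reduces_eucRed _ _).comul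
        counit := fun n => ((hr n).reduces_eucRed _ _).counit }
  · exact
      { isHopf := fun n => (h n).isBosonisation_mink.isHopf
        isReduction := fun n => (hr n).isReduction_minkRed _ _
        comul := fun n => ((hr n).reduces_minkRed _ _).comul
        counit := fun n => ((hr n).reduces_minkRed _ _).counit }
  · exact
      { rotation := fun n => (hr n).eucRed_rotation _ _
        dilaton := fun n => (hr n).eucRed_dilaton _ _
        momentum := fun n i j => (hr n).eucRed_gen _ _ (i, j) }
  · exact
      { rotation := fun n => (hr n).minkRed_rotation _ _
        dilaton := fun n => (hr n).minkRed_dilaton _ _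
        momentum := fun n i j => (hr n).minkRed_gen _ _ (i, j) }
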